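/- Let $n,r,s,t\ge 1$ be integers, and consider the generalized $n$-fold integer program $$\max\{c^{T}x : \mathcal{A}x=b,\ l\le x\le u,\ x\in\mathbb{Z}^{nt}\},\qquad \mathcal{A}=\begin{pmatrix}A^{(1)}&A^{(2)}&\cdots&A^{(n)}\\ B^{(1)}&0&\cdots&0\\ 0&B^{(2)}&&\vdots\\ \vdots&&\ddots&0\\ 0&\cdots&0&B^{(n)}\end{pmatrix},$$ where $A^{(1)},\dots,A^{(n)}\in\mathbb{Z}^{r\times t}$ and $B^{(1)},\dots,B^{(n)}\in\mathbb{Z}^{s\times t}$ are arbitrary, $b\in\mathbb{Z}^{r+ns}$, $c\in\mathbb{Z}^{nt}$, $l\in(\mathbb{Z}\cup\{-\infty\})^{nt}$ and $u\in(\mathbb{Z}\cup\{\infty\})^{nt}$. Let $\Delta\ge 1$ be an integer that bounds the absolute value of every entry of $\mathcal{A}$, and let $\varphi\ge 1$ be an integer such that every finite number occurring in the input ($\mathcal{A},b,c,l,u$) has absolute value at most $2^{\varphi}$. To solve the problem (or its LP relaxation) means to find an optimal solution, or to report that there is no feasible solution, or to report that the objective function is unbounded and return a feasible solution. There is one algorithm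 that solves every such integer program in time $$n^{2}t^{2}\,\varphi\,\log^{2}(nt+1)\cdot(rs\Delta)^{\mathcal{O}(r^{2}s+rs^{2})}+\mathbf{LP},$$ that is, in at most $C\,n^{2}t^{2}\varphi\lceil\log_2(nt+1)\rceil^{2}(rs\Delta)^{C(r^{2}s+rs^{2})}+\mathbf{LP}$ steps for an absolute constant $C$. Here $\mathbf{LP}$ is the time that a solver for the LP relaxation, which the algorithm may call as a subroutine and which returns rational solutions, takes on the relaxation of the given instance. The steps of the algorithm are those of a random access machine with integer cells, on which additions, subtractions, integer divisions, comparisons and memory accesses cost one step each. -/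

import Mathlib

/-! ## Generalized n-fold integer programs -/

/-- The data of a generalized `n`-fold integer program
`max {cᵀ x : 𝒜 x = b, l ≤ x ≤ u, x ∈ ℤ^(nt)}`: arbitrary blocks `A i` (`r × t`) in the top row and
`B i` (`s × t`) on the diagonal. The variable `(i, k)` is the `k`-th entry of the `i`-th brick.
The row `Sum.inl j` is the `j`-th row of the top part, the row `Sum.inr (i, j)` is the
`j`-th row of the `i`-th diagonal block. A bound may be infinite (`⊥` for `-∞`, `⊤` for `∞`). -/
structure NFoldIP (n r s t : ℕ) where
  A : Fin n → Matrix (Fin r) (Fin t) ℤ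
  B : Fin n → Matrix (Fin s) (Fin t) ℤ
  b : Fin r ⊕ Fin n × Fin s → ℤ
  c : Fin n × Fin t → ℤ
  l : Fin n × Fin t → WithBot ℤ
  u : Fin n × Fin t → WithTop ℤ

namespace NFoldIP

variable {n r s t : ℕ}

/-- The constraint matrix `𝒜`. -/
def matrix (I : NFoldIP n r s t) : Matrix (Fin r ⊕ Fin n × Fin s) (Fin n × Fin t) ℤ :=
  Matrix.of fun row v =>
    match row with
    | Sum.inl j => I.A v.1 j v.2
    | Sum.inr (i, j) => if i = v.1 then I.B i j v.2 else 0

/-- Feasibility of a vector with entries in `R`: with `R = ℤ` these are the feasible points of the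
integer program, with `R = ℝ` those of its LP relaxation. -/
def Feasible {R : Type} [CommRing R] [LinearOrder R] (I : NFoldIP n r s t)
    (x : Fin n × Fin t → R) : Prop :=
  (I.matrix.map (fun z : ℤ => (z : R))).mulVec x = (fun row => (I.b row : R)) ∧
  (∀ v, ∀ z : ℤ, I.l v = (z : WithBot ℤ) → (z : R) ≤ x v) ∧
  (∀ v, ∀ z : ℤ, I.u v = (z : WithTop ℤ) → x v ≤ (z : R))

/-- The objective value `cᵀ x`. -/
def objective {R : Type} [CommRing R] (I : NFoldIP n r s t) (x : Fin n × Fin t → R) : R :=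
  ∑ v, (I.c v : R) * x v

/-- The status `code` and the vector `x` solve the maximization problem over `R`:
`0` reports that there is no feasible point, `1` that the objective is unbounded
(and `x` is a feasible point), `2` that `x` is an optimal solution. -/
def Solved {R : Type} [CommRing R] [LinearOrder R] (I : NFoldIP n r s t)
    (code : ℤ) (x : Fin n × Fin t → R) : Prop :=
  (code = 0 ∧ ∀ y : Fin n × Fin t → R, ¬ I.Feasible y) ∨
  (code = 1 ∧ I.Feasible x ∧
    ∀ K : R, ∃ y : Fin n × Fin t → R, I.Feasible y ∧ K < I.objective y) ∨
  (code = 2 ∧ I.Feasible x ∧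
    ∀ y : Fin n × Fin t → R, I.Feasible y → I.objective y ≤ I.objective x)

/-- `Δ` bounds the absolute value of every entry of the blocks. -/
def EntriesLE (I : NFoldIP n r s t) (Δ : ℕ) : Prop :=
  (∀ i j k, |I.A i j k| ≤ (Δ : ℤ)) ∧ (∀ i j k, |I.B i j k| ≤ (Δ : ℤ))

/-- `M` bounds the absolute value of every (finite) number occurring in the input. -/
def InputLE (I : NFoldIP n r s t) (M : ℕ) : Prop :=
  I.EntriesLE M ∧
  (∀ row, |I.b row| ≤ (M : ℤ)) ∧
  (∀ v, |I.c v| ≤ (M : ℤ)) ∧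
  (∀ v, ∀ z : ℤ, I.l v = (z : WithBot ℤ) → |z| ≤ (M : ℤ)) ∧
  (∀ v, ∀ z : ℤ, I.u v = (z : WithTop ℤ) → |z| ≤ (M : ℤ))

end NFoldIP

/-! ## The machine model

A random access machine with integer cells, written as a structured language. The memory consists
of arrays, named by natural numbers and indexed by integers (a program names finitely many of them;
a scalar variable is a fixed cell of an array). Every elementary operation costs one step.
Addition, subtraction, integer division and comparison are elementary; multiplication is not, so
that the length of the numbers can grow by at most one bit per step. -/

/-- The contents of the memory: `σ a i` is the cell with index `i` of the array `a`. -/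
abbrev Store := ℕ → ℤ → ℤ

/-- Arithmetic expressions. -/
inductive RExpr where
  | const (z : ℤ)
  | read (a : ℕ) (idx : RExpr)
  | add (e f : RExpr)
  | sub (e f : RExpr)
  | div (e f : RExpr)

namespace RExpr

/-- The value of an expression. Division by a positive number rounds down,
and division by zero gives zero. -/
def eval (σ : Store) : RExpr → ℤ
  | const z => z
  | read a idx => σ a (idx.eval σ)
  | add e f => e.eval σ + f.eval σ
  | sub e f => e.eval σ - f.eval σ
  | div e f => e.eval σ / f.eval σ

/-- The number of steps that the evaluation of an expression takes. -/
def cost : RExpr → ℕ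
  | const _ => 1
  | read _ idx => idx.cost + 1
  | add e f => e.cost + f.cost + 1
  | sub e f => e.cost + f.cost + 1
  | div e f => e.cost + f.cost + 1

end RExpr

/-- Programs. `write a idx e` stores the value of `e` in the cell `idx` of the array `a`,
`ifLe e f p q` and `whileLe e f p` test `e ≤ f`, and `solveLP` calls a solver
for the LP relaxation of the instance that was given as the input. -/
inductive Program where
  | skip
  | write (a : ℕ) (idx e : RExpr)
  | seq (p q : Program)
  | ifLe (e f : RExpr) (p q : Program)
  | whileLe (e f : RExpr) (p : Program)
  | solveLP

/-! Names of the arrays that are used for input and output. -/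

/-- The numbers `n, r, s, t`. -/
def arrDim : ℕ := 0
/-- The blocks `A i`, column by column. -/
def arrA : ℕ := 1
/-- The blocks `B i`, column by column. -/
def arrB : ℕ := 2
/-- The right-hand side `b`. -/
def arrRhs : ℕ := 3
/-- The objective function `c`. -/
def arrObj : ℕ := 4
/-- Flags: `1` for a finite lower bound, `0` for `-∞`. -/
def arrLowerFin : ℕ := 5
/-- The finite lower bounds. -/
def arrLower : ℕ := 6
/-- Flags: `1` for a finite upper bound, `0` for `∞`. -/
def arrUpperFin : ℕ := 7
/-- The finite upper bounds. -/
def arrUpper : ℕ := 8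
/-- The status reported by the LP solver. -/
def arrLPStatus : ℕ := 9
/-- The numerators of the vector returned by the LP solver. -/
def arrLPNum : ℕ := 10
/-- The denominators of the vector returned by the LP solver. -/
def arrLPDen : ℕ := 11
/-- The status reported for the integer program. -/
def arrStatus : ℕ := 12
/-- The vector returned for the integer program. -/
def arrSol : ℕ := 13

namespace NFoldIP

variable {n r s t : ℕ}

/-- The position of the variable `(i, k)` in a vector of length `n t`. -/
def varPos (v : Fin n × Fin t) : ℕ := (v.1 : ℕ) * t + (v.2 : ℕ)

/-- The position of a row of `𝒜` in a vector of length `r + n s`. -/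
def rowPos : Fin r ⊕ Fin n × Fin s → ℕ
  | Sum.inl j => (j : ℕ)
  | Sum.inr (i, j) => r + ((i : ℕ) * s + (j : ℕ))

/-- The memory `σ` contains the instance `I`. The contents of all other cells are arbitrary. -/
structure Loaded (I : NFoldIP n r s t) (σ : Store) : Prop where
  dim_n : σ arrDim 0 = n
  dim_r : σ arrDim 1 = r
  dim_s : σ arrDim 2 = s
  dim_t : σ arrDim 3 = t
  block_A : ∀ (i : Fin n) (j : Fin r) (k : Fin t),
    σ arrA ((varPos (i, k) * r + (j : ℕ) : ℕ) : ℤ) = I.A i j k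
  block_B : ∀ (i : Fin n) (j : Fin s) (k : Fin t),
    σ arrB ((varPos (i, k) * s + (j : ℕ) : ℕ) : ℤ) = I.B i j k
  rhs : ∀ row : Fin r ⊕ Fin n × Fin s, σ arrRhs (rowPos row : ℤ) = I.b row
  obj : ∀ v : Fin n × Fin t, σ arrObj (varPos v : ℤ) = I.c v
  lower_inf : ∀ v : Fin n × Fin t, I.l v = ⊥ → σ arrLowerFin (varPos v : ℤ) = 0
  lower_fin : ∀ (v : Fin n × Fin t) (z : ℤ), I.l v = (z : WithBot ℤ) →
    σ arrLowerFin (varPos v : ℤ) = 1 ∧ σ arrLower (varPos v : ℤ) = z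
  upper_inf : ∀ v : Fin n × Fin t, I.u v = ⊤ → σ arrUpperFin (varPos v : ℤ) = 0
  upper_fin : ∀ (v : Fin n × Fin t) (z : ℤ), I.u v = (z : WithTop ℤ) →
    σ arrUpperFin (varPos v : ℤ) = 1 ∧ σ arrUpper (varPos v : ℤ) = z

/-- The memory `σ` contains a solution of the integer program `I`. -/
def IPOutput (I : NFoldIP n r s t) (σ : Store) : Prop :=
  I.Solved (σ arrStatus 0) (fun v => σ arrSol (varPos v : ℤ))

/-- The memory `σ` contains a solution of the LP relaxation of `I`; the vector is given by
the numerators and the (positive) denominators of its entries. -/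
def LPOutput (I : NFoldIP n r s t) (σ : Store) : Prop :=
  (σ arrLPStatus 0 ≠ 0 → ∀ v : Fin n × Fin t, 0 < σ arrLPDen (varPos v : ℤ)) ∧
  I.Solved (σ arrLPStatus 0)
    (fun v => (σ arrLPNum (varPos v : ℤ) : ℝ) / (σ arrLPDen (varPos v : ℤ) : ℝ))

/-- A run of some LP solver, on whatever machine, on the LP relaxation of `I`: its output and the
time it takes. -/
structure LPRun (I : NFoldIP n r s t) where
  out : Store
  time : ℕ
  correct : I.LPOutput out

end NFoldIP

/-- `Exec out time p σ T σ'`: the program `p`, started with memory `σ`, stops after exactly `T`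
steps with memory `σ'`. Every call of the LP solver takes `time` steps and copies the three
arrays of its output `out` to the memory. -/
inductive Exec (out : Store) (time : ℕ) : Program → Store → ℕ → Store → Prop where
  | skip (σ : Store) : Exec out time Program.skip σ 1 σ
  | write (σ : Store) (a : ℕ) (idx e : RExpr) :
      Exec out time (Program.write a idx e) σ (idx.cost + e.cost + 1)
        (Function.update σ a (Function.update (σ a) (idx.eval σ) (e.eval σ)))
  | seq {p q : Program} {σ σ₁ σ₂ : Store} {T₁ T₂ : ℕ} :
      Exec out time p σ T₁ σ₁ → Exec out time q σ₁ T₂ σ₂ →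
      Exec out time (Program.seq p q) σ (T₁ + T₂) σ₂
  | if_true {e f : RExpr} {p q : Program} {σ σ₁ : Store} {T : ℕ} :
      e.eval σ ≤ f.eval σ → Exec out time p σ T σ₁ →
      Exec out time (Program.ifLe e f p q) σ (e.cost + f.cost + 1 + T) σ₁
  | if_false {e f : RExpr} {p q : Program} {σ σ₁ : Store} {T : ℕ} :
      ¬ e.eval σ ≤ f.eval σ → Exec out time q σ T σ₁ →
      Exec out time (Program.ifLe e f p q) σ (e.cost + f.cost + 1 + T) σ₁
  | while_true {e f : RExpr} {p : Program} {σ σ₁ σ₂ : Store} {T₁ T₂ : ℕ} :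
      e.eval σ ≤ f.eval σ → Exec out time p σ T₁ σ₁ →
      Exec out time (Program.whileLe e f p) σ₁ T₂ σ₂ →
      Exec out time (Program.whileLe e f p) σ (e.cost + f.cost + 1 + T₁ + T₂) σ₂
  | while_false {e f : RExpr} {p : Program} {σ : Store} :
      ¬ e.eval σ ≤ f.eval σ →
      Exec out time (Program.whileLe e f p) σ (e.cost + f.cost + 1) σ
  | solveLP (σ : Store) :
      Exec out time Program.solveLP σ (time + 1)
        (fun a => if a = arrLPStatus ∨ a = arrLPNum ∨ a = arrLPDen then out a else σ a)

/-! The algorithm rounds a solution of the LP relaxation down and searches for the best integer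
point in a box around it, by repeated augmentation with short kernel vectors.

Short vectors. A zero-sum family in ℤ^d with entries of size at most D can be ordered so that all
its initial sums lie in [-dD, dD]^d (`BalancedFamily.exists_chain`). Two equal initial sums would
cut out a smaller zero-sum family, so a minimal one has at most (2dD+1)^d members. Applied inside
each block `B i`, and then to the A-sums of the resulting pieces, this gives below every nonzero
kernel vector a nonzero one of ℓ₁-norm at most L = `shortBound r s D`, which does not depend on n
and t (`shortKernel_blockRows`). A real kernel vector is then a sum of integer multiples of short
vectors and a remainder of norm at most dim·L (`ShortKernel.exists_rounding`). Three consequences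
carry the proof: near an LP solution there is an integer solution that is good enough
(`ShortKernel.proximity`); an unbounded relaxation of a feasible program makes the program unbounded
(`ShortKernel.exists_large`); some short vector times a power of two gains a fixed fraction of any
possible improvement (`ShortKernel.exists_step`).

Finding a step. For a fixed step length a dynamic program chooses the entries of the vector one by
one. Its state is a single integer: in a base M it holds the partial sums of the B-rows, those of
the A-rows and a multiple of the norm so far. Divisibility by M^s at the end of each block and by
M^(s+r) at the very end forces the vector into the kernel, and all short kernel vectors pass
(`Coding.inKer_of_validPath`, `Coding.validPath_of_inKer`). The number of states depends on r, s, D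
only.

Starting point. Every row gets a slack variable that begins at the residual of the rounded LP
solution and may only move towards zero, at a cost that outweighs every change of the objective
within the box. If slack survives at the optimum, the program is infeasible; otherwise the optimum
answers the program with the status of the relaxation (`NFoldIP.Prepared.solved`).

Time. With m = n(t+s)+r columns the gap to the optimum shrinks by the factor 1 - 1/(2m(L+1)) per
round, so 2m(L+1)·E rounds suffice for an initial gap below 2^E, where E is at most φ plus a binary
length of order log(nt) up to parameters. Each round fills a table of m rows for each of about
log(nt) step lengths. The product is n²t²φ log²(nt+1) times a power of rsΔ. The program is written
in a total source language, with costs, and compiled to the machine (`exec_stmt`). -/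

/-! ## A source language with bounded loops

Programs are written in a small language with multiplication, maximum, minimum, binary length and
`for` loops. Its semantics is a total function on stores, and it is compiled to the machine. -/

/-- The store `σ` after writing `z` to the cell `i` of the array `a`. -/
def put (σ : Store) (a : ℕ) (i z : ℤ) : Store :=
  Function.update σ a (Function.update (σ a) i z)

theorem put_apply (σ : Store) (a : ℕ) (i z : ℤ) (b : ℕ) (j : ℤ) :
    put σ a i z b j = if b = a then (if j = i then z else σ b j) else σ b j := by
  unfold put
  by_cases h : b = a
  · subst h
    simp [Function.update_apply]
  · simp [h]

theorem put_other (σ : Store) {a b : ℕ} (i z : ℤ) (h : b ≠ a) : put σ a i z b = σ b := by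
  simp [put, h]

/-- Binary operations of source expressions. -/
inductive XOp where
  | add | sub | div | mul | max | min

namespace XOp

/-- The value of a binary operation. -/
def eval : XOp → ℤ → ℤ → ℤ
  | add, x, y => x + y
  | sub, x, y => x - y
  | div, x, y => x / y
  | mul, x, y => x * y
  | max, x, y => Max.max x y
  | min, x, y => Min.min x y

/-- A bound on the steps of a binary operation. -/
def cost : XOp → ℤ → ℕ
  | mul, y => 40 + 20 * y.natAbs
  | _, _ => 40

end XOp

/-- Source expressions. -/
inductive XE where
  | const (z : ℤ)
  | read (a : ℕ) (i : XE)
  | bin (op : XOp) (e f : XE)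
  | size (e : XE)

namespace XE

/-- The value of a source expression. -/
def eval (σ : Store) : XE → ℤ
  | const z => z
  | read a i => σ a (i.eval σ)
  | bin op e f => op.eval (e.eval σ) (f.eval σ)
  | size e => (Nat.size (e.eval σ).toNat : ℤ)

/-- A bound on the steps that the compiled expression takes. -/
def cost (σ : Store) : XE → ℕ
  | const _ => 3
  | read _ i => i.cost σ + 6
  | bin op e f => e.cost σ + f.cost σ + op.cost (f.eval σ)
  | size e => e.cost σ + 40 + 40 * Nat.size (e.eval σ).toNat

/-- Every array that the expression reads lies below the arrays of the compiler. -/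
def ok : XE → Bool
  | const _ => true
  | read a i => decide (a < 100) && i.ok
  | bin _ e f => e.ok && f.ok
  | size e => e.ok

end XE

/-- Conditions. -/
inductive BE where
  | le (e f : XE)
  | and (b c : BE)
  | not (b : BE)

namespace BE

/-- The truth of a condition. -/
def holds (σ : Store) : BE → Prop
  | le e f => e.eval σ ≤ f.eval σ
  | and b c => b.holds σ ∧ c.holds σ
  | not b => ¬ b.holds σ

instance decidableHolds (σ : Store) : (b : BE) → Decidable (b.holds σ)
  | le e f => inferInstanceAs (Decidable (e.eval σ ≤ f.eval σ))
  | and b c =>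
    haveI := decidableHolds σ b
    haveI := decidableHolds σ c
    inferInstanceAs (Decidable (b.holds σ ∧ c.holds σ))
  | not b =>
    haveI := decidableHolds σ b
    inferInstanceAs (Decidable (¬ b.holds σ))

/-- A bound on the steps that testing a condition takes. -/
def cost (σ : Store) : BE → ℕ
  | le e f => e.cost σ + f.cost σ + 5
  | and b c => b.cost σ + c.cost σ
  | not b => b.cost σ

/-- Every array that the condition reads lies below the arrays of the compiler. -/
def ok : BE → Bool
  | le e f => e.ok && f.ok
  | and b c => b.ok && c.ok
  | not b => b.ok

end BE

/-- The store after `N` rounds of a loop body that depends on the round. -/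
def iter (F : ℕ → Store → Store) : ℕ → Store → Store
  | 0, σ => σ
  | k + 1, σ => F k (iter F k σ)

/-- Source statements. -/
inductive St where
  | skip
  | assign (a : ℕ) (i e : XE)
  | seq (p q : St)
  | ite (b : BE) (p q : St)
  | loop (i : ℕ) (e : XE) (p : St)

namespace St

/-- The store after running a statement. -/
def run : St → Store → Store
  | skip, σ => σ
  | assign a i e, σ => put σ a (i.eval σ) (e.eval σ)
  | seq p q, σ => run q (run p σ)
  | ite b p q, σ => if b.holds σ then run p σ else run q σ
  | loop i e p, σ => iter (fun k τ => run p (put τ i 0 k)) (e.eval σ).toNat σ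

/-- A bound on the steps of the compiled statement. -/
def tm : St → Store → ℕ
  | skip, _ => 1
  | assign _ i e, σ => i.cost σ + e.cost σ + 5
  | seq p q, σ => tm p σ + tm q (run p σ)
  | ite b p q, σ => b.cost σ + if b.holds σ then tm p σ else tm q σ
  | loop i e p, σ => e.cost σ + 20 +
      ∑ k ∈ Finset.range (e.eval σ).toNat,
        (tm p (put (iter (fun k τ => run p (put τ i 0 k)) k σ) i 0 k) + 20)

/-- Every array that the statement uses lies below the arrays of the compiler. -/
def ok : St → Bool
  | skip => true
  | assign a i e => decide (a < 100) && i.ok && e.ok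
  | seq p q => p.ok && q.ok
  | ite b p q => b.ok && p.ok && q.ok
  | loop i e p => decide (i < 100) && e.ok && p.ok

/-- The arrays that a statement may write to. -/
def mods : St → List ℕ
  | skip => []
  | assign a _ _ => [a]
  | seq p q => mods p ++ mods q
  | ite _ p q => mods p ++ mods q
  | loop i _ p => i :: mods p

end St

/-! ### Compilation -/

/-- The content of the cell `0` of an array. -/
def cell (d : ℕ) : RExpr := RExpr.read d (RExpr.const 0)

/-- Assignment to the cell `0` of an array. -/
def setCell (d : ℕ) (e : RExpr) : Program := Program.write d (RExpr.const 0) e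

/-- The code for multiplication of the cells `d` and `d + 1`. -/
def mulProgram (d : ℕ) : Program :=
  .seq (setCell (d + 2) (.const 0))
  (.seq (.ifLe (.const 0) (cell (d + 1))
      (.seq .skip (setCell (d + 3) (cell (d + 1))))
      (.seq (setCell d (.sub (.const 0) (cell d)))
        (setCell (d + 3) (.sub (.const 0) (cell (d + 1))))))
  (.seq (.whileLe (.const 1) (cell (d + 3))
      (.seq (setCell (d + 2) (.add (cell (d + 2)) (cell d)))
        (setCell (d + 3) (.sub (cell (d + 3)) (.const 1)))))
    (setCell d (cell (d + 2)))))

/-- The code for a binary operation on the cells `d` and `d + 1`. -/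
def XOp.compile (d : ℕ) : XOp → Program
  | .add => setCell d (.add (cell d) (cell (d + 1)))
  | .sub => setCell d (.sub (cell d) (cell (d + 1)))
  | .div => setCell d (.div (cell d) (cell (d + 1)))
  | .mul => mulProgram d
  | .max => .ifLe (cell d) (cell (d + 1)) (setCell d (cell (d + 1))) .skip
  | .min => .ifLe (cell d) (cell (d + 1)) .skip (setCell d (cell (d + 1)))

/-- The code for the binary length of the cell `d`. -/
def sizeProgram (d : ℕ) : Program :=
  .seq (setCell (d + 1) (.const 0))
  (.seq (.whileLe (.const 1) (cell d)
      (.seq (setCell (d + 1) (.add (cell (d + 1)) (.const 1)))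
        (setCell d (.div (cell d) (.const 2)))))
    (setCell d (cell (d + 1))))

/-- The code that evaluates an expression into the cell `0` of the array `d`. -/
def XE.compile : ℕ → XE → Program
  | d, .const z => setCell d (.const z)
  | d, .read a i => .seq (i.compile d) (setCell d (.read a (cell d)))
  | d, .bin op e f => .seq (e.compile d) (.seq (f.compile (d + 1)) (op.compile d))
  | d, .size e => .seq (e.compile d) (sizeProgram d)

/-- The code for a conditional. -/
def BE.compile : ℕ → BE → Program → Program → Program
  | d, .le e f, p, q =>
      .seq (e.compile d) (.seq (f.compile (d + 1)) (.ifLe (cell d) (cell (d + 1)) p q))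
  | d, .and b c, p, q => b.compile d (c.compile d p q) q
  | d, .not b, p, q => b.compile d q p

/-- The code of a statement, with auxiliary cells in the arrays from `d` on. -/
def St.compile : ℕ → St → Program
  | _, .skip => .skip
  | d, .assign a i e =>
      .seq (i.compile d) (.seq (e.compile (d + 1)) (.write a (cell d) (cell (d + 1))))
  | d, .seq p q => .seq (p.compile d) (q.compile d)
  | d, .ite b p q => b.compile d (p.compile d) (q.compile d)
  | d, .loop i e p =>
      .seq (e.compile d)
      (.seq (setCell (d + 1) (.const 0))
        (.whileLe (.add (cell (d + 1)) (.const 1)) (cell d)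
          (.seq (setCell i (cell (d + 1)))
          (.seq (p.compile (d + 2))
            (setCell (d + 1) (.add (cell (d + 1)) (.const 1)))))))

/-! ### Correctness and cost of the compiler. -/

section Correctness

variable {out : Store} {time : ℕ}

theorem exec_setCell (σ : Store) (d : ℕ) (e : RExpr) :
    Exec out time (setCell d e) σ (e.cost + 2) (put σ d 0 (e.eval σ)) := by
  have h := Exec.write (out := out) (time := time) σ d (RExpr.const 0) e
  have h2 : (RExpr.const 0).cost + e.cost + 1 = e.cost + 2 := by
    simp only [RExpr.cost]; ring
  rw [h2] at h
  exact h

theorem cell_eval (σ : Store) (d : ℕ) : (cell d).eval σ = σ d 0 := rfl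

theorem cell_cost (d : ℕ) : (cell d).cost = 2 := rfl

theorem exec_mul_loop (d : ℕ) (k : ℕ) : ∀ σ : Store, σ (d + 3) 0 = k →
    ∃ T σ', Exec out time (.whileLe (.const 1) (cell (d + 3))
      (.seq (setCell (d + 2) (.add (cell (d + 2)) (cell d)))
        (setCell (d + 3) (.sub (cell (d + 3)) (.const 1))))) σ T σ' ∧
      T ≤ 17 * k + 5 ∧ σ' (d + 2) 0 = σ (d + 2) 0 + k * σ d 0 ∧ ∀ a ≤ d + 1, σ' a = σ a := by
  induction k with
  | zero =>
    intro σ h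
    refine ⟨_, σ, Exec.while_false ?_, ?_, ?_, fun a _ => rfl⟩
    · simp [RExpr.eval, cell_eval, h]
    · simp [RExpr.cost, cell_cost]
    · simp
  | succ k ih =>
    intro σ h
    set σ₁ := put (put σ (d + 2) 0 (σ (d + 2) 0 + σ d 0)) (d + 3) 0 (k : ℤ) with hσ₁
    have e1 := exec_setCell (out := out) (time := time) σ (d + 2) (.add (cell (d + 2)) (cell d))
    have e2 := exec_setCell (out := out) (time := time)
      (put σ (d + 2) 0 (σ (d + 2) 0 + σ d 0)) (d + 3) (.sub (cell (d + 3)) (.const 1))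
    have h3 : RExpr.eval (put σ (d + 2) 0 (σ (d + 2) 0 + σ d 0))
        (.sub (cell (d + 3)) (.const 1)) = k := by
      simp [RExpr.eval, cell_eval, put_apply, h]
    rw [h3] at e2
    obtain ⟨T, σ', hx, hT, hv, hf⟩ := ih σ₁ (by simp [hσ₁, put_apply])
    refine ⟨_, σ', Exec.while_true ?_ (Exec.seq e1 e2) hx, ?_, ?_, ?_⟩
    · simp [RExpr.eval, cell_eval, h]
    · simp only [RExpr.cost, cell_cost]
      omega
    · rw [hv]
      simp only [hσ₁, put_apply]
      simp
      ring
    · intro a ha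
      rw [hf a ha, hσ₁, put_other _ _ _ (by omega), put_other _ _ _ (by omega)]

/-- Multiplication is repeated addition, with the first factor negated if the second is negative.
The time is linear in the absolute value of the second factor and independent of the first, so the
programs below put a factor of controlled size second. -/
theorem exec_mulProgram (d : ℕ) (σ : Store) :
    ∃ T σ', Exec out time (mulProgram d) σ T σ' ∧ T ≤ XOp.cost .mul (σ (d + 1) 0) ∧
      σ' d 0 = σ d 0 * σ (d + 1) 0 ∧ ∀ a < d, σ' a = σ a := by
  have e1 := exec_setCell (out := out) (time := time) σ (d + 2) (.const 0)
  set σ₁ := put σ (d + 2) 0 (RExpr.eval σ (.const 0)) with hσ₁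
  obtain ⟨T₂, σ₂, e2, hT₂, h3, h4, h5, hf⟩ : ∃ T₂ σ₂, Exec out time
      (.ifLe (.const 0) (cell (d + 1))
      (.seq .skip (setCell (d + 3) (cell (d + 1))))
      (.seq (setCell d (.sub (.const 0) (cell d)))
        (setCell (d + 3) (.sub (.const 0) (cell (d + 1)))))) σ₁ T₂ σ₂ ∧ T₂ ≤ 16 ∧
      σ₂ (d + 3) 0 = (σ (d + 1) 0).natAbs ∧ σ₂ (d + 2) 0 = 0 ∧
      (σ (d + 1) 0).natAbs * σ₂ d 0 = σ d 0 * σ (d + 1) 0 ∧ ∀ a < d, σ₂ a = σ a := by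
    by_cases hc : 0 ≤ σ (d + 1) 0
    · refine ⟨_, _, Exec.if_true ?_ (Exec.seq (Exec.skip _) (exec_setCell _ _ _)), ?_, ?_, ?_, ?_,
        ?_⟩
      · simp [RExpr.eval, cell_eval, hσ₁, put_apply, hc]
      · simp [RExpr.cost, cell_cost]
      · simp [cell_eval, hσ₁, put_apply, abs_of_nonneg hc]
      · simp [hσ₁, put_apply, RExpr.eval]
      · simp [hσ₁, put_apply, abs_of_nonneg hc, mul_comm]
      · intro a ha
        rw [put_other _ _ _ (by omega), hσ₁, put_other _ _ _ (by omega)]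
    · refine ⟨_, _, Exec.if_false ?_ (Exec.seq (exec_setCell _ _ _) (exec_setCell _ _ _)), ?_, ?_,
        ?_, ?_, ?_⟩
      · simpa [RExpr.eval, cell_eval, hσ₁, put_apply] using hc
      · simp [RExpr.cost, cell_cost]
      · simp [cell_eval, hσ₁, put_apply, RExpr.eval, abs_of_neg (not_le.1 hc)]
      · simp [hσ₁, put_apply, RExpr.eval]
      · simp [hσ₁, put_apply, cell_eval, RExpr.eval, abs_of_neg (not_le.1 hc), mul_comm]
      · intro a ha
        rw [put_other _ _ _ (by omega), put_other _ _ _ (by omega), hσ₁,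
          put_other _ _ _ (by omega)]
  obtain ⟨T₃, σ₃, e3, hT₃, hv, hf3⟩ := exec_mul_loop (out := out) (time := time) d _ σ₂ h3
  refine ⟨_, _, Exec.seq e1 (Exec.seq e2 (Exec.seq e3 (exec_setCell _ _ _))), ?_, ?_, ?_⟩
  · simp only [RExpr.cost, cell_cost, XOp.cost]
    omega
  · simpa [put_apply, cell_eval, hv, h4] using h5
  · intro a ha
    rw [put_other _ _ _ (by omega), hf3 a (by omega), hf a ha]

theorem exec_op (op : XOp) (d : ℕ) (σ : Store) :
    ∃ T σ', Exec out time (op.compile d) σ T σ' ∧ T ≤ op.cost (σ (d + 1) 0) ∧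
      σ' d 0 = op.eval (σ d 0) (σ (d + 1) 0) ∧ ∀ a < d, σ' a = σ a := by
  cases op with
  | mul => exact exec_mulProgram d σ
  | add | sub | div =>
    refine ⟨_, _, exec_setCell _ _ _, ?_, ?_, ?_⟩
    · simp [RExpr.cost, cell_cost, XOp.cost]
    · simp [put_apply, RExpr.eval, cell_eval, XOp.eval]
    · intro a ha
      rw [put_other _ _ _ (by omega)]
  | max =>
    by_cases h : σ d 0 ≤ σ (d + 1) 0
    · refine ⟨_, _, Exec.if_true h (exec_setCell _ _ _), ?_, ?_, ?_⟩
      · simp [cell_cost, XOp.cost]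
      · simp [put_apply, cell_eval, XOp.eval, h]
      · intro a ha
        rw [put_other _ _ _ (by omega)]
    · refine ⟨_, _, Exec.if_false h (Exec.skip _), ?_, ?_, fun _ _ => rfl⟩
      · simp [cell_cost, XOp.cost]
      · simp [XOp.eval, le_of_not_ge h]
  | min =>
    by_cases h : σ d 0 ≤ σ (d + 1) 0
    · refine ⟨_, _, Exec.if_true h (Exec.skip _), ?_, ?_, fun _ _ => rfl⟩
      · simp [cell_cost, XOp.cost]
      · simp [XOp.eval, h]
    · refine ⟨_, _, Exec.if_false h (exec_setCell _ _ _), ?_, ?_, ?_⟩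
      · simp [cell_cost, XOp.cost]
      · simp [put_apply, cell_eval, XOp.eval, le_of_not_ge h]
      · intro a ha
        rw [put_other _ _ _ (by omega)]

theorem size_toNat_pos {z : ℤ} (h : 1 ≤ z) : Nat.size z.toNat = Nat.size (z / 2).toNat + 1 := by
  obtain ⟨k, rfl⟩ := Int.eq_ofNat_of_zero_le (by omega : 0 ≤ z)
  have hk : (k : ℤ) / 2 = ((k / 2 : ℕ) : ℤ) := by simp
  rw [Int.toNat_natCast, hk, Int.toNat_natCast]
  have hk1 : 1 ≤ k := by exact_mod_cast h
  have h2 : k = Nat.bit (k % 2 == 1) (k / 2) := by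
    rw [Nat.bit_val]
    rcases Nat.mod_two_eq_zero_or_one k with h | h <;> simp [h] <;> omega
  conv_lhs => rw [h2]
  rw [Nat.size_bit (by rw [← h2]; omega)]

theorem exec_size_loop (d : ℕ) (k : ℕ) : ∀ σ : Store, Nat.size (σ d 0).toNat = k →
    ∃ T σ', Exec out time (.whileLe (.const 1) (cell d)
      (.seq (setCell (d + 1) (.add (cell (d + 1)) (.const 1)))
        (setCell d (.div (cell d) (.const 2))))) σ T σ' ∧
      T ≤ 20 * k + 5 ∧ σ' (d + 1) 0 = σ (d + 1) 0 + k ∧ ∀ a < d, σ' a = σ a := by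
  induction k with
  | zero =>
    intro σ h
    have h0 : ¬ 1 ≤ σ d 0 := by
      intro h1
      rw [size_toNat_pos h1] at h
      omega
    refine ⟨_, σ, Exec.while_false ?_, ?_, ?_, fun a _ => rfl⟩
    · simpa [RExpr.eval, cell_eval] using h0
    · simp [RExpr.cost, cell_cost]
    · simp
  | succ k ih =>
    intro σ h
    have h0 : 1 ≤ σ d 0 := by
      by_contra h1
      have : (σ d 0).toNat = 0 := by omega
      rw [this] at h
      simp at h
    rw [size_toNat_pos h0] at h
    set σ₁ := put (put σ (d + 1) 0 (σ (d + 1) 0 + 1)) d 0 (σ d 0 / 2) with hσ₁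
    have e1 := exec_setCell (out := out) (time := time) σ (d + 1)
      (.add (cell (d + 1)) (.const 1))
    have e2 := exec_setCell (out := out) (time := time)
      (put σ (d + 1) 0 (σ (d + 1) 0 + 1)) d (.div (cell d) (.const 2))
    have h3 : RExpr.eval (put σ (d + 1) 0 (σ (d + 1) 0 + 1))
        (.div (cell d) (.const 2)) = σ d 0 / 2 := by
      simp [RExpr.eval, cell_eval, put_apply]
    rw [h3] at e2
    obtain ⟨T, σ', hx, hT, hv, hf⟩ := ih σ₁ (by simp [hσ₁, put_apply]; omega)
    refine ⟨_, σ', Exec.while_true h0 (Exec.seq e1 e2) hx, ?_, ?_, ?_⟩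
    · simp only [RExpr.cost, cell_cost]
      omega
    · rw [hv]
      simp only [hσ₁, put_apply]
      simp
      ring
    · intro a ha
      rw [hf a ha, hσ₁, put_other _ _ _ (by omega), put_other _ _ _ (by omega)]

theorem exec_sizeProgram (d : ℕ) (σ : Store) :
    ∃ T σ', Exec out time (sizeProgram d) σ T σ' ∧ T ≤ 40 + 40 * Nat.size (σ d 0).toNat ∧
      σ' d 0 = Nat.size (σ d 0).toNat ∧ ∀ a < d, σ' a = σ a := by
  have e1 := exec_setCell (out := out) (time := time) σ (d + 1) (.const 0)
  obtain ⟨T, σ', hx, hT, hv, hf⟩ := exec_size_loop (out := out) (time := time) d _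
    (put σ (d + 1) 0 (RExpr.eval σ (.const 0))) rfl
  have h0 : put σ (d + 1) 0 (RExpr.eval σ (.const 0)) d 0 = σ d 0 := by
    rw [put_other _ _ _ (by omega)]
  rw [h0] at hT hv
  refine ⟨_, _, Exec.seq e1 (Exec.seq hx (exec_setCell _ _ _)), ?_, ?_, ?_⟩
  · simp only [RExpr.cost, cell_cost]
    omega
  · simp [put_apply, cell_eval, hv, RExpr.eval]
  · intro a ha
    rw [put_other _ _ _ (by omega), hf a ha, put_other _ _ _ (by omega)]

/-- The auxiliary arrays from `d` on serve as a stack: evaluation at depth `d` leaves its value in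
array `d` and spares everything below. The machine store `σ` has to agree with the source store `τ`
only on the arrays below 100, which are all that the expression reads. -/
theorem exec_expr (e : XE) (hok : e.ok = true) : ∀ (d : ℕ) (_ : 100 ≤ d) (σ τ : Store),
    (∀ a < 100, σ a = τ a) →
    ∃ T σ', Exec out time (e.compile d) σ T σ' ∧ T ≤ e.cost τ ∧
      σ' d 0 = e.eval τ ∧ ∀ a < d, σ' a = σ a := by
  induction e with
  | const z =>
    intro d _ σ τ _
    refine ⟨_, _, exec_setCell _ _ _, ?_, ?_, ?_⟩
    · simp [RExpr.cost, XE.cost]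
    · simp [put_apply, RExpr.eval, XE.eval]
    · intro a ha
      rw [put_other _ _ _ (by omega)]
  | read a i ih =>
    intro d hd σ τ h
    simp only [XE.ok, Bool.and_eq_true, decide_eq_true_eq] at hok
    obtain ⟨T, σ', hx, hT, hv, hf⟩ := ih hok.2 d hd σ τ h
    refine ⟨_, _, Exec.seq hx (exec_setCell _ _ _), ?_, ?_, ?_⟩
    · simp only [RExpr.cost, cell_cost, XE.cost]
      omega
    · simp [put_apply, RExpr.eval, cell_eval, XE.eval, hv, hf a (by omega), h a hok.1]
    · intro b hb
      rw [put_other _ _ _ (by omega), hf b hb]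
  | bin op e f ihe ihf =>
    intro d hd σ τ h
    simp only [XE.ok, Bool.and_eq_true] at hok
    obtain ⟨T, σ', hx, hT, hv, hf⟩ := ihe hok.1 d hd σ τ h
    obtain ⟨T₂, σ₂, hx₂, hT₂, hv₂, hf₂⟩ := ihf hok.2 (d + 1) (by omega) σ' τ
      (fun a ha => by rw [hf a (by omega), h a ha])
    obtain ⟨T₃, σ₃, hx₃, hT₃, hv₃, hf₃⟩ := exec_op (out := out) (time := time) op d σ₂
    refine ⟨_, _, Exec.seq hx (Exec.seq hx₂ hx₃), ?_, ?_, ?_⟩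
    · simp only [XE.cost]
      rw [hv₂] at hT₃
      omega
    · rw [hv₃, hv₂, hf₂ d (by omega), hv]
      rfl
    · intro b hb
      rw [hf₃ b hb, hf₂ b (by omega), hf b hb]
  | size e ih =>
    intro d hd σ τ h
    obtain ⟨T, σ', hx, hT, hv, hf⟩ := ih hok d hd σ τ h
    obtain ⟨T₃, σ₃, hx₃, hT₃, hv₃, hf₃⟩ := exec_sizeProgram (out := out) (time := time) d σ'
    refine ⟨_, _, Exec.seq hx hx₃, ?_, ?_, ?_⟩
    · simp only [XE.cost]
      rw [hv] at hT₃
      omega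
    · rw [hv₃, hv]
      rfl
    · intro b hb
      rw [hf₃ b hb, hf b hb]

/-- Conditions compile to nested branches rather than to truth values, so correctness takes a
continuation form: after a prefix of `T₀` steps that spares the arrays below `d`, the code behaves
like the selected branch. -/
theorem exec_cond (b : BE) (hok : b.ok = true) : ∀ (d : ℕ) (_ : 100 ≤ d) (σ τ : Store),
    (∀ a < 100, σ a = τ a) → ∀ (p q : Program), ∃ T₀ σ₀, (∀ a < d, σ₀ a = σ a) ∧ T₀ ≤ b.cost τ ∧
      ∀ T σ', Exec out time (if b.holds τ then p else q) σ₀ T σ' →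
        Exec out time (b.compile d p q) σ (T₀ + T) σ' := by
  induction b with
  | le e f =>
    intro d hd σ τ h p q
    simp only [BE.ok, Bool.and_eq_true] at hok
    obtain ⟨T₁, σ₁, hx₁, hT₁, hv₁, hf₁⟩ :=
      exec_expr (out := out) (time := time) e hok.1 d hd σ τ h
    obtain ⟨T₂, σ₂, hx₂, hT₂, hv₂, hf₂⟩ :=
      exec_expr (out := out) (time := time) f hok.2 (d + 1) (by omega) σ₁ τ
      (fun a ha => by rw [hf₁ a (by omega), h a ha])
    refine ⟨T₁ + T₂ + 5, σ₂, ?_, ?_, ?_⟩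
    · intro a ha
      rw [hf₂ a (by omega), hf₁ a ha]
    · simp only [BE.cost]
      omega
    · intro T σ' hx
      have hd0 : σ₂ d 0 = e.eval τ := by rw [hf₂ d (by omega), hv₁]
      have hT : T₁ + T₂ + 5 + T = T₁ + (T₂ + ((cell d).cost + (cell (d + 1)).cost + 1 + T)) := by
        simp only [cell_cost]
        omega
      rw [hT]
      by_cases hc : (BE.le e f).holds τ
      · rw [if_pos hc] at hx
        refine Exec.seq hx₁ (Exec.seq hx₂ (Exec.if_true ?_ hx))
        rw [cell_eval, cell_eval, hd0, hv₂]
        exact hc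
      · rw [if_neg hc] at hx
        refine Exec.seq hx₁ (Exec.seq hx₂ (Exec.if_false ?_ hx))
        rw [cell_eval, cell_eval, hd0, hv₂]
        exact hc
  | and b c ihb ihc =>
    intro d hd σ τ h p q
    simp only [BE.ok, Bool.and_eq_true] at hok
    obtain ⟨T₁, σ₁, hf₁, hT₁, hx₁⟩ := ihb hok.1 d hd σ τ h (c.compile d p q) q
    by_cases hb : b.holds τ
    · obtain ⟨T₂, σ₂, hf₂, hT₂, hx₂⟩ := ihc hok.2 d hd σ₁ τ
        (fun a ha => by rw [hf₁ a (by omega), h a ha]) p q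
      refine ⟨T₁ + T₂, σ₂, fun a ha => by rw [hf₂ a ha, hf₁ a ha], ?_, ?_⟩
      · simp only [BE.cost]
        omega
      · intro T σ' hx
        rw [add_assoc]
        apply hx₁
        rw [if_pos hb]
        apply hx₂
        by_cases hc : c.holds τ
        · rw [if_pos hc]
          rwa [if_pos (show (BE.and b c).holds τ from ⟨hb, hc⟩)] at hx
        · rw [if_neg hc]
          rwa [if_neg (show ¬ (BE.and b c).holds τ from fun h => hc h.2)] at hx
    · refine ⟨T₁, σ₁, hf₁, ?_, ?_⟩
      · simp only [BE.cost]
        omega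
      · intro T σ' hx
        apply hx₁
        rw [if_neg hb]
        rwa [if_neg (show ¬ (BE.and b c).holds τ from fun h => hb h.1)] at hx
  | not b ih =>
    intro d hd σ τ h p q
    obtain ⟨T₁, σ₁, hf₁, hT₁, hx₁⟩ := ih hok d hd σ τ h q p
    refine ⟨T₁, σ₁, hf₁, hT₁, ?_⟩
    intro T σ' hx
    apply hx₁
    by_cases hb : b.holds τ
    · rw [if_pos hb]
      rwa [if_neg (show ¬ (BE.not b).holds τ from fun h => h hb)] at hx
    · rw [if_neg hb]
      rwa [if_pos (show (BE.not b).holds τ from hb)] at hx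

/-- The arrays from 100 up to `d` must survive because they hold the limits and counters of the
enclosing loops. -/
theorem exec_stmt (s : St) (hok : s.ok = true) : ∀ (d : ℕ) (_ : 100 ≤ d) (σ τ : Store),
    (∀ a < 100, σ a = τ a) →
    ∃ T σ', Exec out time (s.compile d) σ T σ' ∧ T ≤ s.tm τ ∧
      (∀ a < 100, σ' a = s.run τ a) ∧ ∀ a < d, 100 ≤ a → σ' a = σ a := by
  induction s with
  | skip =>
    intro d _ σ τ h
    exact ⟨1, σ, Exec.skip σ, le_refl _, h, fun _ _ _ => rfl⟩
  | assign a i e =>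
    intro d hd σ τ h
    simp only [St.ok, Bool.and_eq_true, decide_eq_true_eq] at hok
    obtain ⟨T₁, σ₁, hx₁, hT₁, hv₁, hf₁⟩ :=
      exec_expr (out := out) (time := time) i hok.1.2 d hd σ τ h
    obtain ⟨T₂, σ₂, hx₂, hT₂, hv₂, hf₂⟩ :=
      exec_expr (out := out) (time := time) e hok.2 (d + 1) (by omega) σ₁ τ
      (fun b hb => by rw [hf₁ b (by omega), h b hb])
    refine ⟨_, _, Exec.seq hx₁ (Exec.seq hx₂ (Exec.write _ _ _ _)), ?_, ?_, ?_⟩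
    · simp only [St.tm, cell_cost]
      omega
    · intro b hb
      have h2 : ∀ b < 100, σ₂ b = τ b := fun b hb => by
        rw [hf₂ b (by omega), hf₁ b (by omega), h b hb]
      rw [cell_eval, cell_eval, hv₂, hf₂ d (by omega), hv₁]
      simp only [St.run, put]
      by_cases hba : b = a
      · subst hba
        simp [h2 b hb]
      · simp [hba, h2 b hb]
    · intro b hb hb2
      rw [Function.update_of_ne (by omega), hf₂ b (by omega), hf₁ b (by omega)]
  | seq p q ihp ihq =>
    intro d hd σ τ h
    simp only [St.ok, Bool.and_eq_true] at hok
    obtain ⟨T₁, σ₁, hx₁, hT₁, hv₁, hf₁⟩ := ihp hok.1 d hd σ τ h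
    obtain ⟨T₂, σ₂, hx₂, hT₂, hv₂, hf₂⟩ := ihq hok.2 d hd σ₁ _ hv₁
    refine ⟨_, _, Exec.seq hx₁ hx₂, ?_, hv₂, ?_⟩
    · simp only [St.tm]
      omega
    · intro b hb hb2
      rw [hf₂ b hb hb2, hf₁ b hb hb2]
  | ite b p q ihp ihq =>
    intro d hd σ τ h
    simp only [St.ok, Bool.and_eq_true] at hok
    obtain ⟨T₀, σ₀, hf₀, hT₀, hx₀⟩ := exec_cond (out := out) (time := time) b hok.1.1 d hd σ τ h
      (p.compile d) (q.compile d)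
    have h0 : ∀ a < 100, σ₀ a = τ a := fun a ha => by rw [hf₀ a (by omega), h a ha]
    by_cases hb : b.holds τ
    · obtain ⟨T₁, σ₁, hx₁, hT₁, hv₁, hf₁⟩ := ihp hok.1.2 d hd σ₀ τ h0
      refine ⟨_, σ₁, hx₀ T₁ σ₁ (by rwa [if_pos hb]), ?_, ?_, ?_⟩
      · simp only [St.tm, if_pos hb]
        omega
      · simpa only [St.run, if_pos hb] using hv₁
      · intro a ha ha2
        rw [hf₁ a ha ha2, hf₀ a ha]
    · obtain ⟨T₁, σ₁, hx₁, hT₁, hv₁, hf₁⟩ := ihq hok.2 d hd σ₀ τ h0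
      refine ⟨_, σ₁, hx₀ T₁ σ₁ (by rwa [if_neg hb]), ?_, ?_, ?_⟩
      · simp only [St.tm, if_neg hb]
        omega
      · simpa only [St.run, if_neg hb] using hv₁
      · intro a ha ha2
        rw [hf₁ a ha ha2, hf₀ a ha]
  | loop i e p ih =>
    intro d hd σ τ h
    simp only [St.ok, Bool.and_eq_true, decide_eq_true_eq] at hok
    obtain ⟨T₁, σ₁, hx₁, hT₁, hv₁, hf₁⟩ :=
      exec_expr (out := out) (time := time) e hok.1.2 d hd σ τ h
    set F : ℕ → Store → Store := fun k τ => p.run (put τ i 0 k) with hF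
    set N := (e.eval τ).toNat with hN
    -- Induction on the number `k` of remaining rounds, for any number `c` of rounds already done.
    -- The counter is kept in array `d + 1`, out of reach of the body, and is copied to the loop
    -- variable `i` in each round.
    have key : ∀ k c : ℕ, c + k = N → ∀ σ : Store, σ d 0 = e.eval τ → σ (d + 1) 0 = c →
        (∀ a < 100, σ a = iter F c τ a) →
        ∃ T σ', Exec out time (.whileLe (.add (cell (d + 1)) (.const 1)) (cell d)
          (.seq (setCell i (cell (d + 1)))
          (.seq (p.compile (d + 2))
            (setCell (d + 1) (.add (cell (d + 1)) (.const 1)))))) σ T σ' ∧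
          T ≤ 10 + ∑ j ∈ Finset.range k, (p.tm (put (iter F (c + j) τ) i 0 (c + j : ℕ)) + 20) ∧
          (∀ a < 100, σ' a = iter F N τ a) ∧ ∀ a < d, 100 ≤ a → σ' a = σ a := by
      intro k
      induction k with
      | zero =>
        intro c hc σ h1 h2 h3
        refine ⟨_, σ, Exec.while_false ?_, ?_, ?_, fun _ _ _ => rfl⟩
        · simp only [RExpr.eval, cell_eval, h1, h2]
          omega
        · simp [RExpr.cost, cell_cost]
        · rw [← hc]
          exact h3
      | succ k ihk =>
        intro c hc σ h1 h2 h3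
        have hle : RExpr.eval σ (.add (cell (d + 1)) (.const 1)) ≤ (cell d).eval σ := by
          simp only [RExpr.eval, cell_eval, h1, h2]
          omega
        have e1 := exec_setCell (out := out) (time := time) σ i (cell (d + 1))
        rw [cell_eval, h2] at e1
        obtain ⟨T₂, σ₂, hx₂, hT₂, hv₂, hf₂⟩ := ih hok.2 (d + 2) (by omega)
          (put σ i 0 c) (put (iter F c τ) i 0 c) (fun a ha => by
            funext j
            rw [put_apply, put_apply, h3 a ha])
        have e3 := exec_setCell (out := out) (time := time) σ₂ (d + 1)
          (.add (cell (d + 1)) (.const 1))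
        have hc2 : RExpr.eval σ₂ (.add (cell (d + 1)) (.const 1)) = ((c + 1 : ℕ) : ℤ) := by
          simp only [RExpr.eval, cell_eval]
          rw [hf₂ (d + 1) (by omega) (by omega), put_other _ _ _ (by omega), h2]
          simp
        rw [hc2] at e3
        obtain ⟨T₄, σ₄, hx₄, hT₄, hv₄, hf₄⟩ := ihk (c + 1) (by omega)
          (put σ₂ (d + 1) 0 ((c + 1 : ℕ) : ℤ))
          (by rw [put_other _ _ _ (by omega), hf₂ d (by omega) (by omega),
              put_other _ _ _ (by omega), h1])
          (by simp [put_apply])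
          (fun a ha => by
            rw [put_other _ _ _ (by omega), hv₂ a ha]
            rfl)
        refine ⟨_, σ₄, Exec.while_true hle (Exec.seq e1 (Exec.seq hx₂ e3)) hx₄, ?_, hv₄, ?_⟩
        · rw [Finset.sum_range_succ']
          simp only [RExpr.cost, cell_cost, Nat.add_zero]
          have h5 : ∀ j, c + 1 + j = c + (j + 1) := fun j => by omega
          simp only [h5] at hT₄
          omega
        · intro a ha ha2
          rw [hf₄ a ha ha2, put_other _ _ _ (by omega), hf₂ a (by omega) ha2,
            put_other _ _ _ (by omega)]
    have e2 := exec_setCell (out := out) (time := time) σ₁ (d + 1) (.const 0)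
    obtain ⟨T₃, σ₃, hx₃, hT₃, hv₃, hf₃⟩ := key N 0 (by simp) (put σ₁ (d + 1) 0 0)
      (by rw [put_other _ _ _ (by omega), hv₁])
      (by simp [put_apply])
      (fun a ha => by
        rw [put_other _ _ _ (by omega), hf₁ a (by omega), h a ha]
        rfl)
    refine ⟨_, σ₃, Exec.seq hx₁ (Exec.seq e2 hx₃), ?_, hv₃, ?_⟩
    · simp only [Nat.zero_add] at hT₃
      change T₁ + (1 + 2 + T₃) ≤ e.cost τ + 20 +
        ∑ j ∈ Finset.range N, (p.tm (put (iter F j τ) i 0 j) + 20)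
      omega
    · intro a ha ha2
      rw [hf₃ a ha ha2, put_other _ _ _ (by omega), hf₁ a ha]

end Correctness

/-! ### Reasoning about source programs -/

/-- The frame rule: since `mods` is computable, the survival of a concrete array can be decided. -/
theorem run_frame (s : St) : ∀ (σ : Store) (a : ℕ), a ∉ s.mods → s.run σ a = σ a := by
  induction s with
  | skip => intro σ a _; rfl
  | assign b i e =>
    intro σ a h
    exact put_other _ _ _ (by simpa [St.mods] using h)
  | seq p q ihp ihq =>
    intro σ a h
    simp only [St.mods, List.mem_append, not_or] at h
    rw [St.run, ihq _ _ h.2, ihp _ _ h.1]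
  | ite b p q ihp ihq =>
    intro σ a h
    simp only [St.mods, List.mem_append, not_or] at h
    rw [St.run]
    split_ifs
    · exact ihp _ _ h.1
    · exact ihq _ _ h.2
  | loop i e p ih =>
    intro σ a h
    simp only [St.mods, List.mem_cons, not_or] at h
    rw [St.run]
    generalize (e.eval σ).toNat = N
    induction N with
    | zero => rfl
    | succ k ihk =>
      rw [iter, ih _ _ h.2, put_other _ _ _ h.1, ihk]

/-- Started in `σ`, the statement ends in a store with the property `Q`
after at most `T` steps. -/
def Sat (s : St) (σ : Store) (T : ℕ) (Q : Store → Prop) : Prop :=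
  Q (s.run σ) ∧ s.tm σ ≤ T

theorem Sat.mono {s : St} {σ : Store} {T T' : ℕ} {Q Q' : Store → Prop} (h : Sat s σ T Q)
    (hT : T ≤ T') (hQ : ∀ τ, (∀ a, a ∉ s.mods → τ a = σ a) → Q τ → Q' τ) : Sat s σ T' Q' :=
  ⟨hQ _ (fun a ha => run_frame s σ a ha) h.1, h.2.trans hT⟩

theorem Sat.seq {p q : St} {σ : Store} {T₁ T₂ : ℕ} {Q₁ Q : Store → Prop} (h₁ : Sat p σ T₁ Q₁)
    (h₂ : ∀ τ, (∀ a, a ∉ p.mods → τ a = σ a) → Q₁ τ → Sat q τ T₂ Q) :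
    Sat (.seq p q) σ (T₁ + T₂) Q := by
  have h := h₂ (p.run σ) (fun a ha => run_frame p σ a ha) h₁.1
  exact ⟨h.1, Nat.add_le_add h₁.2 h.2⟩

theorem Sat.assign (a : ℕ) (i e : XE) (σ : Store) (T : ℕ) (Q : Store → Prop)
    (hT : i.cost σ + e.cost σ + 5 ≤ T) (hQ : Q (put σ a (i.eval σ) (e.eval σ))) :
    Sat (.assign a i e) σ T Q := ⟨hQ, hT⟩

theorem Sat.ite {b : BE} {p q : St} {σ : Store} {T₀ T : ℕ} {Q : Store → Prop}
    (hb : b.cost σ ≤ T₀)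
    (hp : b.holds σ → Sat p σ T Q) (hq : ¬ b.holds σ → Sat q σ T Q) :
    Sat (.ite b p q) σ (T₀ + T) Q := by
  unfold Sat St.run St.tm
  split_ifs with h
  · exact ⟨(hp h).1, Nat.add_le_add hb (hp h).2⟩
  · exact ⟨(hq h).1, Nat.add_le_add hb (hq h).2⟩

theorem Sat.skip {σ : Store} {Q : Store → Prop} (h : Q σ) : Sat .skip σ 1 Q := ⟨h, le_refl _⟩

/-- The invariant rule for loops. -/
theorem Sat.loop {i : ℕ} {e : XE} {p : St} {σ : Store} (Inv : ℕ → Store → Prop) (N T T₀ : ℕ)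
    (hN : e.eval σ = N) (hT₀ : e.cost σ ≤ T₀) (h0 : Inv 0 σ)
    (hstep : ∀ k τ, k < N → (∀ a, a ∉ i :: p.mods → τ a = σ a) → Inv k τ →
      Sat p (put τ i 0 k) T (Inv (k + 1))) :
    Sat (.loop i e p) σ (T₀ + 20 + N * (T + 20)) (Inv N) := by
  set F : ℕ → Store → Store := fun k τ => p.run (put τ i 0 k) with hF
  have hfr : ∀ k a, a ∉ i :: p.mods → iter F k σ a = σ a := by
    intro k a ha
    simp only [List.mem_cons, not_or] at ha
    induction k with
    | zero => rfl
    | succ k ih =>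
      change p.run (put (iter F k σ) i 0 k) a = σ a
      rw [run_frame _ _ _ ha.2, put_other _ _ _ ha.1, ih]
  have hinv : ∀ k ≤ N, Inv k (iter F k σ) := by
    intro k
    induction k with
    | zero => intro _; exact h0
    | succ k ih => intro hk; exact (hstep k _ (by omega) (hfr k) (ih (by omega))).1
  have hNN : (e.eval σ).toNat = N := by rw [hN]; simp
  constructor
  · rw [St.run, hNN]
    exact hinv N le_rfl
  · rw [St.tm, hNN]
    refine Nat.add_le_add (Nat.add_le_add_right hT₀ 20) ?_
    calc _ ≤ ∑ _k ∈ Finset.range N, (T + 20) := Finset.sum_le_sum (fun k hk => by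
            have hk' := Finset.mem_range.1 hk
            exact Nat.add_le_add_right (hstep k _ hk' (hfr k) (hinv k hk'.le)).2 20)
      _ = _ := by simp

/-! ## Zero-sum subfamilies

A rearrangement lemma of Steinitz type: a zero-sum family of integer vectors contains a zero-sum
subfamily whose size is bounded in terms of the dimension and the size of the entries. -/

section Steinitz

variable {ι : Type*} {d : ℕ}

/-- The admissible weights form a nonempty compact polytope, and an extreme point of it has the
required form: among more than `d + 1` fractional weights there would be a direction that keeps all
`d + 1` equations, and a small move along it in either sense stays in the polytope. -/
theorem exists_few_fractional [Fintype ι] (v : ι → Fin d → ℝ) (c : ℝ) (w₀ : ι → ℝ)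
    (h₀ : ∀ i, 0 ≤ w₀ i ∧ w₀ i ≤ 1) (hc : ∑ i, w₀ i = c) (hv : ∀ j, ∑ i, w₀ i * v i j = 0) :
    ∃ w : ι → ℝ, (∀ i, 0 ≤ w i ∧ w i ≤ 1) ∧ ∑ i, w i = c ∧ (∀ j, ∑ i, w i * v i j = 0) ∧
      (Finset.univ.filter fun i => 0 < w i ∧ w i < 1).card ≤ d + 1 := by
  classical
  set K : Set (ι → ℝ) := {w | (∀ i, 0 ≤ w i ∧ w i ≤ 1) ∧ ∑ i, w i = c ∧
    ∀ j, ∑ i, w i * v i j = 0} with hK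
  have hcl : IsClosed K := by
    have h1 : IsClosed {w : ι → ℝ | ∀ i, 0 ≤ w i ∧ w i ≤ 1} := by
      simp only [Set.ofPred_forall]
      exact isClosed_iInter fun i => (isClosed_le continuous_const (continuous_apply i)).inter
        (isClosed_le (continuous_apply i) continuous_const)
    have h2 : IsClosed {w : ι → ℝ | ∑ i, w i = c} :=
      isClosed_eq (by fun_prop) continuous_const
    have h3 : IsClosed {w : ι → ℝ | ∀ j, ∑ i, w i * v i j = 0} := by
      simp only [Set.ofPred_forall]
      exact isClosed_iInter fun j => isClosed_eq (by fun_prop) continuous_const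
    exact h1.inter (h2.inter h3)
  have hco : IsCompact K := by
    refine IsCompact.of_isClosed_subset (isCompact_Icc (a := (0 : ι → ℝ)) (b := 1)) hcl ?_
    intro w hw
    exact ⟨fun i => (hw.1 i).1, fun i => (hw.1 i).2⟩
  obtain ⟨w, hw⟩ := hco.extremePoints_nonempty ⟨w₀, h₀, hc, hv⟩
  rw [mem_extremePoints] at hw
  obtain ⟨⟨hw1, hw2, hw3⟩, hext⟩ := hw
  refine ⟨w, hw1, hw2, hw3, ?_⟩
  by_contra hcard
  set F := Finset.univ.filter fun i => 0 < w i ∧ w i < 1 with hF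
  -- The extra coordinate `none`, constantly 1, stands for the equation that fixes the sum of the
  -- weights.
  let u : F → Option (Fin d) → ℝ := fun i o => o.elim 1 (fun j => v i j)
  have hdep : ¬ LinearIndependent ℝ u := by
    intro hli
    have := hli.fintype_card_le_finrank
    simp at this
    omega
  rw [Fintype.not_linearIndependent_iff] at hdep
  obtain ⟨f, hf, ⟨i₀, hi₀⟩⟩ := hdep
  set h : ι → ℝ := fun i => if hi : i ∈ F then f ⟨i, hi⟩ else 0 with hh
  have hsum : ∀ y : ι → ℝ, ∑ i, h i * y i = ∑ i : F, f i * y i := by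
    intro y
    rw [← Finset.sum_subset (Finset.subset_univ F) (fun i _ hi => by simp [hh, hi]),
      ← Finset.sum_coe_sort F]
    refine Finset.sum_congr rfl fun i _ => ?_
    simp [hh]
  have hs1 : ∑ i, h i = 0 := by
    have h1 := hsum (fun _ => 1)
    have h2 := congrFun hf none
    simp [u] at h2
    simpa [h2] using h1
  have hs2 : ∀ j, ∑ i, h i * v i j = 0 := by
    intro j
    rw [hsum]
    have h2 := congrFun hf (some j)
    simpa [u] using h2
  have hmem : ∀ᶠ ε : ℝ in nhds 0, ∀ i ∈ F, (0 < w i + ε * h i ∧ w i + ε * h i < 1) := by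
    rw [Filter.eventually_all_finset]
    intro i hi
    rw [hF, Finset.mem_filter] at hi
    have hcont : Filter.Tendsto (fun ε : ℝ => w i + ε * h i) (nhds 0) (nhds (w i)) := by
      have : Continuous (fun ε : ℝ => w i + ε * h i) := by fun_prop
      simpa using this.tendsto 0
    exact (hcont.eventually (lt_mem_nhds hi.2.1)).and (hcont.eventually (gt_mem_nhds hi.2.2))
  have hmem' : ∀ᶠ ε : ℝ in nhds 0, w + ε • h ∈ K := by
    filter_upwards [hmem] with ε hε
    refine ⟨fun i => ?_, ?_, fun j => ?_⟩
    · by_cases hi : i ∈ F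
      · exact ⟨(hε i hi).1.le, (hε i hi).2.le⟩
      · have : h i = 0 := by simp [hh, hi]
        simpa [this] using hw1 i
    · simp [Finset.sum_add_distrib, ← Finset.mul_sum, hs1, hw2]
    · simp [add_mul, Finset.sum_add_distrib, mul_assoc, ← Finset.mul_sum, hs2, hw3]
  have hneg : ∀ᶠ ε : ℝ in nhds 0, w + (-ε) • h ∈ K := by
    have : Filter.Tendsto (fun ε : ℝ => -ε) (nhds 0) (nhds 0) := by
      simpa using (continuous_neg (G := ℝ)).tendsto 0
    exact this.eventually hmem'
  have hpos : ∃ᶠ ε : ℝ in nhds 0, ε ≠ 0 := by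
    have h1 : ∀ᶠ ε : ℝ in nhdsWithin (0 : ℝ) (Set.Ioi 0), ε ≠ 0 := by
      filter_upwards [self_mem_nhdsWithin] with ε hε
      exact ne_of_gt hε
    exact h1.frequently.filter_mono nhdsWithin_le_nhds
  -- Now `w` is the midpoint of two points of `K`, which extremality allows only if they coincide
  -- with `w`.
  obtain ⟨ε, hε0, hε1, hε2⟩ := (hpos.and_eventually (hmem'.and hneg)).exists
  have heq := (hext _ hε1 _ hε2 ⟨1 / 2, 1 / 2, by norm_num, by norm_num, by norm_num, by
    ext i
    simp
    ring⟩)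
  have h0 : h i₀ = 0 := by
    have h1 := congrFun heq.1 i₀
    simpa [hε0] using h1
  apply hi₀
  simpa [hh] using h0

/-- A family that is small, or has a fractional zero-sum subfamily of all but `d` members. -/
def BalancedFamily (v : ι → Fin d → ℝ) (S : Finset ι) : Prop :=
  S.card ≤ d ∨ ∃ w : ι → ℝ, (∀ i ∈ S, 0 ≤ w i ∧ w i ≤ 1) ∧
    ∑ i ∈ S, w i = (S.card : ℝ) - d ∧ ∀ j, ∑ i ∈ S, w i * v i j = 0

/-- The constant weight (|S| - d)/|S| works. -/
theorem BalancedFamily.of_sum_eq_zero {v : ι → Fin d → ℝ} {S : Finset ι}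
    (h : ∀ j, ∑ i ∈ S, v i j = 0) : BalancedFamily v S := by
  by_cases hS : S.card ≤ d
  · exact Or.inl hS
  have hpos : (0 : ℝ) < S.card := by
    have : 0 < S.card := by omega
    exact_mod_cast this
  have hd : (d : ℝ) ≤ S.card := by
    exact_mod_cast (by omega : d ≤ S.card)
  refine Or.inr ⟨fun _ => ((S.card : ℝ) - d) / S.card, fun i _ => ⟨?_, ?_⟩, ?_, fun j => ?_⟩
  · exact div_nonneg (by linarith) hpos.le
  · rw [div_le_one hpos]
    have : (0 : ℝ) ≤ d := by positivity
    linarith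
  · rw [Finset.sum_const, nsmul_eq_mul]
    field_simp
  · rw [← Finset.mul_sum, h, mul_zero]

/-- Weights of total |S| - d - 1 are chosen with at most `d + 1` fractional values. The deficits 1 -
μ sum to `d + 1`. If no weight were zero, each of the at most `d + 1` nonzero deficits would be less
than 1, a contradiction. A member of weight zero can be dropped. -/
theorem BalancedFamily.exists_erase [DecidableEq ι] {v : ι → Fin d → ℝ} {S : Finset ι}
    (h : BalancedFamily v S) (hne : S.Nonempty) : ∃ i ∈ S, BalancedFamily v (S.erase i) := by
  classical
  by_cases hS : S.card ≤ d + 1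
  · obtain ⟨i, hi⟩ := hne
    exact ⟨i, hi, Or.inl (by rw [Finset.card_erase_of_mem hi]; omega)⟩
  rcases h with h | ⟨w, hw1, hw2, hw3⟩
  · omega
  have hk : ((d : ℝ) + 2) ≤ S.card := by exact_mod_cast (by omega : d + 2 ≤ S.card)
  -- Scaling lowers the total weight from |S| - d to |S| - d - 1, the value that the definition asks
  -- for once one member is gone.
  set θ : ℝ := ((S.card : ℝ) - d - 1) / ((S.card : ℝ) - d) with hθ
  have hpos : (0 : ℝ) < (S.card : ℝ) - d := by linarith
  have hθ0 : 0 ≤ θ := div_nonneg (by linarith) hpos.le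
  have hθ1 : θ ≤ 1 := by rw [hθ, div_le_one hpos]; linarith
  obtain ⟨μ, hμ1, hμ2, hμ3, hμ4⟩ := exists_few_fractional (fun i : S => v i)
    ((S.card : ℝ) - d - 1) (fun i => θ * w i)
    (fun i => ⟨mul_nonneg hθ0 (hw1 i i.2).1,
      mul_le_one₀ hθ1 (hw1 i i.2).1 (hw1 i i.2).2⟩)
    (by
      rw [← Finset.mul_sum, Finset.sum_coe_sort S w, hw2, hθ]
      field_simp)
    (fun j => by
      simp_rw [mul_assoc]
      rw [← Finset.mul_sum, Finset.sum_coe_sort S (fun i => w i * v i j), hw3, mul_zero])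
  have hzero : ∃ i : S, μ i = 0 := by
    by_contra hno
    push Not at hno
    have hs : ∑ i : S, (1 - μ i) = d + 1 := by
      rw [Finset.sum_sub_distrib, hμ2]
      simp
      ring
    set F := Finset.univ.filter fun i : S => 0 < μ i ∧ μ i < 1 with hF
    have hsF : ∑ i : S, (1 - μ i) = ∑ i ∈ F, (1 - μ i) := by
      symm
      refine Finset.sum_subset (Finset.subset_univ F) (fun i _ hi => ?_)
      have h1 : 0 < μ i := lt_of_le_of_ne (hμ1 i).1 (Ne.symm (hno i))
      have h2 : ¬ μ i < 1 := fun h => hi (by simp [hF, h1, h])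
      linarith [(hμ1 i).2]
    by_cases hFe : F.Nonempty
    · have hlt : ∑ i ∈ F, (1 - μ i) < ∑ i ∈ F, (1 : ℝ) := by
        refine Finset.sum_lt_sum_of_nonempty hFe (fun i hi => ?_)
        have := (Finset.mem_filter.1 hi).2.1
        linarith
      have hc : ((F.card : ℕ) : ℝ) ≤ d + 1 := by exact_mod_cast hμ4
      rw [Finset.sum_const, nsmul_eq_mul, mul_one] at hlt
      linarith
    · rw [Finset.not_nonempty_iff_eq_empty] at hFe
      rw [hsF, hFe, Finset.sum_empty] at hs
      have : (0 : ℝ) ≤ d := by positivity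
      linarith
  obtain ⟨i₀, hi₀⟩ := hzero
  refine ⟨i₀, i₀.2, Or.inr ⟨fun i => if hi : i ∈ S then μ ⟨i, hi⟩ else 0, ?_, ?_, ?_⟩⟩
  · intro i hi
    have hi' := Finset.mem_of_mem_erase hi
    simpa [hi'] using hμ1 ⟨i, hi'⟩
  · have h1 : ∑ i ∈ S, (if hi : i ∈ S then μ ⟨i, hi⟩ else 0) = ∑ i : S, μ i := by
      rw [← Finset.sum_coe_sort S]
      exact Finset.sum_congr rfl fun i _ => by simp
    rw [← Finset.add_sum_erase S _ i₀.2] at h1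
    simp only [Finset.coe_mem, dite_true, Subtype.coe_eta, hi₀, zero_add] at h1
    rw [h1, hμ2, Finset.card_erase_of_mem i₀.2, Nat.cast_sub (by omega)]
    push_cast
    ring
  · intro j
    have h1 : ∑ i ∈ S, (if hi : i ∈ S then μ ⟨i, hi⟩ else 0) * v i j
        = ∑ i : S, μ i * v i j := by
      rw [← Finset.sum_coe_sort S]
      exact Finset.sum_congr rfl fun i _ => by simp
    rw [← Finset.add_sum_erase S _ i₀.2, hμ3] at h1
    simpa [hi₀] using h1

/-- Subtracting the vanishing combination leaves the weights 1 - w, which are nonnegative and have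
total `d`. -/
theorem BalancedFamily.abs_sum_le {v : ι → Fin d → ℝ} {S : Finset ι} (h : BalancedFamily v S) {D : ℝ}
    (hD0 : 0 ≤ D) (hD : ∀ i j, |v i j| ≤ D) (j : Fin d) : |∑ i ∈ S, v i j| ≤ d * D := by
  rcases h with h | ⟨w, hw1, hw2, hw3⟩
  · calc |∑ i ∈ S, v i j| ≤ ∑ i ∈ S, |v i j| := Finset.abs_sum_le_sum_abs _ _
      _ ≤ ∑ i ∈ S, D := Finset.sum_le_sum fun i _ => hD i j
      _ = S.card * D := by simp
      _ ≤ d * D := by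
        gcongr
  · have h1 : ∑ i ∈ S, v i j = ∑ i ∈ S, (1 - w i) * v i j := by
      simp only [sub_mul, one_mul, Finset.sum_sub_distrib, hw3, sub_zero]
    rw [h1]
    calc |∑ i ∈ S, (1 - w i) * v i j| ≤ ∑ i ∈ S, |(1 - w i) * v i j| :=
          Finset.abs_sum_le_sum_abs _ _
      _ ≤ ∑ i ∈ S, (1 - w i) * D := Finset.sum_le_sum fun i hi => by
          rw [abs_mul, abs_of_nonneg (by linarith [(hw1 i hi).2])]
          exact mul_le_mul_of_nonneg_left (hD i j) (by linarith [(hw1 i hi).2])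
      _ = d * D := by
          rw [← Finset.sum_mul, Finset.sum_sub_distrib, hw2]
          simp

/-- Removing members one at a time, starting from a zero-sum family, orders it in such a way that
every initial sum is small: this is the Steinitz rearrangement. -/
theorem BalancedFamily.exists_chain [DecidableEq ι] {v : ι → Fin d → ℝ} (k : ℕ) :
    ∀ S : Finset ι, S.card = k → BalancedFamily v S →
    ∃ f : ℕ → Finset ι, f k = S ∧ ∀ l ≤ k, (f l).card = l ∧ BalancedFamily v (f l) ∧
      ∀ l' ≤ l, f l' ⊆ f l := by
  induction k with
  | zero =>
    intro S hS hb
    refine ⟨fun _ => S, rfl, fun l hl => ⟨by simp [hS]; omega, hb, fun _ _ => Finset.Subset.refl _⟩⟩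
  | succ k ih =>
    intro S hS hb
    obtain ⟨i, hi, hbi⟩ := hb.exists_erase (Finset.card_pos.1 (by omega))
    obtain ⟨f, hf, hall⟩ := ih (S.erase i) (by rw [Finset.card_erase_of_mem hi]; omega) hbi
    refine ⟨fun l => if l ≤ k then f l else S, by simp, fun l hl => ?_⟩
    by_cases hlk : l ≤ k
    · simp only [hlk, if_true]
      refine ⟨(hall l hlk).1, (hall l hlk).2.1, fun l' hl' => ?_⟩
      rw [if_pos (by omega)]
      exact (hall l hlk).2.2 l' hl'
    · simp only [hlk, if_false]
      refine ⟨by omega, hb, fun l' hl' => ?_⟩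
      split_ifs with h
      · have h1 := (hall k le_rfl).2.2 l' h
        rw [hf] at h1
        exact h1.trans (Finset.erase_subset _ _)
      · exact Finset.Subset.refl _

/-- A nonempty zero-sum family of integer vectors with entries of absolute value at most `D`
contains a nonempty zero-sum subfamily with at most `(2 * d * D + 1) ^ d` members. -/
theorem exists_zero_sum_subset [DecidableEq ι] (v : ι → Fin d → ℤ) (D : ℕ)
    (hD : ∀ i j, |v i j| ≤ (D : ℤ)) (S : Finset ι) (hS : S.Nonempty)
    (hsum : ∀ j, ∑ i ∈ S, v i j = 0) :
    ∃ U ⊆ S, U.Nonempty ∧ (∀ j, ∑ i ∈ U, v i j = 0) ∧ U.card ≤ (2 * d * D + 1) ^ d := by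
  classical
  obtain ⟨U, hU, hmin⟩ := Finset.exists_min_image
    (S.powerset.filter fun U => U.Nonempty ∧ ∀ j, ∑ i ∈ U, v i j = 0) Finset.card
    ⟨S, by simp [hS, hsum]⟩
  simp only [Finset.mem_filter, Finset.mem_powerset] at hU hmin
  refine ⟨U, hU.1, hU.2.1, hU.2.2, ?_⟩
  by_contra hbig
  push Not at hbig
  set vr : ι → Fin d → ℝ := fun i j => (v i j : ℝ) with hvr
  have hDr : ∀ i j, |vr i j| ≤ (D : ℝ) := fun i j => by
    simp only [hvr]
    exact_mod_cast hD i j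
  have hb : BalancedFamily vr U := BalancedFamily.of_sum_eq_zero fun j => by
    simp only [hvr]
    exact_mod_cast hU.2.2 j
  obtain ⟨f, hf, hall⟩ := BalancedFamily.exists_chain U.card U rfl hb
  set box : Finset (Fin d → ℤ) := Fintype.piFinset fun _ => Finset.Icc (-(d * D : ℤ)) (d * D)
    with hbox
  have hcard : box.card = (2 * d * D + 1) ^ d := by
    rw [hbox, Fintype.card_piFinset]
    simp only [Int.card_Icc, Finset.prod_const, Finset.card_univ, Fintype.card_fin]
    congr 1
    have : ((d : ℤ) * D + 1 - -(d * D)) = ((2 * d * D + 1 : ℕ) : ℤ) := by push_cast; ring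
    rw [this, Int.toNat_natCast]
  -- Pigeonhole on the initial sums. The sizes start at 1, not at 0, so that the difference of two
  -- initial segments has fewer members than `U` and contradicts its minimality.
  obtain ⟨k, hk, l, hl, hne, heq⟩ := Finset.exists_ne_map_eq_of_card_lt_of_maps_to
    (s := Finset.Icc 1 U.card) (t := box) (f := fun k j => ∑ i ∈ f k, v i j)
    (by rw [hcard]; simpa using hbig)
    (fun k hk => by
      simp only [Finset.coe_Icc, Set.mem_Icc] at hk
      simp only [hbox, Fintype.coe_piFinset, Set.mem_pi, Finset.coe_Icc, Set.mem_Icc]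
      intro j _
      have h1 := (hall k hk.2).2.1.abs_sum_le (Nat.cast_nonneg D) hDr j
      have h2 : |∑ i ∈ f k, v i j| ≤ (d * D : ℤ) := by
        simp only [hvr] at h1
        exact_mod_cast h1
      exact abs_le.1 h2)
  have key : ∀ k l, 1 ≤ k → l ≤ U.card → k < l →
      (∀ j, ∑ i ∈ f k, v i j = ∑ i ∈ f l, v i j) → False := by
    intro k l hk hl hkl heq
    have hsub : f k ⊆ f l := (hall l hl).2.2 k hkl.le
    have hlU : f l ⊆ U := by
      have := (hall U.card le_rfl).2.2 l hl
      rwa [hf] at this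
    have hc : (f l \ f k).card = l - k := by
      rw [Finset.card_sdiff_of_subset hsub, (hall l hl).1, (hall k (by omega)).1]
    have := hmin (f l \ f k) ⟨(Finset.sdiff_subset.trans hlU).trans hU.1,
      Finset.card_pos.1 (by omega), fun j => by
        have := Finset.sum_sdiff (f := fun i => v i j) hsub
        have h2 := heq j
        linarith⟩
    omega
  simp only [Finset.mem_Icc] at hk hl
  rcases lt_or_gt_of_ne hne with h | h
  · exact key k l hk.1 hl.2 h (fun j => congrFun heq j)
  · exact key l k hl.1 hk.2 h (fun j => (congrFun heq j).symm)

end Steinitz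

/-! ## Short kernel elements -/

section Kernel

variable {ι ρ : Type*} [Fintype ι]

/-- The vector `g` lies in the kernel of the integer matrix `N`. -/
def InKer {R : Type*} [CommRing R] (N : ρ → ι → ℤ) (g : ι → R) : Prop :=
  ∀ a, ∑ v, (N a v : R) * g v = 0

/-- Every entry of `g` lies between zero and the corresponding entry of `y`. -/
def Conf {R : Type*} [Zero R] [LE R] (g y : ι → R) : Prop :=
  ∀ v, (0 ≤ g v ∧ g v ≤ y v) ∨ (y v ≤ g v ∧ g v ≤ 0)

/-- Below every nonzero integer vector in the kernel there is one of `ℓ₁`-norm at most `L`. -/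
def ShortKernel (N : ρ → ι → ℤ) (L : ℕ) : Prop :=
  ∀ z : ι → ℤ, InKer N z → z ≠ 0 → ∃ g : ι → ℤ, InKer N g ∧ g ≠ 0 ∧ Conf g z ∧ ∑ v, |g v| ≤ (L : ℤ)

/-- Each part is found inside the members of a single block, so its size does not depend on the
number of blocks. Removing it leaves all block sums zero. -/
theorem exists_zero_sum_partition {U κ : Type*} [DecidableEq U] [DecidableEq κ] {s : ℕ} (D : ℕ)
    (vec : U → Fin s → ℤ) (hvec : ∀ u j, |vec u j| ≤ (D : ℤ)) (blk : U → κ) (S : Finset U) :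
    (∀ i j, ∑ u ∈ S, (if blk u = i then vec u j else 0) = 0) →
    ∃ P : Finset (Finset U), (∀ p ∈ P, p.Nonempty ∧ p.card ≤ (2 * s * D + 1) ^ s ∧
      ∀ i j, ∑ u ∈ p, (if blk u = i then vec u j else 0) = 0) ∧
      (P : Set (Finset U)).PairwiseDisjoint id ∧ P.biUnion id = S := by
  induction S using Finset.strongInduction with
  | H S ih =>
    intro hS
    rcases S.eq_empty_or_nonempty with rfl | ⟨u₀, hu₀⟩
    · exact ⟨∅, by simp, by simp, by simp⟩
    obtain ⟨p, hp, hne, hsum, hcard⟩ := exists_zero_sum_subset vec D hvec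
      (S.filter fun u => blk u = blk u₀) ⟨u₀, by simp [hu₀]⟩ (fun j => by
        rw [Finset.sum_filter]
        exact hS _ j)
    have hpS : p ⊆ S := hp.trans (Finset.filter_subset _ _)
    have hblk : ∀ u ∈ p, blk u = blk u₀ := fun u hu => (Finset.mem_filter.1 (hp hu)).2
    have hpz : ∀ i j, ∑ u ∈ p, (if blk u = i then vec u j else 0) = 0 := by
      intro i j
      by_cases hi : blk u₀ = i
      · rw [← hsum j]
        exact Finset.sum_congr rfl fun u hu => by rw [if_pos ((hblk u hu).trans hi)]
      · exact Finset.sum_eq_zero fun u hu => by rw [if_neg (by rw [hblk u hu]; exact hi)]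
    obtain ⟨P, hP, hdis, hun⟩ := ih (S \ p) (Finset.sdiff_ssubset hpS hne) (fun i j => by
      have := Finset.sum_sdiff (f := fun u => if blk u = i then vec u j else 0) hpS
      rw [hpz, hS] at this
      simpa using this)
    refine ⟨insert p P, ?_, ?_, ?_⟩
    · intro q hq
      rcases Finset.mem_insert.1 hq with rfl | hq
      · exact ⟨hne, hcard, hpz⟩
      · exact hP q hq
    · rw [Finset.coe_insert]
      refine hdis.insert fun q hq _ => ?_
      have hq' : q ⊆ S \ p := by
        rw [← hun]
        exact Finset.subset_biUnion_of_mem id hq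
      exact (Finset.disjoint_sdiff (s := p) (t := S)).mono_right hq'
    · rw [Finset.biUnion_insert, hun]
      exact Finset.union_sdiff_of_subset hpS

/-- The rows of a block-structured matrix: `r` rows of `A`, and `s` rows of `B` for every block. -/
def blockRows {κ : Type*} [DecidableEq κ] {r s : ℕ} (A : ι → Fin r → ℤ) (B : ι → Fin s → ℤ)
    (blk : ι → κ) : Fin r ⊕ κ × Fin s → ι → ℤ
  | Sum.inl j, v => A v j
  | Sum.inr (i, j), v => if blk v = i then B v j else 0

/-- The bound on the norm of short kernel elements of a block-structured matrix. -/
def shortBound (r s D : ℕ) : ℕ :=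
  (2 * s * D + 1) ^ s * (2 * r * (D * (2 * s * D + 1) ^ s) + 1) ^ r

/-- The zero-sum lemma is used twice. First the signed columns of `B` are partitioned into zero-sum
parts of at most b = (2sD+1)^s members. Then the A-sums of the parts, with entries of size at most
D·b, contain a zero-sum selection of at most (2rDb+1)^r parts. The product of the two numbers is
`shortBound`. -/
theorem shortKernel_blockRows {κ : Type*} [DecidableEq κ] {r s : ℕ} (A : ι → Fin r → ℤ)
    (B : ι → Fin s → ℤ) (blk : ι → κ) (D : ℕ) (hA : ∀ v j, |A v j| ≤ (D : ℤ))
    (hB : ∀ v j, |B v j| ≤ (D : ℤ)) : ShortKernel (blockRows A B blk) (shortBound r s D) := by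
  classical
  intro z hz hz0
  -- One signed copy of column `v` for each unit of |z v|; sets of copies correspond to integer
  -- vectors between 0 and `z`.
  let U := Σ v : ι, Fin (z v).natAbs
  let sg : U → ℤ := fun u => (z u.1).sign
  have hsg : ∀ u, |sg u| ≤ 1 := fun u => by
    rcases lt_trichotomy (z u.1) 0 with h | h | h <;> simp [sg, h, Int.sign_eq_neg_one_of_neg,
      Int.sign_eq_one_of_pos]
  have hone : ∀ (x : ℤ) (u : U), |x| ≤ (D : ℤ) → |sg u * x| ≤ (D : ℤ) := fun x u hx => by
    rw [abs_mul]
    calc |sg u| * |x| ≤ 1 * |x| := mul_le_mul_of_nonneg_right (hsg u) (abs_nonneg x)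
      _ ≤ D := by rwa [one_mul]
  have hfull : ∀ F : ι → ℤ, ∑ u : U, sg u * F u.1 = ∑ v, F v * z v := by
    intro F
    rw [Fintype.sum_sigma]
    refine Finset.sum_congr rfl fun v _ => ?_
    simp only [sg, Finset.sum_const, Finset.card_univ, Fintype.card_fin, nsmul_eq_mul]
    have := Int.sign_mul_natAbs (z v)
    linear_combination F v * this
  obtain ⟨P, hP, hdis, hun⟩ := exists_zero_sum_partition D (fun (u : U) j => sg u * B u.1 j)
    (fun u j => hone _ u (hB _ _)) (fun u => blk u.1) Finset.univ (fun i j => by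
      have h1 := hfull (fun v => if blk v = i then B v j else 0)
      have h2 := hz (Sum.inr (i, j))
      simp only [blockRows, Int.cast_id] at h2
      rw [h2] at h1
      refine Eq.trans (Finset.sum_congr rfl fun u _ => ?_) h1
      split_ifs <;> simp)
  set b := (2 * s * D + 1) ^ s with hb
  have hPne : P.Nonempty := by
    rw [Finset.nonempty_iff_ne_empty]
    rintro rfl
    apply hz0
    funext v
    by_contra hv
    have : (⟨v, ⟨0, Int.natAbs_pos.2 hv⟩⟩ : U) ∈ (Finset.univ : Finset U) := Finset.mem_univ _
    rw [← hun] at this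
    simp at this
  -- Second application: the objects are now the parts, represented by their A-sums.
  obtain ⟨V, -, hVne, hVsum, hVcard⟩ := exists_zero_sum_subset
    (fun (p : P) (j : Fin r) => ∑ u ∈ p.1, sg u * A u.1 j) (D * b)
    (fun p j => by
      calc |∑ u ∈ p.1, sg u * A u.1 j| ≤ ∑ u ∈ p.1, |sg u * A u.1 j| :=
            Finset.abs_sum_le_sum_abs _ _
        _ ≤ ∑ u ∈ p.1, (D : ℤ) := Finset.sum_le_sum fun u _ => hone _ u (hA _ _)
        _ = p.1.card * D := by simp
        _ ≤ ((D * b : ℕ) : ℤ) := by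
            have := (hP p.1 p.2).2.1
            push_cast
            rw [mul_comm]
            gcongr)
    Finset.univ ⟨⟨hPne.choose, hPne.choose_spec⟩, Finset.mem_univ _⟩
    (fun j => by
      rw [Finset.sum_coe_sort P (fun p => ∑ u ∈ p, sg u * A u.1 j)]
      have h1 := Finset.sum_biUnion (s := P) (t := id) (f := fun u : U => sg u * A u.1 j) hdis
      rw [hun] at h1
      simp only [id] at h1
      rw [← h1, hfull (fun v => A v j)]
      simpa [blockRows] using hz (Sum.inl j))
  set T : Finset U := V.biUnion fun p => p.1 with hT
  have hTsum : ∀ F : U → ℤ, ∑ u ∈ T, F u = ∑ p ∈ V, ∑ u ∈ p.1, F u := by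
    intro F
    rw [hT, Finset.sum_biUnion]
    intro p _ q _ hpq
    exact hdis p.2 q.2 (fun h => hpq (Subtype.ext h))
  set cnt : ι → ℕ := fun v => (T.filter fun u => u.1 = v).card with hcnt
  have hle : ∀ v, cnt v ≤ (z v).natAbs := by
    intro v
    calc cnt v ≤ (Finset.univ.image (fun i : Fin (z v).natAbs => (⟨v, i⟩ : U))).card := by
          refine Finset.card_le_card fun u hu => ?_
          obtain ⟨w, i⟩ := u
          have : w = v := (Finset.mem_filter.1 hu).2
          subst this
          simp
      _ ≤ (Finset.univ : Finset (Fin (z v).natAbs)).card := Finset.card_image_le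
      _ = _ := by simp
  have hg : ∀ F : ι → ℤ, ∑ v, F v * ((z v).sign * cnt v) = ∑ u ∈ T, sg u * F u.1 := by
    intro F
    rw [← Finset.sum_fiberwise T (fun u => u.1)]
    refine Finset.sum_congr rfl fun v _ => ?_
    have : ∀ u ∈ T.filter (fun u => u.1 = v), sg u * F u.1 = (z v).sign * F v := by
      intro u hu
      have h : u.1 = v := (Finset.mem_filter.1 hu).2
      simp only [sg, h]
    rw [Finset.sum_congr rfl this, Finset.sum_const, nsmul_eq_mul]
    ring
  refine ⟨fun v => (z v).sign * cnt v, ?_, ?_, ?_, ?_⟩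
  · rintro (j | ⟨i, j⟩)
    · simp only [blockRows, Int.cast_id]
      rw [hg (fun v => A v j), hTsum]
      exact hVsum j
    · simp only [blockRows, Int.cast_id]
      rw [hg (fun v => if blk v = i then B v j else 0), hTsum]
      refine Finset.sum_eq_zero fun p _ => ?_
      refine Eq.trans (Finset.sum_congr rfl fun u _ => ?_) ((hP p.1 p.2).2.2 i j)
      split_ifs <;> simp
  · obtain ⟨p, hp⟩ := hVne
    obtain ⟨u, hu⟩ := (hP p.1 p.2).1
    have huT : u ∈ T := Finset.mem_biUnion.2 ⟨p, hp, hu⟩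
    intro h0
    have h1 := congrFun h0 u.1
    simp only [Pi.zero_apply, mul_eq_zero, Nat.cast_eq_zero] at h1
    rcases h1 with h1 | h1
    · have h2 : (z u.1).natAbs = 0 := by simpa using Int.sign_eq_zero_iff_zero.1 h1
      exact absurd u.2.2 (by omega)
    · simp only [hcnt, Finset.card_eq_zero] at h1
      have : u ∈ T.filter fun w => w.1 = u.1 := by simp [huT]
      rw [h1] at this
      simp at this
  · intro v
    have h1 := hle v
    rcases lt_trichotomy (z v) 0 with h | h | h
    · right
      simp only [Int.sign_eq_neg_one_of_neg h]
      omega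
    · left
      simp [h]
    · left
      simp only [Int.sign_eq_one_of_pos h]
      omega
  · have hc : ∀ v, |(z v).sign * (cnt v : ℤ)| ≤ cnt v := by
      intro v
      rcases lt_trichotomy (z v) 0 with h | h | h <;>
        simp [h, Int.sign_eq_neg_one_of_neg, Int.sign_eq_one_of_pos]
    have hTc : T.card ≤ shortBound r s D := by
      calc T.card ≤ ∑ p ∈ V, p.1.card := Finset.card_biUnion_le
        _ ≤ ∑ p ∈ V, b := Finset.sum_le_sum fun p _ => (hP p.1 p.2).2.1
        _ = V.card * b := by simp
        _ ≤ _ := by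
          rw [shortBound, mul_comm]
          exact Nat.mul_le_mul_left _ hVcard
    have hs : ∑ v, cnt v = T.card := by
      rw [hcnt, Finset.card_eq_sum_card_fiberwise (f := fun u => u.1) (t := Finset.univ)]
      intro u _
      simp
    calc ∑ v, |(z v).sign * (cnt v : ℤ)| ≤ ∑ v, (cnt v : ℤ) := Finset.sum_le_sum fun v _ => hc v
      _ = ((∑ v, cnt v : ℕ) : ℤ) := by push_cast; rfl
      _ ≤ _ := by rw [hs]; exact_mod_cast hTc

/-! ### Real kernel elements -/

/-- A real kernel element of an integer matrix has the signs of an integer kernel element. -/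
theorem exists_int_kernel_same_sign (N : ρ → ι → ℤ) (y : ι → ℝ) (hy : InKer N y) :
    ∃ z : ι → ℤ, InKer N z ∧ ∀ v, (0 < z v ↔ 0 < y v) ∧ (z v < 0 ↔ y v < 0) := by
  classical
  -- Over a ℚ-basis of ℝ the integer equations hold for every coordinate of `y` separately. Hence
  -- they persist when the basis elements that occur are replaced by rational numbers, and rationals
  -- close enough to them keep the strict signs. Zero entries have zero coordinates and remain zero.
  let b := Module.Basis.ofVectorSpace ℚ ℝ
  let S : Finset _ := Finset.univ.biUnion fun v => (b.repr (y v)).support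
  have hyS : ∀ v, y v = ∑ i : S, ((b.repr (y v) i : ℚ) : ℝ) * b i := by
    intro v
    have h1 := b.linearCombination_repr (y v)
    rw [Finsupp.linearCombination_apply, Finsupp.sum_of_support_subset (s := S) _
      (Finset.subset_biUnion_of_mem (fun v => (b.repr (y v)).support) (Finset.mem_univ v)) _
      (fun i _ => by simp)] at h1
    rw [← Finset.sum_coe_sort S] at h1
    conv_lhs => rw [← h1]
    exact Finset.sum_congr rfl fun i _ => by rw [Rat.smul_def]
  have hker : ∀ a i, ∑ v, (N a v : ℚ) * b.repr (y v) i = 0 := by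
    intro a i
    have h1 : b.repr (∑ v, (N a v : ℝ) * y v) i = 0 := by
      rw [hy a]
      simp
    rw [map_sum, Finsupp.finsetSum_apply] at h1
    rw [← h1]
    refine Finset.sum_congr rfl fun v _ => ?_
    have h2 : (N a v : ℝ) * y v = (N a v : ℚ) • y v := by
      rw [Rat.smul_def]
      simp
    rw [h2, map_smul]
    simp
  have hopen : IsOpen {h : S → ℝ | ∀ v, (0 < y v → 0 < ∑ i : S, ((b.repr (y v) i : ℚ) : ℝ) * h i) ∧
      (y v < 0 → ∑ i : S, ((b.repr (y v) i : ℚ) : ℝ) * h i < 0)} := by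
    rw [Set.ofPred_forall]
    refine isOpen_iInter_of_finite fun v => ?_
    have hc : Continuous fun h : S → ℝ => ∑ i : S, ((b.repr (y v) i : ℚ) : ℝ) * h i := by fun_prop
    have h1 : IsOpen {h : S → ℝ | 0 < y v →
        0 < ∑ i : S, ((b.repr (y v) i : ℚ) : ℝ) * h i} := by
      by_cases h : 0 < y v
      · simpa only [h, forall_const] using isOpen_lt continuous_const hc
      · simp [h]
    have h2 : IsOpen {h : S → ℝ | y v < 0 →
        ∑ i : S, ((b.repr (y v) i : ℚ) : ℝ) * h i < 0} := by
      by_cases h : y v < 0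
      · simpa only [h, forall_const] using isOpen_lt hc continuous_const
      · simp [h]
    exact h1.inter h2
  have hdense : DenseRange (Pi.map fun (_ : S) (q : ℚ) => (q : ℝ)) :=
    DenseRange.piMap fun _ => Rat.denseRange_cast
  obtain ⟨h, hh⟩ := hdense.exists_mem_open hopen ⟨fun i => b i, fun v => by
    rw [← hyS v]
    exact ⟨id, id⟩⟩
  set w : ι → ℚ := fun v => ∑ i : S, b.repr (y v) i * h i with hw
  have hwr : ∀ v, ((w v : ℚ) : ℝ) = ∑ i : S, ((b.repr (y v) i : ℚ) : ℝ) * (h i : ℝ) := by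
    intro v
    simp [hw]
  have hwker : ∀ a, ∑ v, (N a v : ℚ) * w v = 0 := by
    intro a
    simp only [hw, Finset.mul_sum, ← mul_assoc]
    rw [Finset.sum_comm]
    refine Finset.sum_eq_zero fun i _ => ?_
    rw [← Finset.sum_mul, hker, zero_mul]
  have hpos : ∀ v, 0 < w v ↔ 0 < y v := by
    intro v
    have h1 := hh v
    simp only [Pi.map_apply, ← hwr] at h1
    constructor
    · intro h2
      by_contra h3
      rcases lt_or_eq_of_le (not_lt.1 h3) with h4 | h4
      · have := h1.2 h4
        have : w v < 0 := by exact_mod_cast this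
        linarith
      · simp [hw, h4] at h2
    · intro h2
      exact_mod_cast h1.1 h2
  have hneg : ∀ v, w v < 0 ↔ y v < 0 := by
    intro v
    have h1 := hh v
    simp only [Pi.map_apply, ← hwr] at h1
    constructor
    · intro h2
      by_contra h3
      rcases lt_or_eq_of_le (not_lt.1 h3) with h4 | h4
      · have := h1.1 h4
        have : 0 < w v := by exact_mod_cast this
        linarith
      · simp [hw, ← h4] at h2
    · intro h2
      exact_mod_cast h1.2 h2
  set D : ℕ := ∏ v, (w v).den with hD
  have hD0 : (0 : ℚ) < D := by
    have : 0 < D := Finset.prod_pos fun v _ => (w v).den_pos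
    exact_mod_cast this
  have hint : ∀ v, ∃ z : ℤ, (z : ℚ) = D * w v := by
    intro v
    obtain ⟨e, he⟩ : (w v).den ∣ D := Finset.dvd_prod_of_mem _ (Finset.mem_univ v)
    refine ⟨e * (w v).num, ?_⟩
    rw [he]
    push_cast
    have := Rat.den_mul_eq_num (w v)
    linear_combination (-(e : ℚ)) * this
  choose z hz using hint
  refine ⟨z, fun a => ?_, fun v => ⟨?_, ?_⟩⟩
  · have h1 : ((∑ v, N a v * z v : ℤ) : ℚ) = 0 := by
      push_cast
      simp only [hz]
      have h2 := hwker a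
      calc ∑ v, (N a v : ℚ) * (D * w v) = D * ∑ v, (N a v : ℚ) * w v := by
            rw [Finset.mul_sum]
            exact Finset.sum_congr rfl fun v _ => by ring
        _ = 0 := by rw [h2, mul_zero]
    simpa using (by exact_mod_cast h1 : ∑ v, N a v * z v = 0)
  · rw [← hpos v, ← mul_pos_iff_of_pos_left hD0, ← hz]
    simp
  · have h1 : (D : ℚ) * w v < 0 ↔ w v < 0 :=
      ⟨fun h => by
        by_contra h'
        exact absurd (mul_nonneg hD0.le (not_lt.1 h')) (not_le.2 h), mul_neg_of_pos_of_neg hD0⟩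
    rw [← hneg v, ← h1, ← hz]
    simp

theorem ShortKernel.exists_sign_compatible {N : ρ → ι → ℤ} {L : ℕ} (hN : ShortKernel N L)
    (y : ι → ℝ) (hy : InKer N y) (hy0 : y ≠ 0) :
    ∃ g : ι → ℤ, InKer N g ∧ g ≠ 0 ∧ ∑ v, |g v| ≤ (L : ℤ) ∧
      ∀ v, (0 < g v → 0 < y v) ∧ (g v < 0 → y v < 0) := by
  obtain ⟨z, hz, hs⟩ := exists_int_kernel_same_sign N y hy
  have hz0 : z ≠ 0 := by
    rintro rfl
    apply hy0
    funext v
    have h := hs v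
    simp at h
    exact le_antisymm h.1 h.2
  obtain ⟨g, hg, hg0, hc, hn⟩ := hN z hz hz0
  refine ⟨g, hg, hg0, hn, fun v => ⟨fun h => ?_, fun h => ?_⟩⟩
  · rw [← (hs v).1]
    rcases hc v with h1 | h1 <;> omega
  · rw [← (hs v).2]
    rcases hc v with h1 | h1 <;> omega

/-- A real kernel element is a conic combination of short sign-compatible integer kernel
elements, with no more terms than there are nonzero entries. -/
theorem ShortKernel.exists_conic {N : ρ → ι → ℤ} {L : ℕ} (hN : ShortKernel N L) (k : ℕ) :
    ∀ y : ι → ℝ, InKer N y → (Finset.univ.filter fun v => y v ≠ 0).card ≤ k →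
    ∃ (lam : Fin k → ℝ) (g : Fin k → ι → ℤ), (∀ i, 0 ≤ lam i) ∧
      (∀ i, InKer N (g i) ∧ ∑ v, |g i v| ≤ (L : ℤ)) ∧
      (∀ i v, (0 < g i v → 0 < y v) ∧ (g i v < 0 → y v < 0)) ∧
      ∀ v, y v = ∑ i, lam i * g i v := by
  classical
  induction k with
  | zero =>
    intro y _ hc
    refine ⟨fun _ => 0, fun _ _ => 0, fun i => i.elim0, fun i => i.elim0, fun i => i.elim0,
      fun v => ?_⟩
    simp only [Nat.le_zero, Finset.card_eq_zero, Finset.filter_eq_empty_iff] at hc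
    simpa using hc (Finset.mem_univ v)
  | succ k ih =>
    intro y hy hc
    by_cases hy0 : y = 0
    · refine ⟨fun _ => 0, fun _ _ => 0, fun i => le_refl _, fun i => ⟨fun a => by simp, by simp⟩,
        fun i v => by simp, fun v => by simp [hy0]⟩
    obtain ⟨g, hg, hg0, hn, hs⟩ := hN.exists_sign_compatible y hy hy0
    have hpos : ∀ v, g v ≠ 0 → 0 < y v / g v := by
      intro v hv
      rcases lt_or_gt_of_ne hv with h | h
      · exact div_pos_of_neg_of_neg ((hs v).2 h) (by exact_mod_cast h)
      · exact div_pos ((hs v).1 h) (by exact_mod_cast h)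
    obtain ⟨v₀, hv₀⟩ : ∃ v, g v ≠ 0 := by
      by_contra h
      push Not at h
      exact hg0 (funext h)
    obtain ⟨w, hw, hmin⟩ := Finset.exists_min_image
      (Finset.univ.filter fun v => g v ≠ 0) (fun v => y v / g v) ⟨v₀, by simp [hv₀]⟩
    simp only [Finset.mem_filter, Finset.mem_univ, true_and] at hw hmin
    -- The largest multiple of `g` that can be subtracted without changing a sign; the entry `w`
    -- then vanishes, so the support shrinks.
    set c := y w / g w with hcdef
    have hc0 : 0 < c := hpos w hw
    have hp : ∀ v, 0 < g v → c * g v ≤ y v := fun v hv => by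
      have hv' : (0 : ℝ) < g v := by exact_mod_cast hv
      have := hmin v hv.ne'
      rwa [le_div_iff₀ hv'] at this
    have hm : ∀ v, g v < 0 → y v ≤ c * g v := fun v hv => by
      have hv' : (g v : ℝ) < 0 := by exact_mod_cast hv
      have := hmin v hv.ne
      rwa [le_div_iff_of_neg hv'] at this
    set y' : ι → ℝ := fun v => y v - c * g v with hy'
    have hy'k : InKer N y' := by
      intro a
      simp only [hy', mul_sub, Finset.sum_sub_distrib, hy a]
      have h1 : ∑ v, (N a v : ℝ) * (c * g v) = c * ((∑ v, N a v * g v : ℤ) : ℝ) := by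
        push_cast
        rw [Finset.mul_sum]
        exact Finset.sum_congr rfl fun v _ => by ring
      have h2 := hg a
      simp only [Int.cast_id] at h2
      rw [h1, h2]
      simp
    have hsg : ∀ v, (0 < y' v → 0 < y v) ∧ (y' v < 0 → y v < 0) := by
      intro v
      rcases lt_trichotomy (g v) 0 with h | h | h
      · refine ⟨fun h1 => ?_, fun _ => (hs v).2 h⟩
        have := hm v h
        simp only [hy'] at h1
        linarith
      · simp [hy', h]
      · refine ⟨fun _ => (hs v).1 h, fun h1 => ?_⟩
        have := hp v h
        simp only [hy'] at h1
        linarith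
    have hsupp : (Finset.univ.filter fun v => y' v ≠ 0) ⊂ Finset.univ.filter fun v => y v ≠ 0 := by
      rw [Finset.ssubset_iff_of_subset]
      · refine ⟨w, ?_, ?_⟩
        · simp only [Finset.mem_filter, Finset.mem_univ, true_and]
          intro h
          rw [hcdef, h, zero_div] at hc0
          exact lt_irrefl _ hc0
        · have hw' : (g w : ℝ) ≠ 0 := by exact_mod_cast hw
          simp only [Finset.mem_filter, Finset.mem_univ, true_and, not_not, hy', hcdef]
          field_simp
          simp
      · intro v
        simp only [Finset.mem_filter, Finset.mem_univ, true_and]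
        intro h1
        rcases lt_or_gt_of_ne h1 with h | h
        · exact ((hsg v).2 h).ne
        · exact ((hsg v).1 h).ne'
    obtain ⟨lam, G, h1, h2, h3, h4⟩ := ih y' hy'k
      (by have := Finset.card_lt_card hsupp; omega)
    refine ⟨Fin.cons c lam, Fin.cons g G, ?_, ?_, ?_, ?_⟩
    · intro i
      refine Fin.cases ?_ (fun i => ?_) i
      · simpa using hc0.le
      · simpa using h1 i
    · intro i
      refine Fin.cases ?_ (fun i => ?_) i
      · simpa using ⟨hg, hn⟩
      · simpa using h2 i
    · intro i v
      refine Fin.cases ?_ (fun i => ?_) i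
      · simpa using hs v
      · simp only [Fin.cons_succ]
        exact ⟨fun h => (hsg v).1 ((h3 i v).1 h), fun h => (hsg v).2 ((h3 i v).2 h)⟩
    · intro v
      rw [Fin.sum_univ_succ]
      simp only [Fin.cons_zero, Fin.cons_succ]
      rw [← h4 v]
      simp [hy']

/-- A real kernel element is a sum of integer multiples of short integer kernel elements, one
for every coordinate, and a remainder of bounded norm. -/
theorem ShortKernel.exists_rounding {N : ρ → ι → ℤ} {L : ℕ} (hN : ShortKernel N L)
    (y : ι → ℝ) (hy : InKer N y) :
    ∃ (a : Fin (Fintype.card ι) → ℕ) (g : Fin (Fintype.card ι) → ι → ℤ) (rem : ι → ℝ),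
      (∀ v, y v = ∑ i, (a i : ℝ) * g i v + rem v) ∧
      (∀ i, InKer N (g i) ∧ ∑ v, |g i v| ≤ (L : ℤ)) ∧
      (∀ i, Conf (fun v => (a i : ℝ) * g i v) y) ∧ Conf rem y ∧
      ∑ v, |rem v| ≤ Fintype.card ι * L := by
  classical
  obtain ⟨lam, g, h1, h2, h3, h4⟩ := hN.exists_conic (Fintype.card ι) y hy (Finset.card_le_univ _)
  have hfl : ∀ i, ((⌊lam i⌋₊ : ℕ) : ℝ) ≤ lam i := fun i => Nat.floor_le (h1 i)
  have hfl0 : ∀ i, (0 : ℝ) ≤ ((⌊lam i⌋₊ : ℕ) : ℝ) := fun i => Nat.cast_nonneg _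
  have hfl1 : ∀ i, lam i - (⌊lam i⌋₊ : ℕ) ≤ 1 := fun i => by
    have := Nat.lt_floor_add_one (lam i)
    linarith
  have hgp : ∀ v, 0 ≤ y v → ∀ i, (0 : ℝ) ≤ g i v := fun v hv i => by
    by_contra h
    have : g i v < 0 := by
      have := not_le.1 h
      exact_mod_cast this
    linarith [(h3 i v).2 this]
  have hgm : ∀ v, y v ≤ 0 → ∀ i, (g i v : ℝ) ≤ 0 := fun v hv i => by
    by_contra h
    have : 0 < g i v := by
      have := not_le.1 h
      exact_mod_cast this
    linarith [(h3 i v).1 this]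
  -- The conic coefficients are rounded down. Each of the `card ι` leftover coefficients is at most
  -- 1, whence the norm of the remainder.
  refine ⟨fun i => ⌊lam i⌋₊, g, fun v => ∑ i, (lam i - (⌊lam i⌋₊ : ℕ)) * g i v, ?_, h2, ?_, ?_, ?_⟩
  · intro v
    rw [← Finset.sum_add_distrib, h4 v]
    exact Finset.sum_congr rfl fun i _ => by ring
  · intro i v
    rcases le_total 0 (y v) with h | h
    · left
      refine ⟨mul_nonneg (hfl0 i) (hgp v h i), ?_⟩
      calc _ ≤ lam i * g i v := mul_le_mul_of_nonneg_right (hfl i) (hgp v h i)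
        _ ≤ ∑ i, lam i * g i v := Finset.single_le_sum (f := fun i => lam i * (g i v : ℝ))
            (fun i _ => mul_nonneg (h1 i) (hgp v h i)) (Finset.mem_univ i)
        _ = y v := (h4 v).symm
    · right
      refine ⟨?_, mul_nonpos_of_nonneg_of_nonpos (hfl0 i) (hgm v h i)⟩
      have h5 : ∑ i, -(lam i * g i v) = - y v := by rw [Finset.sum_neg_distrib, ← h4 v]
      have h6 := Finset.single_le_sum (f := fun i => -(lam i * (g i v : ℝ)))
            (fun i _ => neg_nonneg.2 (mul_nonpos_of_nonneg_of_nonpos (h1 i) (hgm v h i)))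
            (Finset.mem_univ i)
      have h7 := mul_le_mul_of_nonpos_right (hfl i) (hgm v h i)
      linarith
  · intro v
    rcases le_total 0 (y v) with h | h
    · left
      constructor
      · exact Finset.sum_nonneg fun i _ => mul_nonneg (by linarith [hfl i]) (hgp v h i)
      · conv_rhs => rw [h4 v]
        exact Finset.sum_le_sum fun i _ =>
          mul_le_mul_of_nonneg_right (by linarith [hfl0 i]) (hgp v h i)
    · right
      constructor
      · conv_lhs => rw [h4 v]
        exact Finset.sum_le_sum fun i _ =>
          mul_le_mul_of_nonpos_right (by linarith [hfl0 i]) (hgm v h i)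
      · exact Finset.sum_nonpos fun i _ =>
          mul_nonpos_of_nonneg_of_nonpos (by linarith [hfl i]) (hgm v h i)
  · calc ∑ v, |∑ i, (lam i - (⌊lam i⌋₊ : ℕ)) * (g i v : ℝ)|
        ≤ ∑ v, ∑ i, |(g i v : ℝ)| := Finset.sum_le_sum fun v _ =>
          (Finset.abs_sum_le_sum_abs _ _).trans (Finset.sum_le_sum fun i _ => by
            rw [abs_mul, abs_of_nonneg (by linarith [hfl i])]
            exact mul_le_of_le_one_left (abs_nonneg _) (hfl1 i))
      _ = ∑ i, ∑ v, |(g i v : ℝ)| := Finset.sum_comm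
      _ ≤ ∑ _i : Fin (Fintype.card ι), (L : ℝ) := Finset.sum_le_sum fun i _ => by
          exact_mod_cast (h2 i).2
      _ = _ := by simp

/-- An integer kernel element is a sum of short conformal kernel elements. -/
theorem ShortKernel.exists_sum {N : ρ → ι → ℤ} {L : ℕ} (hN : ShortKernel N L) (k : ℕ) :
    ∀ z : ι → ℤ, InKer N z → ∑ v, |z v| ≤ (k : ℤ) →
    ∃ g : Fin k → ι → ℤ, (∀ i, InKer N (g i) ∧ Conf (g i) z ∧ ∑ v, |g i v| ≤ (L : ℤ)) ∧
      ∀ v, z v = ∑ i, g i v := by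
  induction k with
  | zero =>
    intro z _ hz
    refine ⟨fun i => i.elim0, fun i => i.elim0, fun v => ?_⟩
    have h1 := (Finset.single_le_sum (f := fun v => |z v|) (fun v _ => abs_nonneg _)
      (Finset.mem_univ v)).trans hz
    simpa using h1
  | succ k ih =>
    intro z hz hn
    by_cases hz0 : z = 0
    · subst hz0
      exact ⟨fun _ _ => 0, fun i => ⟨fun a => by simp, fun v => by simp, by simp⟩,
        fun v => by simp⟩
    obtain ⟨g, hg, hg0, hc, hgn⟩ := hN z hz hz0
    have habs : ∀ v, |z v - g v| = |z v| - |g v| := by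
      intro v
      rcases hc v with h | h
      · rw [abs_of_nonneg (by omega), abs_of_nonneg (by omega), abs_of_nonneg (by omega)]
      · rw [abs_of_nonpos (by omega), abs_of_nonpos (by omega), abs_of_nonpos (by omega)]
        ring
    obtain ⟨v₀, hv₀⟩ : ∃ v, g v ≠ 0 := by
      by_contra h
      push Not at h
      exact hg0 (funext h)
    have hg1 : 1 ≤ ∑ v, |g v| := by
      have := Finset.single_le_sum (f := fun v => |g v|) (fun v _ => abs_nonneg _)
        (Finset.mem_univ v₀)
      have h2 := Int.one_le_abs hv₀
      omega
    obtain ⟨G, hG, hsum⟩ := ih (fun v => z v - g v) (fun a => by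
        simp only [Int.cast_id, mul_sub, Finset.sum_sub_distrib]
        have h1 := hz a
        have h2 := hg a
        simp only [Int.cast_id] at h1 h2
        rw [h1, h2, sub_zero])
      (by
        simp only [habs, Finset.sum_sub_distrib]
        push_cast at hn
        linarith)
    refine ⟨Fin.cons g G, fun i => ?_, fun v => ?_⟩
    · refine Fin.cases ?_ (fun i => ?_) i
      · simpa using ⟨hg, hc, hgn⟩
      · simp only [Fin.cons_succ]
        refine ⟨(hG i).1, fun v => ?_, (hG i).2.2⟩
        have h1 := (hG i).2.1 v
        have h2 := hc v
        simp only at h1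
        omega
    · rw [Fin.sum_univ_succ]
      simp only [Fin.cons_zero, Fin.cons_succ]
      rw [← hsum v]
      ring

end Kernel

/-! ## Augmentation, proximity and unboundedness -/

section Augmentation

variable {ι ρ : Type*} [Fintype ι]

theorem InKer.intCast {N : ρ → ι → ℤ} {g : ι → ℤ} (h : InKer N g) :
    InKer N (fun v => (g v : ℝ)) := by
  intro a
  have h1 := h a
  simp only [Int.cast_id] at h1
  simp only
  exact_mod_cast h1

theorem InKer.add {R : Type*} [CommRing R] {N : ρ → ι → ℤ} {g h : ι → R} (hg : InKer N g)
    (hh : InKer N h) : InKer N (fun v => g v + h v) := by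
  intro a
  simp only [mul_add, Finset.sum_add_distrib, hg a, hh a, add_zero]

theorem InKer.sub {R : Type*} [CommRing R] {N : ρ → ι → ℤ} {g h : ι → R} (hg : InKer N g)
    (hh : InKer N h) : InKer N (fun v => g v - h v) := by
  intro a
  simp only [mul_sub, Finset.sum_sub_distrib, hg a, hh a, sub_zero]

theorem InKer.smul {R : Type*} [CommRing R] {N : ρ → ι → ℤ} {g : ι → R} (c : R)
    (hg : InKer N g) : InKer N (fun v => c * g v) := by
  intro a
  calc ∑ v, (N a v : R) * (c * g v) = c * ∑ v, (N a v : R) * g v := by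
        rw [Finset.mul_sum]
        exact Finset.sum_congr rfl fun v _ => by ring
    _ = 0 := by rw [hg a, mul_zero]

theorem InKer.sum {R : Type*} [CommRing R] {N : ρ → ι → ℤ} {α : Type*} (S : Finset α)
    {g : α → ι → R} (hg : ∀ i ∈ S, InKer N (g i)) : InKer N (fun v => ∑ i ∈ S, g i v) := by
  intro a
  simp only [Finset.mul_sum]
  rw [Finset.sum_comm]
  exact Finset.sum_eq_zero fun i hi => hg i hi a

/-- Used to replace a multiplicity `a` by the power of two `p` below it without leaving the segment
between 0 and `y`. -/
theorem conf_of_le_mul {p a g y : ℤ} (hp : 0 ≤ p) (hpa : p ≤ a)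
    (h : (0 ≤ a * g ∧ a * g ≤ y) ∨ (y ≤ a * g ∧ a * g ≤ 0)) :
    (0 ≤ p * g ∧ p * g ≤ y) ∨ (y ≤ p * g ∧ p * g ≤ 0) := by
  have ha : 0 ≤ a := hp.trans hpa
  rcases lt_trichotomy g 0 with hg | rfl | hg
  · have h1 : p * g ≤ 0 := mul_nonpos_of_nonneg_of_nonpos hp hg.le
    have h2 : a * g ≤ p * g := mul_le_mul_of_nonpos_right hpa hg.le
    rcases h with h | h
    · have h3 : p * g = 0 := by
        have h4 : a = 0 := by
          rcases mul_eq_zero.1 (by omega : a * g = 0) with h | h <;> omega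
        simp [(by omega : p = 0)]
      omega
    · omega
  · simpa using h
  · have h1 : 0 ≤ p * g := mul_nonneg hp hg.le
    have h2 : p * g ≤ a * g := mul_le_mul_of_nonneg_right hpa hg.le
    rcases h with h | h
    · omega
    · have h3 : p * g = 0 := by
        have h4 : a = 0 := by
          rcases mul_eq_zero.1 (by omega : a * g = 0) with h | h <;> omega
        simp [(by omega : p = 0)]
      omega

/-- If a kernel element `y` improves the objective, then so does a short one, scaled by a power
of two, and it gains a fixed fraction of what `y` gains. -/
theorem ShortKernel.exists_step {N : ρ → ι → ℤ} {L : ℕ} (hN : ShortKernel N L) (y : ι → ℤ)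
    (hy : InKer N y) (c : ι → ℤ) (hc : 0 < ∑ v, c v * y v) :
    ∃ (k : ℕ) (g : ι → ℤ), InKer N g ∧ ∑ v, |g v| ≤ (L : ℤ) ∧ Conf (fun v => 2 ^ k * g v) y ∧
      ∑ v, c v * y v ≤ 2 * (Fintype.card ι * (L + 1)) * (2 ^ k * ∑ v, c v * g v) := by
  classical
  obtain ⟨a, g, rem, hsum, hg, hconf, hrem, hrn⟩ := hN.exists_rounding _ hy.intCast
  set remZ : ι → ℤ := fun v => y v - ∑ i, (a i : ℤ) * g i v with hremZ
  have hrz : ∀ v, rem v = (remZ v : ℝ) := by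
    intro v
    have := hsum v
    simp only [hremZ]
    push_cast
    linarith
  have hrk : InKer N remZ := by
    refine hy.sub (InKer.sum _ fun i _ => ?_)
    exact (hg i).1.smul _
  obtain ⟨g', hg', hsum'⟩ := hN.exists_sum (Fintype.card ι * L) remZ hrk (by
    have : ∑ v, |(remZ v : ℝ)| ≤ Fintype.card ι * L := by
      simpa only [hrz] using hrn
    exact_mod_cast this)
  set S := ∑ v, c v * y v with hS
  -- There are `card ι` multiples of short vectors and, after the remainder has been split too,
  -- `card ι * L` further short vectors. One of these `m` terms gains at least the average.
  set m : ℤ := Fintype.card ι * (L + 1) with hm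
  let τ : Fin (Fintype.card ι) ⊕ Fin (Fintype.card ι * L) → ℤ
    | Sum.inl i => a i * ∑ v, c v * g i v
    | Sum.inr j => ∑ v, c v * g' j v
  have hτ : ∑ i, τ i = S := by
    rw [Fintype.sum_sum_type]
    simp only [τ, Finset.mul_sum]
    rw [Finset.sum_comm, Finset.sum_comm (s := (Finset.univ : Finset (Fin (Fintype.card ι * L)))), ← Finset.sum_add_distrib, hS]
    refine Finset.sum_congr rfl fun v _ => ?_
    have h1 := hsum' v
    simp only [hremZ] at h1
    have h2 : y v = ∑ i, (a i : ℤ) * g i v + ∑ j, g' j v := by linarith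
    rw [h2, mul_add, Finset.mul_sum, Finset.mul_sum]
    congr 1
    exact Finset.sum_congr rfl fun i _ => by ring
  obtain ⟨i, hi⟩ : ∃ i, S ≤ m * τ i := by
    by_contra h
    push Not at h
    have hcard : (Finset.univ : Finset (Fin (Fintype.card ι) ⊕ Fin (Fintype.card ι * L))).card = Fintype.card ι * (L + 1) := by
      simp
      ring
    have hne : (Finset.univ : Finset (Fin (Fintype.card ι) ⊕ Fin (Fintype.card ι * L))).Nonempty := by
      by_contra h0
      rw [Finset.not_nonempty_iff_eq_empty] at h0
      rw [h0] at hτ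
      simp at hτ
      omega
    have h1 := Finset.sum_lt_sum_of_nonempty hne fun i _ => h i
    rw [← Finset.mul_sum, hτ, Finset.sum_const, hcard, nsmul_eq_mul] at h1
    simp only [hm] at h1
    push_cast at h1
    exact lt_irrefl _ h1
  have hm0 : 0 ≤ m := by positivity
  rcases i with i | j
  · simp only [τ] at hi
    have hai : a i ≠ 0 := by
      intro h0
      simp [h0] at hi
      omega
    have hcg : 0 < ∑ v, c v * g i v := by
      by_contra h0
      have h1 : (a i : ℤ) * ∑ v, c v * g i v ≤ 0 :=
        mul_nonpos_of_nonneg_of_nonpos (by positivity) (not_lt.1 h0)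
      have h2 := mul_nonpos_of_nonneg_of_nonpos hm0 h1
      omega
    -- Rounding the multiplicity down to a power of two loses at most a factor 2, the one in the
    -- statement.
    have hlo : 2 ^ Nat.log 2 (a i) ≤ a i := Nat.pow_log_le_self 2 hai
    have hhi : a i < 2 ^ (Nat.log 2 (a i) + 1) := Nat.lt_pow_succ_log_self (by norm_num) _
    have hlo' : (2 : ℤ) ^ Nat.log 2 (a i) ≤ a i := by exact_mod_cast hlo
    have hhi' : (a i : ℤ) ≤ 2 * 2 ^ Nat.log 2 (a i) := by
      rw [pow_succ, mul_comm] at hhi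
      exact_mod_cast hhi.le
    refine ⟨Nat.log 2 (a i), g i, (hg i).1, (hg i).2, fun v => ?_, ?_⟩
    · have h1 := hconf i v
      simp only at h1
      have h2 : (0 ≤ (a i : ℤ) * g i v ∧ (a i : ℤ) * g i v ≤ y v) ∨
          (y v ≤ (a i : ℤ) * g i v ∧ (a i : ℤ) * g i v ≤ 0) := by exact_mod_cast h1
      exact conf_of_le_mul (by positivity) hlo' h2
    · calc S ≤ m * (a i * ∑ v, c v * g i v) := hi
        _ ≤ m * ((2 * 2 ^ Nat.log 2 (a i)) * ∑ v, c v * g i v) := by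
            gcongr
        _ = _ := by rw [hm]; ring
  · simp only [τ] at hi
    refine ⟨0, g' j, (hg' j).1, (hg' j).2.2, fun v => ?_, ?_⟩
    · have h1 := (hg' j).2.1 v
      have h2 := hrem v
      simp only [hrz v] at h2
      have h3 : (0 ≤ remZ v ∧ remZ v ≤ y v) ∨ (y v ≤ remZ v ∧ remZ v ≤ 0) := by
        exact_mod_cast h2
      simp only [pow_zero, one_mul]
      omega
    · rw [pow_zero, one_mul]
      have : 0 ≤ m * ∑ v, c v * g' j v := by omega
      linarith

/-- Near every optimal solution of the relaxation there is an integer solution that is at least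
as good as a given one. -/
theorem ShortKernel.proximity {N : ρ → ι → ℤ} {L : ℕ} (hN : ShortKernel N L) (x : ι → ℝ)
    (z : ι → ℤ) (hk : InKer N (fun v => (z v : ℝ) - x v)) (c : ι → ℤ)
    (hopt : ∀ y : ι → ℝ, InKer N y → Conf y (fun v => (z v : ℝ) - x v) → ∑ v, (c v : ℝ) * y v ≤ 0) :
    ∃ z' : ι → ℤ, InKer N (fun v => (z' v : ℝ) - x v) ∧
      Conf (fun v => (z' v : ℝ) - x v) (fun v => (z v : ℝ) - x v) ∧
      (∀ v, |(z' v : ℝ) - x v| ≤ Fintype.card ι * L) ∧ ∑ v, c v * z v ≤ ∑ v, c v * z' v := by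
  classical
  obtain ⟨a, g, rem, hsum, hg, hconf, hrem, hrn⟩ := hN.exists_rounding _ hk
  -- Taking all integer multiples out of `z - x` leaves the remainder, so the new point is `x` plus
  -- a vector of norm at most `card ι * L`. By `hopt` none of the removed multiples has positive
  -- objective value, so nothing is lost.
  have hz' : ∀ v, ((z v - ∑ i, (a i : ℤ) * g i v : ℤ) : ℝ) - x v = rem v := by
    intro v
    have := hsum v
    push_cast
    linarith
  have hgk : ∀ i, InKer N (fun v => (a i : ℝ) * (g i v : ℝ)) := fun i =>
    (hg i).1.intCast.smul _
  refine ⟨fun v => z v - ∑ i, (a i : ℤ) * g i v, ?_, ?_, ?_, ?_⟩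
  · have h1 := hk.sub (InKer.sum Finset.univ fun i _ => hgk i)
    convert h1 using 2 with v
    push_cast
    ring
  · simp only [hz']
    exact hrem
  · intro v
    simp only [hz']
    exact (Finset.single_le_sum (f := fun v => |rem v|) (fun v _ => abs_nonneg _)
      (Finset.mem_univ v)).trans hrn
  · simp only [mul_sub, Finset.sum_sub_distrib]
    have h1 : ∀ i, ∑ v, c v * ((a i : ℤ) * g i v) ≤ 0 := by
      intro i
      have := hopt _ (hgk i) (hconf i)
      exact_mod_cast this
    have h2 : ∑ v, c v * ∑ i, (a i : ℤ) * g i v ≤ 0 := by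
      simp only [Finset.mul_sum]
      rw [Finset.sum_comm]
      refine Finset.sum_nonpos fun i _ => ?_
      exact h1 i
    linarith

/-- If a real kernel element has a very large objective value, then there is an integer one below
it with a large objective value. -/
theorem ShortKernel.exists_large {N : ρ → ι → ℤ} {L : ℕ} (hN : ShortKernel N L) (y : ι → ℝ)
    (hy : InKer N y) (c : ι → ℤ) (K : ℤ)
    (hK : Fintype.card ι * (K : ℝ) + (∑ v, |(c v : ℝ)|) * (Fintype.card ι * L) <
      ∑ v, (c v : ℝ) * y v) :
    ∃ w : ι → ℤ, InKer N w ∧ Conf (fun v => (w v : ℝ)) y ∧ K < ∑ v, c v * w v := by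
  classical
  obtain ⟨a, g, rem, hsum, hg, hconf, hrem, hrn⟩ := hN.exists_rounding _ hy
  -- If every multiple `a i * g i` had value at most `K`, then `y` could not exceed `card ι * K`
  -- plus the largest possible value of the remainder.
  by_contra hno
  push Not at hno
  have h1 : ∀ i, ∑ v, (c v : ℝ) * ((a i : ℝ) * g i v) ≤ K := by
    intro i
    have := hno (fun v => (a i : ℤ) * g i v) ((hg i).1.smul _) (by
      have := hconf i
      convert this using 2 with v
      push_cast
      rfl)
    exact_mod_cast this
  have h2 : ∑ v, (c v : ℝ) * rem v ≤ (∑ v, |(c v : ℝ)|) * (Fintype.card ι * L) := by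
    rw [Finset.sum_mul]
    refine Finset.sum_le_sum fun v _ => ?_
    calc (c v : ℝ) * rem v ≤ |(c v : ℝ) * rem v| := le_abs_self _
      _ = |(c v : ℝ)| * |rem v| := abs_mul _ _
      _ ≤ _ := by
        gcongr
        exact (Finset.single_le_sum (f := fun v => |rem v|) (fun v _ => abs_nonneg _)
          (Finset.mem_univ v)).trans hrn
  have h3 : ∑ v, (c v : ℝ) * y v =
      ∑ i, ∑ v, (c v : ℝ) * ((a i : ℝ) * g i v) + ∑ v, (c v : ℝ) * rem v := by
    rw [Finset.sum_comm, ← Finset.sum_add_distrib]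
    refine Finset.sum_congr rfl fun v _ => ?_
    rw [hsum v, mul_add, Finset.mul_sum]
  have h4 : ∑ i, ∑ v, (c v : ℝ) * ((a i : ℝ) * g i v) ≤ Fintype.card ι * (K : ℝ) := by
    calc _ ≤ ∑ _i : Fin (Fintype.card ι), (K : ℝ) := Finset.sum_le_sum fun i _ => h1 i
      _ = _ := by simp
  linarith

end Augmentation

/-! ## Coding kernel elements by single integers -/

section Digits

/-- With balanced digits of size at most h = (M-1)/2 the extreme value is (M^k - 1)/2. -/
theorem two_mul_abs_digits_lt {h M : ℤ} (hM : M = 2 * h + 1) (h0 : 0 ≤ h) (k : ℕ) :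
    ∀ e : Fin k → ℤ, (∀ j, |e j| ≤ h) → 2 * |∑ j, e j * M ^ (j : ℕ)| < M ^ k := by
  induction k with
  | zero => intro e _; simp
  | succ k ih =>
    intro e he
    rw [Fin.sum_univ_succ]
    have h1 := ih (fun j => e j.succ) (fun j => he _)
    have h2 : ∑ j : Fin k, e j.succ * M ^ ((j.succ : Fin (k + 1)) : ℕ) =
        M * ∑ j : Fin k, e j.succ * M ^ (j : ℕ) := by
      rw [Finset.mul_sum]
      refine Finset.sum_congr rfl fun j _ => ?_
      rw [Fin.val_succ, pow_succ]
      ring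
    rw [h2]
    set S := ∑ j : Fin k, e j.succ * M ^ (j : ℕ)
    have h3 := abs_add_le (e 0 * M ^ ((0 : Fin (k + 1)) : ℕ)) (M * S)
    rw [abs_mul M S, abs_of_nonneg (by omega : 0 ≤ M)] at h3
    simp only [Fin.val_zero, pow_zero, mul_one] at h3 ⊢
    have h4 := he 0
    have h5 : M * (2 * |S|) ≤ M * (M ^ k - 1) := mul_le_mul_of_nonneg_left (by omega) (by omega)
    rw [pow_succ]
    nlinarith

/-- The lowest digit is a multiple of `M` and smaller than `M` in absolute value; after dividing by
`M` the argument repeats. -/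
theorem digits_eq_zero {h M : ℤ} (hM : M = 2 * h + 1) (h0 : 0 ≤ h) (k : ℕ) :
    ∀ e : Fin k → ℤ, (∀ j, |e j| ≤ h) → ∑ j, e j * M ^ (j : ℕ) = 0 → ∀ j, e j = 0 := by
  induction k with
  | zero => intro e _ _ j; exact j.elim0
  | succ k ih =>
    intro e he hs
    rw [Fin.sum_univ_succ] at hs
    have h2 : ∑ j : Fin k, e j.succ * M ^ ((j.succ : Fin (k + 1)) : ℕ) =
        M * ∑ j : Fin k, e j.succ * M ^ (j : ℕ) := by
      rw [Finset.mul_sum]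
      refine Finset.sum_congr rfl fun j _ => ?_
      rw [Fin.val_succ, pow_succ]
      ring
    rw [h2] at hs
    simp only [Fin.val_zero, pow_zero, mul_one] at hs
    have hd : M ∣ e 0 := ⟨-∑ j : Fin k, e j.succ * M ^ (j : ℕ), by linarith⟩
    have he0 : e 0 = 0 := Int.eq_zero_of_abs_lt_dvd hd (by have := he 0; omega)
    rw [he0, zero_add] at hs
    have hS : ∑ j : Fin k, e j.succ * M ^ (j : ℕ) = 0 := by
      rcases mul_eq_zero.1 hs with h | h
      · omega
      · exact h
    intro j
    refine Fin.cases he0 (fun j => ?_) j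
    exact ih _ (fun j => he _) hS j

/-- A multiple of `M ^ k` that is smaller than `M ^ k` in absolute value is zero. -/
theorem digits_eq_zero_of_dvd {h M : ℤ} (hM : M = 2 * h + 1) (h0 : 0 ≤ h) (k : ℕ)
    (e : Fin k → ℤ) (he : ∀ j, |e j| ≤ h) (hd : M ^ k ∣ ∑ j, e j * M ^ (j : ℕ)) :
    ∀ j, e j = 0 := by
  refine digits_eq_zero hM h0 k e he (Int.eq_zero_of_abs_lt_dvd hd ?_)
  have := two_mul_abs_digits_lt hM h0 k e he
  have h1 := abs_nonneg (∑ j, e j * M ^ (j : ℕ))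
  omega

end Digits

theorem sum_range_mul_eq {w k m : ℕ} (hw : 0 < w) (hk : k * w ≤ m) (f : ℕ → ℤ) :
    ∑ v ∈ Finset.range m, (if v / w < k then f v else 0) = ∑ v ∈ Finset.range (k * w), f v := by
  rw [← Finset.sum_filter]
  congr 1
  ext v
  simp only [Finset.mem_filter, Finset.mem_range, Nat.div_lt_iff_lt_mul hw]
  omega

/-- The dynamic program only sees sums over initial segments; the sum over one block is the
difference of two of them. -/
theorem sum_block_eq {w k m : ℕ} (hw : 0 < w) (hk : (k + 1) * w ≤ m) (f : ℕ → ℤ) :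
    ∑ v ∈ Finset.range m, (if v / w = k then f v else 0) =
      ∑ v ∈ Finset.range ((k + 1) * w), f v - ∑ v ∈ Finset.range (k * w), f v := by
  rw [← sum_range_mul_eq hw hk, ← sum_range_mul_eq hw (by nlinarith : k * w ≤ m),
    ← Finset.sum_sub_distrib]
  refine Finset.sum_congr rfl fun v _ => ?_
  split_ifs <;> omega

/-- The code of the first `v` entries of a vector. -/
def pathCode (del : ℕ → ℤ) (Q : ℤ) (g : ℕ → ℤ) (v : ℕ) : ℤ :=
  ∑ i ∈ Finset.range v, (g i * del i + |g i| * Q)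

/-- The conditions on the codes of a vector that are checked by the dynamic program. -/
def ValidPath (m : ℕ) (L J Q : ℤ) (del md g : ℕ → ℤ) : Prop :=
  ∀ v < m, |g v| ≤ L ∧ pathCode del Q g (v + 1) ≤ J ∧ md v ∣ pathCode del Q g (v + 1)

/-- The columns `A v`, `B v` of a block-structured matrix with blocks of width `w` (followed by
columns with `B v = 0`) are coded by the integers `del v`, and `md` marks the ends of blocks. -/
structure Coding (n w m r s : ℕ) (A : ℕ → Fin r → ℤ) (B : ℕ → Fin s → ℤ) (D L : ℕ) (M : ℤ)
    (del md : ℕ → ℤ) : Prop where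
  width_pos : 0 < w
  blocks_lt : n * w < m
  absA : ∀ v j, |A v j| ≤ (D : ℤ)
  absB : ∀ v j, |B v j| ≤ (D : ℤ)
  B_zero : ∀ v, n * w ≤ v → ∀ j, B v j = 0
  base : M = 8 * D * L + 1
  one_le_D : 1 ≤ D
  one_le_L : 1 ≤ L
  del_eq : ∀ v < m, del v = ∑ j, B v j * M ^ (j : ℕ) + M ^ s * ∑ j, A v j * M ^ (j : ℕ)
  md_cases : ∀ v < m, md v = 1 ∨ (∃ i < n, v + 1 = (i + 1) * w ∧ md v = M ^ s) ∨
    (v + 1 = m ∧ md v = M ^ (s + r))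
  md_block : ∀ i < n, md ((i + 1) * w - 1) = M ^ s
  md_last : md (m - 1) = M ^ (s + r)

namespace Coding

variable {n w m r s : ℕ} {A : ℕ → Fin r → ℤ} {B : ℕ → Fin s → ℤ} {D L : ℕ} {M : ℤ}
  {del md : ℕ → ℤ}

theorem base_pos (H : Coding n w m r s A B D L M del md) : 0 < M := by
  rw [H.base]
  positivity

theorem base_eq (H : Coding n w m r s A B D L M del md) : M = 2 * (4 * D * L) + 1 := by
  rw [H.base]
  ring

/-- The code of a column has `s + r` balanced digits: the entries of `B` are the low ones, those of
`A` the high ones. -/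
theorem two_abs_del_lt (H : Coding n w m r s A B D L M del md) {v : ℕ} (hv : v < m) :
    2 * |del v| < M ^ (s + r) := by
  have hDL : (D : ℤ) ≤ 4 * D * L := by
    have h1 : (1 : ℤ) ≤ L := by exact_mod_cast H.one_le_L
    have h2 : (0 : ℤ) ≤ D := by positivity
    nlinarith
  have h1 := two_mul_abs_digits_lt H.base_eq (by positivity) s (B v) fun j => (H.absB v j).trans hDL
  have h2 := two_mul_abs_digits_lt H.base_eq (by positivity) r (A v) fun j => (H.absA v j).trans hDL
  rw [H.del_eq v hv]
  set b := ∑ j, B v j * M ^ (j : ℕ)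
  set a := ∑ j, A v j * M ^ (j : ℕ)
  have h3 := abs_add_le b (M ^ s * a)
  have h4 : 0 < M ^ s := pow_pos H.base_pos s
  rw [abs_mul, abs_of_pos h4] at h3
  have h5 : M ^ s * (2 * |a|) ≤ M ^ s * (M ^ r - 1) := mul_le_mul_of_nonneg_left (by omega) h4.le
  rw [pow_add]
  nlinarith

/-- The term |g|·M^(s+r) dominates g·`del v`. So codes never decrease along a vector, and they
measure its norm, in units of M^(s+r), up to a factor 2 either way. -/
theorem step_bounds (H : Coding n w m r s A B D L M del md) {v : ℕ} (hv : v < m) (g : ℤ) :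
    |g| * M ^ (s + r) ≤ 2 * (g * del v + |g| * M ^ (s + r)) ∧
    g * del v + |g| * M ^ (s + r) ≤ 2 * (|g| * M ^ (s + r)) := by
  have h1 := H.two_abs_del_lt hv
  have h2 : |g * del v| * 2 ≤ |g| * M ^ (s + r) := by
    rw [abs_mul]
    nlinarith [abs_nonneg g]
  have h3 := abs_le.1 (le_refl |g * del v|)
  have h4 : 0 ≤ |g| * M ^ (s + r) := mul_nonneg (abs_nonneg g) (pow_pos H.base_pos _).le
  constructor <;> linarith

theorem norm_le (H : Coding n w m r s A B D L M del md) {g : ℕ → ℤ} {v : ℕ} (hv : v ≤ m) :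
    (∑ i ∈ Finset.range v, |g i|) * M ^ (s + r) ≤ 2 * pathCode del (M ^ (s + r)) g v := by
  rw [pathCode, Finset.sum_mul, Finset.mul_sum]
  refine Finset.sum_le_sum fun i hi => (H.step_bounds (by
    have := Finset.mem_range.1 hi
    omega) (g i)).1

theorem code_le (H : Coding n w m r s A B D L M del md) {g : ℕ → ℤ} {v : ℕ} (hv : v ≤ m) :
    pathCode del (M ^ (s + r)) g v ≤ 2 * ((∑ i ∈ Finset.range v, |g i|) * M ^ (s + r)) := by
  rw [pathCode, Finset.sum_mul, Finset.mul_sum]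
  refine Finset.sum_le_sum fun i hi => (H.step_bounds (by
    have := Finset.mem_range.1 hi
    omega) (g i)).2

theorem code_nonneg (H : Coding n w m r s A B D L M del md) {g : ℕ → ℤ} {v : ℕ} (hv : v ≤ m) :
    0 ≤ pathCode del (M ^ (s + r)) g v := by
  have h1 := H.norm_le (g := g) hv
  have h2 : 0 ≤ (∑ i ∈ Finset.range v, |g i|) * M ^ (s + r) :=
    mul_nonneg (Finset.sum_nonneg fun i _ => abs_nonneg _) (pow_pos H.base_pos _).le
  omega

/-- As a polynomial in `M` the code has three layers: the B-sums, the A-sums from M^s on, and the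
norm from M^(s+r) on. -/
theorem code_eq (H : Coding n w m r s A B D L M del md) {g : ℕ → ℤ} {v : ℕ} (hv : v ≤ m) :
    pathCode del (M ^ (s + r)) g v =
      ∑ j, (∑ i ∈ Finset.range v, B i j * g i) * M ^ (j : ℕ) +
      M ^ s * ∑ j, (∑ i ∈ Finset.range v, A i j * g i) * M ^ (j : ℕ) +
      (∑ i ∈ Finset.range v, |g i|) * M ^ (s + r) := by
  rw [pathCode, Finset.sum_add_distrib, Finset.sum_mul]
  congr 1
  simp only [Finset.sum_mul, Finset.mul_sum]
  rw [Finset.sum_comm, Finset.sum_comm (s := (Finset.univ : Finset (Fin r))),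
    ← Finset.sum_add_distrib]
  refine Finset.sum_congr rfl fun i hi => ?_
  rw [H.del_eq i (by have := Finset.mem_range.1 hi; omega), mul_add]
  simp only [Finset.mul_sum]
  congr 1
  · exact Finset.sum_congr rfl fun j _ => by ring
  · exact Finset.sum_congr rfl fun j _ => by ring

theorem abs_sum_le {F : ℕ → ℤ} {D : ℕ} {g : ℕ → ℤ} {c : ℤ} (hF : ∀ v, |F v| ≤ (D : ℤ)) {m : ℕ}
    (hg : ∑ i ∈ Finset.range m, |g i| ≤ c) : |∑ i ∈ Finset.range m, F i * g i| ≤ D * c := by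
  calc |∑ i ∈ Finset.range m, F i * g i| ≤ ∑ i ∈ Finset.range m, |F i * g i| :=
        Finset.abs_sum_le_sum_abs _ _
    _ ≤ ∑ i ∈ Finset.range m, D * |g i| := Finset.sum_le_sum fun i _ => by
        rw [abs_mul]
        exact mul_le_mul_of_nonneg_right (hF i) (abs_nonneg _)
    _ = D * ∑ i ∈ Finset.range m, |g i| := by rw [Finset.mul_sum]
    _ ≤ D * c := by gcongr

theorem initial_B_eq_zero (H : Coding n w m r s A B D L M del md) {g : ℕ → ℤ}
    (hB : ∀ i j, ∑ v ∈ Finset.range m, (if v / w = i then B v j * g v else 0) = 0) {k : ℕ}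
    (hk : k ≤ n) (j : Fin s) : ∑ v ∈ Finset.range (k * w), B v j * g v = 0 := by
  induction k with
  | zero => simp
  | succ k ih =>
    have hiw : (k + 1) * w ≤ m := (Nat.mul_le_mul_right w hk).trans H.blocks_lt.le
    have h1 := hB k j
    rw [sum_block_eq H.width_pos hiw, ih (by omega), sub_zero] at h1
    exact h1

theorem sum_B_eq_zero (H : Coding n w m r s A B D L M del md) {g : ℕ → ℤ}
    (hB : ∀ i j, ∑ v ∈ Finset.range m, (if v / w = i then B v j * g v else 0) = 0) (j : Fin s) :
    ∑ v ∈ Finset.range m, B v j * g v = 0 := by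
  rw [← H.initial_B_eq_zero hB le_rfl j]
  symm
  refine Finset.sum_subset (fun v => ?_) fun v _ hv => ?_
  · simp only [Finset.mem_range]
    have := H.blocks_lt
    omega
  · rw [H.B_zero v (by simpa using hv), zero_mul]

/-- A vector passes the tests of the dynamic program only if it lies in the kernel. -/
theorem inKer_of_validPath (H : Coding n w m r s A B D L M del md) {g : ℕ → ℤ}
    (hg : ValidPath m L (2 * L * M ^ (s + r)) (M ^ (s + r)) del md g) :
    InKer (blockRows (fun v : Fin m => A v) (fun v : Fin m => B v) (fun v : Fin m => (v : ℕ) / w))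
      (fun v : Fin m => g v) := by
  have hQ : 0 < M ^ (s + r) := pow_pos H.base_pos _
  have hm : 0 < m := by have := H.blocks_lt; omega
  -- The code is at most 2L·M^(s+r), and the norm times M^(s+r) is at most twice the code. Row sums
  -- are therefore at most 4DL, the size of digit for which the base 8DL + 1 is made.
  have hnorm : ∑ i ∈ Finset.range m, |g i| ≤ 4 * L := by
    have h1 := H.norm_le (g := g) le_rfl
    have h2 := (hg (m - 1) (by omega)).2.1
    rw [Nat.sub_add_cancel hm] at h2
    by_contra h3
    have h4 : (4 * L + 1 : ℤ) * M ^ (s + r) ≤ (∑ i ∈ Finset.range m, |g i|) * M ^ (s + r) :=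
      mul_le_mul_of_nonneg_right (by omega) hQ.le
    nlinarith
  -- The layers of `A` and of the norm are multiples of M^s, so the test at the end of a block
  -- concerns the B-sums alone. They add up all blocks so far; taking differences isolates one
  -- block, whose sums are valid digits.
  have hdvd : ∀ k ≤ n, M ^ s ∣ ∑ j, (∑ i ∈ Finset.range (k * w), B i j * g i) * M ^ (j : ℕ) := by
    intro k hk
    rcases Nat.eq_zero_or_pos k with rfl | hk0
    · simp
    have hkw : k * w ≤ m := (Nat.mul_le_mul_right w hk).trans H.blocks_lt.le
    have hkw0 : 0 < k * w := Nat.mul_pos hk0 H.width_pos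
    have h1 := (hg (k * w - 1) (by omega)).2.2
    have h2 := H.md_block (k - 1) (by omega)
    rw [Nat.sub_add_cancel hk0] at h2
    rw [h2, Nat.sub_add_cancel hkw0, H.code_eq hkw, pow_add] at h1
    rw [add_assoc] at h1
    refine (Int.dvd_add_left ?_).1 h1
    exact dvd_add (dvd_mul_right _ _) ((dvd_mul_right _ _).mul_left _)
  have hB : ∀ i j, ∑ v ∈ Finset.range m, (if v / w = i then B v j * g v else 0) = 0 := by
    intro i
    by_cases hi : i < n
    · have hiw : (i + 1) * w ≤ m := (Nat.mul_le_mul_right w (by omega)).trans H.blocks_lt.le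
      refine digits_eq_zero_of_dvd H.base_eq (by positivity) s
        (fun j => ∑ v ∈ Finset.range m, (if v / w = i then B v j * g v else 0)) (fun j => ?_) ?_
      · have h1 := abs_sum_le (F := fun v => if v / w = i then B v j else 0) (D := D) (fun v => by
          split_ifs
          · exact H.absB v j
          · simp) hnorm
        simp only [ite_mul, zero_mul] at h1
        refine h1.trans (le_of_eq (by ring))
      · simp only [sum_block_eq H.width_pos hiw]
        simp only [sub_mul, Finset.sum_sub_distrib]
        exact dvd_sub (hdvd (i + 1) (by omega)) (hdvd i (by omega))
    · intro j
      refine Finset.sum_eq_zero fun v _ => ?_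
      split_ifs with h
      · rw [H.B_zero v, zero_mul]
        rw [← h] at hi
        have h1 := Nat.div_mul_le_self v w
        have h2 := Nat.mul_le_mul_right w (not_lt.1 hi)
        omega
      · rfl
  have hBt := H.sum_B_eq_zero hB
  have hA : ∀ j, ∑ v ∈ Finset.range m, A v j * g v = 0 := by
    refine digits_eq_zero_of_dvd H.base_eq (by positivity) r
      (fun j => ∑ v ∈ Finset.range m, A v j * g v) (fun j => ?_) ?_
    · have h1 := abs_sum_le (F := fun v => A v j) (D := D) (fun v => H.absA v j) hnorm
      refine h1.trans (le_of_eq (by ring))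
    · have h1 := (hg (m - 1) (by omega)).2.2
      rw [H.md_last, Nat.sub_add_cancel hm, H.code_eq le_rfl] at h1
      simp only [hBt, zero_mul, Finset.sum_const_zero, zero_add] at h1
      -- The B-layer has vanished and the norm layer is a multiple of M^(s+r), so the last test says
      -- that M^r divides the coded A-sums.
      have h2 := (Int.dvd_add_left (Dvd.intro_left _ rfl)).1 h1
      rw [pow_add] at h2
      exact (mul_dvd_mul_iff_left (pow_pos H.base_pos s).ne').1 h2
  rintro (j | ⟨i, j⟩)
  · simp only [blockRows, Int.cast_id]
    rw [Fin.sum_univ_eq_sum_range (fun v => A v j * g v) m]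
    exact hA j
  · simp only [blockRows, Int.cast_id]
    rw [Fin.sum_univ_eq_sum_range (fun v => (if v / w = i then B v j else 0) * g v) m]
    simp only [ite_mul, zero_mul]
    exact hB i j

/-- Short kernel elements pass the tests of the dynamic program. -/
theorem validPath_of_inKer (H : Coding n w m r s A B D L M del md) {g : ℕ → ℤ}
    (hg : InKer (blockRows (fun v : Fin m => A v) (fun v : Fin m => B v)
      (fun v : Fin m => (v : ℕ) / w)) (fun v : Fin m => g v))
    (hn : ∑ i ∈ Finset.range m, |g i| ≤ L) :
    ValidPath m L (2 * L * M ^ (s + r)) (M ^ (s + r)) del md g := by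
  have hQ : 0 < M ^ (s + r) := pow_pos H.base_pos _
  have hA : ∀ j, ∑ v ∈ Finset.range m, A v j * g v = 0 := by
    intro j
    have h1 := hg (Sum.inl j)
    simp only [blockRows, Int.cast_id] at h1
    rwa [Fin.sum_univ_eq_sum_range (fun v => A v j * g v) m] at h1
  have hB : ∀ i j, ∑ v ∈ Finset.range m, (if v / w = i then B v j * g v else 0) = 0 := by
    intro i j
    have h1 := hg (Sum.inr (i, j))
    simp only [blockRows, Int.cast_id] at h1
    rw [Fin.sum_univ_eq_sum_range (fun v => (if v / w = i then B v j else 0) * g v) m] at h1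
    simpa only [ite_mul, zero_mul] using h1
  intro v hv
  refine ⟨?_, ?_, ?_⟩
  · exact (Finset.single_le_sum (f := fun i => |g i|) (fun i _ => abs_nonneg _)
      (Finset.mem_range.2 hv)).trans hn
  · refine (H.code_le (by omega)).trans ?_
    have h1 : ∑ i ∈ Finset.range (v + 1), |g i| ≤ ∑ i ∈ Finset.range m, |g i| :=
      Finset.sum_le_sum_of_subset_of_nonneg (by
        intro i
        simp only [Finset.mem_range]
        omega) fun i _ _ => abs_nonneg _
    have h2 := mul_le_mul_of_nonneg_right (h1.trans hn) hQ.le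
    linarith
  · rcases H.md_cases v hv with h | ⟨i, hi, h1, h2⟩ | ⟨h1, h2⟩
    · rw [h]
      exact one_dvd _
    · rw [h2, H.code_eq (by omega), h1]
      simp only [H.initial_B_eq_zero hB (by omega : i + 1 ≤ n), zero_mul, Finset.sum_const_zero,
        zero_add]
      rw [pow_add]
      exact dvd_add (dvd_mul_right _ _) ((dvd_mul_right _ _).mul_left _)
    · rw [h2, H.code_eq (by omega), h1]
      simp only [H.sum_B_eq_zero hB, hA, zero_mul, Finset.sum_const_zero, zero_add, mul_zero]
      exact Dvd.intro_left _ rfl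

end Coding

/-! ## The dynamic program -/

/-- The tables of the dynamic program: `ch v j` is zero if no valid vector of length `v` has the
code `j`, and otherwise determines the last entry of an optimal one, whose value is `val v j`. -/
structure DPTable (m : ℕ) (L J Q P : ℤ) (del md c lo up x : ℕ → ℤ) (ch val : ℕ → ℤ → ℤ) :
    Prop where
  start : 1 ≤ ch 0 0
  start_val : val 0 0 = 0
  start_only : ∀ j, 0 ≤ j → j ≤ J → 1 ≤ ch 0 j → j = 0
  link : ∀ v < m, ∀ j, 0 ≤ j → j ≤ J → 1 ≤ ch (v + 1) j → ∀ g, g = ch (v + 1) j - 1 - L →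
    |g| ≤ L ∧ md v ∣ j ∧ 0 ≤ j - (g * del v + |g| * Q) ∧ lo v ≤ x v + P * g ∧ x v + P * g ≤ up v ∧
    1 ≤ ch v (j - (g * del v + |g| * Q)) ∧
    val (v + 1) j = val v (j - (g * del v + |g| * Q)) + c v * g
  dom : ∀ v < m, ∀ j, 0 ≤ j → j ≤ J → ∀ g, |g| ≤ L → md v ∣ j →
    0 ≤ j - (g * del v + |g| * Q) → lo v ≤ x v + P * g → x v + P * g ≤ up v →
    1 ≤ ch v (j - (g * del v + |g| * Q)) →
    1 ≤ ch (v + 1) j ∧ val v (j - (g * del v + |g| * Q)) + c v * g ≤ val (v + 1) j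

namespace DPTable

variable {m : ℕ} {L J Q P : ℤ} {del md c lo up x : ℕ → ℤ} {ch val : ℕ → ℤ → ℤ}

/-- By induction along the vector, each code of an initial segment is a reachable state whose table
value is at least that of the segment. -/
theorem le_val (H : DPTable m L J Q P del md c lo up x ch val) {g : ℕ → ℤ}
    (hg : ValidPath m L J Q del md g) (hJ : 0 ≤ J) (hcode : ∀ v ≤ m, 0 ≤ pathCode del Q g v)
    (hb : ∀ v < m, lo v ≤ x v + P * g v ∧ x v + P * g v ≤ up v) (v : ℕ) (hv : v ≤ m) :
    pathCode del Q g v ≤ J ∧ 1 ≤ ch v (pathCode del Q g v) ∧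
      ∑ i ∈ Finset.range v, c i * g i ≤ val v (pathCode del Q g v) := by
  induction v with
  | zero => simp [pathCode, H.start, H.start_val, hJ]
  | succ v ih =>
    obtain ⟨h1, h2, h3⟩ := ih (by omega)
    obtain ⟨g1, g2, g3⟩ := hg v (by omega)
    have hp : pathCode del Q g (v + 1) - (g v * del v + |g v| * Q) = pathCode del Q g v := by
      rw [pathCode, Finset.sum_range_succ, pathCode]
      ring
    have h4 := H.dom v (by omega) (pathCode del Q g (v + 1)) (hcode _ hv) g2 (g v) g1 g3
      (by rw [hp]; exact hcode v (by omega)) (hb v (by omega)).1 (hb v (by omega)).2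
      (by rw [hp]; exact h2)
    rw [hp] at h4
    refine ⟨g2, h4.1, ?_⟩
    rw [Finset.sum_range_succ]
    linarith [h4.2]

/-- Following the choices backwards yields a valid vector with the value of the table. -/
theorem backtrack (H : DPTable m L J Q P del md c lo up x ch val)
    (hQ : ∀ v < m, ∀ g : ℤ, 0 ≤ g * del v + |g| * Q) {g jj : ℕ → ℤ}
    (hg : ∀ v < m, g v = ch (v + 1) (jj (v + 1)) - 1 - L)
    (hj : ∀ v < m, jj v = jj (v + 1) - (g v * del v + |g v| * Q))
    (h0 : 0 ≤ jj m) (hJ : jj m ≤ J) (hch : 1 ≤ ch m (jj m)) :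
    ValidPath m L J Q del md g ∧
    (∀ v < m, lo v ≤ x v + P * g v ∧ x v + P * g v ≤ up v) ∧
    val m (jj m) = ∑ i ∈ Finset.range m, c i * g i := by
  -- The induction runs downwards from the last layer. The codes stay at most `J` because each entry
  -- adds a nonnegative amount.
  have hall : ∀ k ≤ m, 0 ≤ jj (m - k) ∧ jj (m - k) ≤ J ∧ 1 ≤ ch (m - k) (jj (m - k)) := by
    intro k
    induction k with
    | zero => intro _; exact ⟨h0, hJ, hch⟩
    | succ k ih =>
      intro hk
      obtain ⟨i1, i2, i3⟩ := ih (by omega)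
      have hmk : m - k = (m - (k + 1)) + 1 := by omega
      rw [hmk] at i1 i2 i3
      have hlt : m - (k + 1) < m := by omega
      obtain ⟨l1, l2, l3, l4, l5, l6, l7⟩ := H.link _ hlt _ i1 i2 i3 _ (hg _ hlt)
      rw [← hj _ hlt] at l3 l6
      refine ⟨l3, ?_, l6⟩
      rw [hj _ hlt]
      have := hQ _ hlt (g (m - (k + 1)))
      omega
  have hall' : ∀ v ≤ m, 0 ≤ jj v ∧ jj v ≤ J ∧ 1 ≤ ch v (jj v) := by
    intro v hv
    have := hall (m - v) (by omega)
    rwa [Nat.sub_sub_self hv] at this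
  have hlink : ∀ v < m, |g v| ≤ L ∧ md v ∣ jj (v + 1) ∧ lo v ≤ x v + P * g v ∧
      x v + P * g v ≤ up v ∧ val (v + 1) (jj (v + 1)) = val v (jj v) + c v * g v := by
    intro v hv
    obtain ⟨i1, i2, i3⟩ := hall' (v + 1) hv
    obtain ⟨l1, l2, l3, l4, l5, l6, l7⟩ := H.link _ hv _ i1 i2 i3 _ (hg _ hv)
    rw [← hj _ hv] at l7
    exact ⟨l1, l2, l4, l5, l7⟩
  have hj0 : jj 0 = 0 := by
    obtain ⟨i1, i2, i3⟩ := hall' 0 (by omega)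
    exact H.start_only _ i1 i2 i3
  have hcode : ∀ v ≤ m, pathCode del Q g v = jj v ∧
      val v (jj v) = ∑ i ∈ Finset.range v, c i * g i := by
    intro v
    induction v with
    | zero => intro _; simp [pathCode, hj0, H.start_val]
    | succ v ih =>
      intro hv
      obtain ⟨i1, i2⟩ := ih (by omega)
      constructor
      · rw [pathCode, Finset.sum_range_succ, ← pathCode, i1, hj v hv]
        ring
      · rw [Finset.sum_range_succ, ← i2, (hlink v hv).2.2.2.2]
  refine ⟨fun v hv => ?_, fun v hv => ⟨(hlink v hv).2.2.1, (hlink v hv).2.2.2.1⟩, (hcode m le_rfl).2⟩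
  rw [(hcode (v + 1) hv).1]
  exact ⟨(hlink v hv).1, (hall' _ hv).2.1, (hlink v hv).2.1⟩

end DPTable

/-! ## The program: names of arrays and expressions -/

-- Names in r, i and x are scalars in cell 0 of an array of their own; names in a are proper arrays.
-- Among the scalars, `rW` is the radius of the box, `rBM` the penalty for slack, `rK` the number of
-- step lengths and `rZ` the number of rounds. All lie above the input and output arrays and below
-- the arrays of the compiler.
notation "rD" => (20 : ℕ)
notation "rLB" => (21 : ℕ)
notation "rL" => (22 : ℕ)
notation "rM" => (23 : ℕ)
notation "rQ" => (25 : ℕ)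
notation "rJ" => (26 : ℕ)
notation "rW" => (27 : ℕ)
notation "rBM" => (28 : ℕ)
notation "rItems" => (29 : ℕ)
notation "rK" => (30 : ℕ)
notation "rZ" => (31 : ℕ)
notation "rCsum" => (32 : ℕ)
notation "rGap" => (33 : ℕ)
notation "aPow" => (40 : ℕ)
notation "aDel" => (41 : ℕ)
notation "aMd" => (42 : ℕ)
notation "aCost" => (43 : ℕ)
notation "aLo" => (44 : ℕ)
notation "aUp" => (45 : ℕ)
notation "aX" => (46 : ℕ)
notation "aCh" => (47 : ℕ)
notation "aVal" => (48 : ℕ)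
notation "aStep" => (49 : ℕ)
notation "aSlack" => (50 : ℕ)
notation "iV" => (60 : ℕ)
notation "iJ" => (61 : ℕ)
notation "iH" => (62 : ℕ)
notation "iK" => (63 : ℕ)
notation "iZ" => (64 : ℕ)
notation "xG" => (65 : ℕ)
notation "xJp" => (66 : ℕ)
notation "xBase" => (67 : ℕ)
notation "xY" => (68 : ℕ)
notation "xNew" => (69 : ℕ)
notation "rP" => (70 : ℕ)
notation "rBest" => (71 : ℕ)
notation "rEnd" => (72 : ℕ)
notation "rFlag" => (73 : ℕ)

instance : Add XE := ⟨XE.bin .add⟩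
instance : Sub XE := ⟨XE.bin .sub⟩
instance : Mul XE := ⟨XE.bin .mul⟩
instance : Div XE := ⟨XE.bin .div⟩

/-- A scalar variable. -/
def va (a : ℕ) : XE := .read a (.const 0)

/-- The absolute value. -/
def XE.abs (e : XE) : XE := .bin .max e (.const 0 - e)

/-- Assignment to a scalar variable. -/
def St.set (a : ℕ) (e : XE) : St := .assign a (.const 0) e

@[simp] theorem eval_const (σ : Store) (z : ℤ) : (XE.const z).eval σ = z := rfl
@[simp] theorem eval_read (σ : Store) (a : ℕ) (i : XE) : (XE.read a i).eval σ = σ a (i.eval σ) := rfl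
@[simp] theorem eval_va (σ : Store) (a : ℕ) : (va a).eval σ = σ a 0 := rfl
@[simp] theorem eval_add (σ : Store) (e f : XE) : (e + f).eval σ = e.eval σ + f.eval σ := rfl
@[simp] theorem eval_sub (σ : Store) (e f : XE) : (e - f).eval σ = e.eval σ - f.eval σ := rfl
@[simp] theorem eval_mul (σ : Store) (e f : XE) : (e * f).eval σ = e.eval σ * f.eval σ := rfl
@[simp] theorem eval_div (σ : Store) (e f : XE) : (e / f).eval σ = e.eval σ / f.eval σ := rfl
@[simp] theorem eval_max (σ : Store) (e f : XE) :
    (XE.bin .max e f).eval σ = max (e.eval σ) (f.eval σ) := rfl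
@[simp] theorem eval_min (σ : Store) (e f : XE) :
    (XE.bin .min e f).eval σ = min (e.eval σ) (f.eval σ) := rfl
@[simp] theorem eval_size (σ : Store) (e : XE) :
    (XE.size e).eval σ = Nat.size (e.eval σ).toNat := rfl
@[simp] theorem eval_abs (σ : Store) (e : XE) : e.abs.eval σ = |e.eval σ| := by
  simp [XE.abs, abs_eq_max_neg]

@[simp] theorem cost_const (σ : Store) (z : ℤ) : (XE.const z).cost σ = 3 := rfl
@[simp] theorem cost_read (σ : Store) (a : ℕ) (i : XE) :
    (XE.read a i).cost σ = i.cost σ + 6 := rfl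
@[simp] theorem cost_va (σ : Store) (a : ℕ) : (va a).cost σ = 9 := rfl
@[simp] theorem cost_add (σ : Store) (e f : XE) : (e + f).cost σ = e.cost σ + f.cost σ + 40 := rfl
@[simp] theorem cost_sub (σ : Store) (e f : XE) : (e - f).cost σ = e.cost σ + f.cost σ + 40 := rfl
@[simp] theorem cost_mul (σ : Store) (e f : XE) :
    (e * f).cost σ = e.cost σ + f.cost σ + (40 + 20 * (f.eval σ).natAbs) := rfl
@[simp] theorem cost_div (σ : Store) (e f : XE) : (e / f).cost σ = e.cost σ + f.cost σ + 40 := rfl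
@[simp] theorem cost_max (σ : Store) (e f : XE) :
    (XE.bin .max e f).cost σ = e.cost σ + f.cost σ + 40 := rfl
@[simp] theorem cost_min (σ : Store) (e f : XE) :
    (XE.bin .min e f).cost σ = e.cost σ + f.cost σ + 40 := rfl
@[simp] theorem cost_size (σ : Store) (e : XE) :
    (XE.size e).cost σ = e.cost σ + 40 + 40 * Nat.size (e.eval σ).toNat := rfl
@[simp] theorem cost_abs (σ : Store) (e : XE) : e.abs.cost σ = 2 * e.cost σ + 83 := by
  simp [XE.abs]
  ring

@[simp] theorem holds_le (σ : Store) (e f : XE) :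
    (BE.le e f).holds σ ↔ e.eval σ ≤ f.eval σ := Iff.rfl
@[simp] theorem holds_and (σ : Store) (b c : BE) :
    (BE.and b c).holds σ ↔ b.holds σ ∧ c.holds σ := Iff.rfl
@[simp] theorem holds_not (σ : Store) (b : BE) : (BE.not b).holds σ ↔ ¬ b.holds σ := Iff.rfl
@[simp] theorem costB_le (σ : Store) (e f : XE) :
    (BE.le e f).cost σ = e.cost σ + f.cost σ + 5 := rfl
@[simp] theorem costB_and (σ : Store) (b c : BE) :
    (BE.and b c).cost σ = b.cost σ + c.cost σ := rfl
@[simp] theorem costB_not (σ : Store) (b : BE) : (BE.not b).cost σ = b.cost σ := rfl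

theorem Sat.set {a : ℕ} {e : XE} {σ : Store} {T : ℕ} {Q : Store → Prop}
    (hT : e.cost σ + 8 ≤ T) (hQ : Q (put σ a 0 (e.eval σ))) : Sat (.set a e) σ T Q :=
  Sat.assign a (.const 0) e σ T Q (by simp only [cost_const]; omega) hQ

theorem Sat.set_seq {a : ℕ} {e : XE} {q : St} {σ : Store} {T₁ T₂ : ℕ} {Q : Store → Prop}
    (hT : e.cost σ + 8 ≤ T₁) (hQ : Sat q (put σ a 0 (e.eval σ)) T₂ Q) :
    Sat (.seq (.set a e) q) σ (T₁ + T₂) Q :=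
  ⟨hQ.1, Nat.add_le_add (by
    simp only [St.set, St.tm, cost_const]
    omega) hQ.2⟩

theorem Sat.assign_seq {a : ℕ} {i e : XE} {q : St} {σ : Store} {T₁ T₂ : ℕ} {Q : Store → Prop}
    (hT : i.cost σ + e.cost σ + 5 ≤ T₁) (hQ : Sat q (put σ a (i.eval σ) (e.eval σ)) T₂ Q) :
    Sat (.seq (.assign a i e) q) σ (T₁ + T₂) Q :=
  ⟨hQ.1, Nat.add_le_add hT hQ.2⟩

theorem Sat.le {s : St} {σ : Store} {T T' : ℕ} {Q : Store → Prop} (h : Sat s σ T Q)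
    (hT : T ≤ T') : Sat s σ T' Q := ⟨h.1, h.2.trans hT⟩

theorem put_eq (σ : Store) (a : ℕ) (i z : ℤ) : put σ a i z a i = z := by simp [put_apply]

theorem put_ne_idx (σ : Store) (a : ℕ) {i j : ℤ} (z : ℤ) (b : ℕ) (h : j ≠ i) :
    put σ a i z b j = σ b j := by simp [put_apply, h]

/-! ## The dynamic program on the machine -/

/-- Try the entry `iH - L` for the item `iV` and the code `iJ`. -/
def tryEntry : St :=
  .seq (.set xG (va iH - va rL))
  (.seq (.set xJp (va iJ - (.read aDel (va iV) * va xG + va rQ * (va xG).abs)))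
  (.seq (.set xY (.read aX (va iV) + va rP * va xG))
  (.ite (.and (.le (.const 0) (va xJp)) (.and (.le (.read aLo (va iV)) (va xY))
      (.and (.le (va xY) (.read aUp (va iV))) (.le (.const 1) (.read aCh (va xBase + va xJp))))))
    (.seq (.set xNew (.read aVal (va xBase + va xJp) + .read aCost (va iV) * va xG))
    (.ite (.and (.le (.const 1) (.read aCh (va xBase + va rJ + .const 1 + va iJ)))
        (.le (va xNew) (.read aVal (va xBase + va rJ + .const 1 + va iJ))))
      .skip
      (.seq (.assign aVal (va xBase + va rJ + .const 1 + va iJ) (va xNew))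
        (.assign aCh (va xBase + va rJ + .const 1 + va iJ) (va iH + .const 1)))))
    .skip)))

/-- Compute the entry of the table for the code `iJ` after the item `iV`. -/
def fillCell : St :=
  .seq (.assign aCh (va xBase + va rJ + .const 1 + va iJ) (.const 0))
  (.ite (.le ((va iJ - .const 1) / .read aMd (va iV) + .const 1) (va iJ / .read aMd (va iV)))
    (.loop iH (.const 2 * va rL + .const 1) tryEntry)
    .skip)

/-- Compute the layer of the table after the item `iV`. -/
def fillLayer : St :=
  .seq (.set xBase (va iV * (va rJ + .const 1)))
    (.loop iJ (va rJ + .const 1) fillCell)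

/-- Compute the table of the dynamic program. -/
def fillTable : St :=
  .seq (.loop iJ (va rJ + .const 1) (.assign aCh (va iJ) (.const 0)))
  (.seq (.assign aCh (.const 0) (.const 1))
  (.seq (.assign aVal (.const 0) (.const 0))
    (.loop iV (va rItems) fillLayer)))

/-- The entry `g` is possible for the item `v` if the code afterwards is `j`. -/
def Candidate (σ : Store) (base : ℤ) (ch : ℤ → ℤ) (v : ℕ) (j g : ℤ) : Prop :=
  0 ≤ j - (σ aDel v * g + σ rQ 0 * |g|) ∧ σ aLo v ≤ σ aX v + σ rP 0 * g ∧
    σ aX v + σ rP 0 * g ≤ σ aUp v ∧ 1 ≤ ch (base + (j - (σ aDel v * g + σ rQ 0 * |g|)))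

/-- The value obtained with the entry `g`. -/
def candVal (σ : Store) (base : ℤ) (val : ℤ → ℤ) (v : ℕ) (j g : ℤ) : ℤ :=
  val (base + (j - (σ aDel v * g + σ rQ 0 * |g|))) + σ aCost v * g

/-- The state of a cell of the table after the entries below `h - L` have been tried. -/
structure CellInv (σ τ₀ : Store) (base idx : ℤ) (v : ℕ) (j : ℤ) (h : ℕ) (τ : Store) : Prop where
  ch_ne : ∀ i, i ≠ idx → τ aCh i = τ₀ aCh i
  val_ne : ∀ i, i ≠ idx → τ aVal i = τ₀ aVal i
  link : 1 ≤ τ aCh idx → τ aCh idx ≤ h ∧ Candidate σ base (τ₀ aCh) v j (τ aCh idx - 1 - σ rL 0) ∧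
    τ aVal idx = candVal σ base (τ₀ aVal) v j (τ aCh idx - 1 - σ rL 0)
  dom : ∀ g, - σ rL 0 ≤ g → g < h - σ rL 0 → Candidate σ base (τ₀ aCh) v j g →
    1 ≤ τ aCh idx ∧ candVal σ base (τ₀ aVal) v j g ≤ τ aVal idx

/-- By `hsep` every predecessor state is stored before the cell `idx` that is being filled, so
writing to this cell does not affect what later candidates read. -/
theorem sat_tryEntry {σ τ₀ τ : Store} {base idx j : ℤ} {v h L : ℕ} (hL : σ rL 0 = L)
    (hh : h < 2 * L + 1)
    (hst : ∀ a ∈ [aDel, aX, aLo, aUp, aCost, rQ, rP, rL, rJ], τ a = σ a)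
    (hv : τ iV 0 = v) (hj : τ iJ 0 = j) (hb : τ xBase 0 = base)
    (hidx : idx = base + σ rJ 0 + 1 + j)
    (hsep : ∀ g, base + (j - (σ aDel v * g + σ rQ 0 * |g|)) < idx)
    (hinv : CellInv σ τ₀ base idx v j h τ) :
    Sat tryEntry (put τ iH 0 h) (2500 + 100 * L) (CellInv σ τ₀ base idx v j (h + 1)) := by
  simp only [List.mem_cons, List.not_mem_nil, or_false, forall_eq_or_imp, forall_eq] at hst
  obtain ⟨s1, s2, s3, s4, s5, s6, s7, s8, s9⟩ := hst
  set g : ℤ := h - L with hg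
  set jp : ℤ := j - (σ aDel v * g + σ rQ 0 * |g|) with hjp
  have hgn : g.natAbs ≤ L := by omega
  have hgn' : |g|.natAbs ≤ L := by rw [Int.natAbs_abs]; exact hgn
  have hsep' := hsep g
  rw [← hjp] at hsep'
  unfold tryEntry
  refine Sat.le (T := 300 + (400 + 40 * L + (200 + 20 * L + (300 + (200 + 20 * L + (340 + 400))))))
    (Sat.set_seq ?_ ?_) (by omega)
  · simp
  have e1 : (va iH - va rL).eval (put τ iH 0 h) = g := by
    simp [put_apply, s8, hL, hg]
  rw [e1]
  refine Sat.set_seq ?_ ?_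
  · simp only [cost_sub, cost_add, cost_mul, cost_va, cost_read, cost_abs, eval_va, eval_abs,
      put_apply]
    simp
    omega
  have e2 : (va iJ - (.read aDel (va iV) * va xG + va rQ * (va xG).abs)).eval
      (put (put τ iH 0 h) xG 0 g) = jp := by
    simp [put_apply, hj, hv, s1, s6, hjp]
  rw [e2]
  refine Sat.set_seq ?_ ?_
  · simp only [cost_add, cost_mul, cost_va, cost_read, eval_va, put_apply]
    simp
    omega
  have e3 : (.read aX (va iV) + va rP * va xG : XE).eval
      (put (put (put τ iH 0 h) xG 0 g) xJp 0 jp) = σ aX v + σ rP 0 * g := by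
    simp [put_apply, hv, s2, s7]
  rw [e3]
  set τ' := put (put (put (put τ iH 0 h) xG 0 g) xJp 0 jp) xY 0 (σ aX v + σ rP 0 * g) with hτ'
  have f1 : τ' aCh = τ aCh := by
    simp only [hτ']
    repeat rw [put_other _ _ _ (by decide)]
  have f2 : τ' aVal = τ aVal := by
    simp only [hτ']
    repeat rw [put_other _ _ _ (by decide)]
  have r1 : τ' xJp 0 = jp := by simp [hτ', put_apply]
  have r2 : τ' xBase 0 = base := by simp [hτ', put_apply, hb]
  have r3 : τ' iJ 0 = j := by simp [hτ', put_apply, hj]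
  have r4 : τ' rJ 0 = σ rJ 0 := by simp [hτ', put_apply, s9]
  have r5 : τ' iH 0 = h := by simp [hτ', put_apply]
  have r6 : τ' xG 0 = g := by simp [hτ', put_apply]
  have r7 : τ' aCost v = σ aCost v := by simp [hτ', put_apply, s5]
  have r8 : τ' iV 0 = v := by simp [hτ', put_apply, hv]
  have hcand : (BE.and (.le (.const 0) (va xJp)) (.and (.le (.read aLo (va iV)) (va xY))
      (.and (.le (va xY) (.read aUp (va iV))) (.le (.const 1) (.read aCh (va xBase + va xJp)))))
      ).holds τ' ↔ Candidate σ base (τ₀ aCh) v j g := by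
    simp only [holds_and, holds_le, eval_const, eval_va, eval_read, eval_add, r1, r2, r8, f1,
      Candidate, ← hjp]
    have q1 : τ' aLo v = σ aLo v := by simp [hτ', put_apply, s3]
    have q2 : τ' aUp v = σ aUp v := by simp [hτ', put_apply, s4]
    have q3 : τ' xY 0 = σ aX v + σ rP 0 * g := by simp [hτ', put_apply]
    rw [q1, q2, q3, hinv.ch_ne _ (by omega)]
  refine Sat.ite ?_ (fun hc => ?_) (fun hc => ?_)
  · simp
  · rw [hcand] at hc
    refine Sat.set_seq ?_ ?_
    · simp only [cost_add, cost_mul, cost_va, cost_read, eval_va, r6]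
      omega
    have e4 : (.read aVal (va xBase + va xJp) + .read aCost (va iV) * va xG : XE).eval τ' =
        candVal σ base (τ₀ aVal) v j g := by
      simp only [eval_add, eval_mul, eval_read, eval_va, r1, r2, r6, r7, r8, f2, candVal, ← hjp]
      rw [hinv.val_ne _ (by omega)]
    rw [e4]
    set nv := candVal σ base (τ₀ aVal) v j g with hnv
    set τ'' := put τ' xNew 0 nv with hτ''
    have hi : ∀ τ₁ : Store, τ₁ xBase = τ' xBase → τ₁ rJ = τ' rJ → τ₁ iJ = τ' iJ →
        (va xBase + va rJ + .const 1 + va iJ : XE).eval τ₁ = idx := by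
      intro τ₁ h1 h2 h3
      simp only [eval_add, eval_va, eval_const, h1, h2, h3, r2, r3, r4, hidx]
    have hi' := hi τ'' (put_other _ _ _ (by decide)) (put_other _ _ _ (by decide))
      (put_other _ _ _ (by decide))
    have g1 : τ'' aCh = τ aCh := by rw [hτ'', put_other _ _ _ (by decide), f1]
    have g2 : τ'' aVal = τ aVal := by rw [hτ'', put_other _ _ _ (by decide), f2]
    have g3 : τ'' xNew 0 = nv := put_eq _ _ _ _
    refine Sat.ite ?_ (fun hb => ?_) (fun hb => ?_)
    · simp
    · simp only [holds_and, holds_le, eval_const, eval_read, hi', eval_va, g1, g2, g3] at hb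
      refine Sat.le (Sat.skip ?_) (by omega)
      refine ⟨fun i hi => by rw [g1, hinv.ch_ne i hi], fun i hi => by rw [g2, hinv.val_ne i hi],
        fun h1 => ?_, fun g' h1 h2 h3 => ?_⟩
      · rw [g1, g2]
        rw [g1] at h1
        have := hinv.link h1
        exact ⟨by push_cast; omega, this.2⟩
      · rw [g1, g2]
        by_cases hg' : g' = g
        · subst hg'
          exact hb
        · exact hinv.dom g' h1 (by push_cast at h2; omega) h3
    · simp only [holds_and, holds_le, eval_const, eval_read, hi', eval_va, g1, g2, g3] at hb
      refine Sat.le (T := 180 + 220) (Sat.assign_seq ?_ (Sat.assign _ _ _ _ _ _ ?_ ?_)) (by omega)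
      · simp
      · simp
      have hi'' := hi (put τ'' aVal idx nv)
        (by rw [put_other _ _ _ (by decide), hτ'', put_other _ _ _ (by decide)])
        (by rw [put_other _ _ _ (by decide), hτ'', put_other _ _ _ (by decide)])
        (by rw [put_other _ _ _ (by decide), hτ'', put_other _ _ _ (by decide)])
      have e5 : (va iH + .const 1 : XE).eval (put τ'' aVal idx nv) = h + 1 := by
        simp [put_apply, hτ'', r5]
      rw [hi', eval_va, g3, hi'', e5]
      set τf := put (put τ'' aVal idx nv) aCh idx (h + 1) with hτf
      have k1 : τf aCh idx = h + 1 := put_eq _ _ _ _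
      have k2 : τf aVal idx = nv := by
        rw [hτf, put_other _ _ _ (by decide), put_eq]
      -- The entry g is stored as g + L + 1, which is positive; zero is thus free to mark
      -- unreachable states.
      have hgh : (h : ℤ) + 1 - 1 - σ rL 0 = g := by rw [hL, hg]; ring
      refine ⟨fun i hi => ?_, fun i hi => ?_, fun _ => ?_, fun g' h1 h2 h3 => ?_⟩
      · rw [hτf, put_ne_idx _ _ _ _ hi, put_ne_idx _ _ _ _ hi, g1, hinv.ch_ne i hi]
      · rw [hτf, put_ne_idx _ _ _ _ hi, put_ne_idx _ _ _ _ hi, g2, hinv.val_ne i hi]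
      · rw [k1, k2, hgh]
        exact ⟨by push_cast; omega, hc, rfl⟩
      · rw [k1, k2]
        refine ⟨by omega, ?_⟩
        by_cases hg' : g' = g
        · subst hg'
          exact le_refl _
        · have h4 := hinv.dom g' h1 (by push_cast at h2; omega) h3
          by_contra h5
          exact hb ⟨h4.1, by omega⟩
  · rw [hcand] at hc
    refine Sat.le (Sat.skip ?_) (by omega)
    constructor
    · intro i hi
      rw [f1, hinv.ch_ne i hi]
    · intro i hi
      rw [f2, hinv.val_ne i hi]
    · intro h1
      rw [f1, f2] at *
      have := hinv.link h1
      push_cast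
      exact ⟨by omega, this.2⟩
    · intro g' h1 h2 h3
      rw [f1, f2]
      by_cases hg' : g' = g
      · subst hg'
        exact absurd h3 hc
      · exact hinv.dom g' h1 (by push_cast at h2; omega) h3

/-- The language has no remainder operation. The quotient by d jumps between j - 1 and j exactly at
the multiples of d, so two divisions test divisibility. -/
theorem dvd_iff_div_pred {d j : ℤ} (hd : 0 < d) : (j - 1) / d + 1 ≤ j / d ↔ d ∣ j := by
  constructor
  · intro h
    have h1 := Int.emod_add_mul_ediv j d
    have h2 := Int.emod_add_mul_ediv (j - 1) d
    have h3 := Int.emod_lt_of_pos (j - 1) hd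
    have h4 := Int.emod_nonneg j hd.ne'
    have h5 : d * ((j - 1) / d + 1) ≤ d * (j / d) := mul_le_mul_of_nonneg_left h hd.le
    refine Int.dvd_of_emod_eq_zero ?_
    nlinarith
  · rintro ⟨q, rfl⟩
    rw [Int.mul_ediv_cancel_left _ hd.ne']
    have : (d * q - 1) / d < q := Int.ediv_lt_of_lt_mul hd (by linarith)
    omega

/-- The recurrence of the dynamic program for one cell of the table, which is stored row by row. -/
structure CellOK (σ : Store) (v : ℕ) (j : ℤ) (ch val : ℤ → ℤ) : Prop where
  link : 1 ≤ ch ((v + 1) * (σ rJ 0 + 1) + j) → σ aMd v ∣ j ∧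
    ch ((v + 1) * (σ rJ 0 + 1) + j) ≤ 2 * σ rL 0 + 1 ∧
    Candidate σ (v * (σ rJ 0 + 1)) ch v j (ch ((v + 1) * (σ rJ 0 + 1) + j) - 1 - σ rL 0) ∧
    val ((v + 1) * (σ rJ 0 + 1) + j) =
      candVal σ (v * (σ rJ 0 + 1)) val v j (ch ((v + 1) * (σ rJ 0 + 1) + j) - 1 - σ rL 0)
  dom : ∀ g, |g| ≤ σ rL 0 → σ aMd v ∣ j → Candidate σ (v * (σ rJ 0 + 1)) ch v j g →
    1 ≤ ch ((v + 1) * (σ rJ 0 + 1) + j) ∧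
    candVal σ (v * (σ rJ 0 + 1)) val v j g ≤ val ((v + 1) * (σ rJ 0 + 1) + j)

/-- The recurrence of a cell reads no index beyond its own, so it survives all later writes to the
table. -/
theorem CellOK.congr {σ : Store} {v : ℕ} {j : ℤ} {ch val ch' val' : ℤ → ℤ}
    (h : CellOK σ v j ch val) (hJ : 0 ≤ σ rJ 0)
    (hQ : ∀ g, 0 ≤ σ aDel v * g + σ rQ 0 * |g|)
    (hch : ∀ i ≤ (v + 1) * (σ rJ 0 + 1) + j, ch' i = ch i)
    (hval : ∀ i ≤ (v + 1) * (σ rJ 0 + 1) + j, val' i = val i) : CellOK σ v j ch' val' := by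
  have h1 : ∀ g, v * (σ rJ 0 + 1) + (j - (σ aDel v * g + σ rQ 0 * |g|)) ≤
      (v + 1) * (σ rJ 0 + 1) + j := fun g => by
    have := hQ g
    linarith
  have hc : ∀ g, Candidate σ (v * (σ rJ 0 + 1)) ch' v j g ↔
      Candidate σ (v * (σ rJ 0 + 1)) ch v j g := fun g => by
    rw [Candidate, Candidate, hch _ (h1 g)]
  have hv : ∀ g, candVal σ (v * (σ rJ 0 + 1)) val' v j g =
      candVal σ (v * (σ rJ 0 + 1)) val v j g := fun g => by
    rw [candVal, candVal, hval _ (h1 g)]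
  constructor
  · rw [hch _ le_rfl, hval _ le_rfl, hc, hv]
    exact h.link
  · intro g
    rw [hch _ le_rfl, hval _ le_rfl, hc, hv]
    exact h.dom g

/-- The cell is cleared before candidates are tried, so the remains of an earlier table do no harm;
it stays empty if the divisibility test fails. -/
theorem sat_fillCell {σ τ : Store} {v j L J : ℕ} (hL : σ rL 0 = L) (hJ : σ rJ 0 = J)
    (hmd : 0 < σ aMd v)
    (hQ : ∀ g, 0 ≤ σ aDel v * g + σ rQ 0 * |g|)
    (hst : ∀ a ∈ [aDel, aX, aLo, aUp, aCost, rQ, rP, rL, rJ, aMd], τ a = σ a)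
    (hv : τ iV 0 = v) (hb : τ xBase 0 = v * (J + 1)) :
    Sat fillCell (put τ iJ 0 j) (1000 + 20 * L + (2 * L + 1) * (2500 + 100 * L + 20)) (fun τ' =>
      (∀ i, i ≠ ((v + 1) * (J + 1) + j : ℤ) → τ' aCh i = τ aCh i ∧ τ' aVal i = τ aVal i) ∧
      CellOK σ v j (τ' aCh) (τ' aVal)) := by
  have hst' := hst
  simp only [List.mem_cons, List.not_mem_nil, or_false, forall_eq_or_imp, forall_eq] at hst
  obtain ⟨s1, s2, s3, s4, s5, s6, s7, s8, s9, s10⟩ := hst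
  set idx : ℤ := (v + 1) * (J + 1) + j with hidx
  have hi : (va xBase + va rJ + .const 1 + va iJ : XE).eval (put τ iJ 0 j) = idx := by
    simp [put_apply, hb, s9, hJ, hidx]
    ring
  unfold fillCell
  refine Sat.le (T := 200 + (300 + ((100 + 20 * L) + 20 + (2 * L + 1) * (2500 + 100 * L + 20))))
    (Sat.assign_seq ?_ ?_) (by omega)
  · simp
  rw [hi, eval_const]
  set τ₀ := put (put τ iJ 0 j) aCh idx 0 with hτ₀
  have u1 : ∀ i, i ≠ idx → τ₀ aCh i = τ aCh i := fun i h => by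
    rw [hτ₀, put_ne_idx _ _ _ _ h, put_other _ _ _ (by decide)]
  have u2 : τ₀ aVal = τ aVal := by
    rw [hτ₀, put_other _ _ _ (by decide), put_other _ _ _ (by decide)]
  have u3 : τ₀ aCh idx = 0 := put_eq _ _ _ _
  have u4 : τ₀ iJ 0 = j := by simp [hτ₀, put_apply]
  have u5 : τ₀ iV 0 = v := by simp [hτ₀, put_apply, hv]
  have u6 : τ₀ aMd = σ aMd := by
    rw [hτ₀, put_other _ _ _ (by decide), put_other _ _ _ (by decide), s10]
  have u7 : τ₀ xBase 0 = v * (J + 1) := by simp [hτ₀, put_apply, hb]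
  have hst₀ : ∀ a ∈ [aDel, aX, aLo, aUp, aCost, rQ, rP, rL, rJ], τ₀ a = σ a := by
    intro a ha
    rw [← hst' a (by
      simp only [List.mem_cons, List.not_mem_nil, or_false] at ha ⊢
      tauto), hτ₀]
    simp only [List.mem_cons, List.not_mem_nil, or_false] at ha
    rw [put_other _ _ _ (by omega), put_other _ _ _ (by omega)]
  have hcond : (BE.le ((va iJ - .const 1) / .read aMd (va iV) + .const 1)
      (va iJ / .read aMd (va iV))).holds τ₀ ↔ σ aMd v ∣ j := by
    simp only [holds_le, eval_add, eval_div, eval_sub, eval_va, eval_const, eval_read, u4, u5, u6]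
    exact dvd_iff_div_pred hmd
  have hsep : ∀ g, (v * (J + 1) : ℤ) + (j - (σ aDel v * g + σ rQ 0 * |g|)) < idx := fun g => by
    have := hQ g
    rw [hidx]
    linarith
  refine Sat.ite ?_ (fun hc => ?_) (fun hc => ?_)
  · simp
  · rw [hcond] at hc
    have hinit : CellInv σ τ₀ (v * (J + 1)) idx v j 0 τ₀ := by
      refine ⟨fun _ _ => rfl, fun _ _ => rfl, fun h => ?_, fun g h1 h2 _ => ?_⟩
      · rw [u3] at h
        omega
      · push_cast at h2
        omega
    have hloop := Sat.loop (i := iH) (e := .const 2 * va rL + .const 1) (p := tryEntry) (σ := τ₀)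
      (CellInv σ τ₀ (v * (J + 1)) idx v j) (2 * L + 1) (2500 + 100 * L) (100 + 20 * L)
      (by
        have : τ₀ rL 0 = L := by rw [hst₀ rL (by simp), hL]
        simp [this])
      (by
        have : τ₀ rL 0 = L := by rw [hst₀ rL (by simp), hL]
        simp [this]
        omega)
      hinit
      (fun h τ₁ hh hfr hinv => sat_tryEntry hL hh
        (fun a ha => by
          rw [hfr a, hst₀ a ha]
          exact (by decide : ∀ a ∈ [aDel, aX, aLo, aUp, aCost, rQ, rP, rL, rJ],
            a ∉ iH :: tryEntry.mods) a ha)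
        (by rw [hfr iV (by decide), u5]) (by rw [hfr iJ (by decide), u4])
        (by rw [hfr xBase (by decide), u7]) (by rw [hJ, hidx]; ring) hsep hinv)
    refine hloop.mono le_rfl fun τ' _ h => ⟨fun i hi => ⟨?_, ?_⟩, ?_⟩
    · rw [h.ch_ne i hi, u1 i hi]
    · rw [h.val_ne i hi, u2]
    · have hc1 : ∀ g, v * (J + 1) + (j - (σ aDel v * g + σ rQ 0 * |g|)) ≠ idx := fun g =>
        (hsep g).ne
      have hcand : ∀ g, Candidate σ (v * (J + 1)) (τ' aCh) v j g ↔
          Candidate σ (v * (J + 1)) (τ₀ aCh) v j g := fun g => by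
        rw [Candidate, Candidate, h.ch_ne _ (hc1 g)]
      have hcv : ∀ g, candVal σ (v * (J + 1)) (τ' aVal) v j g =
          candVal σ (v * (J + 1)) (τ₀ aVal) v j g := fun g => by
        rw [candVal, candVal, h.val_ne _ (hc1 g)]
      constructor
      · rw [hJ, ← hidx]
        intro h1
        have h2 := h.link h1
        rw [hcand, hcv, hL]
        rw [hL] at h2
        exact ⟨hc, by have := h2.1; push_cast at this; exact this, h2.2⟩
      · rw [hJ, ← hidx]
        intro g hg _ hcg
        rw [hcand] at hcg
        rw [hcv]
        have := abs_le.1 hg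
        refine h.dom g this.1 ?_ hcg
        rw [hL] at this ⊢
        push_cast
        omega
  · rw [hcond] at hc
    refine Sat.le (Sat.skip ⟨fun i hi => ⟨u1 i hi, by rw [u2]⟩, ?_⟩) (by omega)
    constructor
    · rw [hJ, ← hidx, u3]
      intro h
      omega
    · intro g _ h1
      exact absurd h1 hc

/-- A bound on the time for one cell of the table. -/
def cellTime (L : ℕ) : ℕ := 1000 + 20 * L + (2 * L + 1) * (2500 + 100 * L + 20)

theorem sat_fillLayer {σ τ : Store} {v L J : ℕ} (hL : σ rL 0 = L) (hJ : σ rJ 0 = J)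
    (hmd : 0 < σ aMd v)
    (hQ : ∀ g, 0 ≤ σ aDel v * g + σ rQ 0 * |g|)
    (hst : ∀ a ∈ [aDel, aX, aLo, aUp, aCost, rQ, rP, rL, rJ, aMd], τ a = σ a) :
    Sat fillLayer (put τ iV 0 v) (300 + 20 * J + (J + 1) * (cellTime L + 20)) (fun τ' =>
      (∀ i, i < ((v + 1) * (J + 1) : ℤ) → τ' aCh i = τ aCh i ∧ τ' aVal i = τ aVal i) ∧
      ∀ j : ℕ, j < J + 1 → CellOK σ v j (τ' aCh) (τ' aVal)) := by
  have hτJ : τ rJ 0 = J := by rw [hst rJ (by simp), hJ]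
  unfold fillLayer
  refine Sat.le (T := (200 + 20 * J) + (61 + 20 + (J + 1) * (cellTime L + 20)))
    (Sat.set_seq ?_ ?_) (by omega)
  · simp [put_apply, hτJ]
    omega
  have e1 : (va iV * (va rJ + .const 1)).eval (put τ iV 0 v) = v * (J + 1) := by
    simp [put_apply, hτJ]
  rw [e1]
  set τ₀ := put (put τ iV 0 v) xBase 0 (v * (J + 1)) with hτ₀
  have hst₀ : ∀ a ∈ [aDel, aX, aLo, aUp, aCost, rQ, rP, rL, rJ, aMd], τ₀ a = σ a := by
    intro a ha
    have h1 := (by decide : ∀ a ∈ [aDel, aX, aLo, aUp, aCost, rQ, rP, rL, rJ, aMd],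
      a ≠ iV ∧ a ≠ xBase) a ha
    rw [hτ₀, put_other _ _ _ h1.2, put_other _ _ _ h1.1, hst a ha]
  have c1 : τ₀ aCh = τ aCh := by
    rw [hτ₀, put_other _ _ _ (by decide), put_other _ _ _ (by decide)]
  have c2 : τ₀ aVal = τ aVal := by
    rw [hτ₀, put_other _ _ _ (by decide), put_other _ _ _ (by decide)]
  have hJ₀ : τ₀ rJ 0 = J := by rw [hst₀ rJ (by simp), hJ]
  have hloop := Sat.loop (i := iJ) (e := va rJ + .const 1) (p := fillCell) (σ := τ₀)
    (fun k τ' => (∀ i, i < ((v + 1) * (J + 1) : ℤ) → τ' aCh i = τ₀ aCh i ∧ τ' aVal i = τ₀ aVal i) ∧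
      ∀ j : ℕ, j < k → CellOK σ v j (τ' aCh) (τ' aVal)) (J + 1) (cellTime L) 61
    (by simp [hJ₀]) (by simp) ⟨fun i _ => ⟨rfl, rfl⟩, fun j hj => by omega⟩
    (fun k τ₁ hk hfr hinv => by
      refine (sat_fillCell (σ := σ) (v := v) (j := k) hL hJ hmd hQ (fun a ha => ?_) ?_ ?_).mono
        le_rfl ?_
      · rw [hfr a, hst₀ a ha]
        exact (by decide : ∀ a ∈ [aDel, aX, aLo, aUp, aCost, rQ, rP, rL, rJ, aMd],
          a ∉ iJ :: fillCell.mods) a ha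
      · rw [hfr iV (by decide)]
        simp [hτ₀, put_apply]
      · rw [hfr xBase (by decide)]
        simp [hτ₀, put_apply]
      · rintro τ₂ - ⟨h1, h2⟩
        refine ⟨fun i hi => ?_, fun j hj => ?_⟩
        · have h3 := h1 i (by omega)
          rw [h3.1, h3.2]
          exact hinv.1 i hi
        · rcases Nat.lt_succ_iff_lt_or_eq.1 hj with h | rfl
          · refine (hinv.2 j h).congr (by rw [hJ]; positivity) hQ (fun i hi => (h1 i ?_).1)
              (fun i hi => (h1 i ?_).2)
            · rw [hJ] at hi
              omega
            · rw [hJ] at hi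
              omega
          · exact h2)
  refine hloop.mono le_rfl fun τ' _ h => ⟨fun i hi => ?_, h.2⟩
  rw [← c1, ← c2]
  exact h.1 i hi

/-- A bound on the time for the table. -/
def tableTime (m L J : ℕ) : ℕ :=
  400 + (J + 1) * 50 + m * (300 + 20 * J + (J + 1) * (cellTime L + 20) + 20)

/-- Row `v` of the table begins at the index v(J+1). Row 0 contains only the code 0, and each
further row depends on the previous one. -/
theorem sat_fillTable {σ : Store} {m L J : ℕ} (hL : σ rL 0 = L) (hJ : σ rJ 0 = J)
    (hm : σ rItems 0 = m) (hmd : ∀ v < m, 0 < σ aMd v)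
    (hQ : ∀ v < m, ∀ g, 0 ≤ g * σ aDel v + |g| * σ rQ 0) :
    Sat fillTable σ (tableTime m L J) (fun τ =>
      DPTable m L J (σ rQ 0) (σ rP 0) (fun v => σ aDel v) (fun v => σ aMd v) (fun v => σ aCost v)
        (fun v => σ aLo v) (fun v => σ aUp v) (fun v => σ aX v)
        (fun v j => τ aCh (v * (J + 1) + j)) (fun v j => τ aVal (v * (J + 1) + j))) := by
  have hQ' : ∀ v < m, ∀ g, 0 ≤ σ aDel v * g + σ rQ 0 * |g| := fun v hv g => by
    have := hQ v hv g
    linarith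
  unfold fillTable
  refine Sat.le (T := (61 + 20 + (J + 1) * (20 + 20)) + (20 + (20 + (9 + 20 +
    m * ((300 + 20 * J + (J + 1) * (cellTime L + 20)) + 20)))))
    (Sat.seq (Q₁ := fun τ => ∀ j : ℕ, j < J + 1 → τ aCh j = 0) ?_ ?_) (by
      unfold tableTime
      omega)
  · refine Sat.loop (fun k τ => ∀ j : ℕ, j < k → τ aCh j = 0) (J + 1) 20 61 (by simp [hJ]) (by simp)
      (fun j hj => by omega) (fun k τ hk _ hinv => Sat.assign _ _ _ _ _ _ (by simp) ?_)
    intro j hj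
    by_cases hjk : j = k
    · simp [put_apply, hjk]
    · rw [put_ne_idx _ _ _ _ (by simp [put_apply, hjk]), put_other _ _ _ (by decide)]
      exact hinv j (by omega)
  intro τ hfr hz
  refine Sat.assign_seq (by simp) (Sat.assign_seq (by simp) ?_)
  simp only [eval_const]
  set τ₀ := put (put τ aCh 0 1) aVal 0 0 with hτ₀
  have hst₀ : ∀ a, a ∉ [iJ, aCh, aVal] → τ₀ a = σ a := by
    intro a ha
    simp only [List.mem_cons, List.not_mem_nil, or_false, not_or] at ha
    rw [hτ₀, put_other _ _ _ ha.2.2, put_other _ _ _ ha.2.1, hfr a]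
    simp only [St.mods, List.mem_cons, List.not_mem_nil, or_false, not_or]
    exact ⟨ha.1, ha.2.1⟩
  have z1 : τ₀ aCh 0 = 1 := by simp [hτ₀, put_apply]
  have z2 : τ₀ aVal 0 = 0 := by simp [hτ₀, put_apply]
  have z3 : ∀ j : ℕ, 0 < j → j < J + 1 → τ₀ aCh j = 0 := fun j h0 hj => by
    rw [hτ₀, put_other _ _ _ (by decide), put_ne_idx _ _ _ _ (by exact_mod_cast h0.ne'), hz j hj]
  have hloop := Sat.loop (i := iV) (e := va rItems) (p := fillLayer) (σ := τ₀)
    (fun k τ' => (∀ i, i < (J + 1 : ℤ) → τ' aCh i = τ₀ aCh i ∧ τ' aVal i = τ₀ aVal i) ∧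
      ∀ v < k, ∀ j : ℕ, j < J + 1 → CellOK σ v j (τ' aCh) (τ' aVal)) m
      (300 + 20 * J + (J + 1) * (cellTime L + 20)) 9
    (by rw [eval_va, hst₀ rItems (by decide), hm]) (by simp)
    ⟨fun i _ => ⟨rfl, rfl⟩, fun j hj => by omega⟩
    (fun k τ₁ hk hfr₁ hinv => by
      refine (sat_fillLayer (σ := σ) (v := k) hL hJ (hmd k hk) (hQ' k hk) (fun a ha => ?_)).mono
        le_rfl ?_
      · have h1 := (by decide : ∀ a ∈ [aDel, aX, aLo, aUp, aCost, rQ, rP, rL, rJ, aMd],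
          a ∉ iV :: fillLayer.mods ∧ a ∉ [iJ, aCh, aVal]) a ha
        rw [hfr₁ a h1.1, hst₀ a h1.2]
      · rintro τ₂ - ⟨h1, h2⟩
        have hkJ : (J + 1 : ℤ) ≤ (k + 1) * (J + 1) := by nlinarith
        refine ⟨fun i hi => ?_, fun v hv j hj => ?_⟩
        · have h3 := h1 i (by omega)
          rw [h3.1, h3.2]
          exact hinv.1 i hi
        · rcases Nat.lt_succ_iff_lt_or_eq.1 hv with h | rfl
          · have hlt : ((v + 1) * (J + 1) + j : ℤ) < (k + 1) * (J + 1) := by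
              have : (v + 1 : ℤ) ≤ k := by exact_mod_cast h
              have h5 : (v + 1 : ℤ) * (J + 1) ≤ k * (J + 1) :=
                mul_le_mul_of_nonneg_right this (by positivity)
              have h6 : (j : ℤ) < J + 1 := by exact_mod_cast hj
              linarith
            refine (hinv.2 v h j hj).congr (by rw [hJ]; positivity) (hQ' v (by omega))
              (fun i hi => (h1 i ?_).1) (fun i hi => (h1 i ?_).2)
            · rw [hJ] at hi
              omega
            · rw [hJ] at hi
              omega
          · exact h2 j hj)
  refine hloop.mono le_rfl fun τ' _ h => ?_
  have hrow : ∀ (v : ℕ) (g j : ℤ), (v : ℤ) * (J + 1) + (j - (σ aDel v * g + σ rQ 0 * |g|)) =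
      v * (J + 1) + (j - (g * σ aDel v + |g| * σ rQ 0)) := fun v g j => by ring
  have hjj : ∀ (v : ℕ) (g j : ℤ), j - (σ aDel v * g + σ rQ 0 * |g|) =
      j - (g * σ aDel v + |g| * σ rQ 0) := fun v g j => by ring
  constructor
  · simp only [Nat.cast_zero, zero_mul, zero_add]
    rw [(h.1 0 (by positivity)).1, z1]
  · simp only [Nat.cast_zero, zero_mul, zero_add]
    rw [(h.1 0 (by positivity)).2, z2]
  · intro j h0 h1 h2
    simp only [Nat.cast_zero, zero_mul, zero_add] at h2
    rw [(h.1 j (by omega)).1] at h2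
    lift j to ℕ using h0
    by_contra h3
    rw [z3 j (by omega) (by omega)] at h2
    omega
  · intro v hv j h0 h1 h2 g hg
    lift j to ℕ using h0
    have hc := (h.2 v hv j (by omega)).link
    rw [hJ, hL] at hc
    push_cast at h2 hg ⊢
    obtain ⟨c1, c2, c3, c4⟩ := hc h2
    rw [← hg] at c3 c4
    simp only [Candidate, candVal, hjj] at c3 c4
    exact ⟨abs_le.2 ⟨by omega, by omega⟩, c1, c3.1, c3.2.1, c3.2.2.1, c3.2.2.2, c4⟩
  · intro v hv j h0 h1 g hg hd p1 p2 p3 p4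
    lift j to ℕ using h0
    have hc := (h.2 v hv j (by omega)).dom g (by rw [hL]; exact hg) hd
    rw [hJ] at hc
    push_cast
    simp only [Candidate, candVal, hjj] at hc
    exact hc ⟨p1, p2, p3, p4⟩

/-! ## Augmentation on the machine -/

/-- Follow the choices of the table backwards from the code `rEnd`. -/
def traceBack : St :=
  .loop iV (va rItems)
    (.seq (.set xG (.read aCh ((va rItems - va iV) * (va rJ + .const 1) + va rEnd) - .const 1 -
        va rL))
    (.seq (.assign aStep (va rItems - .const 1 - va iV) (va rP * va xG))
      (.set rEnd (va rEnd - (.read aDel (va rItems - .const 1 - va iV) * va xG +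
        va rQ * (va xG).abs)))))

/-- The code after `q` steps of the backward pass. -/
def traceCode (m : ℕ) (L Q : ℤ) (del : ℕ → ℤ) (ch : ℕ → ℤ → ℤ) (e : ℤ) : ℕ → ℤ
  | 0 => e
  | q + 1 =>
    traceCode m L Q del ch e q -
      ((ch (m - q) (traceCode m L Q del ch e q) - 1 - L) * del (m - 1 - q) +
        |ch (m - q) (traceCode m L Q del ch e q) - 1 - L| * Q)

/-- A bound on the time for the backward pass. -/
def traceTime (m L J : ℕ) : ℕ := 50 + m * (1500 + 20 * J + 60 * L)

/-- `traceCode` counts steps from the end, whereas `DPTable.backtrack` needs the codes by position;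
the reflection v ↦ m - v translates between them. -/
theorem sat_traceBack {σ : Store} {m L J : ℕ} {Q P : ℤ} {del md c lo up x : ℕ → ℤ}
    {ch val : ℕ → ℤ → ℤ} (hL : σ rL 0 = L) (hJ : σ rJ 0 = J) (hm : σ rItems 0 = m)
    (hQ : σ rQ 0 = Q) (hP : σ rP 0 = P) (hdel : ∀ v < m, σ aDel v = del v)
    (hch : ∀ (v : ℕ) (j : ℤ), σ aCh (v * (J + 1) + j) = ch v j)
    (H : DPTable m L J Q P del md c lo up x ch val)
    (hμ : ∀ v < m, ∀ g : ℤ, 0 ≤ g * del v + |g| * Q)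
    (h0 : 0 ≤ σ rEnd 0) (hJe : σ rEnd 0 ≤ J) (hche : 1 ≤ ch m (σ rEnd 0)) :
    Sat traceBack σ (traceTime m L J) (fun τ => ∃ g : ℕ → ℤ,
      ValidPath m L J Q del md g ∧
      (∀ v < m, lo v ≤ x v + P * g v ∧ x v + P * g v ≤ up v) ∧
      val m (σ rEnd 0) = ∑ i ∈ Finset.range m, c i * g i ∧
      ∀ v < m, τ aStep v = P * g v) := by
  set bt := traceCode m L Q del ch (σ rEnd 0) with hbt
  set jj : ℕ → ℤ := fun v => bt (m - v) with hjj
  set g : ℕ → ℤ := fun v => ch (v + 1) (jj (v + 1)) - 1 - L with hg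
  have hj : ∀ v < m, jj v = jj (v + 1) - (g v * del v + |g v| * Q) := by
    intro v hv
    simp only [hjj, hg]
    have h1 : m - v = (m - (v + 1)) + 1 := by omega
    have h2 : m - (m - (v + 1)) = v + 1 := by omega
    have h3 : m - 1 - (m - (v + 1)) = v := by omega
    conv_lhs => rw [h1, hbt, traceCode, ← hbt, h2, h3]
  have hback := H.backtrack hμ (g := g) (jj := jj) (fun v _ => rfl) hj
    (by simpa [hjj, hbt, traceCode] using h0) (by simpa [hjj, hbt, traceCode] using hJe)
    (by simpa [hjj, hbt, traceCode] using hche)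
  have hall : ∀ v < m, |g v| ≤ L := fun v hv => (hback.1 v hv).1
  unfold traceBack
  refine (Sat.loop (fun k τ => τ rEnd 0 = bt k ∧ ∀ v < m, m - k ≤ v → τ aStep v = P * g v) m
    (1300 + 20 * J + 60 * L) 9 (by simp [hm]) (by simp) ⟨by simp [hbt, traceCode], fun v hv hv' => by
      omega⟩ ?_).mono ?_ ?_
  · intro k τ hk hfr ⟨hi1, hi2⟩
    have q1 : τ rItems 0 = m := by rw [hfr rItems (by decide), hm]
    have q2 : τ rJ 0 = J := by rw [hfr rJ (by decide), hJ]
    have q3 : τ rL 0 = L := by rw [hfr rL (by decide), hL]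
    have q4 : τ rQ 0 = Q := by rw [hfr rQ (by decide), hQ]
    have q5 : τ rP 0 = P := by rw [hfr rP (by decide), hP]
    have q6 : τ aCh = σ aCh := hfr aCh (by decide)
    have q7 : τ aDel = σ aDel := hfr aDel (by decide)
    set v := m - 1 - k with hv
    have hvm : v < m := by omega
    have hvz : (m : ℤ) - 1 - k = v := by omega
    have hvz' : (m : ℤ) - k = ((v + 1 : ℕ) : ℤ) := by omega
    have hjv : jj (v + 1) = bt k := by
      simp only [hjj]
      congr 1
      omega
    have e1 : (.read aCh ((va rItems - va iV) * (va rJ + .const 1) + va rEnd) - .const 1 -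
        va rL : XE).eval (put τ iV 0 k) = g v := by
      simp only [eval_sub, eval_read, eval_add, eval_mul, eval_va, eval_const, put_apply]
      simp only [Nat.reduceEqDiff, if_false, if_true]
      rw [q1, q2, q3, q6, hi1, hvz', hch, ← hjv]
    have hgv := hall v hvm
    have hgn : (g v).natAbs ≤ L := by
      have := abs_le.1 hgv
      omega
    have hgn' : |g v|.natAbs ≤ L := by rw [Int.natAbs_abs]; exact hgn
    refine Sat.le (T := (400 + 20 * J) + ((300 + 20 * L) + (500 + 40 * L)))
      (Sat.set_seq ?_ ?_) (by omega)
    · simp [put_apply, q2]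
      omega
    rw [e1]
    refine Sat.assign_seq ?_ ?_
    · simp [put_apply]
      omega
    have e2 : (va rItems - .const 1 - va iV).eval (put (put τ iV 0 k) xG 0 (g v)) = v := by
      simp [put_apply, q1, hvz]
    have e3 : (va rP * va xG).eval (put (put τ iV 0 k) xG 0 (g v)) = P * g v := by
      simp [put_apply, q5]
    rw [e2, e3]
    refine Sat.set ?_ ?_
    · simp only [cost_sub, cost_add, cost_mul, cost_va, cost_read, cost_abs, eval_va, eval_abs,
        cost_const, put_apply]
      simp
      omega
    have e4 : (va rEnd - (.read aDel (va rItems - .const 1 - va iV) * va xG +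
        va rQ * (va xG).abs)).eval (put (put (put τ iV 0 k) xG 0 (g v)) aStep v (P * g v)) =
        bt (k + 1) := by
      have h1 : bt (k + 1) = jj v := by
        simp only [hjj]
        congr 1
        omega
      rw [h1, hj v hvm, hjv, ← hdel v hvm]
      simp [put_apply, q1, q4, q7, hi1, hvz]
      ring
    rw [e4]
    refine ⟨put_eq _ _ _ _, fun u hu hu' => ?_⟩
    rw [put_other _ _ _ (by decide)]
    by_cases huv : u = v
    · rw [huv, put_eq]
    · rw [put_ne_idx _ _ _ _ (by exact_mod_cast huv), put_other _ _ _ (by decide),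
        put_other _ _ _ (by decide)]
      exact hi2 u hu (by omega)
  · unfold traceTime
    nlinarith
  · intro τ _ h
    refine ⟨g, hback.1, hback.2.1, ?_, fun v hv => h.2 v hv (by omega)⟩
    have := hback.2.2
    simpa [hjj, hbt, traceCode] using this

/-- Find the best code in the last layer of the table, if it improves on `rBest`. -/
def pickLoop : St :=
  .loop iJ (va rJ + .const 1)
    (.ite (.and (.le (.const 1) (.read aCh (va xBase + va iJ)))
        (.le (va rBest + .const 1) (.read aVal (va xBase + va iJ) * va rP)))
      (.seq (.set rBest (.read aVal (va xBase + va iJ) * va rP))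
      (.seq (.set rEnd (va iJ)) (.set rFlag (.const 1))))
      .skip)

/-- Update the best step found so far. -/
def pickBest : St :=
  .seq (.set rFlag (.const 0))
  (.seq (.set xBase (va rItems * (va rJ + .const 1)))
  (.seq pickLoop
  (.ite (.le (.const 1) (va rFlag)) traceBack .skip)))

/-- A bound on the time for updating the best step. -/
def pickTime (m L J P : ℕ) : ℕ :=
  500 + 20 * J + (J + 1) * (700 + 40 * P) + traceTime m L J

/-- The stored step is overwritten only when `rFlag` records a strict improvement. In either case
the best value afterwards dominates the whole last row, scaled by the step length. -/
theorem sat_pickBest {σ : Store} {m L J P : ℕ} {Q : ℤ} {del md c lo up x : ℕ → ℤ}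
    {ch val : ℕ → ℤ → ℤ} (hL : σ rL 0 = L) (hJ : σ rJ 0 = J) (hm : σ rItems 0 = m)
    (hQ : σ rQ 0 = Q) (hP : σ rP 0 = P) (hdel : ∀ v < m, σ aDel v = del v)
    (hch : ∀ (v : ℕ) (j : ℤ), σ aCh (v * (J + 1) + j) = ch v j)
    (hval : ∀ (v : ℕ) (j : ℤ), σ aVal (v * (J + 1) + j) = val v j)
    (H : DPTable m L J Q P del md c lo up x ch val)
    (hμ : ∀ v < m, ∀ g : ℤ, 0 ≤ g * del v + |g| * Q) :
    Sat pickBest σ (pickTime m L J P) (fun τ =>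
      ((τ rBest 0 = σ rBest 0 ∧ τ aStep = σ aStep) ∨ (∃ g : ℕ → ℤ,
        ValidPath m L J Q del md g ∧
        (∀ v < m, lo v ≤ x v + P * g v ∧ x v + P * g v ≤ up v) ∧
        τ rBest 0 = P * ∑ i ∈ Finset.range m, c i * g i ∧
        ∀ v < m, τ aStep v = P * g v)) ∧
      σ rBest 0 ≤ τ rBest 0 ∧
      ∀ j : ℕ, j < J + 1 → 1 ≤ ch m j → val m j * P ≤ τ rBest 0) := by
  unfold pickBest
  refine Sat.le (T := 20 + ((200 + 20 * J) + ((61 + 20 + (J + 1) * (600 + 40 * P + 20)) +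
    (20 + (traceTime m L J + 1))))) (Sat.set_seq (by simp) (Sat.set_seq ?_ ?_)) (by
      unfold pickTime
      have : (J + 1) * (600 + 40 * P + 20) ≤ (J + 1) * (700 + 40 * P) :=
        Nat.mul_le_mul_left _ (by omega)
      omega)
  · simp [put_apply, hJ]
    omega
  have e1 : (va rItems * (va rJ + .const 1)).eval (put σ rFlag 0 ((XE.const 0).eval σ)) =
      m * (J + 1) := by
    simp [put_apply, hJ, hm]
  rw [e1, eval_const]
  set τ₀ := put (put σ rFlag 0 0) xBase 0 (m * (J + 1)) with hτ₀
  have hf₀ : ∀ a, a ≠ rFlag → a ≠ xBase → τ₀ a = σ a := fun a h1 h2 => by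
    rw [hτ₀, put_other _ _ _ h2, put_other _ _ _ h1]
  have hch0 : τ₀ aCh = σ aCh := hf₀ aCh (by decide) (by decide)
  have hval0 : τ₀ aVal = σ aVal := hf₀ aVal (by decide) (by decide)
  refine Sat.seq (Q₁ := fun τ => ((τ rFlag 0 = 0 ∧ τ rBest 0 = σ rBest 0) ∨
      (τ rFlag 0 = 1 ∧ 0 ≤ τ rEnd 0 ∧ τ rEnd 0 ≤ J ∧ 1 ≤ ch m (τ rEnd 0) ∧
        τ rBest 0 = val m (τ rEnd 0) * P)) ∧ σ rBest 0 ≤ τ rBest 0 ∧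
      ∀ j : ℕ, j < J + 1 → 1 ≤ ch m j → val m j * P ≤ τ rBest 0) ?_ ?_
  · refine Sat.loop (fun k τ => ((τ rFlag 0 = 0 ∧ τ rBest 0 = σ rBest 0) ∨
      (τ rFlag 0 = 1 ∧ 0 ≤ τ rEnd 0 ∧ τ rEnd 0 ≤ J ∧ 1 ≤ ch m (τ rEnd 0) ∧
        τ rBest 0 = val m (τ rEnd 0) * P)) ∧ σ rBest 0 ≤ τ rBest 0 ∧
      ∀ j : ℕ, j < k → 1 ≤ ch m j → val m j * P ≤ τ rBest 0) (J + 1) _ 61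
      (by simp [hτ₀, put_apply, hJ]) (by simp) ⟨Or.inl ⟨by simp [hτ₀, put_apply],
        by rw [hf₀ rBest (by decide) (by decide)]⟩,
        by rw [hf₀ rBest (by decide) (by decide)], fun j hj => by omega⟩ ?_
    intro k τ hk hfr ⟨hi1, hi2, hi3⟩
    have q2 : τ xBase 0 = m * (J + 1) := by
      rw [hfr xBase (by decide)]
      simp [hτ₀, put_apply]
    have q3 : τ aCh = σ aCh := by rw [hfr aCh (by decide), hch0]
    have q4 : τ aVal = σ aVal := by rw [hfr aVal (by decide), hval0]
    have q5 : τ rP 0 = P := by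
      rw [hfr rP (by decide), hf₀ rP (by decide) (by decide), hP]
    have r1 : (XE.read aCh (va xBase + va iJ)).eval (put τ iJ 0 k) = ch m k := by
      simp [put_apply, q2, q3, hch]
    have r2 : (.read aVal (va xBase + va iJ) * va rP : XE).eval (put τ iJ 0 k) = val m k * P := by
      simp [put_apply, q2, q4, hval, q5]
    have r3 : put τ iJ 0 k rBest = τ rBest := put_other _ _ _ (by decide)
    have r4 : put τ iJ 0 k rFlag = τ rFlag := put_other _ _ _ (by decide)
    have r5 : put τ iJ 0 k rEnd = τ rEnd := put_other _ _ _ (by decide)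
    refine Sat.le (T := (300 + 20 * P) + ((200 + 20 * P) + (20 + 20))) (Sat.ite ?_ ?_ ?_) (by omega)
    · simp [put_apply, q5]
      omega
    · intro hc
      simp only [holds_and, holds_le, eval_const, r1, r2, eval_add, eval_va, r3] at hc
      refine Sat.set_seq ?_ (Sat.set_seq ?_ (Sat.set ?_ ?_))
      · simp [put_apply, q5]
        omega
      · simp
      · simp
      rw [r2]
      simp only [eval_va, eval_const]
      refine ⟨Or.inr ⟨by simp [put_apply], ?_, ?_, ?_, ?_⟩, ?_, ?_⟩
      · simp [put_apply]
      · simp [put_apply]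
        omega
      · simpa [put_apply] using hc.1
      · simp [put_apply]
      · simp [put_apply]
        omega
      · intro j hj hj1
        simp only [put_apply]
        simp
        by_cases hjk : j = k
        · rw [hjk]
        · have := hi3 j (by omega) hj1
          omega
    · intro hc
      simp only [holds_and, holds_le, eval_const, r1, r2, eval_add, eval_va, r3] at hc
      refine Sat.le (Sat.skip ?_) (by omega)
      rw [r3, r4, r5]
      refine ⟨hi1, hi2, fun j hj hj1 => ?_⟩
      by_cases hjk : j = k
      · subst hjk
        by_contra h
        exact hc ⟨hj1, by omega⟩
      · exact hi3 j (by omega) hj1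
  · intro τ hfr ⟨h1, h2, h3⟩
    have hfr' : ∀ a, a ∉ [rFlag, xBase, iJ, rBest, rEnd] → τ a = σ a := by
      intro a ha
      have ha' := ha
      simp only [List.mem_cons, List.not_mem_nil, or_false, not_or] at ha
      rw [hfr a (fun hmem => ha' ((by decide : ∀ b ∈ pickLoop.mods,
        b ∈ [rFlag, xBase, iJ, rBest, rEnd]) a hmem)), hf₀ a ha.1 ha.2.1]
    refine Sat.ite (by simp) (fun hc => ?_) (fun hc => ?_)
    · simp only [holds_le, eval_const, eval_va] at hc
      rcases h1 with h1 | ⟨_, h4, h5, h6, h7⟩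
      · omega
      refine (sat_traceBack (σ := τ) (by rw [hfr' rL (by decide), hL])
        (by rw [hfr' rJ (by decide), hJ]) (by rw [hfr' rItems (by decide), hm])
        (by rw [hfr' rQ (by decide), hQ]) (by rw [hfr' rP (by decide), hP])
        (fun v hv => by rw [hfr' aDel (by decide), hdel v hv])
        (fun v j => by rw [hfr' aCh (by decide), hch]) H hμ h4 h5 h6).mono (by omega) ?_
      rintro τ' hτ' ⟨g, g1, g2, g3, g4⟩
      rw [hτ' rBest (by decide)]
      refine ⟨Or.inr ⟨g, g1, g2, ?_, g4⟩, h2, h3⟩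
      rw [h7, g3, mul_comm]
    · simp only [holds_le, eval_const, eval_va] at hc
      refine Sat.le (Sat.skip ⟨Or.inl ⟨?_, hfr' aStep (by decide)⟩, h2, h3⟩) (by omega)
      rcases h1 with h1 | h1
      · exact h1.2
      · omega

/-- Set the best step to zero. -/
def clearStep : St := .loop iV (va rItems) (.assign aStep (va iV) (.const 0))

/-- Find the best step for the step length `rP`, and double the step length. -/
def scaleBody : St := .seq fillTable (.seq pickBest (.set rP (va rP + va rP)))

/-- Find the best step among all step lengths. -/
def scaleLoop : St := .loop iK (va rK) scaleBody

/-- Add the best step to the current solution. -/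
def applyStep : St :=
  .loop iV (va rItems) (.assign aX (va iV) (.read aX (va iV) + .read aStep (va iV)))

/-- Improve the current solution by the best step. -/
def augment : St :=
  .seq (.set rBest (.const 0)) (.seq clearStep (.seq (.set rP (.const 1)) (.seq scaleLoop applyStep)))

/-- The store contains the data of a coded system for the dynamic program. -/
structure Ready (σ : Store) (n w m r s : ℕ) (A : ℕ → Fin r → ℤ) (B : ℕ → Fin s → ℤ)
    (D L J K : ℕ) (M : ℤ) : Prop where
  coding : Coding n w m r s A B D L M (fun v => σ aDel v) (fun v => σ aMd v)
  reg_L : σ rL 0 = L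
  reg_J : σ rJ 0 = J
  reg_Q : σ rQ 0 = M ^ (s + r)
  reg_K : σ rK 0 = K
  reg_items : σ rItems 0 = m
  J_eq : (J : ℤ) = 2 * L * M ^ (s + r)

namespace Ready

variable {σ τ : Store} {n w m r s : ℕ} {A : ℕ → Fin r → ℤ} {B : ℕ → Fin s → ℤ} {D L J K : ℕ} {M : ℤ}

theorem congr (H : Ready σ n w m r s A B D L J K M)
    (h : ∀ a ∈ [aDel, aMd, rL, rJ, rQ, rK, rItems], τ a = σ a) :
    Ready τ n w m r s A B D L J K M := by
  simp only [List.mem_cons, List.not_mem_nil, or_false, forall_eq_or_imp, forall_eq] at h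
  obtain ⟨h1, h2, h3, h4, h5, h6, h7⟩ := h
  constructor
  · rw [h1, h2]; exact H.coding
  · rw [h3, H.reg_L]
  · rw [h4, H.reg_J]
  · rw [h5, H.reg_Q]
  · rw [h6, H.reg_K]
  · rw [h7, H.reg_items]
  · exact H.J_eq

theorem md_pos (H : Ready σ n w m r s A B D L J K M) {v : ℕ} (hv : v < m) : 0 < σ aMd v := by
  have hM := H.coding.base_pos
  rcases H.coding.md_cases v hv with h | ⟨i, _, _, h⟩ | ⟨_, h⟩ <;> rw [h]
  · exact one_pos
  · positivity
  · positivity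

theorem step_nonneg (H : Ready σ n w m r s A B D L J K M) {v : ℕ} (hv : v < m) (g : ℤ) :
    0 ≤ g * σ aDel v + |g| * σ rQ 0 := by
  have h1 := (H.coding.step_bounds hv g).1
  have hM := H.coding.base_pos
  have h2 : 0 ≤ |g| * M ^ (s + r) := by positivity
  rw [H.reg_Q]
  omega

/-- The vector `g` passes the tests of the dynamic program. -/
abbrev Valid (σ : Store) (m L J : ℕ) (g : ℕ → ℤ) : Prop :=
  ValidPath m L J (σ rQ 0) (fun v => σ aDel v) (fun v => σ aMd v) g

/-- The current solution plus the step `y` satisfies the bounds. -/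
def InBox (σ : Store) (m : ℕ) (y : ℕ → ℤ) : Prop :=
  ∀ v : ℕ, v < m → σ aLo v ≤ σ aX v + y v ∧ σ aX v + y v ≤ σ aUp v

/-- The value of a step. -/
def gain (σ : Store) (m : ℕ) (y : ℕ → ℤ) : ℤ := ∑ v ∈ Finset.range m, σ aCost v * y v

theorem gain_mul (σ : Store) (m : ℕ) (p : ℤ) (g : ℕ → ℤ) :
    gain σ m (fun v => p * g v) = p * gain σ m g := by
  rw [gain, gain, Finset.mul_sum]
  exact Finset.sum_congr rfl fun v _ => by ring

/-- The best step after the step lengths below `2 ^ k` have been tried. -/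
structure ScaleInv (σ : Store) (m L J k : ℕ) (τ : Store) : Prop where
  len : τ rP 0 = 2 ^ k
  best : ∃ (p : ℤ) (g : ℕ → ℤ), Valid σ m L J g ∧ InBox σ m (fun v => p * g v) ∧
    τ rBest 0 = gain σ m (fun v => p * g v) ∧ ∀ v : ℕ, v < m → τ aStep v = p * g v
  nonneg : 0 ≤ τ rBest 0
  dom : ∀ k' < k, ∀ g, Valid σ m L J g → InBox σ m (fun v => 2 ^ k' * g v) →
    2 ^ k' * gain σ m g ≤ τ rBest 0

/-- For the current length, dominance over all valid vectors in the box comes from `DPTable.le_val`: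
each of them appears with its code in the last row. For the smaller lengths it is inherited, as
`rBest` never decreases. -/
theorem sat_scaleBody {k : ℕ} (H : Ready σ n w m r s A B D L J K M)
    (hst : ∀ a ∈ [aDel, aMd, rL, rJ, rQ, rK, rItems, aCost, aLo, aUp, aX], τ a = σ a)
    (hinv : ScaleInv σ m L J k τ) (hk : k < K) :
    Sat scaleBody (put τ iK 0 k) (tableTime m L J + (pickTime m L J (2 ^ K) + 80))
      (ScaleInv σ m L J (k + 1)) := by
  have hst₀ : ∀ a ∈ [aDel, aMd, rL, rJ, rQ, rK, rItems, aCost, aLo, aUp, aX],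
      put τ iK 0 k a = σ a := by
    intro a ha
    rw [put_other _ _ _ ((by decide : ∀ a ∈ [aDel, aMd, rL, rJ, rQ, rK, rItems, aCost, aLo, aUp,
      aX], a ≠ iK) a ha), hst a ha]
  set τ₀ := put τ iK 0 k with hτ₀
  have eP : τ₀ rP 0 = 2 ^ k := by rw [hτ₀, put_other _ _ _ (by decide), hinv.len]
  have eB : τ₀ rBest = τ rBest := put_other _ _ _ (by decide)
  have eS : τ₀ aStep = τ aStep := put_other _ _ _ (by decide)
  have e1 := hst₀ aDel (by decide)
  have e2 := hst₀ aMd (by decide)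
  have e3 := hst₀ rQ (by decide)
  have e4 := hst₀ aCost (by decide)
  have e5 := hst₀ aLo (by decide)
  have e6 := hst₀ aUp (by decide)
  have e7 := hst₀ aX (by decide)
  have H₀ : Ready τ₀ n w m r s A B D L J K M := H.congr fun a ha => hst₀ a
    ((by decide : ∀ a ∈ [aDel, aMd, rL, rJ, rQ, rK, rItems], a ∈ [aDel, aMd, rL, rJ, rQ, rK, rItems,
      aCost, aLo, aUp, aX]) a ha)
  unfold scaleBody
  refine Sat.seq (sat_fillTable H₀.reg_L H₀.reg_J H₀.reg_items (fun v hv => H₀.md_pos hv)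
    (fun v hv => H₀.step_nonneg hv)) ?_
  intro τ₁ hfr₁ htab
  rw [e1, e2, e3, e4, e5, e6, e7, eP] at htab
  have hf₁ : ∀ a ∈ [aDel, aMd, rL, rJ, rQ, rK, rItems, rP, rBest, aStep], τ₁ a = τ₀ a := fun a ha =>
    hfr₁ a ((by decide : ∀ a ∈ [aDel, aMd, rL, rJ, rQ, rK, rItems, rP, rBest, aStep],
      a ∉ fillTable.mods) a ha)
  have hpick := sat_pickBest (σ := τ₁) (m := m) (L := L) (J := J) (P := 2 ^ k)
    (by rw [hf₁ rL (by decide), H₀.reg_L]) (by rw [hf₁ rJ (by decide), H₀.reg_J])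
    (by rw [hf₁ rItems (by decide), H₀.reg_items]) (by rw [hf₁ rQ (by decide), e3])
    (by rw [hf₁ rP (by decide), eP]; simp) (fun v hv => by rw [hf₁ aDel (by decide), e1])
    (fun v j => rfl) (fun v j => rfl) (by push_cast; exact htab) (fun v hv => H.step_nonneg hv)
  have hkK : (2 : ℕ) ^ k ≤ 2 ^ K := Nat.pow_le_pow_right (by norm_num) hk.le
  refine Sat.seq (hpick.le (T' := pickTime m L J (2 ^ K)) ?_) ?_
  · unfold pickTime
    gcongr
  intro τ₂ hfr₂ ⟨h1, h2, h3⟩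
  rw [hf₁ rBest (by decide), eB] at h1 h2
  rw [hf₁ aStep (by decide), eS] at h1
  have eP₂ : τ₂ rP 0 = 2 ^ k := by rw [hfr₂ rP (by decide), hf₁ rP (by decide), eP]
  refine Sat.set (by simp) ?_
  have q1 : ∀ z, put τ₂ rP 0 z rBest = τ₂ rBest := fun z => put_other _ _ _ (by decide)
  have q2 : ∀ z, put τ₂ rP 0 z aStep = τ₂ aStep := fun z => put_other _ _ _ (by decide)
  constructor
  · rw [put_eq]
    simp only [eval_add, eval_va, eP₂]
    ring
  · rw [q1, q2]
    rcases h1 with ⟨h1, h1'⟩ | ⟨g, g1, g2, g3, g4⟩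
    · rw [h1, h1']
      exact hinv.best
    · push_cast at g2 g3 g4
      exact ⟨2 ^ k, g, g1, g2, by rw [g3, gain_mul]; rfl, g4⟩
  · rw [q1]
    exact hinv.nonneg.trans h2
  · intro k' hk' g hg hbox
    rw [q1]
    rcases Nat.lt_succ_iff_lt_or_eq.1 hk' with h | rfl
    · exact (hinv.dom k' h g hg hbox).trans h2
    · have hcode : ∀ v ≤ m, 0 ≤ pathCode (fun v => σ aDel v) (σ rQ 0) g v := fun v hv => by
        rw [H.reg_Q]
        exact H.coding.code_nonneg hv
      obtain ⟨l1, l2, l3⟩ := htab.le_val hg (by positivity) hcode hbox m le_rfl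
      have l0 := hcode m le_rfl
      lift pathCode (fun v => σ aDel v) (σ rQ 0) g m to ℕ using l0 with j hj
      have h4 := h3 j (by omega) l2
      refine le_trans ?_ h4
      rw [mul_comm]
      push_cast
      exact mul_le_mul_of_nonneg_right l3 (by positivity)

/-- A bound on the time of an augmentation. -/
def augTime (m L J K : ℕ) : ℕ :=
  200 + m * 300 + K * (tableTime m L J + pickTime m L J (2 ^ K) + 100)

/-- The search runs over the valid vectors, which may be somewhat longer than `L` but always lie in
the kernel and include all kernel vectors of norm at most `L`. So the step is admissible and at
least as good as every short one. -/
theorem sat_augment (H : Ready σ n w m r s A B D L J K M) (hbox : InBox σ m 0) :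
    Sat augment σ (augTime m L J K) (fun τ => ∃ y : ℕ → ℤ,
      (∀ v : ℕ, v < m → τ aX v = σ aX v + y v) ∧ InBox σ m y ∧
      InKer (blockRows (fun v : Fin m => A v) (fun v : Fin m => B v) (fun v : Fin m => (v : ℕ) / w))
        (fun v : Fin m => y v) ∧ 0 ≤ gain σ m y ∧
      ∀ k < K, ∀ g : ℕ → ℤ, InKer (blockRows (fun v : Fin m => A v) (fun v : Fin m => B v)
        (fun v : Fin m => (v : ℕ) / w)) (fun v : Fin m => g v) →
        ∑ v ∈ Finset.range m, |g v| ≤ L → InBox σ m (fun v => 2 ^ k * g v) →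
        2 ^ k * gain σ m g ≤ gain σ m y) := by
  unfold augment
  refine Sat.le (T := 20 + ((9 + 20 + m * (20 + 20)) + (20 + ((9 + 20 + K * ((tableTime m L J +
    (pickTime m L J (2 ^ K) + 80)) + 20)) + (9 + 20 + m * (100 + 20))))))
    (Sat.set_seq (by simp) ?_) (by
      unfold augTime
      rw [show tableTime m L J + (pickTime m L J (2 ^ K) + 80) + 20 =
        tableTime m L J + pickTime m L J (2 ^ K) + 100 by ring]
      omega)
  rw [eval_const]
  refine Sat.seq (Q₁ := fun τ => ∀ v : ℕ, v < m → τ aStep v = 0)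
    (Sat.loop (fun k τ => ∀ v : ℕ, v < k → τ aStep v = 0) m 20 9 ?_ (by simp) (by omega) ?_) ?_
  · simp [put_apply, H.reg_items]
  · intro k τ hk _ hi
    refine Sat.assign _ _ _ _ _ _ (by simp) ?_
    intro v hv
    simp only [eval_va, eval_const, put_eq]
    by_cases hvk : v = k
    · rw [hvk, put_eq]
    · rw [put_ne_idx _ _ _ _ (by exact_mod_cast hvk), put_other _ _ _ (by decide)]
      exact hi v (by omega)
  intro τ₁ hfr₁ hstep
  refine Sat.set_seq (by simp) ?_
  rw [eval_const]
  set τ₂ := put τ₁ rP 0 1 with hτ₂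
  have hf₂ : ∀ a ∉ [rP, rBest, iV, aStep], τ₂ a = σ a := by
    intro a ha
    have ha' := ha
    simp only [List.mem_cons, List.not_mem_nil, or_false, not_or] at ha
    rw [hτ₂, put_other _ _ _ ha.1, hfr₁ a (fun hmem => ha' ((by decide : ∀ b ∈ clearStep.mods,
      b ∈ [rP, rBest, iV, aStep]) a hmem)), put_other _ _ _ ha.2.1]
  -- The zero vector is the initial best step, so the gain is never negative.
  have hval0 : Valid σ m L J 0 := by
    intro v hv
    simp [pathCode]
  refine Sat.seq (Q₁ := ScaleInv σ m L J K) (Sat.loop (ScaleInv σ m L J) K _ 9 ?_ (by simp) ?_ ?_) ?_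
  · rw [eval_va, hf₂ rK (by decide), H.reg_K]
  · refine ⟨by rw [hτ₂, put_eq]; simp, ⟨0, 0, hval0, ?_, ?_, fun v hv => ?_⟩, ?_, by omega⟩
    · simpa [InBox] using hbox
    · rw [hτ₂, put_other _ _ _ (by decide), hfr₁ rBest (by decide), put_eq]
      simp [gain]
    · rw [hτ₂, put_other _ _ _ (by decide), hstep v hv]
      simp
    · rw [hτ₂, put_other _ _ _ (by decide), hfr₁ rBest (by decide), put_eq]
  · intro k τ hk hfr hinv
    refine sat_scaleBody H (fun a ha => ?_) hinv hk
    have := (by decide : ∀ a ∈ [aDel, aMd, rL, rJ, rQ, rK, rItems, aCost, aLo, aUp, aX],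
      a ∉ iK :: scaleBody.mods ∧ a ∉ [rP, rBest, iV, aStep]) a ha
    rw [hfr a this.1, hf₂ a this.2]
  intro τ₃ hfr₃ hinv
  obtain ⟨p, g, g1, g2, g3, g4⟩ := hinv.best
  have hX₃ : τ₃ aX = σ aX := by rw [hfr₃ aX (by decide), hf₂ aX (by decide)]
  refine (Sat.loop (fun k τ => ∀ v : ℕ, v < m → τ aX v = if v < k then σ aX v + p * g v else
    σ aX v) m 100 9 ?_ (by simp) (fun v _ => by simp [hX₃]) ?_).mono le_rfl ?_
  · rw [eval_va, hfr₃ rItems (by decide), hf₂ rItems (by decide), H.reg_items]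
  · intro k τ hk hfr hi
    refine Sat.assign _ _ _ _ _ _ (by simp) ?_
    intro v hv
    simp only [eval_va, eval_add, eval_read, put_eq]
    rw [put_other τ (a := iV) (b := aX) _ _ (by decide),
      put_other τ (a := iV) (b := aStep) _ _ (by decide), hfr aStep (by decide)]
    by_cases hvk : v = k
    · subst hvk
      rw [put_eq, hi v hv, g4 v hv]
      simp
    · rw [put_ne_idx _ _ _ _ (by exact_mod_cast hvk), put_other _ _ _ (by decide), hi v hv]
      have : v < k ↔ v < k + 1 := by omega
      simp only [this]
  · intro τ _ h
    refine ⟨fun v => p * g v, fun v hv => ?_, g2, ?_, ?_, ?_⟩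
    · rw [h v hv, if_pos hv]
    · refine InKer.smul p ?_
      refine H.coding.inKer_of_validPath ?_
      have := g1
      rw [Valid, H.J_eq, H.reg_Q] at this
      exact this
    · rw [← g3]
      exact hinv.nonneg
    · intro k hk g' h1 h2 h3
      rw [← g3]
      refine hinv.dom k hk g' ?_ h3
      rw [Valid, H.J_eq, H.reg_Q]
      exact H.coding.validPath_of_inKer h1 h2

end Ready

/-! ### Convergence of repeated augmentation. -/

/-- (1 - 1/ρ)^ρ is at most 1/e, hence at most 1/2: every ρ rounds halve the gap. -/
theorem geometric_decay_lt_one {ρ E : ℕ} (hρ : 2 ≤ ρ) {G : ℝ} (h0 : 0 ≤ G) (hG : G < 2 ^ E) :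
    G * (1 - 1 / (ρ : ℝ)) ^ (ρ * E) < 1 := by
  have hρ' : (2 : ℝ) ≤ ρ := by exact_mod_cast hρ
  have h1 : (0 : ℝ) ≤ 1 - 1 / ρ := by
    rw [sub_nonneg, div_le_one (by linarith)]
    linarith
  have h2 : (1 - 1 / (ρ : ℝ)) ^ ρ ≤ 1 / 2 := by
    have h3 : 1 - 1 / (ρ : ℝ) ≤ Real.exp (-(1 / ρ)) := by
      have := Real.add_one_le_exp (-(1 / (ρ : ℝ)))
      linarith
    calc (1 - 1 / (ρ : ℝ)) ^ ρ ≤ Real.exp (-(1 / ρ)) ^ ρ := pow_le_pow_left₀ h1 h3 ρ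
      _ = Real.exp (-1) := by
        rw [← Real.exp_nat_mul]
        congr 1
        field_simp
      _ ≤ 1 / 2 := by
        rw [Real.exp_neg, one_div]
        refine inv_anti₀ (by norm_num) ?_
        have := Real.add_one_le_exp (1 : ℝ)
        linarith
  rw [pow_mul]
  calc G * ((1 - 1 / (ρ : ℝ)) ^ ρ) ^ E ≤ G * (1 / 2) ^ E := by gcongr
    _ < 2 ^ E * (1 / 2) ^ E := by gcongr
    _ = 1 := by rw [← mul_pow]; norm_num

namespace Ready

variable {σ τ : Store} {n w m r s : ℕ} {A : ℕ → Fin r → ℤ} {B : ℕ → Fin s → ℤ} {D L J K : ℕ} {M : ℤ}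

theorem gain_add (σ : Store) (m : ℕ) (y z : ℕ → ℤ) :
    gain σ m (fun v => y v + z v) = gain σ m y + gain σ m z := by
  simp only [gain, mul_add, Finset.sum_add_distrib]

theorem gain_sub (σ : Store) (m : ℕ) (y z : ℕ → ℤ) :
    gain σ m (fun v => y v - z v) = gain σ m y - gain σ m z := by
  simp only [gain, mul_sub, Finset.sum_sub_distrib]

/-- The best augmentation step makes up for a fixed fraction of the gap to any solution. -/
theorem exists_fraction {x z : ℕ → ℤ} {c lo up : ℕ → ℤ} {N : Fin r ⊕ ℕ × Fin s → Fin m → ℤ}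
    (hN : ShortKernel N L) (hK : ∀ v < m, up v - lo v < 2 ^ K)
    (hx : ∀ v < m, lo v ≤ x v ∧ x v ≤ up v) (hz : ∀ v < m, lo v ≤ z v ∧ z v ≤ up v)
    (hker : InKer N (fun v : Fin m => z v - x v))
    (hpos : 0 < ∑ v ∈ Finset.range m, c v * (z v - x v)) :
    ∃ k < K, ∃ g : ℕ → ℤ, InKer N (fun v : Fin m => g v) ∧ ∑ v ∈ Finset.range m, |g v| ≤ (L : ℤ) ∧
      (∀ v < m, lo v ≤ x v + 2 ^ k * g v ∧ x v + 2 ^ k * g v ≤ up v) ∧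
      ∑ v ∈ Finset.range m, c v * (z v - x v) ≤
        2 * (m * (L + 1)) * (2 ^ k * ∑ v ∈ Finset.range m, c v * g v) := by
  obtain ⟨k, g, g1, g2, g3, g4⟩ := hN.exists_step _ hker (fun v : Fin m => c v) (by
    rw [Fin.sum_univ_eq_sum_range (fun v => c v * (z v - x v)) m]
    exact hpos)
  set g' : ℕ → ℤ := fun v => if h : v < m then g ⟨v, h⟩ else 0 with hg'
  have hgg : ∀ v : Fin m, g v = g' v := fun v => by simp [hg']
  have s1 : ∑ v : Fin m, |g v| = ∑ v ∈ Finset.range m, |g' v| := by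
    simp only [hgg]
    exact Fin.sum_univ_eq_sum_range (fun v => |g' v|) m
  have s2 : ∑ v : Fin m, c v * g v = ∑ v ∈ Finset.range m, c v * g' v := by
    simp only [hgg]
    exact Fin.sum_univ_eq_sum_range (fun v => c v * g' v) m
  rw [s2, Fin.sum_univ_eq_sum_range (fun v => c v * (z v - x v)) m, Fintype.card_fin] at g4
  rw [s1] at g2
  have hgk : InKer N (fun v : Fin m => g' v) := by
    have : (fun v : Fin m => g' v) = g := funext fun v => (hgg v).symm
    rw [this]
    exact g1
  have hconf : ∀ v < m, (0 ≤ 2 ^ k * g' v ∧ 2 ^ k * g' v ≤ z v - x v) ∨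
      (z v - x v ≤ 2 ^ k * g' v ∧ 2 ^ k * g' v ≤ 0) := by
    intro v hv
    have := g3 ⟨v, hv⟩
    simp only [hgg] at this
    exact this
  refine ⟨k, ?_, g', hgk, g2, fun v hv => ?_, g4⟩
  -- With a nonzero entry, a step of length at least 2^K would be longer than the box is wide. So
  -- all entries would vanish, and nothing would be gained.
  · by_contra hk
    have hz0 : ∀ v < m, g' v = 0 := by
      intro v hv
      by_contra hne
      have h1 : (2 : ℤ) ^ K ≤ 2 ^ k := pow_le_pow_right₀ (by norm_num) (not_lt.1 hk)
      have h2 : (0 : ℤ) < 2 ^ k := by positivity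
      have := hK v hv
      have := hx v hv
      have := hz v hv
      rcases lt_or_gt_of_ne hne with h | h
      · have h3 : (2 : ℤ) ^ k * g' v ≤ - 2 ^ k := by nlinarith
        rcases hconf v hv with h4 | h4 <;> omega
      · have h3 : (2 : ℤ) ^ k ≤ 2 ^ k * g' v := by nlinarith
        rcases hconf v hv with h4 | h4 <;> omega
    have : ∑ v ∈ Finset.range m, c v * g' v = 0 := Finset.sum_eq_zero fun v hv => by
      rw [hz0 v (Finset.mem_range.1 hv), mul_zero]
    rw [this] at g4
    simp at g4
    omega
  · have := hx v hv
    have := hz v hv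
    rcases hconf v hv with h4 | h4 <;> omega

/-- Repeated augmentation. -/
def augmentLoop : St := .loop iZ (va rZ) augment

/-- In each round the gain is at least the fraction 1/ρ of the gap to any competitor, with ρ =
2m(L+1). The gap begins at most `G`, which is below 2^E, so after ρ·E rounds it is less than 1.
Being an integer, it is then at most 0. -/
theorem sat_augmentLoop {E : ℕ} (H : Ready σ n w m r s A B D L J K M) (hbox : InBox σ m 0)
    (hN : ShortKernel (blockRows (fun v : Fin m => A v) (fun v : Fin m => B v)
      (fun v : Fin m => (v : ℕ) / w)) L)
    (hK : ∀ v : ℕ, v < m → σ aUp v - σ aLo v < 2 ^ K)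
    (hE : ∑ v ∈ Finset.range m, |σ aCost v| * (σ aUp v - σ aLo v) < 2 ^ E)
    (hZ : σ rZ 0 = (2 * (m * (L + 1)) * E : ℕ)) :
    Sat augmentLoop σ (30 + 2 * (m * (L + 1)) * E * (augTime m L J K + 20)) (fun τ =>
      InBox τ m 0 ∧
      InKer (blockRows (fun v : Fin m => A v) (fun v : Fin m => B v)
        (fun v : Fin m => (v : ℕ) / w)) (fun v : Fin m => τ aX v - σ aX v) ∧
      ∀ z : ℕ → ℤ, (∀ v : ℕ, v < m → σ aLo v ≤ z v ∧ z v ≤ σ aUp v) →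
        InKer (blockRows (fun v : Fin m => A v) (fun v : Fin m => B v)
          (fun v : Fin m => (v : ℕ) / w)) (fun v : Fin m => z v - σ aX v) →
        gain σ m z ≤ gain σ m (fun v => τ aX v)) := by
  set N := blockRows (fun v : Fin m => A v) (fun v : Fin m => B v)
    (fun v : Fin m => (v : ℕ) / w) with hNdef
  set ρ := 2 * (m * (L + 1)) with hρ
  set G := ∑ v ∈ Finset.range m, |σ aCost v| * (σ aUp v - σ aLo v) with hG
  have hm : 0 < m := by have := H.coding.blocks_lt; omega
  have hρ2 : 2 ≤ ρ := by
    have : 0 < m * (L + 1) := by positivity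
    omega
  have hρ0 : (0 : ℝ) < ρ := by
    have : 0 < ρ := by omega
    exact_mod_cast this
  have hb : ∀ v : ℕ, v < m → σ aLo v ≤ σ aX v ∧ σ aX v ≤ σ aUp v := fun v hv => by
    simpa using hbox v hv
  have hG0 : 0 ≤ G := Finset.sum_nonneg fun v hv => by
    have := hb v (Finset.mem_range.1 hv)
    exact mul_nonneg (abs_nonneg _) (by omega)
  unfold augmentLoop
  refine (Sat.loop (fun i τ => (∀ v : ℕ, v < m → σ aLo v ≤ τ aX v ∧ τ aX v ≤ σ aUp v) ∧
      InKer N (fun v : Fin m => τ aX v - σ aX v) ∧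
      ∀ z : ℕ → ℤ, (∀ v : ℕ, v < m → σ aLo v ≤ z v ∧ z v ≤ σ aUp v) →
        InKer N (fun v : Fin m => z v - σ aX v) →
        ((gain σ m z - gain σ m (fun v => τ aX v) : ℤ) : ℝ) ≤ G * (1 - 1 / (ρ : ℝ)) ^ i)
    (ρ * E) (augTime m L J K) 9 ?_ (by simp) ?_ ?_).mono (by omega) ?_
  · rw [eval_va, hZ]
  · refine ⟨hb, fun a => by simp, fun z hz _ => ?_⟩
    rw [pow_zero, mul_one, ← gain_sub]
    have : gain σ m (fun v => z v - σ aX v) ≤ G := Finset.sum_le_sum fun v hv => by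
      have h1 := hb v (Finset.mem_range.1 hv)
      have h2 := hz v (Finset.mem_range.1 hv)
      refine (le_abs_self _).trans ?_
      rw [abs_mul]
      simp only
      refine mul_le_mul_of_nonneg_left (abs_le.2 ⟨by omega, by omega⟩) (abs_nonneg _)
    exact_mod_cast this
  · intro i τ hi hfr ⟨i1, i2, i3⟩
    set τ₀ := put τ iZ 0 i with hτ₀
    have hf : ∀ a, a ∉ iZ :: augment.mods → τ₀ a = σ a := fun a ha => by
      rw [hτ₀, put_other _ _ _ (fun h => ha (by rw [h]; exact List.mem_cons_self)), hfr a ha]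
    have e1 : τ₀ aX = τ aX := put_other _ _ _ (by decide)
    have e2 : τ₀ aLo = σ aLo := hf aLo (by decide)
    have e3 : τ₀ aUp = σ aUp := hf aUp (by decide)
    have e4 : τ₀ aCost = σ aCost := hf aCost (by decide)
    have egain : ∀ y, gain τ₀ m y = gain σ m y := fun y => by rw [gain, gain, e4]
    have ebox : ∀ y, InBox τ₀ m y ↔ ∀ v : ℕ, v < m → σ aLo v ≤ τ aX v + y v ∧
        τ aX v + y v ≤ σ aUp v := fun y => by rw [InBox, e1, e2, e3]
    have H₀ : Ready τ₀ n w m r s A B D L J K M := H.congr fun a ha => hf a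
      ((by decide : ∀ a ∈ [aDel, aMd, rL, rJ, rQ, rK, rItems], a ∉ iZ :: augment.mods) a ha)
    refine (sat_augment H₀ ((ebox 0).2 (by simpa using i1))).mono le_rfl ?_
    rintro τ' - ⟨y, y1, y2, y3, y4, y5⟩
    rw [e1] at y1
    rw [ebox] at y2
    simp only [egain, ebox] at y4 y5
    have hg' : gain σ m (fun v => τ' aX v) = gain σ m (fun v => τ aX v) + gain σ m y := by
      rw [← gain_add]
      refine Finset.sum_congr rfl fun v hv => ?_
      simp only
      rw [y1 v (Finset.mem_range.1 hv)]
    refine ⟨fun v hv => by rw [y1 v hv]; exact y2 v hv, ?_, fun z hz hzk => ?_⟩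
    · have : (fun v : Fin m => τ' aX v - σ aX v) =
          fun v : Fin m => (τ aX v - σ aX v) + y v := funext fun v => by
        rw [y1 v v.2]
        ring
      rw [this]
      exact i2.add y3
    · have hgap := i3 z hz hzk
      set gap : ℤ := gain σ m z - gain σ m (fun v => τ aX v) with hgapdef
      have hgap' : gain σ m z - gain σ m (fun v => τ' aX v) = gap - gain σ m y := by
        rw [hg', hgapdef]
        ring
      rw [hgap']
      have h1 : (0 : ℝ) ≤ 1 - 1 / ρ := by
        rw [sub_nonneg, div_le_one hρ0]
        exact_mod_cast (by omega : 1 ≤ ρ)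
      by_cases hpos : 0 < gap
      · obtain ⟨k, hk, g, g1, g2, g3, g4⟩ := exists_fraction (K := K) (x := fun v => τ aX v) (z := z)
          (c := fun v => σ aCost v) (lo := fun v => σ aLo v) (up := fun v => σ aUp v) hN hK i1 hz
          (by
            have : (fun v : Fin m => z v - τ aX v) =
              fun v : Fin m => (z v - σ aX v) - (τ aX v - σ aX v) := funext fun v => by ring
            rw [this]
            exact hzk.sub i2) (by
            rw [hgapdef, ← gain_sub] at hpos
            exact hpos)
        have g5 := y5 k hk g g1 g2 g3
        have g6 : gap ≤ ρ * gain σ m y := by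
          rw [hgapdef, ← gain_sub]
          refine g4.trans ?_
          rw [hρ]
          push_cast
          exact mul_le_mul_of_nonneg_left g5 (by positivity)
        have g7 : (gap : ℝ) ≤ ρ * gain σ m y := by exact_mod_cast g6
        have g8 : (gap : ℝ) / ρ ≤ gain σ m y := by
          rw [div_le_iff₀ hρ0]
          linarith
        calc ((gap - gain σ m y : ℤ) : ℝ) ≤ gap - gap / ρ := by push_cast; linarith
          _ = gap * (1 - 1 / ρ) := by ring
          _ ≤ (G * (1 - 1 / (ρ : ℝ)) ^ i) * (1 - 1 / ρ) := by gcongr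
          _ = _ := by ring
      -- A competitor that has already been reached stays behind, since the gain of a round is
      -- nonnegative.
      · have : ((gap - gain σ m y : ℤ) : ℝ) ≤ 0 := by
          have : gap - gain σ m y ≤ 0 := by omega
          exact_mod_cast this
        refine this.trans ?_
        have : (0 : ℝ) ≤ G := by exact_mod_cast hG0
        positivity
  · intro τ hfr ⟨i1, i2, i3⟩
    refine ⟨?_, i2, fun z hz hzk => ?_⟩
    · intro v hv
      rw [hfr aLo (by decide), hfr aUp (by decide)]
      simpa using i1 v hv
    · have h1 := i3 z hz hzk
      have h2 := geometric_decay_lt_one (E := E) hρ2 (G := G) (by exact_mod_cast hG0)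
        (by exact_mod_cast hE)
      have h3 : ((gain σ m z - gain σ m (fun v => τ aX v) : ℤ) : ℝ) < 1 := h1.trans_lt h2
      have h4 : gain σ m z - gain σ m (fun v => τ aX v) < 1 := by exact_mod_cast h3
      omega

end Ready

/-! ## The parameters of an instance on the machine -/

notation "xI" => (74 : ℕ)
notation "xC" => (75 : ℕ)
notation "xPos" => (76 : ℕ)
notation "xAcc" => (77 : ℕ)

theorem Sat.loop_sum {a i : ℕ} {e f : XE} {σ : Store} (N T T₀ : ℕ) (b : ℕ → ℤ) (hai : a ≠ i)
    (hN : e.eval σ = N) (hT₀ : e.cost σ ≤ T₀)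
    (hf : ∀ k τ, k < N → (∀ x, x ≠ i → x ≠ a → τ x = σ x) →
      f.eval (put τ i 0 k) = b k ∧ f.cost (put τ i 0 k) ≤ T) :
    Sat (.loop i e (.set a (va a + f))) σ (T₀ + 20 + N * (T + 60 + 20))
      (fun τ => τ a 0 = σ a 0 + ∑ k ∈ Finset.range N, b k) := by
  refine Sat.loop (fun j τ => τ a 0 = σ a 0 + ∑ k ∈ Finset.range j, b k) N _ T₀ hN hT₀ (by simp) ?_
  intro k τ hk hfr hinv
  obtain ⟨h1, h2⟩ := hf k τ hk (fun x hx hx' => hfr x (by simp [St.mods, St.set, hx, hx']))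
  refine Sat.set ?_ ?_
  · simp only [cost_add, cost_va]
    omega
  · rw [put_eq, eval_add, eval_va, h1, put_other _ _ _ hai, hinv, Finset.sum_range_succ]
    ring

theorem Sat.loop_mul {a i : ℕ} {e f : XE} {σ : Store} (N T T₀ : ℕ) (b : ℕ) (hai : a ≠ i)
    (hN : e.eval σ = N) (hT₀ : e.cost σ ≤ T₀)
    (hf : ∀ k τ, k < N → (∀ x, x ≠ i → x ≠ a → τ x = σ x) →
      f.eval (put τ i 0 k) = b ∧ f.cost (put τ i 0 k) ≤ T) :
    Sat (.loop i e (.set a (va a * f))) σ (T₀ + 20 + N * (T + 60 + 20 * b + 20))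
      (fun τ => τ a 0 = σ a 0 * b ^ N) := by
  refine Sat.loop (fun j τ => τ a 0 = σ a 0 * b ^ j) N _ T₀ hN hT₀ (by simp) ?_
  intro k τ hk hfr hinv
  obtain ⟨h1, h2⟩ := hf k τ hk (fun x hx hx' => hfr x (by simp [St.mods, St.set, hx, hx']))
  refine Sat.set ?_ ?_
  · simp only [cost_mul, cost_va, h1]
    simp only [Int.natAbs_natCast]
    omega
  · rw [put_eq, eval_mul, eval_va, h1, put_other _ _ _ hai, hinv, pow_succ]
    ring

theorem Sat.loop_max {arr : ℕ} {e : XE} {σ : Store} (N T₀ : ℕ) (harr : arr ≠ iV) (harr' : arr ≠ rD)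
    (hN : e.eval σ = N) (hT₀ : e.cost σ ≤ T₀) :
    Sat (.loop iV e (.set rD (.bin .max (va rD) (XE.read arr (va iV)).abs))) σ
      (T₀ + 20 + N * (180 + 20))
      (fun τ => σ rD 0 ≤ τ rD 0 ∧ (∀ k : ℕ, k < N → |σ arr k| ≤ τ rD 0) ∧
        ∀ Δ : ℤ, σ rD 0 ≤ Δ → (∀ k : ℕ, k < N → |σ arr k| ≤ Δ) → τ rD 0 ≤ Δ) := by
  refine Sat.loop (fun j τ => σ rD 0 ≤ τ rD 0 ∧ (∀ k : ℕ, k < j → |σ arr k| ≤ τ rD 0) ∧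
        ∀ Δ : ℤ, σ rD 0 ≤ Δ → (∀ k : ℕ, k < N → |σ arr k| ≤ Δ) → τ rD 0 ≤ Δ) N _ T₀ hN hT₀
    ⟨le_rfl, by omega, fun Δ h _ => h⟩ ?_
  intro k τ hk hfr ⟨h1, h2, h3⟩
  have h4 : τ arr = σ arr := hfr arr (by simp [St.mods, St.set, harr, harr'])
  refine Sat.set (by simp) ?_
  have e1 : (XE.bin .max (va rD) (XE.read arr (va iV)).abs).eval (put τ iV 0 k) =
      max (τ rD 0) |σ arr k| := by
    rw [eval_max, eval_abs, eval_va, eval_read, eval_va, put_eq, put_other _ _ _ harr, h4,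
      put_other _ _ _ (by decide)]
  rw [e1, put_eq]
  refine ⟨h1.trans (le_max_left _ _), fun j hj => ?_, fun Δ hΔ hall => max_le (h3 Δ hΔ hall)
    (hall k hk)⟩
  rcases Nat.lt_succ_iff_lt_or_eq.1 hj with h | rfl
  · exact (h2 j h).trans (le_max_left _ _)
  · exact le_max_right _ _

/-- The number `n` of bricks. -/
def dimN : XE := .read arrDim (.const 0)
/-- The number `r` of rows of the top part. -/
def dimR : XE := .read arrDim (.const 1)
/-- The number `s` of rows of a diagonal block. -/
def dimS : XE := .read arrDim (.const 2)
/-- The number `t` of columns of a brick. -/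
def dimT : XE := .read arrDim (.const 3)

@[simp] theorem cost_dimN (σ : Store) : dimN.cost σ = 9 := rfl
@[simp] theorem cost_dimR (σ : Store) : dimR.cost σ = 9 := rfl
@[simp] theorem cost_dimS (σ : Store) : dimS.cost σ = 9 := rfl
@[simp] theorem cost_dimT (σ : Store) : dimT.cost σ = 9 := rfl

/-- The store contains the dimensions of the instance. -/
structure Dims (σ : Store) (n r s t : ℕ) : Prop where
  dimN : dimN.eval σ = n
  dimR : dimR.eval σ = r
  dimS : dimS.eval σ = s
  dimT : dimT.eval σ = t

theorem Dims.congr {σ τ : Store} {n r s t : ℕ} (h : Dims σ n r s t) (hτ : τ arrDim = σ arrDim) :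
    Dims τ n r s t := by
  obtain ⟨h1, h2, h3, h4⟩ := h
  unfold _root_.dimN at h1
  unfold _root_.dimR at h2
  unfold _root_.dimS at h3
  unfold _root_.dimT at h4
  simp only [eval_read, eval_const] at h1 h2 h3 h4
  constructor
  · unfold _root_.dimN
    rw [eval_read, eval_const, hτ, h1]
  · unfold _root_.dimR
    rw [eval_read, eval_const, hτ, h2]
  · unfold _root_.dimS
    rw [eval_read, eval_const, hτ, h3]
  · unfold _root_.dimT
    rw [eval_read, eval_const, hτ, h4]

theorem Dims.put {σ : Store} {n r s t : ℕ} (h : Dims σ n r s t) {a : ℕ} (i z : ℤ)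
    (ha : arrDim ≠ a) : Dims (put σ a i z) n r s t :=
  h.congr (put_other _ _ _ ha)

/-- Compute a bound on the entries of the matrix. -/
def maxEntry : St :=
  .seq (.set rD (.const 1))
  (.seq (.loop iV (dimN * dimT * dimR) (.set rD (.bin .max (va rD) (XE.read arrA (va iV)).abs)))
    (.loop iV (dimN * dimT * dimS) (.set rD (.bin .max (va rD) (XE.read arrB (va iV)).abs))))

/-- `D` is the maximum of `1` and the absolute values of the entries in the store. -/
structure MaxEntry (σ : Store) (n r s t D : ℕ) : Prop where
  one_le : 1 ≤ D
  entryA : ∀ k : ℕ, k < n * t * r → |σ arrA k| ≤ D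
  entryB : ∀ k : ℕ, k < n * t * s → |σ arrB k| ≤ D
  le_of_bound : ∀ Δ : ℕ, 1 ≤ Δ → (∀ k : ℕ, k < n * t * r → |σ arrA k| ≤ Δ) →
    (∀ k : ℕ, k < n * t * s → |σ arrB k| ≤ Δ) → D ≤ Δ

/-- `Δ` is not part of the input on the machine, so the program measures the true maximum `D`. Its
minimality allows the running time to be stated with any valid `Δ`. -/
theorem sat_maxEntry {σ : Store} {n r s t : ℕ} (hd : Dims σ n r s t) :
    Sat maxEntry σ (400 + 20 * (t + r) + 20 * (t + s) + (n * t * r + n * t * s) * 200)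
      (fun τ => ∃ D : ℕ, τ rD 0 = D ∧ MaxEntry σ n r s t D) := by
  unfold maxEntry
  refine Sat.le (T := 20 + ((150 + 20 * (t + r) + 20 + n * t * r * (180 + 20)) +
    (150 + 20 * (t + s) + 20 + n * t * s * (180 + 20)))) (Sat.set_seq (by simp) ?_) (by
      rw [add_mul]; omega)
  rw [eval_const]
  have hd₁ := hd.put (a := rD) 0 1 (by decide)
  refine Sat.seq (Sat.loop_max (n * t * r) _ (by decide) (by decide) ?_ ?_) ?_
  · rw [eval_mul, eval_mul, hd₁.dimN, hd₁.dimR, hd₁.dimT]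
    push_cast
    rfl
  · simp [hd₁.dimR, hd₁.dimT]
    omega
  intro τ hfr ⟨h1, h2, h3⟩
  have eA : put σ rD 0 1 arrA = σ arrA := put_other _ _ _ (by decide)
  have eB : τ arrB = σ arrB := by rw [hfr arrB (by decide), put_other _ _ _ (by decide)]
  have hd₂ := hd₁.congr (hfr arrDim (by decide))
  refine (Sat.loop_max (n * t * s) _ (by decide) (by decide) ?_ ?_).mono le_rfl ?_
  · rw [eval_mul, eval_mul, hd₂.dimN, hd₂.dimS, hd₂.dimT]
    push_cast
    rfl
  · simp [hd₂.dimS, hd₂.dimT]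
    omega
  intro τ' _ ⟨k1, k2, k3⟩
  rw [eB] at k2 k3
  rw [eA] at h2 h3
  rw [put_eq] at h1 h3
  have h0 : 0 ≤ τ' rD 0 := by omega
  refine ⟨(τ' rD 0).toNat, by omega, ?_⟩
  have hc : ((τ' rD 0).toNat : ℤ) = τ' rD 0 := by omega
  constructor
  · omega
  · intro k hk
    rw [hc]
    exact (h2 k hk).trans k1
  · intro k hk
    rw [hc]
    exact k2 k hk
  · intro Δ hΔ hA hB
    have := k3 Δ (h3 Δ (by exact_mod_cast hΔ) hA) hB
    omega

/-- Compute the bound on short kernel elements. -/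
def shortBoundProg : St :=
  .seq (.set rLB (.const 1))
  (.seq (.loop iV dimS (.set rLB (va rLB * (.const 2 * dimS * va rD + .const 1))))
  (.seq (.set rL (va rLB))
    (.loop iV dimR (.set rL (va rL * (.const 2 * dimR * (va rD * va rLB) + .const 1))))))

/-- The bound on short zero-sum subsets. -/
def blockBound (s D : ℕ) : ℕ := (2 * s * D + 1) ^ s

/-- Powers are computed by repeated multiplication, in time polynomial in the numbers themselves
rather than in their length. This is affordable, as they depend only on `r`, `s` and `D`. -/
theorem sat_shortBoundProg {σ : Store} {n r s t D : ℕ} (hd : Dims σ n r s t) (hD : σ rD 0 = D) :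
    Sat shortBoundProg σ (300 + s * (400 + 40 * s + 20 * D + 20 * (2 * s * D + 1)) +
      r * (400 + 40 * r + 20 * blockBound s D + 20 * (D * blockBound s D) +
        20 * (2 * r * (D * blockBound s D) + 1)))
      (fun τ => τ rL 0 = shortBound r s D) := by
  unfold shortBoundProg
  refine Sat.le (T := 20 + ((9 + 20 + s * ((240 + 20 * s + 20 * D) + 60 + 20 * (2 * s * D + 1) + 20)) +
    (20 + (9 + 20 + r * ((280 + 20 * r + 20 * blockBound s D + 20 * (D * blockBound s D)) + 60 +
      20 * (2 * r * (D * blockBound s D) + 1) + 20))))) (Sat.set_seq (by simp) ?_) (by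
      have h1 : s * ((240 + 20 * s + 20 * D) + 60 + 20 * (2 * s * D + 1) + 20) ≤
        s * (400 + 40 * s + 20 * D + 20 * (2 * s * D + 1)) := Nat.mul_le_mul_left _ (by omega)
      have h2 : r * ((280 + 20 * r + 20 * blockBound s D + 20 * (D * blockBound s D)) + 60 +
          20 * (2 * r * (D * blockBound s D) + 1) + 20) ≤ r * (400 + 40 * r + 20 * blockBound s D +
          20 * (D * blockBound s D) + 20 * (2 * r * (D * blockBound s D) + 1)) :=
        Nat.mul_le_mul_left _ (by omega)
      omega)
  rw [eval_const]
  have hd₁ := hd.put (a := rLB) 0 1 (by decide)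
  refine Sat.seq (Sat.loop_mul s _ 9 (2 * s * D + 1) (by decide) hd₁.dimS (by simp) ?_) ?_
  · intro k τ hk hfr
    have hd₂ := (hd₁.congr (hfr arrDim (by decide) (by decide))).put (a := iV) 0 k (by decide)
    have h1 : put τ iV 0 k rD 0 = D := by
      rw [put_other _ _ _ (by decide), hfr rD (by decide) (by decide), put_other _ _ _ (by decide),
        hD]
    constructor
    · simp [hd₂.dimS, h1]
    · simp [hd₂.dimS, h1]
      omega
  intro τ hfr h1
  rw [put_eq, one_mul] at h1
  have hLB : τ rLB 0 = blockBound s D := by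
    rw [h1, blockBound]
    push_cast
    rfl
  refine Sat.set_seq (by simp) ?_
  rw [eval_va, hLB]
  have hd₂ := (hd₁.congr (hfr arrDim (by decide))).put (a := rL) 0 (blockBound s D) (by decide)
  refine (Sat.loop_mul r _ 9 (2 * r * (D * blockBound s D) + 1) (by decide) hd₂.dimR (by simp)
    ?_).mono le_rfl ?_
  · intro k τ₁ hk hfr₁
    have hd₃ := (hd₂.congr (hfr₁ arrDim (by decide) (by decide))).put (a := iV) 0 k (by decide)
    have h1 : put τ₁ iV 0 k rD 0 = D := by
      rw [put_other _ _ _ (by decide), hfr₁ rD (by decide) (by decide), put_other _ _ _ (by decide),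
        hfr rD (by decide), put_other _ _ _ (by decide), hD]
    have h2 : put τ₁ iV 0 k rLB 0 = blockBound s D := by
      rw [put_other _ _ _ (by decide), hfr₁ rLB (by decide) (by decide), put_other _ _ _ (by decide),
        hLB]
    constructor
    · simp [hd₃.dimR, h1, h2]
    · simp [hd₃.dimR, h1, h2, Int.natAbs_mul]
      omega
  · intro τ' _ h
    rw [h, put_eq, shortBound, blockBound]
    push_cast
    rfl

/-- The base of the codes. -/
def codeBase (r s D : ℕ) : ℕ := 8 * D * shortBound r s D + 1

/-- The bound on the codes. -/
def codeBound (r s D : ℕ) : ℕ := 2 * shortBound r s D * codeBase r s D ^ (s + r)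

/-- The number of variables together with slack variables. -/
def itemCount (n r s t : ℕ) : ℕ := n * (t + s) + r

/-- The distance to the solution of the LP relaxation within which solutions are searched. -/
def radius (n r s t D : ℕ) : ℕ := itemCount n r s t * shortBound r s D + 1

/-- Compute the powers of the base of the codes. -/
def powProg : St :=
  .seq (.set rM (.const 8 * va rD * va rL + .const 1))
  (.seq (.assign aPow (.const 0) (.const 1))
    (.loop iV (dimS + dimR) (.assign aPow (va iV + .const 1) (.read aPow (va iV) * va rM))))

/-- Compute the penalty for slack variables. -/
def penaltyProg : St :=
  .seq (.set rCsum (.const 0))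
  (.seq (.loop iV (dimN * dimT) (.set rCsum (va rCsum + (XE.read arrObj (va iV)).abs)))
    (.set rBM (va rCsum * (va rW + va rW) + .const 1)))

/-- Compute the sizes of the tables. -/
def sizesProg : St :=
  .seq (.set rQ (.read aPow (dimS + dimR)))
  (.seq (.set rJ (va rQ * (.const 2 * va rL)))
  (.seq (.set rItems (dimN * (dimT + dimS) + dimR))
  (.seq (.set rW (va rItems * va rL + .const 1))
    (.set rK (.size (va rW + va rW))))))

/-- Compute all parameters. -/
def paramProg : St :=
  .seq maxEntry (.seq shortBoundProg (.seq powProg (.seq sizesProg penaltyProg)))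

/-- The store contains the parameters of the instance. -/
structure Params (σ : Store) (n r s t D : ℕ) : Prop where
  dims : Dims σ n r s t
  entries : MaxEntry σ n r s t D
  reg_L : σ rL 0 = shortBound r s D
  pow : ∀ j : ℕ, j ≤ s + r → σ aPow j = (codeBase r s D : ℤ) ^ j
  reg_Q : σ rQ 0 = (codeBase r s D : ℤ) ^ (s + r)
  reg_J : σ rJ 0 = codeBound r s D
  reg_items : σ rItems 0 = itemCount n r s t
  reg_W : σ rW 0 = radius n r s t D
  reg_K : σ rK 0 = Nat.size (2 * radius n r s t D)
  reg_BM : σ rBM 0 = (∑ k ∈ Finset.range (n * t), |σ arrObj k|) * (2 * radius n r s t D) + 1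

theorem sat_powProg {σ : Store} {n r s t D : ℕ} (hd : Dims σ n r s t) (hD : σ rD 0 = D)
    (hL : σ rL 0 = shortBound r s D) :
    Sat powProg σ (400 + 20 * D + 20 * shortBound r s D + (s + r) * (200 + 20 * codeBase r s D))
      (fun τ => ∀ j : ℕ, j ≤ s + r → τ aPow j = (codeBase r s D : ℤ) ^ j) := by
  unfold powProg
  refine Sat.le (T := (200 + 20 * D + 20 * shortBound r s D) + (20 + (61 + 20 +
    (s + r) * ((160 + 20 * codeBase r s D) + 20)))) (Sat.set_seq ?_ ?_) (by
      have : (s + r) * ((160 + 20 * codeBase r s D) + 20) ≤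
        (s + r) * (200 + 20 * codeBase r s D) := Nat.mul_le_mul_left _ (by omega)
      omega)
  · simp [hD, hL]
    omega
  have e1 : (.const 8 * va rD * va rL + .const 1 : XE).eval σ = codeBase r s D := by
    simp [hD, hL, codeBase]
  rw [e1]
  refine Sat.assign_seq (by simp) ?_
  rw [eval_const, eval_const]
  set τ₀ := put (put σ rM 0 (codeBase r s D)) aPow 0 1 with hτ₀
  have hd₀ : Dims τ₀ n r s t := (hd.put _ _ (by decide)).put _ _ (by decide)
  refine (Sat.loop (fun k τ => ∀ j : ℕ, j ≤ k → τ aPow j = (codeBase r s D : ℤ) ^ j) (s + r)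
    _ _ ?_ (by simp) ?_ ?_)
  · simp [hd₀.dimS, hd₀.dimR]
  · intro j hj
    obtain rfl : j = 0 := by omega
    simp [hτ₀, put_apply]
  · intro k τ hk hfr hinv
    have hM : put τ iV 0 k rM 0 = codeBase r s D := by
      rw [put_other _ _ _ (by decide), hfr rM (by decide), hτ₀, put_other _ _ _ (by decide), put_eq]
    refine Sat.assign _ _ _ _ _ _ ?_ ?_
    · simp [hM]
      omega
    · have e2 : (va iV + .const 1 : XE).eval (put τ iV 0 k) = ((k + 1 : ℕ) : ℤ) := by
        simp [put_eq]
      have e3 : (.read aPow (va iV) * va rM : XE).eval (put τ iV 0 k) =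
          (codeBase r s D : ℤ) ^ (k + 1) := by
        rw [eval_mul, eval_read, eval_va, eval_va, hM, put_eq, put_other _ _ _ (by decide),
          hinv k le_rfl, pow_succ]
      intro j hj
      rw [e2, e3]
      by_cases hjk : j = k + 1
      · rw [hjk, put_eq]
      · rw [put_ne_idx _ _ _ _ (by exact_mod_cast hjk), put_other _ _ _ (by decide),
          hinv j (by omega)]

theorem size_le_self (n : ℕ) : Nat.size n ≤ n := Nat.size_le.2 Nat.lt_two_pow_self

/-- `rK` is the binary length of twice the radius, the largest width that the box can have, so the
step lengths 2^k with k below it suffice. -/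
theorem sat_sizesProg {σ : Store} {n r s t D : ℕ} (hd : Dims σ n r s t)
    (hL : σ rL 0 = shortBound r s D)
    (hpow : ∀ j : ℕ, j ≤ s + r → σ aPow j = (codeBase r s D : ℤ) ^ j) :
    Sat sizesProg σ (1000 + 100 * shortBound r s D + 20 * (t + s) + 80 * radius n r s t D)
      (fun τ => τ rQ 0 = (codeBase r s D : ℤ) ^ (s + r) ∧ τ rJ 0 = codeBound r s D ∧
        τ rItems 0 = itemCount n r s t ∧ τ rW 0 = radius n r s t D ∧
        τ rK 0 = Nat.size (2 * radius n r s t D)) := by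
  unfold sizesProg
  refine Sat.le (T := 100 + ((200 + 60 * shortBound r s D) + ((200 + 20 * (t + s)) +
    ((200 + 20 * shortBound r s D) + (200 + 80 * radius n r s t D)))))
    (Sat.set_seq (by simp) ?_) (by omega)
  have e1 : (XE.read aPow (dimS + dimR)).eval σ = (codeBase r s D : ℤ) ^ (s + r) := by
    rw [eval_read, eval_add, hd.dimS, hd.dimR]
    exact_mod_cast hpow (s + r) le_rfl
  rw [e1]
  have hd₁ := hd.put (a := rQ) 0 ((codeBase r s D : ℤ) ^ (s + r)) (by decide)
  refine Sat.set_seq ?_ ?_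
  · simp [put_apply, hL]
    omega
  have e2 : (va rQ * (.const 2 * va rL)).eval (put σ rQ 0 ((codeBase r s D : ℤ) ^ (s + r))) =
      codeBound r s D := by
    simp only [eval_mul, eval_va, eval_const, put_eq]
    rw [put_other _ _ _ (by decide), hL, codeBound]
    push_cast
    ring
  rw [e2]
  have hd₂ := hd₁.put (a := rJ) 0 (codeBound r s D) (by decide)
  refine Sat.set_seq ?_ ?_
  · simp [hd₂.dimT, hd₂.dimS]
    omega
  have e3 : ∀ τ, Dims τ n r s t → (dimN * (dimT + dimS) + dimR : XE).eval τ = itemCount n r s t := by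
    intro τ hτ
    simp [hτ.dimN, hτ.dimT, hτ.dimS, hτ.dimR, itemCount]
  rw [e3 _ hd₂]
  refine Sat.set_seq ?_ (Sat.set ?_ ?_)
  · simp [put_apply, hL]
    omega
  · have h1 := size_le_self (radius n r s t D + radius n r s t D)
    have h2 : (va rW + va rW).eval (put (put (put (put σ rQ 0 ((codeBase r s D : ℤ) ^ (s + r))) rJ 0
        (codeBound r s D)) rItems 0 (itemCount n r s t)) rW 0
        ((va rItems * va rL + .const 1 : XE).eval (put (put (put σ rQ 0
          ((codeBase r s D : ℤ) ^ (s + r))) rJ 0 (codeBound r s D)) rItems 0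
          (itemCount n r s t)))) = ((radius n r s t D + radius n r s t D : ℕ) : ℤ) := by
      simp [put_apply, hL, radius]
    rw [cost_size, h2, Int.toNat_natCast]
    simp
    omega
  · refine ⟨?_, ?_, ?_, ?_, ?_⟩
    · simp [put_apply]
    · simp [put_apply]
    · simp [put_apply]
    · simp [put_apply, hL, radius]
    · rw [put_eq, eval_size]
      have h2 : ((itemCount n r s t : ℤ) * shortBound r s D + 1 + (itemCount n r s t *
          shortBound r s D + 1)) = ((2 * radius n r s t D : ℕ) : ℤ) := by
        rw [radius]
        push_cast
        ring
      simp only [eval_add, eval_va, put_eq, eval_mul, eval_const, put_apply]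
      simp only [Nat.reduceEqDiff, if_false, if_true, hL]
      rw [h2, Int.toNat_natCast]

/-- Two points of the box differ by at most Σ|c|·2W in the objective; the penalty exceeds this by
one. -/
theorem sat_penaltyProg {σ : Store} {n r s t D : ℕ} (hd : Dims σ n r s t)
    (hW : σ rW 0 = radius n r s t D) :
    Sat penaltyProg σ (500 + 20 * t + n * t * 250 + 40 * radius n r s t D)
      (fun τ => τ rBM 0 =
        (∑ k ∈ Finset.range (n * t), |σ arrObj k|) * (2 * radius n r s t D) + 1) := by
  unfold penaltyProg
  refine Sat.le (T := 20 + ((100 + 20 * t + 20 + n * t * (150 + 60 + 20)) +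
    (300 + 40 * radius n r s t D))) (Sat.set_seq (by simp) ?_) (by omega)
  rw [eval_const]
  have hd₁ := hd.put (a := rCsum) 0 0 (by decide)
  refine Sat.seq (Sat.loop_sum (n * t) _ _ (fun k => |σ arrObj k|) (by decide) ?_ ?_ ?_) ?_
  · simp [hd₁.dimN, hd₁.dimT]
  · simp [hd₁.dimT]
    omega
  · intro k τ hk hfr
    have h1 : put τ iV 0 k arrObj = σ arrObj := by
      rw [put_other _ _ _ (by decide), hfr _ (by decide) (by decide), put_other _ _ _ (by decide)]
    constructor
    · rw [eval_abs, eval_read, eval_va, put_eq, h1]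
    · simp
  intro τ hfr h
  rw [put_eq, zero_add] at h
  have hW' : τ rW 0 = radius n r s t D := by
    rw [hfr rW (by decide), put_other _ _ _ (by decide), hW]
  refine Sat.set ?_ ?_
  · simp [hW']
    omega
  · rw [put_eq]
    simp only [eval_add, eval_mul, eval_va, eval_const, hW', h]
    ring

/-- A bound on the time for the parameters. -/
def paramTime (n r s t D : ℕ) : ℕ :=
  3000 + 200 * (t + r + s + D) + (n * t * r + n * t * s + n * t) * 250 +
    s * (400 + 40 * s + 20 * D + 20 * (2 * s * D + 1)) +
      r * (400 + 40 * r + 20 * blockBound s D + 20 * (D * blockBound s D) +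
        20 * (2 * r * (D * blockBound s D) + 1)) +
    120 * shortBound r s D + (s + r) * (200 + 20 * codeBase r s D) + 120 * radius n r s t D

/-- The number `D` is known only after `maxEntry` has run, so the time bound is assumed for every
`D` that can come out. -/
theorem sat_paramProg {σ : Store} {n r s t : ℕ} (hd : Dims σ n r s t) (T : ℕ)
    (hT : ∀ D, MaxEntry σ n r s t D → paramTime n r s t D ≤ T) :
    Sat paramProg σ T (fun τ => ∃ D : ℕ, Params τ n r s t D) := by
  unfold paramProg
  obtain ⟨⟨D, h1, h2⟩, h3⟩ := sat_maxEntry hd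
  suffices Sat (.seq maxEntry (.seq shortBoundProg (.seq powProg (.seq sizesProg penaltyProg)))) σ
      (paramTime n r s t D) (fun τ => ∃ D : ℕ, Params τ n r s t D) from
    this.le (hT D h2)
  have h0 : Sat maxEntry σ (400 + 20 * (t + r) + 20 * (t + s) + (n * t * r + n * t * s) * 200)
      (fun τ => τ rD 0 = D) := ⟨h1, h3⟩
  refine Sat.le (Sat.seq h0 (T₂ := (300 + s * (400 + 40 * s + 20 * D + 20 * (2 * s * D + 1)) +
      r * (400 + 40 * r + 20 * blockBound s D + 20 * (D * blockBound s D) +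
        20 * (2 * r * (D * blockBound s D) + 1))) + ((400 + 20 * D + 20 * shortBound r s D +
        (s + r) * (200 + 20 * codeBase r s D)) + ((1000 + 100 * shortBound r s D + 20 * (t + s) +
        80 * radius n r s t D) + (500 + 20 * t + n * t * 250 + 40 * radius n r s t D)))) ?_) ?_
  · intro τ₁ hfr₁ hD
    have hd₁ := hd.congr (hfr₁ arrDim (by decide))
    refine Sat.seq (sat_shortBoundProg hd₁ hD) ?_
    intro τ₂ hfr₂ hL
    have hd₂ := hd₁.congr (hfr₂ arrDim (by decide))
    refine Sat.seq (sat_powProg hd₂ (by rw [hfr₂ rD (by decide), hD]) hL) ?_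
    intro τ₃ hfr₃ hpow
    have hd₃ := hd₂.congr (hfr₃ arrDim (by decide))
    have hL₃ : τ₃ rL 0 = shortBound r s D := by rw [hfr₃ rL (by decide), hL]
    refine Sat.seq (sat_sizesProg hd₃ hL₃ hpow) ?_
    intro τ₄ hfr₄ ⟨g1, g2, g3, g4, g5⟩
    have hd₄ := hd₃.congr (hfr₄ arrDim (by decide))
    refine (sat_penaltyProg hd₄ g4).mono le_rfl ?_
    intro τ₅ hfr₅ hBM
    have hobj : τ₅ arrObj = τ₄ arrObj := hfr₅ arrObj (by decide)
    have hA : τ₅ arrA = σ arrA := by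
      rw [hfr₅ arrA (by decide), hfr₄ arrA (by decide), hfr₃ arrA (by decide),
        hfr₂ arrA (by decide), hfr₁ arrA (by decide)]
    have hB : τ₅ arrB = σ arrB := by
      rw [hfr₅ arrB (by decide), hfr₄ arrB (by decide), hfr₃ arrB (by decide),
        hfr₂ arrB (by decide), hfr₁ arrB (by decide)]
    refine ⟨D, hd₄.congr (hfr₅ arrDim (by decide)), ⟨h2.one_le, ?_, ?_, ?_⟩, ?_, ?_, ?_, ?_, ?_, ?_,
      ?_, ?_⟩
    · rw [hA]; exact h2.entryA
    · rw [hB]; exact h2.entryB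
    · rw [hA, hB]; exact h2.le_of_bound
    · rw [hfr₅ rL (by decide), hfr₄ rL (by decide), hL₃]
    · intro j hj
      rw [hfr₅ aPow (by decide), hfr₄ aPow (by decide), hpow j hj]
    · rw [hfr₅ rQ (by decide), g1]
    · rw [hfr₅ rJ (by decide), g2]
    · rw [hfr₅ rItems (by decide), g3]
    · rw [hfr₅ rW (by decide), g4]
    · rw [hfr₅ rK (by decide), g5]
    · rw [hBM, hobj]
  · unfold paramTime
    omega

/-! ## The items of an instance on the machine -/

/-- The entry of the rounded solution of the LP relaxation. -/
def lpFloor (e : XE) : XE := .read arrLPNum e / .read arrLPDen e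

@[simp] theorem eval_lpFloor (σ : Store) (e : XE) :
    (lpFloor e).eval σ = σ arrLPNum (e.eval σ) / σ arrLPDen (e.eval σ) := rfl

@[simp] theorem cost_lpFloor (σ : Store) (e : XE) :
    (lpFloor e).cost σ = 2 * e.cost σ + 52 := by
  simp only [lpFloor, cost_div, cost_read]
  ring

/-- Compute the code of the column `xPos`. -/
def varCode : St :=
  .seq (.set xAcc (.const 0))
  (.seq (.loop iJ dimS (.set xAcc (va xAcc + .read aPow (va iJ) * .read arrB (va xPos * dimS + va iJ))))
    (.loop iJ dimR (.set xAcc (va xAcc + .read aPow (dimS + va iJ) *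
      .read arrA (va xPos * dimR + va iJ)))))

/-- Write the data of the item `iV` for the column `xPos` with the code `xAcc`. -/
def varData : St :=
  .seq (.assign aDel (va iV) (va xAcc))
  (.seq (.assign aMd (va iV) (.const 1))
  (.seq (.assign aCost (va iV) (.read arrObj (va xPos)))
  (.seq (.assign aX (va iV) (lpFloor (va xPos)))
  (.seq (.assign aSlack (va iV) (.const 0))
  (.seq (.ite (.le (.const 1) (.read arrLowerFin (va xPos)))
      (.assign aLo (va iV) (.bin .max (lpFloor (va xPos) - va rW) (.read arrLower (va xPos))))
      (.assign aLo (va iV) (lpFloor (va xPos) - va rW)))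
    (.ite (.le (.const 1) (.read arrUpperFin (va xPos)))
      (.assign aUp (va iV) (.bin .min (lpFloor (va xPos) + va rW) (.read arrUpper (va xPos))))
      (.assign aUp (va iV) (lpFloor (va xPos) + va rW))))))))

/-- Write the data of the slack item `iV` with the residual `xAcc`. -/
def slackData : St :=
  .seq (.assign aX (va iV) (va xAcc))
  (.seq (.assign aLo (va iV) (.bin .min (.const 0) (va xAcc)))
  (.seq (.assign aUp (va iV) (.bin .max (.const 0) (va xAcc)))
  (.seq (.assign aSlack (va iV) (.const 1))
    (.ite (.le (.const 0) (va xAcc)) (.assign aCost (va iV) (.const 0 - va rBM))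
      (.assign aCost (va iV) (va rBM))))))

/-- The item of the column `xC` of the brick `xI`. -/
def varItem : St := .seq (.set xPos (va xI * dimT + va xC)) (.seq varCode varData)

/-- Compute the residual of the row `xC` of the block `xI`. -/
def blockResidual : St :=
  .seq (.set xPos (va xI * dimT))
  (.seq (.set xAcc (.read arrRhs (dimR + (va xI * dimS + va xC))))
    (.loop iJ dimT (.set xAcc (va xAcc + lpFloor (va xPos + va iJ) *
      (.const 0 - .read arrB ((va xPos + va iJ) * dimS + va xC))))))

/-- The item of the slack variable of the row `xC - t` of the block `xI`. -/
def blockItem : St :=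
  .seq (.set xC (va xC - dimT))
  (.seq blockResidual
  (.seq (.assign aDel (va iV) (.read aPow (va xC)))
  (.seq (.ite (.le dimS (va xC + .const 1)) (.assign aMd (va iV) (.read aPow dimS))
      (.assign aMd (va iV) (.const 1)))
    slackData)))

/-- Compute the residual of the row `xC` of the top part. -/
def topResidual : St :=
  .seq (.set xAcc (.read arrRhs (va xC)))
    (.loop iJ (dimN * dimT) (.set xAcc (va xAcc + lpFloor (va iJ) *
      (.const 0 - .read arrA (va iJ * dimR + va xC)))))

/-- The item of the slack variable of the row `iV - n (t + s)` of the top part. -/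
def topItem : St :=
  .seq (.set xC (va iV - dimN * (dimT + dimS)))
  (.seq topResidual
  (.seq (.assign aDel (va iV) (.read aPow (dimS + va xC)))
  (.seq (.ite (.le dimR (va xC + .const 1)) (.assign aMd (va iV) (va rQ))
      (.assign aMd (va iV) (.const 1)))
    slackData)))

/-- Compute the item `iV`. -/
def makeItem : St :=
  .seq (.set xI (va iV / (dimT + dimS)))
  (.seq (.set xC (va iV - va xI * (dimT + dimS)))
    (.ite (.le dimN (va xI)) topItem (.ite (.le dimT (va xC)) blockItem varItem)))

/-- The arrays with the data of the items. -/
def itemArrays : List ℕ := [aDel, aMd, aCost, aX, aLo, aUp, aSlack]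

/-- The store `τ` contains the item `v` of the column `p`. -/
structure VarItem (σ : Store) (r s v p : ℕ) (τ : Store) : Prop where
  del : τ aDel v = ∑ j ∈ Finset.range s, σ aPow j * σ arrB ((p * s + j : ℕ) : ℤ) +
    ∑ j ∈ Finset.range r, σ aPow ((s + j : ℕ) : ℤ) * σ arrA ((p * r + j : ℕ) : ℤ)
  md : τ aMd v = 1
  cost : τ aCost v = σ arrObj p
  sol : τ aX v = σ arrLPNum p / σ arrLPDen p
  slack : τ aSlack v = 0
  lo : τ aLo v = if 1 ≤ σ arrLowerFin p then
    max (σ arrLPNum p / σ arrLPDen p - σ rW 0) (σ arrLower p)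
    else σ arrLPNum p / σ arrLPDen p - σ rW 0
  up : τ aUp v = if 1 ≤ σ arrUpperFin p then
    min (σ arrLPNum p / σ arrLPDen p + σ rW 0) (σ arrUpper p)
    else σ arrLPNum p / σ arrLPDen p + σ rW 0

/-- The store `τ` contains the slack item `v` with the given code and residual. -/
structure SlackItem (σ : Store) (v : ℕ) (del md res : ℤ) (τ : Store) : Prop where
  del : τ aDel v = del
  md : τ aMd v = md
  cost : τ aCost v = if 0 ≤ res then - σ rBM 0 else σ rBM 0
  sol : τ aX v = res
  slack : τ aSlack v = 1
  lo : τ aLo v = min 0 res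
  up : τ aUp v = max 0 res

theorem VarItem.congr {σ τ τ' : Store} {r s v p : ℕ} (h : VarItem σ r s v p τ)
    (hτ : ∀ a ∈ itemArrays, τ' a v = τ a v) : VarItem σ r s v p τ' := by
  simp only [itemArrays, List.mem_cons, List.not_mem_nil, or_false, forall_eq_or_imp,
    forall_eq] at hτ
  obtain ⟨h1, h2, h3, h4, h5, h6, h7⟩ := hτ
  exact ⟨by rw [h1, h.del], by rw [h2, h.md], by rw [h3, h.cost], by rw [h4, h.sol],
    by rw [h7, h.slack], by rw [h5, h.lo], by rw [h6, h.up]⟩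

theorem SlackItem.congr {σ τ τ' : Store} {v : ℕ} {del md res : ℤ} (h : SlackItem σ v del md res τ)
    (hτ : ∀ a ∈ itemArrays, τ' a v = τ a v) : SlackItem σ v del md res τ' := by
  simp only [itemArrays, List.mem_cons, List.not_mem_nil, or_false, forall_eq_or_imp,
    forall_eq] at hτ
  obtain ⟨h1, h2, h3, h4, h5, h6, h7⟩ := hτ
  exact ⟨by rw [h1, h.del], by rw [h2, h.md], by rw [h3, h.cost], by rw [h4, h.sol],
    by rw [h7, h.slack], by rw [h5, h.lo], by rw [h6, h.up]⟩

/-- The residual of a row of a block. -/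
def blockRes (σ : Store) (r s t i j : ℕ) : ℤ :=
  σ arrRhs ((r + (i * s + j) : ℕ) : ℤ) + ∑ k ∈ Finset.range t,
    σ arrLPNum ((i * t + k : ℕ) : ℤ) / σ arrLPDen ((i * t + k : ℕ) : ℤ) *
      (0 - σ arrB (((i * t + k) * s + j : ℕ) : ℤ))

/-- The residual of a row of the top part. -/
def topRes (σ : Store) (n r t j : ℕ) : ℤ :=
  σ arrRhs j + ∑ k ∈ Finset.range (n * t),
    σ arrLPNum k / σ arrLPDen k * (0 - σ arrA ((k * r + j : ℕ) : ℤ))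

/-- The store `τ` contains the item `v`. -/
structure ItemOK (σ : Store) (n r s t v : ℕ) (τ : Store) : Prop where
  var : ∀ i < n, ∀ k < t, v = i * (t + s) + k → VarItem σ r s v (i * t + k) τ
  block : ∀ i < n, ∀ j < s, v = i * (t + s) + (t + j) →
    SlackItem σ v (σ aPow j) (if s ≤ j + 1 then σ aPow s else 1) (blockRes σ r s t i j) τ
  top : ∀ j < r, v = n * (t + s) + j →
    SlackItem σ v (σ aPow ((s + j : ℕ) : ℤ)) (if r ≤ j + 1 then σ rQ 0 else 1) (topRes σ n r t j) τ

theorem ItemOK.congr {σ τ τ' : Store} {n r s t v : ℕ} (h : ItemOK σ n r s t v τ)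
    (hτ : ∀ a ∈ itemArrays, τ' a v = τ a v) : ItemOK σ n r s t v τ' :=
  ⟨fun i hi k hk hv => (h.var i hi k hk hv).congr hτ,
    fun i hi j hj hv => (h.block i hi j hj hv).congr hτ,
    fun j hj hv => (h.top j hj hv).congr hτ⟩

/-- The slack starts at the residual and is confined between it and zero. It thus has a known sign,
and a linear cost of the opposite sign penalises its absolute value. -/
theorem sat_slackData {τ : Store} {v : ℕ} {res : ℤ} (hv : τ iV 0 = v) (hres : τ xAcc 0 = res) :
    Sat slackData τ 500 (fun τ' => (∀ a ∈ itemArrays, ∀ u : ℤ, u ≠ v → τ' a u = τ a u) ∧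
      SlackItem τ v (τ aDel v) (τ aMd v) res τ') := by
  unfold slackData
  refine Sat.le (T := 40 + (80 + (80 + (40 + (20 + 90))))) (Sat.assign_seq (by simp)
    (Sat.assign_seq (by simp) (Sat.assign_seq (by simp) (Sat.assign_seq (by simp)
      (Sat.ite (by simp) (fun hc => ?_) (fun hc => ?_)))))) (by omega)
  all_goals
    simp only [holds_le, eval_va, eval_const, eval_min, eval_max, put_apply, hv, hres,
      Nat.reduceEqDiff, if_false] at hc
    refine Sat.assign _ _ _ _ _ _ (by simp) ⟨fun a ha u hu => ?_, ?_⟩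
    · simp only [itemArrays, List.mem_cons, List.not_mem_nil, or_false] at ha
      rcases ha with rfl | rfl | rfl | rfl | rfl | rfl | rfl <;> simp [put_apply, hv, hu]
    · constructor <;> simp [put_apply, hv, hres, hc]

theorem sat_varData {τ : Store} {v p : ℕ} (hv : τ iV 0 = v) (hp : τ xPos 0 = p) :
    Sat varData τ 1600 (fun τ' => (∀ a ∈ itemArrays, ∀ u : ℤ, u ≠ v → τ' a u = τ a u) ∧
      τ' aDel v = τ xAcc 0 ∧ τ' aMd v = 1 ∧ τ' aCost v = τ arrObj p ∧
      τ' aX v = τ arrLPNum p / τ arrLPDen p ∧ τ' aSlack v = 0 ∧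
      (τ' aLo v = if 1 ≤ τ arrLowerFin p then
        max (τ arrLPNum p / τ arrLPDen p - τ rW 0) (τ arrLower p)
        else τ arrLPNum p / τ arrLPDen p - τ rW 0) ∧
      (τ' aUp v = if 1 ≤ τ arrUpperFin p then
        min (τ arrLPNum p / τ arrLPDen p + τ rW 0) (τ arrUpper p)
        else τ arrLPNum p / τ arrLPDen p + τ rW 0)) := by
  unfold varData
  refine Sat.le (T := 40 + (40 + (40 + (150 + (40 + ((40 + 400) + (40 + 400)))))))
    (Sat.assign_seq (by simp)
    (Sat.assign_seq (by simp) (Sat.assign_seq (by simp) (Sat.assign_seq (by simp)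
      (Sat.assign_seq (by simp) ?_))))) (by omega)
  simp only [eval_va, eval_const, eval_read, eval_lpFloor, put_apply, hv, hp, Nat.reduceEqDiff,
    if_false, arrObj, arrLPNum, arrLPDen]
  set τ₁ := put (put (put (put (put τ aDel v (τ xAcc 0)) aMd v 1) aCost v (τ 4 p)) aX v
    (τ 10 p / τ 11 p)) aSlack v 0 with hτ₁
  have hf : ∀ a ∉ itemArrays, τ₁ a = τ a := by
    intro a ha
    simp only [itemArrays, List.mem_cons, List.not_mem_nil, or_false, not_or] at ha
    rw [hτ₁, put_other _ _ _ ha.2.2.2.2.2.2, put_other _ _ _ ha.2.2.2.1, put_other _ _ _ ha.2.2.1,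
      put_other _ _ _ ha.2.1, put_other _ _ _ ha.1]
  have g1 : τ₁ iV 0 = v := by rw [hf iV (by decide), hv]
  have g2 : τ₁ xPos 0 = p := by rw [hf xPos (by decide), hp]
  have g3 := hf 10 (by decide)
  have g4 := hf 11 (by decide)
  have g5 := hf rW (by decide)
  refine Sat.seq (Q₁ := fun τ' => ∃ lo, (lo = if 1 ≤ τ arrLowerFin p then
        max (τ 10 p / τ 11 p - τ rW 0) (τ arrLower p)
        else τ 10 p / τ 11 p - τ rW 0) ∧ τ' = put τ₁ aLo v lo)
    (Sat.ite (by simp) (fun hc => ?_) (fun hc => ?_)) ?_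
  · refine Sat.assign _ _ _ _ _ _ (by simp) ⟨_, ?_, by rw [eval_va, g1]⟩
    simp only [holds_le, eval_const, eval_read, eval_va, g2, hf arrLowerFin (by decide)] at hc
    rw [if_pos hc]
    simp only [eval_max, eval_sub, eval_lpFloor, eval_va, eval_read, g2, arrLPNum, arrLPDen, g3, g4,
      g5, hf arrLower (by decide)]
  · refine Sat.assign _ _ _ _ _ _ (by simp) ⟨_, ?_, by rw [eval_va, g1]⟩
    simp only [holds_le, eval_const, eval_read, eval_va, g2, hf arrLowerFin (by decide)] at hc
    rw [if_neg hc]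
    simp only [eval_sub, eval_lpFloor, eval_va, g2, arrLPNum, arrLPDen, g3, g4, g5]
  rintro τ₂ - ⟨lo, hlo, rfl⟩
  have hf₂ : ∀ a ∉ itemArrays, put τ₁ aLo v lo a = τ a := by
    intro a ha
    have ha' := ha
    simp only [itemArrays, List.mem_cons, List.not_mem_nil, or_false, not_or] at ha
    rw [put_other _ _ _ ha.2.2.2.2.1, hf a ha']
  have k1 : put τ₁ aLo v lo iV 0 = v := by rw [hf₂ iV (by decide), hv]
  have k2 : put τ₁ aLo v lo xPos 0 = p := by rw [hf₂ xPos (by decide), hp]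
  have k3 := hf₂ 10 (by decide)
  have k4 := hf₂ 11 (by decide)
  have k5 := hf₂ rW (by decide)
  suffices hfin : ∀ up, (up = if 1 ≤ τ arrUpperFin p then
        min (τ 10 p / τ 11 p + τ rW 0) (τ arrUpper p)
        else τ 10 p / τ 11 p + τ rW 0) →
      (∀ a ∈ itemArrays, ∀ u : ℤ, u ≠ v → put (put τ₁ aLo v lo) aUp v up a u = τ a u) ∧
      put (put τ₁ aLo v lo) aUp v up aDel v = τ xAcc 0 ∧
      put (put τ₁ aLo v lo) aUp v up aMd v = 1 ∧
      put (put τ₁ aLo v lo) aUp v up aCost v = τ 4 p ∧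
      put (put τ₁ aLo v lo) aUp v up aX v = τ 10 p / τ 11 p ∧
      put (put τ₁ aLo v lo) aUp v up aSlack v = 0 ∧
      put (put τ₁ aLo v lo) aUp v up aLo v = lo ∧ put (put τ₁ aLo v lo) aUp v up aUp v = up by
    refine Sat.ite (by simp) (fun hc => ?_) (fun hc => ?_)
    · simp only [holds_le, eval_const, eval_read, eval_va, k2, hf₂ arrUpperFin (by decide)] at hc
      refine Sat.assign _ _ _ _ _ _ (by simp) ?_
      rw [← hlo, eval_va, k1]
      have e : (XE.bin .min (lpFloor (va xPos) + va rW) (.read arrUpper (va xPos))).eval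
          (put τ₁ aLo v lo) = if 1 ≤ τ arrUpperFin p then
        min (τ 10 p / τ 11 p + τ rW 0) (τ arrUpper p)
        else τ 10 p / τ 11 p + τ rW 0 := by
        rw [if_pos hc]
        simp only [eval_min, eval_add, eval_lpFloor, eval_va, eval_read, k2, arrLPNum, arrLPDen, k3,
          k4, k5, hf₂ arrUpper (by decide)]
      rw [e]
      exact hfin _ rfl
    · simp only [holds_le, eval_const, eval_read, eval_va, k2, hf₂ arrUpperFin (by decide)] at hc
      refine Sat.assign _ _ _ _ _ _ (by simp) ?_
      rw [← hlo, eval_va, k1]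
      have e : (lpFloor (va xPos) + va rW).eval
          (put τ₁ aLo v lo) = if 1 ≤ τ arrUpperFin p then
        min (τ 10 p / τ 11 p + τ rW 0) (τ arrUpper p)
        else τ 10 p / τ 11 p + τ rW 0 := by
        rw [if_neg hc]
        simp only [eval_add, eval_lpFloor, eval_va, k2, arrLPNum, arrLPDen, k3, k4, k5]
      rw [e]
      exact hfin _ rfl
  intro up _
  refine ⟨fun a ha u hu => ?_, ?_⟩
  · simp only [itemArrays, List.mem_cons, List.not_mem_nil, or_false] at ha
    rcases ha with rfl | rfl | rfl | rfl | rfl | rfl | rfl <;> simp [hτ₁, put_apply, hu]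
  · refine ⟨?_, ?_, ?_, ?_, ?_, ?_, ?_⟩ <;> simp [hτ₁, put_apply]

/-- The data that the computation of the items reads. -/
def itemInputs : List ℕ :=
  [arrDim, arrA, arrB, arrRhs, arrObj, arrLowerFin, arrLower, arrUpperFin, arrUpper, arrLPNum,
    arrLPDen, aPow, rQ, rW, rBM, rItems]

/-- A bound on the time of an inner product with a part of a row or column of the matrix. -/
def dotTime (r s D : ℕ) : ℕ := 500 + 20 * D + 20 * s + 20 * r

/-- In the products the power of the base comes first and the matrix entry second; the time depends
on `D` but not on the size of the codes. -/
theorem sat_varCode {σ τ : Store} {n r s t D p : ℕ} (hd : Dims σ n r s t)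
    (hE : MaxEntry σ n r s t D) (hin : ∀ a ∈ itemInputs, τ a = σ a) (hp : τ xPos 0 = p)
    (hpn : p < n * t) :
    Sat varCode τ (100 + (s + r) * dotTime r s D) (fun τ' =>
      τ' xAcc 0 = ∑ j ∈ Finset.range s, σ aPow j * σ arrB ((p * s + j : ℕ) : ℤ) +
        ∑ j ∈ Finset.range r, σ aPow ((s + j : ℕ) : ℤ) * σ arrA ((p * r + j : ℕ) : ℤ)) := by
  have hdτ := hd.congr (hin arrDim (by decide))
  unfold varCode
  refine Sat.le (T := 20 + ((9 + 20 + s * ((400 + 20 * D + 20 * s) + 60 + 20)) + (9 + 20 + r *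
    ((400 + 20 * D + 20 * r) + 60 + 20)))) (Sat.set_seq (by simp) ?_) (by
      have h1 : s * ((400 + 20 * D + 20 * s) + 60 + 20) ≤ s * dotTime r s D :=
        Nat.mul_le_mul_left _ (by unfold dotTime; omega)
      have h2 : r * ((400 + 20 * D + 20 * r) + 60 + 20) ≤ r * dotTime r s D :=
        Nat.mul_le_mul_left _ (by unfold dotTime; omega)
      rw [add_mul]
      omega)
  rw [eval_const]
  set τ₀ := put τ xAcc 0 0 with hτ₀
  have hf₀ : ∀ a ∈ itemInputs, τ₀ a = σ a := fun a ha => by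
    rw [hτ₀, put_other _ _ _ ((by decide : ∀ a ∈ itemInputs, a ≠ xAcc) a ha), hin a ha]
  have hd₀ := hd.congr (hf₀ arrDim (by decide))
  have hp₀ : τ₀ xPos 0 = p := by rw [hτ₀, put_other _ _ _ (by decide), hp]
  have hloc : ∀ (τ' : Store) (k : ℕ), (∀ x, x ≠ iJ → x ≠ xAcc → τ' x = τ₀ x) →
      (∀ a ∈ itemInputs, put τ' iJ 0 k a = σ a) ∧ put τ' iJ 0 k xPos 0 = p ∧
      put τ' iJ 0 k iJ 0 = k := by
    intro τ' k h
    refine ⟨fun a ha => ?_, ?_, put_eq _ _ _ _⟩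
    · have h1 := (by decide : ∀ a ∈ itemInputs, a ≠ iJ ∧ a ≠ xAcc) a ha
      rw [put_other _ _ _ h1.1, h a h1.1 h1.2, hf₀ a ha]
    · rw [put_other _ _ _ (by decide), h _ (by decide) (by decide), hp₀]
  refine Sat.seq (Sat.loop_sum s _ 9 (fun j => σ aPow j * σ arrB ((p * s + j : ℕ) : ℤ)) (by decide)
    hd₀.dimS (by simp) ?_) ?_
  · intro k τ' hk hfr
    obtain ⟨h1, h2, h3⟩ := hloc τ' k hfr
    have h4 := hd.congr (h1 arrDim (by decide))
    have h5 : |σ arrB ((p * s + k : ℕ) : ℤ)| ≤ D := hE.entryB _ (by nlinarith)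
    have h6 : (va xPos * dimS + va iJ).eval (put τ' iJ 0 k) = ((p * s + k : ℕ) : ℤ) := by
      rw [eval_add, eval_mul, eval_va, eval_va, h2, h3, h4.dimS]
      push_cast
      rfl
    constructor
    · rw [eval_mul, eval_read, eval_read, h6, eval_va, h3, h1 aPow (by decide), h1 arrB (by decide)]
    · rw [cost_mul, eval_read, h6, h1 arrB (by decide)]
      simp only [cost_read, cost_add, cost_mul, cost_va, cost_dimS, h4.dimS]
      have h7 := abs_le.1 h5
      simp only [Int.natAbs_natCast]
      omega
  intro τ₁ hfr₁ h
  have hloc₁ : ∀ x, x ≠ iJ → x ≠ xAcc → τ₁ x = τ₀ x := fun x h1 h2 => hfr₁ x (by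
    simp [St.mods, St.set, h1, h2])
  have hd₁ := hd₀.congr (hloc₁ arrDim (by decide) (by decide))
  refine (Sat.loop_sum r _ 9 (fun j => σ aPow ((s + j : ℕ) : ℤ) * σ arrA ((p * r + j : ℕ) : ℤ))
    (by decide) hd₁.dimR (by simp) ?_).mono le_rfl ?_
  · intro k τ' hk hfr
    obtain ⟨h1, h2, h3⟩ := hloc τ' k (fun x hx hx' => by rw [hfr x hx hx', hloc₁ x hx hx'])
    have h4 := hd.congr (h1 arrDim (by decide))
    have h5 : |σ arrA ((p * r + k : ℕ) : ℤ)| ≤ D := hE.entryA _ (by nlinarith)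
    have h6 : (va xPos * dimR + va iJ).eval (put τ' iJ 0 k) = ((p * r + k : ℕ) : ℤ) := by
      rw [eval_add, eval_mul, eval_va, eval_va, h2, h3, h4.dimR]
      push_cast
      rfl
    constructor
    · rw [eval_mul, eval_read, eval_read, h6, eval_add, eval_va, h3, h4.dimS, h1 aPow (by decide),
        h1 arrA (by decide)]
      push_cast
      rfl
    · rw [cost_mul, eval_read, h6, h1 arrA (by decide)]
      simp only [cost_read, cost_add, cost_mul, cost_va, cost_dimR, cost_dimS, h4.dimR]
      have h7 := abs_le.1 h5
      simp only [Int.natAbs_natCast]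
      omega
  · intro τ' _ h'
    rw [h', h, hτ₀, put_eq, zero_add]

theorem sat_varItem {σ τ : Store} {n r s t D v i k : ℕ} (hd : Dims σ n r s t)
    (hE : MaxEntry σ n r s t D) (hin : ∀ a ∈ itemInputs, τ a = σ a) (hv : τ iV 0 = v)
    (hi : τ xI 0 = i) (hk : τ xC 0 = k) (hin' : i < n) (hkt : k < t) :
    Sat varItem τ (2000 + 20 * t + (s + r) * dotTime r s D) (fun τ' =>
      (∀ a ∈ itemArrays, ∀ u : ℤ, u ≠ v → τ' a u = τ a u) ∧ VarItem σ r s v (i * t + k) τ') := by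
  have hdτ := hd.congr (hin arrDim (by decide))
  have hpn : i * t + k < n * t := by nlinarith
  unfold varItem
  refine Sat.le (T := (200 + 20 * t) + ((100 + (s + r) * dotTime r s D) + 1600))
    (Sat.set_seq ?_ ?_) (by omega)
  · simp [hdτ.dimT]
    omega
  have e1 : (va xI * dimT + va xC).eval τ = ((i * t + k : ℕ) : ℤ) := by
    rw [eval_add, eval_mul, eval_va, eval_va, hi, hk, hdτ.dimT]
    push_cast
    rfl
  rw [e1]
  set τ₀ := put τ xPos 0 ((i * t + k : ℕ) : ℤ) with hτ₀
  have hf₀ : ∀ a, a ≠ xPos → τ₀ a = τ a := fun a ha => by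
    rw [hτ₀, put_other _ _ _ ha]
  refine Sat.seq (sat_varCode hd hE (fun a ha => by
    rw [hf₀ a ((by decide : ∀ a ∈ itemInputs, a ≠ xPos) a ha), hin a ha]) (put_eq _ _ _ _) hpn) ?_
  intro τ₁ hfr₁ hacc
  have hf₁ : ∀ a ∉ [xPos, xAcc, iJ], τ₁ a = τ a := by
    intro a ha
    have ha' := ha
    simp only [List.mem_cons, List.not_mem_nil, or_false, not_or] at ha
    rw [hfr₁ a (fun hm => ha' ((by decide : ∀ b ∈ varCode.mods, b ∈ [xPos, xAcc, iJ]) a hm)),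
      hf₀ a ha.1]
  refine (sat_varData (v := v) (p := i * t + k) (by rw [hf₁ iV (by decide), hv])
    (by rw [hfr₁ xPos (by decide), hτ₀, put_eq])).mono le_rfl ?_
  rintro τ₂ - ⟨h0, h1, h2, h3, h4, h5, h6, h7⟩
  have hf₂ : ∀ a ∈ itemInputs, τ₁ a = σ a := fun a ha => by
    rw [hf₁ a ((by decide : ∀ a ∈ itemInputs, a ∉ [xPos, xAcc, iJ]) a ha), hin a ha]
  rw [hf₂ arrLPNum (by decide), hf₂ arrLPDen (by decide), hf₂ rW (by decide)] at h6 h7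
  rw [hf₂ arrLPNum (by decide), hf₂ arrLPDen (by decide)] at h4
  rw [hf₂ arrLowerFin (by decide), hf₂ arrLower (by decide)] at h6
  rw [hf₂ arrUpperFin (by decide), hf₂ arrUpper (by decide)] at h7
  rw [hf₂ arrObj (by decide)] at h3
  rw [hacc] at h1
  refine ⟨fun a ha u hu => ?_, ⟨h1, h2, h3, h4, h5, h6, h7⟩⟩
  rw [h0 a ha u hu, hf₁ a ((by decide : ∀ a ∈ itemArrays, a ∉ [xPos, xAcc, iJ]) a ha)]

/-- The common part of both kinds of slack items, which differ only in their residual, their code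
and the divisor tested after them. -/
theorem sat_slackTail {σ τ : Store} {v : ℕ} {del md res : ℤ} {eDel : XE} {b : BE} {eMd : XE}
    {T : ℕ} (hin : ∀ a ∈ itemInputs, τ a = σ a) (hv : τ iV 0 = v) (hres : τ xAcc 0 = res)
    (hc : eDel.cost τ + b.cost (put τ aDel v del) + eMd.cost (put τ aDel v del) ≤ T)
    (hdel : eDel.eval τ = del)
    (hmd : md = if b.holds (put τ aDel v del) then eMd.eval (put τ aDel v del) else 1) :
    Sat (.seq (.assign aDel (va iV) eDel)
      (.seq (.ite b (.assign aMd (va iV) eMd) (.assign aMd (va iV) (.const 1))) slackData)) τ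
      (600 + 3 * T) (fun τ' =>
      (∀ a ∈ itemArrays, ∀ u : ℤ, u ≠ v → τ' a u = τ a u) ∧ SlackItem σ v del md res τ') := by
  refine Sat.le (T := (T + 20) + ((T + (T + 20)) + 500)) (Sat.assign_seq ?_ ?_) (by omega)
  · rw [cost_va]
    omega
  rw [eval_va, hv, hdel]
  have hv₁ : put τ aDel v del iV 0 = v := by rw [put_other _ _ _ (by decide), hv]
  refine Sat.seq (Q₁ := fun τ' => τ' = put (put τ aDel v del) aMd v md)
    (Sat.ite (by omega) (fun h => Sat.assign _ _ _ _ _ _ ?_ ?_)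
      (fun h => Sat.assign _ _ _ _ _ _ ?_ ?_)) ?_
  · rw [cost_va]
    omega
  · rw [if_pos h] at hmd
    rw [eval_va, hv₁, hmd]
  · rw [cost_va, cost_const]
    omega
  · rw [if_neg h] at hmd
    rw [eval_va, hv₁, hmd, eval_const]
  rintro τ₁ - rfl
  have hf : ∀ a, a ≠ aDel → a ≠ aMd → put (put τ aDel v del) aMd v md a = τ a := fun a h1 h2 => by
    rw [put_other _ _ _ h2, put_other _ _ _ h1]
  refine (sat_slackData (v := v) (res := res) (by rw [hf _ (by decide) (by decide), hv])
    (by rw [hf _ (by decide) (by decide), hres])).mono le_rfl ?_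
  rintro τ₂ - ⟨h1, h2⟩
  refine ⟨fun a ha u hu => ?_, ⟨?_, ?_, ?_, h2.sol, h2.slack, h2.lo, h2.up⟩⟩
  · rw [h1 a ha u hu, put_ne_idx _ _ _ _ hu, put_ne_idx _ _ _ _ hu]
  · rw [h2.del, put_other _ _ _ (by decide), put_eq]
  · rw [h2.md, put_eq]
  · rw [h2.cost, hf rBM (by decide) (by decide), hin rBM (by decide)]

/-- The slack of row `j` of a block is a unit column, so its code is M^j. Only after the last slack
of a block are the B-sums of the block complete, so only this one carries the test modulo M^s. -/
theorem sat_blockItem {σ τ : Store} {n r s t D v i j : ℕ} (hd : Dims σ n r s t)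
    (hE : MaxEntry σ n r s t D) (hin : ∀ a ∈ itemInputs, τ a = σ a) (hv : τ iV 0 = v)
    (hi : τ xI 0 = i) (hj : τ xC 0 = ((t + j : ℕ) : ℤ)) (hin' : i < n) (hjs : j < s) :
    Sat blockItem τ (3000 + 20 * t + 20 * s + t * dotTime r s D) (fun τ' =>
      (∀ a ∈ itemArrays, ∀ u : ℤ, u ≠ v → τ' a u = τ a u) ∧
      SlackItem σ v (σ aPow j) (if s ≤ j + 1 then σ aPow s else 1) (blockRes σ r s t i j) τ') := by
  have hdτ := hd.congr (hin arrDim (by decide))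
  unfold blockItem
  refine Sat.le (T := 100 + (((100 + 20 * t) + ((200 + 20 * s) + (9 + 20 + t * ((420 + 20 * D +
    20 * s) + 60 + 20)))) + (600 + 3 * 200))) (Sat.set_seq (by simp) ?_) (by
      have h1 : t * ((420 + 20 * D + 20 * s) + 60 + 20) ≤ t * dotTime r s D :=
        Nat.mul_le_mul_left _ (by unfold dotTime; omega)
      omega)
  have e1 : (va xC - dimT).eval τ = j := by
    rw [eval_sub, eval_va, hj, hdτ.dimT]
    push_cast
    ring
  rw [e1]
  set τ₀ := put τ xC 0 j with hτ₀
  have hf₀ : ∀ a, a ≠ xC → τ₀ a = τ a := fun a ha => by rw [hτ₀, put_other _ _ _ ha]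
  have hd₀ := hdτ.congr (hf₀ arrDim (by decide))
  refine Sat.seq (Q₁ := fun τ' => τ' xAcc 0 = blockRes σ r s t i j) ?_ ?_
  · unfold blockResidual
    refine Sat.set_seq ?_ (Sat.set_seq ?_ ?_)
    · simp [hd₀.dimT]
      omega
    · simp only [cost_read, cost_add, cost_mul, cost_va, cost_dimR, cost_dimS,
        (hd₀.put (a := xPos) 0 ((va xI * dimT).eval τ₀) (by decide)).dimS, Int.natAbs_natCast]
      omega
    have e2 : (va xI * dimT).eval τ₀ = ((i * t : ℕ) : ℤ) := by
      rw [eval_mul, eval_va, hf₀ xI (by decide), hi, hd₀.dimT]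
      push_cast
      rfl
    rw [e2]
    set τ₁ := put τ₀ xPos 0 ((i * t : ℕ) : ℤ) with hτ₁
    have hf₁ : ∀ a, a ≠ xC → a ≠ xPos → τ₁ a = τ a := fun a ha ha' => by
      rw [hτ₁, put_other _ _ _ ha', hf₀ a ha]
    have hd₁ := hdτ.congr (hf₁ arrDim (by decide) (by decide))
    have c1 : τ₁ xC 0 = j := by rw [hτ₁, put_other _ _ _ (by decide), hτ₀, put_eq]
    have e3 : (XE.read arrRhs (dimR + (va xI * dimS + va xC))).eval τ₁ =
        σ arrRhs ((r + (i * s + j) : ℕ) : ℤ) := by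
      rw [eval_read, eval_add, eval_add, eval_mul, eval_va, eval_va, hd₁.dimR, hd₁.dimS, c1,
        hf₁ xI (by decide) (by decide), hi, hf₁ arrRhs (by decide) (by decide),
        hin arrRhs (by decide)]
      push_cast
      rfl
    rw [e3]
    set τ₂ := put τ₁ xAcc 0 (σ arrRhs ((r + (i * s + j) : ℕ) : ℤ)) with hτ₂
    have hf₂ : ∀ a, a ≠ xC → a ≠ xPos → a ≠ xAcc → τ₂ a = τ a := fun a h1 h2 h3 => by
      rw [hτ₂, put_other _ _ _ h3, hf₁ a h1 h2]
    have hd₂ := hdτ.congr (hf₂ arrDim (by decide) (by decide) (by decide))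
    refine (Sat.loop_sum t _ 9 (fun k => σ arrLPNum ((i * t + k : ℕ) : ℤ) /
      σ arrLPDen ((i * t + k : ℕ) : ℤ) * (0 - σ arrB (((i * t + k) * s + j : ℕ) : ℤ))) (by decide)
      hd₂.dimT (by simp) ?_).mono le_rfl ?_
    · intro k τ' hk hfr
      have h1 : ∀ a ∈ itemInputs, put τ' iJ 0 k a = σ a := by
        intro a ha
        have h := (by decide : ∀ a ∈ itemInputs, a ≠ iJ ∧ a ≠ xAcc ∧ a ≠ xC ∧ a ≠ xPos) a ha
        rw [put_other _ _ _ h.1, hfr a h.1 h.2.1, hf₂ a h.2.2.1 h.2.2.2 h.2.1, hin a ha]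
      have h2 : put τ' iJ 0 k xPos 0 = ((i * t : ℕ) : ℤ) := by
        rw [put_other _ _ _ (by decide), hfr _ (by decide) (by decide), hτ₂,
          put_other _ _ _ (by decide), hτ₁, put_eq]
      have h3 : put τ' iJ 0 k xC 0 = j := by
        rw [put_other _ _ _ (by decide), hfr _ (by decide) (by decide), hτ₂,
          put_other _ _ _ (by decide), c1]
      have h4 := hd.congr (h1 arrDim (by decide))
      have h5 : |σ arrB (((i * t + k) * s + j : ℕ) : ℤ)| ≤ D := hE.entryB _ (by
        have : i * t + k < n * t := by nlinarith
        nlinarith)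
      have h6 : (va xPos + va iJ).eval (put τ' iJ 0 k) = ((i * t + k : ℕ) : ℤ) := by
        rw [eval_add, eval_va, eval_va, h2, put_eq]
        push_cast
        rfl
      have h7 : ((va xPos + va iJ) * dimS + va xC).eval (put τ' iJ 0 k) =
          (((i * t + k) * s + j : ℕ) : ℤ) := by
        rw [eval_add, eval_mul, h6, h4.dimS, eval_va, h3]
        push_cast
        rfl
      constructor
      · rw [eval_mul, eval_lpFloor, h6, eval_sub, eval_read, h7, eval_const,
          h1 arrLPNum (by decide), h1 arrLPDen (by decide), h1 arrB (by decide)]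
      · rw [cost_mul, eval_sub, eval_read, h7, h1 arrB (by decide)]
        simp only [cost_read, cost_add, cost_sub, cost_mul, cost_va, cost_dimS, h4.dimS,
          cost_lpFloor, cost_const, eval_const, Int.natAbs_natCast]
        have h8 := abs_le.1 h5
        omega
    · intro τ' _ h
      rw [h, hτ₂, put_eq, blockRes]
  · intro τ₃ hfr₃ hres
    have hf₃ : ∀ a ∉ [xC, xPos, xAcc, iJ], τ₃ a = τ a := by
      intro a ha
      have ha' := ha
      simp only [List.mem_cons, List.not_mem_nil, or_false, not_or] at ha
      rw [hfr₃ a (fun hm => ha' ((by decide : ∀ b ∈ blockResidual.mods,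
        b ∈ [xC, xPos, xAcc, iJ]) a hm)), hf₀ a ha.1]
    have hin₃ : ∀ a ∈ itemInputs, τ₃ a = σ a := fun a ha => by
      rw [hf₃ a ((by decide : ∀ a ∈ itemInputs, a ∉ [xC, xPos, xAcc, iJ]) a ha), hin a ha]
    have c3 : τ₃ xC 0 = j := by rw [hfr₃ xC (by decide), hτ₀, put_eq]
    have hd₃ : Dims (put τ₃ aDel v (σ aPow j)) n r s t :=
      (hd.congr (hin₃ arrDim (by decide))).put _ _ (by decide)
    refine (sat_slackTail (v := v) (del := σ aPow j) (md := if s ≤ j + 1 then σ aPow s else 1)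
      hin₃ (by rw [hf₃ iV (by decide), hv]) hres ?_ ?_ ?_).mono le_rfl ?_
    · simp
    · rw [eval_read, eval_va, c3, hin₃ aPow (by decide)]
    · have hc : (BE.le dimS (va xC + .const 1)).holds (put τ₃ aDel v (σ aPow j)) ↔ s ≤ j + 1 := by
        rw [holds_le, hd₃.dimS, eval_add, eval_va, eval_const, put_other _ _ _ (by decide), c3]
        omega
      rw [eval_read, hd₃.dimS, put_other _ _ _ (by decide), hin₃ aPow (by decide)]
      by_cases h : s ≤ j + 1
      · rw [if_pos h, if_pos (hc.2 h)]
      · rw [if_neg h, if_neg (fun h' => h (hc.1 h'))]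
    · rintro τ₄ - ⟨h1, h2⟩
      refine ⟨fun a ha u hu => ?_, h2⟩
      rw [h1 a ha u hu, hf₃ a ((by decide : ∀ a ∈ itemArrays, a ∉ [xC, xPos, xAcc, iJ]) a ha)]

/-- The top slacks are unit columns of the A-part, with codes M^(s+j). They come after all blocks,
and the last of them carries the final test modulo M^(s+r). -/
theorem sat_topItem {σ τ : Store} {n r s t D v j : ℕ} (hd : Dims σ n r s t)
    (hE : MaxEntry σ n r s t D) (hin : ∀ a ∈ itemInputs, τ a = σ a) (hv : τ iV 0 = v)
    (hj : v = n * (t + s) + j) (hjr : j < r) :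
    Sat topItem τ (3000 + 20 * (t + s) + 20 * t + n * t * dotTime r s D) (fun τ' =>
      (∀ a ∈ itemArrays, ∀ u : ℤ, u ≠ v → τ' a u = τ a u) ∧
      SlackItem σ v (σ aPow ((s + j : ℕ) : ℤ)) (if r ≤ j + 1 then σ rQ 0 else 1)
        (topRes σ n r t j) τ') := by
  have hdτ := hd.congr (hin arrDim (by decide))
  unfold topItem
  refine Sat.le (T := (300 + 20 * (t + s)) + ((40 + ((100 + 20 * t) + 20 + n * t * ((400 + 20 * D +
    20 * r) + 60 + 20))) + (600 + 3 * 200))) (Sat.set_seq ?_ ?_) (by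
      have h1 : n * t * ((400 + 20 * D + 20 * r) + 60 + 20) ≤ n * t * dotTime r s D :=
        Nat.mul_le_mul_left _ (by unfold dotTime; omega)
      omega)
  · simp [hdτ.dimT, hdτ.dimS]
    omega
  have e1 : (va iV - dimN * (dimT + dimS)).eval τ = j := by
    rw [eval_sub, eval_va, hv, eval_mul, eval_add, hdτ.dimT, hdτ.dimN, hdτ.dimS, hj]
    push_cast
    ring
  rw [e1]
  set τ₀ := put τ xC 0 j with hτ₀
  have hf₀ : ∀ a, a ≠ xC → τ₀ a = τ a := fun a ha => by rw [hτ₀, put_other _ _ _ ha]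
  have c0 : τ₀ xC 0 = j := by rw [hτ₀, put_eq]
  refine Sat.seq (Q₁ := fun τ' => τ' xAcc 0 = topRes σ n r t j) ?_ ?_
  · unfold topResidual
    refine Sat.set_seq (by simp) ?_
    have e3 : (XE.read arrRhs (va xC)).eval τ₀ = σ arrRhs j := by
      rw [eval_read, eval_va, c0, hf₀ arrRhs (by decide), hin arrRhs (by decide)]
    rw [e3]
    set τ₂ := put τ₀ xAcc 0 (σ arrRhs j) with hτ₂
    have hf₂ : ∀ a, a ≠ xC → a ≠ xAcc → τ₂ a = τ a := fun a h1 h3 => by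
      rw [hτ₂, put_other _ _ _ h3, hf₀ a h1]
    have hd₂ := hdτ.congr (hf₂ arrDim (by decide) (by decide))
    refine (Sat.loop_sum (n * t) _ _ (fun k => σ arrLPNum k / σ arrLPDen k *
      (0 - σ arrA ((k * r + j : ℕ) : ℤ))) (by decide) ?_ ?_ ?_).mono le_rfl ?_
    · rw [eval_mul, hd₂.dimN, hd₂.dimT]
      push_cast
      rfl
    · simp [hd₂.dimT]
      omega
    · intro k τ' hk hfr
      have h1 : ∀ a ∈ itemInputs, put τ' iJ 0 k a = σ a := by
        intro a ha
        have h := (by decide : ∀ a ∈ itemInputs, a ≠ iJ ∧ a ≠ xAcc ∧ a ≠ xC) a ha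
        rw [put_other _ _ _ h.1, hfr a h.1 h.2.1, hf₂ a h.2.2 h.2.1, hin a ha]
      have h3 : put τ' iJ 0 k xC 0 = j := by
        rw [put_other _ _ _ (by decide), hfr _ (by decide) (by decide), hτ₂,
          put_other _ _ _ (by decide), c0]
      have h4 := hd.congr (h1 arrDim (by decide))
      have h5 : |σ arrA ((k * r + j : ℕ) : ℤ)| ≤ D := hE.entryA _ (by nlinarith)
      have h7 : (va iJ * dimR + va xC).eval (put τ' iJ 0 k) = ((k * r + j : ℕ) : ℤ) := by
        rw [eval_add, eval_mul, eval_va, put_eq, h4.dimR, eval_va, h3]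
        push_cast
        rfl
      constructor
      · rw [eval_mul, eval_lpFloor, eval_va, put_eq, eval_sub, eval_read, h7, eval_const,
          h1 arrLPNum (by decide), h1 arrLPDen (by decide), h1 arrA (by decide)]
      · rw [cost_mul, eval_sub, eval_read, h7, h1 arrA (by decide)]
        simp only [cost_read, cost_add, cost_sub, cost_mul, cost_va, cost_dimR, h4.dimR,
          cost_lpFloor, cost_const, eval_const, Int.natAbs_natCast]
        have h8 := abs_le.1 h5
        omega
    · intro τ' _ h
      rw [h, hτ₂, put_eq, topRes]
  · intro τ₃ hfr₃ hres
    have hf₃ : ∀ a ∉ [xC, xAcc, iJ], τ₃ a = τ a := by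
      intro a ha
      have ha' := ha
      simp only [List.mem_cons, List.not_mem_nil, or_false, not_or] at ha
      rw [hfr₃ a (fun hm => ha' ((by decide : ∀ b ∈ topResidual.mods,
        b ∈ [xC, xAcc, iJ]) a hm)), hf₀ a ha.1]
    have hin₃ : ∀ a ∈ itemInputs, τ₃ a = σ a := fun a ha => by
      rw [hf₃ a ((by decide : ∀ a ∈ itemInputs, a ∉ [xC, xAcc, iJ]) a ha), hin a ha]
    have c3 : τ₃ xC 0 = j := by rw [hfr₃ xC (by decide), c0]
    have hd₃ := hd.congr (hin₃ arrDim (by decide))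
    have hd₄ := hd₃.put (a := aDel) v (σ aPow ((s + j : ℕ) : ℤ)) (by decide)
    refine (sat_slackTail (v := v) (del := σ aPow ((s + j : ℕ) : ℤ))
      (md := if r ≤ j + 1 then σ rQ 0 else 1)
      hin₃ (by rw [hf₃ iV (by decide), hv]) hres ?_ ?_ ?_).mono le_rfl ?_
    · simp
    · rw [eval_read, eval_add, hd₃.dimS, eval_va, c3, hin₃ aPow (by decide)]
      push_cast
      rfl
    · have hc : (BE.le dimR (va xC + .const 1)).holds (put τ₃ aDel v (σ aPow ((s + j : ℕ) : ℤ))) ↔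
          r ≤ j + 1 := by
        rw [holds_le, hd₄.dimR, eval_add, eval_va, eval_const, put_other _ _ _ (by decide), c3]
        omega
      rw [eval_va, put_other _ _ _ (by decide), hin₃ rQ (by decide)]
      by_cases h : r ≤ j + 1
      · rw [if_pos h, if_pos (hc.2 h)]
      · rw [if_neg h, if_neg (fun h' => h (hc.1 h'))]
    · rintro τ₄ - ⟨h1, h2⟩
      refine ⟨fun a ha u hu => ?_, h2⟩
      rw [h1 a ha u hu, hf₃ a ((by decide : ∀ a ∈ itemArrays, a ∉ [xC, xAcc, iJ]) a ha)]

/-- A bound on the time for an item. -/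
def itemTime (n r s t D : ℕ) : ℕ :=
  4000 + 100 * (t + s) + (n * t + t + s + r) * dotTime r s D

/-- Each brick occupies `t + s` consecutive items, its variables before its slacks; a quotient of
`n` or more marks a top slack. -/
theorem sat_makeItem {σ τ : Store} {n r s t D v : ℕ} (hs : 0 < s) (hd : Dims σ n r s t)
    (hE : MaxEntry σ n r s t D) (hin : ∀ a ∈ itemInputs, τ a = σ a) (hv : τ iV 0 = v)
    (hvm : v < itemCount n r s t) :
    Sat makeItem τ (itemTime n r s t D) (fun τ' =>
      (∀ a ∈ itemArrays, ∀ u : ℤ, u ≠ v → τ' a u = τ a u) ∧ ItemOK σ n r s t v τ') := by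
  have hw : 0 < t + s := by omega
  have hdτ := hd.congr (hin arrDim (by decide))
  have huniq : ∀ i k : ℕ, k < t + s → v = i * (t + s) + k → v / (t + s) = i ∧ v % (t + s) = k := by
    intro i k hk h
    exact (Nat.div_mod_unique hw).2 ⟨by rw [h]; ring, hk⟩
  have hdm := Nat.div_add_mod v (t + s)
  have hml := Nat.mod_lt v hw
  set i := v / (t + s) with hi
  set c := v % (t + s) with hc
  have hvc : v = i * (t + s) + c := by rw [mul_comm]; omega
  unfold makeItem
  refine Sat.le (T := 200 + ((300 + 20 * (t + s)) + (30 + (30 + (3000 + 40 * (t + s) +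
    (n * t + t + s + r) * dotTime r s D))))) (Sat.set_seq (by simp) ?_) (by
      unfold itemTime
      omega)
  have e1 : (va iV / (dimT + dimS)).eval τ = i := by
    rw [eval_div, eval_add, eval_va, hv, hdτ.dimT, hdτ.dimS, hi]
    push_cast
    rfl
  rw [e1]
  have hd₁ := hdτ.put (a := xI) 0 i (by decide)
  refine Sat.set_seq ?_ ?_
  · simp [hd₁.dimT, hd₁.dimS]
    omega
  have e2 : (va iV - va xI * (dimT + dimS)).eval (put τ xI 0 i) = c := by
    rw [eval_sub, eval_mul, eval_add, eval_va, eval_va, put_eq, put_other _ _ _ (by decide), hv,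
      hd₁.dimT, hd₁.dimS, hvc]
    push_cast
    ring
  rw [e2]
  set τ₁ := put (put τ xI 0 i) xC 0 c with hτ₁
  have hf : ∀ a, a ≠ xI → a ≠ xC → τ₁ a = τ a := fun a h1 h2 => by
    rw [hτ₁, put_other _ _ _ h2, put_other _ _ _ h1]
  have hd₂ := hdτ.congr (hf arrDim (by decide) (by decide))
  have hin₁ : ∀ a ∈ itemInputs, τ₁ a = σ a := fun a ha => by
    have h := (by decide : ∀ a ∈ itemInputs, a ≠ xI ∧ a ≠ xC) a ha
    rw [hf a h.1 h.2, hin a ha]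
  have hv₁ : τ₁ iV 0 = v := by rw [hf iV (by decide) (by decide), hv]
  have hi₁ : τ₁ xI 0 = i := by rw [hτ₁, put_other _ _ _ (by decide), put_eq]
  have hc₁ : τ₁ xC 0 = c := by rw [hτ₁, put_eq]
  have harr : ∀ a ∈ itemArrays, τ₁ a = τ a := fun a ha => by
    have h := (by decide : ∀ a ∈ itemArrays, a ≠ xI ∧ a ≠ xC) a ha
    exact hf a h.1 h.2
  have hexp : (n * t + t + s + r) * dotTime r s D = n * t * dotTime r s D + t * dotTime r s D +
      (s + r) * dotTime r s D := by ring
  refine Sat.ite (by simp) (fun h => ?_) (fun h => Sat.ite (by simp) (fun h' => ?_) (fun h' => ?_))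
  · rw [holds_le, hd₂.dimN, eval_va, hi₁] at h
    have hni : n ≤ i := by exact_mod_cast h
    have hge : n * (t + s) ≤ v := by
      have := Nat.mul_le_mul_right (t + s) hni
      omega
    obtain ⟨j, hj⟩ := Nat.exists_eq_add_of_le hge
    have hjr : j < r := by
      unfold itemCount at hvm
      omega
    refine (sat_topItem hd hE hin₁ hv₁ hj hjr).mono (by rw [hexp]; omega) ?_
    rintro τ₂ - ⟨h1, h2⟩
    refine ⟨fun a ha u hu => by rw [h1 a ha u hu, harr a ha], fun i' hi' k hk hv' => ?_,
      fun i' hi' k hk hv' => ?_, fun j' hj' hv' => ?_⟩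
    · have := (huniq i' k (by omega) hv').1
      omega
    · have := (huniq i' (t + k) (by omega) hv').1
      omega
    · obtain rfl : j' = j := by omega
      exact h2
  · rw [holds_le, hd₂.dimN, eval_va, hi₁] at h
    rw [holds_le, hd₂.dimT, eval_va, hc₁] at h'
    have hni : i < n := by
      by_contra h0
      exact h (by exact_mod_cast not_lt.1 h0)
    have htc : t ≤ c := by exact_mod_cast h'
    obtain ⟨j, hj⟩ := Nat.exists_eq_add_of_le htc
    refine (sat_blockItem (j := j) hd hE hin₁ hv₁ hi₁ (by rw [hc₁, hj]) hni (by omega)).mono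
      (by rw [hexp]; omega) ?_
    rintro τ₂ - ⟨h1, h2⟩
    refine ⟨fun a ha u hu => by rw [h1 a ha u hu, harr a ha], fun i' hi' k hk hv' => ?_,
      fun i' hi' k hk hv' => ?_, fun j' hj' hv' => ?_⟩
    · have := (huniq i' k (by omega) hv').2
      omega
    · obtain ⟨q1, q2⟩ := huniq i' (t + k) (by omega) hv'
      obtain rfl : k = j := by omega
      rw [← q1]
      exact h2
    · have := Nat.mul_le_mul_right (t + s) hni
      rw [Nat.succ_mul] at this
      omega
  · rw [holds_le, hd₂.dimN, eval_va, hi₁] at h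
    rw [holds_le, hd₂.dimT, eval_va, hc₁] at h'
    have hni : i < n := by
      by_contra h0
      exact h (by exact_mod_cast not_lt.1 h0)
    have htc : c < t := by
      by_contra h0
      exact h' (by exact_mod_cast not_lt.1 h0)
    refine (sat_varItem hd hE hin₁ hv₁ hi₁ hc₁ hni htc).mono (by rw [hexp]; omega) ?_
    rintro τ₂ - ⟨h1, h2⟩
    refine ⟨fun a ha u hu => by rw [h1 a ha u hu, harr a ha], fun i' hi' k hk hv' => ?_,
      fun i' hi' k hk hv' => ?_, fun j' hj' hv' => ?_⟩
    · obtain ⟨q1, q2⟩ := huniq i' k (by omega) hv'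
      rw [← q1, ← q2]
      exact h2
    · have := (huniq i' (t + k) (by omega) hv').2
      omega
    · have := Nat.mul_le_mul_right (t + s) hni
      rw [Nat.succ_mul] at this
      omega

/-- Compute all items. -/
def itemLoop : St := .loop iV (va rItems) makeItem

theorem sat_itemLoop {σ : Store} {n r s t D : ℕ} (hs : 0 < s) (hP : Params σ n r s t D) :
    Sat itemLoop σ (30 + itemCount n r s t * (itemTime n r s t D + 20)) (fun τ =>
      ∀ v < itemCount n r s t, ItemOK σ n r s t v τ) := by
  unfold itemLoop
  refine (Sat.loop (fun k τ => ∀ v < k, ItemOK σ n r s t v τ) (itemCount n r s t)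
    (itemTime n r s t D) 9 ?_ (by simp) (by omega) ?_).le (by omega)
  · rw [eval_va, hP.reg_items]
  · intro k τ hk hfr hinv
    refine (sat_makeItem (v := k) hs hP.dims hP.entries (fun a ha => ?_) (put_eq _ _ _ _) hk).mono
      le_rfl ?_
    · have h := (by decide : ∀ a ∈ itemInputs, a ≠ iV ∧ a ∉ iV :: makeItem.mods) a ha
      rw [put_other _ _ _ h.1, hfr a h.2]
    · rintro τ' - ⟨h1, h2⟩ v hv
      rcases Nat.lt_succ_iff_lt_or_eq.1 hv with h | rfl
      · refine (hinv v h).congr fun a ha => ?_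
        rw [h1 a ha v (by
          have : v ≠ k := by omega
          exact_mod_cast this),
          put_other _ _ _ ((by decide : ∀ a ∈ itemArrays, a ≠ iV) a ha)]
      · exact h2

/-- Compute the number of augmentations. -/
def roundsProg : St :=
  .seq (.set rGap (.const 0))
  (.seq (.loop iV (va rItems) (.set rGap (va rGap + (XE.read aCost (va iV)).abs *
      (.read aUp (va iV) - .read aLo (va iV)))))
    (.set rZ (.size (va rGap) * (.const 2 * (va rItems * (va rL + .const 1))))))

/-- `E` is the binary length of Σ|cost|·width, which bounds the difference in value between any two
points of the box. -/
theorem sat_roundsProg {σ : Store} {m L W E : ℕ} (hm : σ rItems 0 = m) (hL : σ rL 0 = L)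
    (hW : ∀ v : ℕ, v < m → |σ aUp v - σ aLo v| ≤ W)
    (hE : E = Nat.size (∑ v ∈ Finset.range m, |σ aCost v| * (σ aUp v - σ aLo v)).toNat) :
    Sat roundsProg σ (500 + m * (400 + 20 * W) + 40 * E + 60 * (m * (L + 1)) + 20 * (L + 1))
      (fun τ => τ rZ 0 = (2 * (m * (L + 1)) * E : ℕ)) := by
  unfold roundsProg
  refine Sat.le (T := 20 + ((9 + 20 + m * ((300 + 20 * W) + 60 + 20)) +
    (400 + 40 * E + 60 * (m * (L + 1)) + 20 * (L + 1)))) (Sat.set_seq (by simp) ?_) (by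
      have h1 : m * ((300 + 20 * W) + 60 + 20) ≤ m * (400 + 20 * W) :=
        Nat.mul_le_mul_left _ (by omega)
      omega)
  rw [eval_const]
  refine Sat.seq (Sat.loop_sum m _ _ (fun v => |σ aCost v| * (σ aUp v - σ aLo v)) (by decide) ?_
    (by simp) ?_) ?_
  · rw [eval_va, put_other _ _ _ (by decide), hm]
  · intro k τ hk hfr
    have h1 : ∀ a, a ≠ iV → a ≠ rGap → put τ iV 0 k a = σ a := fun a ha hb => by
      rw [put_other _ _ _ ha, hfr a ha hb, put_other _ _ _ hb]
    have h2 : (.read aUp (va iV) - .read aLo (va iV) : XE).eval (put τ iV 0 k) =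
        σ aUp k - σ aLo k := by
      rw [eval_sub, eval_read, eval_read, eval_va, put_eq, h1 aUp (by decide) (by decide),
        h1 aLo (by decide) (by decide)]
    constructor
    · rw [eval_mul, h2, eval_abs, eval_read, eval_va, put_eq, h1 aCost (by decide) (by decide)]
    · rw [cost_mul, h2]
      simp only [cost_abs, cost_read, cost_va, cost_sub]
      have h3 := abs_le.1 (hW k hk)
      omega
  intro τ hfr h
  rw [put_eq, zero_add] at h
  have hm' : τ rItems 0 = m := by rw [hfr rItems (by decide), put_other _ _ _ (by decide), hm]
  have hL' : τ rL 0 = L := by rw [hfr rL (by decide), put_other _ _ _ (by decide), hL]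
  have e1 : (va rItems * (va rL + .const 1)).eval τ = ((m * (L + 1) : ℕ) : ℤ) := by
    rw [eval_mul, eval_add, eval_va, eval_va, eval_const, hm', hL']
    push_cast
    rfl
  refine Sat.set ?_ ?_
  · have e2 : (.const 2 * (va rItems * (va rL + .const 1)) : XE).eval τ =
        2 * ((m * (L + 1) : ℕ) : ℤ) := by rw [eval_mul, e1, eval_const]
    rw [cost_mul, cost_mul, cost_size, e2, e1, eval_va, h, ← hE]
    simp only [cost_mul, cost_va, cost_const, cost_add, eval_add, eval_va, eval_const, hL']
    have h1 : ((L : ℤ) + 1).natAbs = L + 1 := by omega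
    have h2 : (2 * ((m * (L + 1) : ℕ) : ℤ)).natAbs = 2 * (m * (L + 1)) := by
      rw [Int.natAbs_mul, Int.natAbs_natCast]
      rfl
    rw [h1, h2, Int.natAbs_natCast]
    omega
  · rw [put_eq, eval_mul, eval_mul, e1, eval_size, eval_va, h, ← hE, eval_const]
    push_cast
    ring

/-- Test whether all slack variables vanish. -/
def slackLoop : St :=
  .loop iV (va rItems) (.ite (.and (.le (.const 1) (.read aSlack (va iV)))
      (.not (.and (.le (.const 0) (.read aX (va iV))) (.le (.read aX (va iV)) (.const 0)))))
    (.set rFlag (.const 1)) .skip)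

/-- Copy the variables of the integer program to the output. -/
def copyLoop : St :=
  .loop iV (dimN * dimT) (.assign arrSol (va iV)
    (.read aX ((va iV / dimT) * (dimT + dimS) + (va iV - (va iV / dimT) * dimT))))

/-- Write the output. -/
def outputProg : St :=
  .seq (.set rFlag (.const 0))
  (.seq slackLoop
  (.seq (.ite (.le (va rFlag) (.const 0)) (.set arrStatus (va arrLPStatus))
      (.set arrStatus (.const 0)))
    copyLoop))

/-- Slack that remains at the end is reported as infeasibility; otherwise the status of the
relaxation is passed on. -/
theorem sat_outputProg {σ : Store} {n r s t m : ℕ} (hd : Dims σ n r s t)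
    (hm : σ rItems 0 = m) :
    Sat outputProg σ (500 + 20 * t + m * 200 + n * t * (500 + 40 * t + 20 * s))
      (fun τ => ((∀ v : ℕ, v < m → 1 ≤ σ aSlack v → σ aX v = 0) →
          τ arrStatus 0 = σ arrLPStatus 0) ∧
        (¬ (∀ v : ℕ, v < m → 1 ≤ σ aSlack v → σ aX v = 0) → τ arrStatus 0 = 0) ∧
        ∀ i < n, ∀ k < t, τ arrSol ((i * t + k : ℕ) : ℤ) = σ aX ((i * (t + s) + k : ℕ) : ℤ)) := by
  unfold outputProg
  refine Sat.le (T := 20 + ((9 + 20 + m * ((100 + 20) + 20)) + ((30 + 20) +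
    ((100 + 20 * t) + 20 + n * t * ((400 + 40 * t + 20 * s) + 20))))) (Sat.set_seq (by simp) ?_) (by
      have h1 : n * t * ((400 + 40 * t + 20 * s) + 20) ≤ n * t * (500 + 40 * t + 20 * s) :=
        Nat.mul_le_mul_left _ (by omega)
      omega)
  rw [eval_const]
  refine Sat.seq (Q₁ := fun τ => (τ rFlag 0 = 0 ∧ ∀ v : ℕ, v < m → 1 ≤ σ aSlack v → σ aX v = 0) ∨
    (τ rFlag 0 = 1 ∧ ¬ ∀ v : ℕ, v < m → 1 ≤ σ aSlack v → σ aX v = 0)) ?_ ?_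
  · refine (Sat.loop (fun k τ => (τ rFlag 0 = 0 ∧ ∀ v : ℕ, v < k → 1 ≤ σ aSlack v → σ aX v = 0) ∨
      (τ rFlag 0 = 1 ∧ ¬ ∀ v : ℕ, v < m → 1 ≤ σ aSlack v → σ aX v = 0)) m (100 + 20) 9 ?_ (by simp)
      ?_ ?_)
    · rw [eval_va, put_other _ _ _ (by decide), hm]
    · exact Or.inl ⟨put_eq _ _ _ _, by omega⟩
    · intro k τ hk hfr hinv
      have e1 : put τ iV 0 k aSlack = σ aSlack := by
        rw [put_other _ _ _ (by decide), hfr aSlack (by decide), put_other _ _ _ (by decide)]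
      have e2 : put τ iV 0 k aX = σ aX := by
        rw [put_other _ _ _ (by decide), hfr aX (by decide), put_other _ _ _ (by decide)]
      have e3 : put τ iV 0 k rFlag = τ rFlag := put_other _ _ _ (by decide)
      refine Sat.ite (by simp) (fun h => Sat.set (by simp) ?_) (fun h => (Sat.skip ?_).le (by omega))
      · simp only [holds_and, holds_le, holds_not, eval_const, eval_read, eval_va, put_eq, e1,
          e2] at h
        refine Or.inr ⟨put_eq _ _ _ _, fun hall => ?_⟩
        have := hall k hk h.1
        omega
      · simp only [holds_and, holds_le, holds_not, eval_const, eval_read, eval_va, put_eq, e1,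
          e2] at h
        rw [e3]
        rcases hinv with ⟨h1, h2⟩ | h1
        · refine Or.inl ⟨h1, fun v hv hsl => ?_⟩
          rcases Nat.lt_succ_iff_lt_or_eq.1 hv with h3 | rfl
          · exact h2 v h3 hsl
          · by_contra h4
            exact h ⟨hsl, fun h5 => h4 (by omega)⟩
        · exact Or.inr h1
  intro τ₁ hfr₁ hflag
  have hlp : τ₁ arrLPStatus = σ arrLPStatus := by
    rw [hfr₁ arrLPStatus (by decide), put_other _ _ _ (by decide)]
  refine Sat.seq (Q₁ := fun τ => ((∀ v : ℕ, v < m → 1 ≤ σ aSlack v → σ aX v = 0) →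
      τ arrStatus 0 = σ arrLPStatus 0) ∧
      (¬ (∀ v : ℕ, v < m → 1 ≤ σ aSlack v → σ aX v = 0) → τ arrStatus 0 = 0))
    (Sat.ite (by simp) (fun h => Sat.set (by simp) ?_) (fun h => Sat.set (by simp) ?_)) ?_
  · simp only [holds_le, eval_va, eval_const] at h
    rw [put_eq, eval_va, hlp]
    rcases hflag with ⟨_, h1⟩ | ⟨h1, _⟩
    · exact ⟨fun _ => rfl, fun h2 => absurd h1 h2⟩
    · omega
  · simp only [holds_le, eval_va, eval_const] at h
    rw [put_eq, eval_const]
    rcases hflag with ⟨h1, _⟩ | ⟨_, h1⟩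
    · omega
    · exact ⟨fun h2 => absurd h2 h1, fun _ => rfl⟩
  intro τ₂ hfr₂ hst
  have hf₂ : ∀ a, a ≠ rFlag → a ≠ iV → a ≠ arrStatus → τ₂ a = σ a := fun a h1 h2 h3 => by
    rw [hfr₂ a (by simp [St.mods, St.set, h3]), hfr₁ a (by
      simp [slackLoop, St.mods, St.set, h1, h2]), put_other _ _ _ h1]
  have hd₂ := hd.congr (hf₂ arrDim (by decide) (by decide) (by decide))
  refine (Sat.loop (fun j τ => ∀ p : ℕ, p < j → ∀ i < n, ∀ k < t, p = i * t + k →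
    τ arrSol p = σ aX ((i * (t + s) + k : ℕ) : ℤ)) (n * t) _ _ ?_ ?_ (by omega) ?_).mono le_rfl ?_
  · rw [eval_mul, hd₂.dimN, hd₂.dimT]
    push_cast
    rfl
  · simp [hd₂.dimT]
    omega
  · intro p τ hp hfr hinv
    have hd₃ := (hd₂.congr (hfr arrDim (by decide))).put (a := iV) 0 p (by decide)
    refine Sat.assign _ _ _ _ _ _ ?_ ?_
    · simp only [cost_va, cost_read, cost_add, cost_sub, cost_mul, cost_div, cost_dimT, cost_dimS,
        eval_add, hd₃.dimT, hd₃.dimS]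
      have h1 : ((t : ℤ) + s).natAbs = t + s := by omega
      rw [h1, Int.natAbs_natCast]
      omega
    · intro q hq i hi k hk hqik
      rw [eval_va, put_eq]
      rcases Nat.lt_succ_iff_lt_or_eq.1 hq with h | rfl
      · rw [put_ne_idx _ _ _ _ (by
          have : q ≠ p := by omega
          exact_mod_cast this), put_other _ _ _ (by decide)]
        exact hinv q h i hi k hk hqik
      · have ht : 0 < t := by omega
        obtain ⟨h1, h2⟩ := (Nat.div_mod_unique ht).2
          ⟨(by rw [hqik]; ring : k + t * i = q), hk⟩
        have h3 : ((q : ℤ) / t) = i := by exact_mod_cast h1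
        rw [put_eq, eval_read, eval_add, eval_mul, eval_sub, eval_mul, eval_add, eval_div, eval_va,
          put_eq, hd₃.dimT, hd₃.dimS, h3, put_other _ _ _ (by decide), hfr aX (by decide),
          hf₂ aX (by decide) (by decide) (by decide)]
        congr 1
        rw [hqik]
        push_cast
        ring
  · intro τ hfr h
    rw [hfr arrStatus (by decide)]
    exact ⟨hst.1, hst.2, fun i hi k hk => h (i * t + k) (by nlinarith) i hi k hk rfl⟩

/-! ## The extended system with slack variables -/

theorem sum_range_mul_add (n w : ℕ) (f : ℕ → ℤ) :
    ∑ v ∈ Finset.range (n * w), f v = ∑ i ∈ Finset.range n, ∑ k ∈ Finset.range w, f (i * w + k) := by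
  induction n with
  | zero => simp
  | succ n ih => rw [Nat.succ_mul, Finset.sum_range_add, ih, Finset.sum_range_succ]

theorem sum_items (n r s t : ℕ) (f : ℕ → ℤ) :
    ∑ v ∈ Finset.range (itemCount n r s t), f v =
      ∑ i ∈ Finset.range n, (∑ k ∈ Finset.range t, f (i * (t + s) + k) +
        ∑ j ∈ Finset.range s, f (i * (t + s) + (t + j))) +
      ∑ j ∈ Finset.range r, f (n * (t + s) + j) := by
  rw [itemCount, Finset.sum_range_add, sum_range_mul_add]
  simp only [Finset.sum_range_add]

theorem item_cases {n r s t v : ℕ} (hv : v < itemCount n r s t) :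
    (∃ i < n, ∃ k < t, v = i * (t + s) + k) ∨ (∃ i < n, ∃ j < s, v = i * (t + s) + (t + j)) ∨
      ∃ j < r, v = n * (t + s) + j := by
  unfold itemCount at hv
  by_cases h : v < n * (t + s)
  · have hw : 0 < t + s := Nat.pos_of_ne_zero fun h0 => by
      rw [h0] at h
      omega
    have h1 := Nat.div_add_mod v (t + s)
    have h2 := Nat.mod_lt v hw
    have h3 : v / (t + s) < n := Nat.div_lt_of_lt_mul (by rwa [mul_comm])
    rw [mul_comm] at h1
    by_cases h4 : v % (t + s) < t
    · exact Or.inl ⟨_, h3, _, h4, h1.symm⟩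
    · exact Or.inr (Or.inl ⟨_, h3, v % (t + s) - t, by omega, by omega⟩)
  · exact Or.inr (Or.inr ⟨v - n * (t + s), by omega, by omega⟩)

/-- The column of the item `v` in the top part. -/
def colA (σ : Store) (n r s t v : ℕ) (j : Fin r) : ℤ :=
  if v < n * (t + s) then
    if v % (t + s) < t then σ arrA (((v / (t + s) * t + v % (t + s)) * r + j : ℕ) : ℤ) else 0
  else if v = n * (t + s) + j then 1 else 0

/-- The column of the item `v` in its block. -/
def colB (σ : Store) (n s t v : ℕ) (j : Fin s) : ℤ :=
  if v < n * (t + s) then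
    if v % (t + s) < t then σ arrB (((v / (t + s) * t + v % (t + s)) * s + j : ℕ) : ℤ)
    else if v % (t + s) = t + j then 1 else 0
  else 0

section Columns

variable {σ τ : Store} {n r s t D i k : ℕ}

theorem div_mod_item {w : ℕ} (hk : k < w) : (i * w + k) / w = i ∧ (i * w + k) % w = k :=
  (Nat.div_mod_unique (by omega)).2 ⟨by ring, hk⟩

theorem item_lt {w : ℕ} (hi : i < n) (hk : k < w) : i * w + k < n * w := by
  have := Nat.mul_le_mul_right w hi
  rw [Nat.succ_mul] at this
  omega

theorem colA_var (hi : i < n) (hk : k < t) (j : Fin r) :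
    colA σ n r s t (i * (t + s) + k) j = σ arrA (((i * t + k) * r + j : ℕ) : ℤ) := by
  obtain ⟨h1, h2⟩ := div_mod_item (i := i) (w := t + s) (k := k) (by omega)
  rw [colA, if_pos (item_lt hi (by omega)), h1, h2, if_pos hk]

theorem colA_block {j' : ℕ} (hi : i < n) (hj : j' < s) (j : Fin r) :
    colA σ n r s t (i * (t + s) + (t + j')) j = 0 := by
  obtain ⟨h1, h2⟩ := div_mod_item (i := i) (w := t + s) (k := t + j') (by omega)
  rw [colA, if_pos (item_lt hi (by omega)), h1, h2, if_neg (by omega)]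

theorem colA_top (j' : ℕ) (j : Fin r) :
    colA σ n r s t (n * (t + s) + j') j = if j' = j then 1 else 0 := by
  rw [colA, if_neg (by omega)]
  simp

theorem colB_var (hi : i < n) (hk : k < t) (j : Fin s) :
    colB σ n s t (i * (t + s) + k) j = σ arrB (((i * t + k) * s + j : ℕ) : ℤ) := by
  obtain ⟨h1, h2⟩ := div_mod_item (i := i) (w := t + s) (k := k) (by omega)
  rw [colB, if_pos (item_lt hi (by omega)), h1, h2, if_pos hk]

theorem colB_block {j' : ℕ} (hi : i < n) (hj : j' < s) (j : Fin s) :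
    colB σ n s t (i * (t + s) + (t + j')) j = if j' = j then 1 else 0 := by
  obtain ⟨h1, h2⟩ := div_mod_item (i := i) (w := t + s) (k := t + j') (by omega)
  rw [colB, if_pos (item_lt hi (by omega)), h2, if_neg (by omega)]
  simp

theorem colB_top {v : ℕ} (hv : n * (t + s) ≤ v) (j : Fin s) : colB σ n s t v j = 0 := by
  rw [colB, if_neg (by omega)]

theorem abs_colA_le (hE : MaxEntry σ n r s t D) (v : ℕ) (j : Fin r) :
    |colA σ n r s t v j| ≤ (D : ℤ) := by
  have h1 : (1 : ℤ) ≤ D := by exact_mod_cast hE.one_le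
  unfold colA
  split_ifs with h2 h3 h4
  · refine hE.entryA _ ?_
    have hp : v / (t + s) * t + v % (t + s) < n * t := item_lt (Nat.div_lt_of_lt_mul (by
      rwa [mul_comm])) h3
    exact item_lt hp j.2
  all_goals simp
  all_goals omega

theorem abs_colB_le (hE : MaxEntry σ n r s t D) (v : ℕ) (j : Fin s) :
    |colB σ n s t v j| ≤ (D : ℤ) := by
  have h1 : (1 : ℤ) ≤ D := by exact_mod_cast hE.one_le
  unfold colB
  split_ifs with h2 h3 h4
  · refine hE.entryB _ ?_
    have hp : v / (t + s) * t + v % (t + s) < n * t := item_lt (Nat.div_lt_of_lt_mul (by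
      rwa [mul_comm])) h3
    exact item_lt hp j.2
  all_goals simp
  all_goals omega

theorem le_shortBound (r : ℕ) (hs : 0 < s) (D : ℕ) : D ≤ shortBound r s D := by
  have h1 : 2 * s * D + 1 ≤ (2 * s * D + 1) ^ s := Nat.le_self_pow hs.ne' _
  have h2 : 1 ≤ (2 * r * (D * (2 * s * D + 1) ^ s) + 1) ^ r := Nat.one_le_pow _ _ (by omega)
  have h3 : D ≤ s * D := Nat.le_mul_of_pos_left D hs
  calc D ≤ 2 * s * D + 1 := by nlinarith
    _ ≤ (2 * s * D + 1) ^ s * 1 := by omega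
    _ ≤ shortBound r s D := Nat.mul_le_mul_left _ h2

theorem one_le_shortBound (r s D : ℕ) : 1 ≤ shortBound r s D := by
  unfold shortBound
  have h1 : 1 ≤ (2 * s * D + 1) ^ s := Nat.one_le_pow _ _ (by omega)
  have h2 : 1 ≤ (2 * r * (D * (2 * s * D + 1) ^ s) + 1) ^ r := Nat.one_le_pow _ _ (by omega)
  nlinarith

/-- Appending identity columns for the slacks keeps the block structure, with bricks of width `t +
s` followed by `r` columns outside the blocks. Entries stay at most `D` because `D` is at least 1,
so the extended system has the same bound on short kernel vectors. -/
theorem coding_items (hr : 0 < r) (hs : 0 < s) (hP : Params σ n r s t D)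
    (hI : ∀ v < itemCount n r s t, ItemOK σ n r s t v τ) :
    Coding n (t + s) (itemCount n r s t) r s (colA σ n r s t) (colB σ n s t) D (shortBound r s D)
      (codeBase r s D) (fun v => τ aDel v) (fun v => τ aMd v) := by
  have hvar : ∀ i < n, ∀ k < t, i * (t + s) + k < itemCount n r s t := fun i hi k hk => by
    have := item_lt hi (by omega : k < t + s)
    unfold itemCount
    omega
  have hblock : ∀ i < n, ∀ j < s, i * (t + s) + (t + j) < itemCount n r s t := fun i hi j hj => by
    have := item_lt hi (by omega : t + j < t + s)
    unfold itemCount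
    omega
  have htop : ∀ j < r, n * (t + s) + j < itemCount n r s t := fun j hj => by
    unfold itemCount
    omega
  constructor
  · omega
  · unfold itemCount
    omega
  · exact abs_colA_le hP.entries
  · exact abs_colB_le hP.entries
  · exact fun v hv j => colB_top hv j
  · rw [codeBase]
    push_cast
    rfl
  · exact hP.entries.one_le
  · exact one_le_shortBound r s D
  · intro v hv
    rcases item_cases hv with ⟨i, hi, k, hk, rfl⟩ | ⟨i, hi, j, hj, rfl⟩ | ⟨j, hj, rfl⟩
    · simp only [colA_var hi hk, colB_var hi hk]
      rw [((hI _ hv).var i hi k hk rfl).del, Finset.sum_range, Finset.sum_range, Finset.mul_sum]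
      congr 1
      · refine Finset.sum_congr rfl fun j _ => ?_
        rw [hP.pow j (by omega)]
        ring
      · refine Finset.sum_congr rfl fun j _ => ?_
        rw [hP.pow (s + j) (by omega), pow_add]
        ring
    · simp only [colA_block hi hj, colB_block hi hj]
      rw [((hI _ hv).block i hi j hj rfl).del, hP.pow j (by omega),
        Finset.sum_eq_single ⟨j, hj⟩]
      · simp
      · intro b _ hb
        rw [if_neg (fun h => hb (Fin.ext h.symm)), zero_mul]
      · simp
    · simp only [colA_top, colB_top (by omega : n * (t + s) ≤ n * (t + s) + j)]
      rw [((hI _ hv).top j hj rfl).del, hP.pow (s + j) (by omega), pow_add,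
        Finset.sum_eq_single (s := (Finset.univ : Finset (Fin r))) ⟨j, hj⟩]
      · simp
      · intro b _ hb
        rw [if_neg (fun h => hb (Fin.ext h.symm)), zero_mul]
      · simp
  · intro v hv
    rcases item_cases hv with ⟨i, hi, k, hk, rfl⟩ | ⟨i, hi, j, hj, rfl⟩ | ⟨j, hj, rfl⟩
    · exact Or.inl ((hI _ hv).var i hi k hk rfl).md
    · have h := ((hI _ hv).block i hi j hj rfl).md
      by_cases hjs : s ≤ j + 1
      · rw [if_pos hjs, hP.pow s (by omega)] at h
        refine Or.inr (Or.inl ⟨i, hi, ?_, h⟩)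
        rw [add_mul, one_mul]
        omega
      · rw [if_neg hjs] at h
        exact Or.inl h
    · have h := ((hI _ hv).top j hj rfl).md
      by_cases hjr : r ≤ j + 1
      · rw [if_pos hjr, hP.reg_Q] at h
        refine Or.inr (Or.inr ⟨?_, h⟩)
        unfold itemCount
        omega
      · rw [if_neg hjr] at h
        exact Or.inl h
  · intro i hi
    have hj : s - 1 < s := by omega
    have h := ((hI _ (hblock i hi _ hj)).block i hi _ hj rfl).md
    rw [if_pos (by omega), hP.pow s (by omega)] at h
    have e : (i + 1) * (t + s) - 1 = i * (t + s) + (t + (s - 1)) := by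
      rw [add_mul, one_mul]
      omega
    rw [e]
    exact h
  · have hj : r - 1 < r := by omega
    have h := ((hI _ (htop _ hj)).top _ hj rfl).md
    rw [if_pos (by omega), hP.reg_Q] at h
    have e : itemCount n r s t - 1 = n * (t + s) + (r - 1) := by
      unfold itemCount
      omega
    rw [e]
    exact h

/-- The rows of the extended system. -/
abbrev itemRows (σ : Store) (n r s t : ℕ) : Fin r ⊕ ℕ × Fin s → Fin (itemCount n r s t) → ℤ :=
  blockRows (fun v : Fin (itemCount n r s t) => colA σ n r s t v)
    (fun v : Fin (itemCount n r s t) => colB σ n s t v)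
    (fun v : Fin (itemCount n r s t) => (v : ℕ) / (t + s))

/-- The kernel of the extended system. -/
theorem inKer_itemRows (y : ℕ → ℤ) :
    InKer (itemRows σ n r s t) (fun v : Fin (itemCount n r s t) => y v) ↔
      (∀ j < r, ∑ i ∈ Finset.range n, ∑ k ∈ Finset.range t,
        σ arrA (((i * t + k) * r + j : ℕ) : ℤ) * y (i * (t + s) + k) + y (n * (t + s) + j) = 0) ∧
      ∀ i < n, ∀ j < s, ∑ k ∈ Finset.range t,
        σ arrB (((i * t + k) * s + j : ℕ) : ℤ) * y (i * (t + s) + k) +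
          y (i * (t + s) + (t + j)) = 0 := by
  have hA : ∀ j : Fin r, ∑ v : Fin (itemCount n r s t), colA σ n r s t v j * y v =
      ∑ i ∈ Finset.range n, ∑ k ∈ Finset.range t,
        σ arrA (((i * t + k) * r + j : ℕ) : ℤ) * y (i * (t + s) + k) + y (n * (t + s) + j) := by
    intro j
    rw [Fin.sum_univ_eq_sum_range (fun v => colA σ n r s t v j * y v), sum_items]
    congr 1
    · refine Finset.sum_congr rfl fun i hi => ?_
      have hi' := Finset.mem_range.1 hi
      rw [Finset.sum_eq_zero (s := Finset.range s) (fun j' hj' => by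
        rw [colA_block hi' (Finset.mem_range.1 hj'), zero_mul]), add_zero]
      exact Finset.sum_congr rfl fun k hk => by rw [colA_var hi' (Finset.mem_range.1 hk)]
    · rw [Finset.sum_eq_single (j : ℕ)]
      · rw [colA_top, if_pos rfl, one_mul]
      · intro b _ hb
        rw [colA_top, if_neg hb, zero_mul]
      · intro h
        exact absurd (Finset.mem_range.2 j.2) h
  have hB : ∀ (i : ℕ) (j : Fin s), ∑ v : Fin (itemCount n r s t),
      (if (v : ℕ) / (t + s) = i then colB σ n s t v j else 0) * y v =
      if i < n then ∑ k ∈ Finset.range t,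
        σ arrB (((i * t + k) * s + j : ℕ) : ℤ) * y (i * (t + s) + k) +
          y (i * (t + s) + (t + j)) else 0 := by
    intro i j
    rw [Fin.sum_univ_eq_sum_range
      (fun v => (if v / (t + s) = i then colB σ n s t v j else 0) * y v), sum_items]
    rw [Finset.sum_eq_zero (s := Finset.range r) (fun j' hj' => by
      rw [colB_top (by omega), ite_self, zero_mul]), add_zero]
    have hterm : ∀ i' ∈ Finset.range n,
        (∑ k ∈ Finset.range t, (if (i' * (t + s) + k) / (t + s) = i then
            colB σ n s t (i' * (t + s) + k) j else 0) * y (i' * (t + s) + k) +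
          ∑ j' ∈ Finset.range s, (if (i' * (t + s) + (t + j')) / (t + s) = i then
            colB σ n s t (i' * (t + s) + (t + j')) j else 0) * y (i' * (t + s) + (t + j'))) =
        if i' = i then ∑ k ∈ Finset.range t,
          σ arrB (((i * t + k) * s + j : ℕ) : ℤ) * y (i * (t + s) + k) +
          y (i * (t + s) + (t + j)) else 0 := by
      intro i' hi'
      have hi'' := Finset.mem_range.1 hi'
      by_cases h : i' = i
      · subst h
        rw [if_pos rfl]
        congr 1
        · refine Finset.sum_congr rfl fun k hk => ?_
          have hk' := Finset.mem_range.1 hk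
          rw [(div_mod_item (by omega)).1, if_pos rfl, colB_var hi'' hk']
        · rw [Finset.sum_eq_single (j : ℕ)]
          · rw [(div_mod_item (by omega)).1, if_pos rfl, colB_block hi'' j.2, if_pos rfl, one_mul]
          · intro b hb hbj
            have hb' := Finset.mem_range.1 hb
            rw [(div_mod_item (by omega)).1, if_pos rfl, colB_block hi'' hb', if_neg hbj, zero_mul]
          · intro h
            exact absurd (Finset.mem_range.2 j.2) h
      · rw [if_neg h, Finset.sum_eq_zero, Finset.sum_eq_zero, add_zero]
        · intro j' hj'
          have hj'' := Finset.mem_range.1 hj'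
          rw [(div_mod_item (by omega)).1, if_neg h, zero_mul]
        · intro k hk
          have hk' := Finset.mem_range.1 hk
          rw [(div_mod_item (by omega)).1, if_neg h, zero_mul]
    rw [Finset.sum_congr rfl hterm]
    simp
  constructor
  · intro h
    refine ⟨fun j hj => ?_, fun i hi j hj => ?_⟩
    · have h1 := h (Sum.inl ⟨j, hj⟩)
      simp only [blockRows, Int.cast_id] at h1
      rwa [hA] at h1
    · have h1 := h (Sum.inr (i, ⟨j, hj⟩))
      simp only [blockRows, Int.cast_id] at h1
      rwa [hB, if_pos hi] at h1
  · rintro ⟨h1, h2⟩ (j | ⟨i, j⟩)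
    · simp only [blockRows, Int.cast_id]
      rw [hA]
      exact h1 j j.2
    · simp only [blockRows, Int.cast_id]
      rw [hB]
      split_ifs with hi
      · exact h2 i hi j j.2
      · rfl

end Columns

/-! ### Integer points near the LP solution, and unboundedness. -/

namespace NFoldIP

variable {n r s t : ℕ} {I : NFoldIP n r s t}

theorem feasible_iff {R : Type} [CommRing R] [LinearOrder R] (x : Fin n × Fin t → R) :
    I.Feasible x ↔ (∀ row, ∑ v, (I.matrix row v : R) * x v = I.b row) ∧
      (∀ v, ∀ z : ℤ, I.l v = (z : WithBot ℤ) → (z : R) ≤ x v) ∧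
      (∀ v, ∀ z : ℤ, I.u v = (z : WithTop ℤ) → x v ≤ (z : R)) := by
  unfold Feasible
  refine and_congr ⟨fun h row => ?_, fun h => ?_⟩ Iff.rfl
  · exact congrFun h row
  · funext row
    exact h row

theorem inKer_sub {R : Type} [CommRing R] [LinearOrder R] {x y : Fin n × Fin t → R}
    (hx : I.Feasible x) (hy : I.Feasible y) :
    InKer (fun row v => I.matrix row v) (fun v => x v - y v) := by
  intro row
  simp only [mul_sub, Finset.sum_sub_distrib]
  rw [((feasible_iff x).1 hx).1 row, ((feasible_iff y).1 hy).1 row, sub_self]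

/-- Adding a kernel element that stays between two feasible points preserves feasibility. -/
theorem Feasible.add {R : Type} [CommRing R] [LinearOrder R] [IsStrictOrderedRing R]
    {x y g : Fin n × Fin t → R} (hx : I.Feasible x) (hy : I.Feasible y)
    (hg : InKer (fun row v => I.matrix row v) g) (hc : Conf g (fun v => y v - x v)) :
    I.Feasible (fun v => x v + g v) := by
  rw [feasible_iff] at *
  refine ⟨fun row => ?_, fun v z hz => ?_, fun v z hz => ?_⟩
  · simp only [mul_add, Finset.sum_add_distrib]
    rw [hx.1 row, hg row, add_zero]
  · have h1 := hx.2.1 v z hz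
    have h2 := hy.2.1 v z hz
    rcases hc v with h | h <;> linarith [h.1, h.2]
  · have h1 := hx.2.2 v z hz
    have h2 := hy.2.2 v z hz
    rcases hc v with h | h <;> linarith [h.1, h.2]

theorem Feasible.intCast {x : Fin n × Fin t → ℤ} (hx : I.Feasible x) :
    I.Feasible (fun v => (x v : ℝ)) := by
  rw [feasible_iff] at *
  refine ⟨fun row => ?_, fun v z hz => ?_, fun v z hz => ?_⟩
  · have h := hx.1 row
    simp only [Int.cast_id] at h
    exact_mod_cast h
  · have h := hx.2.1 v z hz
    simp only [Int.cast_id] at h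
    exact_mod_cast h
  · have h := hx.2.2 v z hz
    simp only [Int.cast_id] at h
    exact_mod_cast h

theorem Feasible.of_intCast {x : Fin n × Fin t → ℤ} (hx : I.Feasible (fun v => (x v : ℝ))) :
    I.Feasible x := by
  rw [feasible_iff] at *
  refine ⟨fun row => ?_, fun v z hz => ?_, fun v z hz => ?_⟩
  · have h := hx.1 row
    simp only [Int.cast_id]
    exact_mod_cast h
  · have h := hx.2.1 v z hz
    simp only [Int.cast_id]
    exact_mod_cast h
  · have h := hx.2.2 v z hz
    simp only [Int.cast_id]
    exact_mod_cast h

theorem objective_add {R : Type} [CommRing R] (x y : Fin n × Fin t → R) :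
    I.objective (fun v => x v + y v) = I.objective x + I.objective y := by
  simp only [objective, mul_add, Finset.sum_add_distrib]

theorem shortKernel_matrix {D : ℕ} (h : I.EntriesLE D) :
    ShortKernel (fun row v => I.matrix row v) (shortBound r s D) := by
  have h1 := shortKernel_blockRows (fun (v : Fin n × Fin t) (j : Fin r) => I.A v.1 j v.2)
    (fun v j => I.B v.1 j v.2) (fun v => v.1) D (fun v j => h.1 _ _ _) (fun v j => h.2 _ _ _)
  have h2 : (fun row v => I.matrix row v) = blockRows
      (fun (v : Fin n × Fin t) (j : Fin r) => I.A v.1 j v.2)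
      (fun v j => I.B v.1 j v.2) (fun v => v.1) := by
    funext row v
    rcases row with j | ⟨i, j⟩
    · rfl
    · simp only [matrix, Matrix.of_apply, blockRows]
      by_cases hi : i = v.1
      · subst hi
        simp
      · rw [if_neg hi, if_neg (fun h => hi h.symm)]
  rw [h2]
  exact h1

theorem abs_matrix_le {D : ℕ} (h : I.EntriesLE D) (row : Fin r ⊕ Fin n × Fin s)
    (v : Fin n × Fin t) : |I.matrix row v| ≤ (D : ℤ) := by
  rcases row with j | ⟨i, j⟩
  · exact h.1 _ _ _
  · simp only [matrix, Matrix.of_apply]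
    split_ifs
    · exact h.2 _ _ _
    · simp

/-- Close to a solution of the LP relaxation there is an integer solution, if there is one at all;
it is at least as good if the solution of the relaxation is optimal. -/
theorem exists_near {D : ℕ} (hD : I.EntriesLE D) {code : ℤ} {x : Fin n × Fin t → ℝ}
    (hx : I.Solved code x) {z : Fin n × Fin t → ℤ} (hz : I.Feasible z) (h0 : code ≠ 0) :
    ∃ z' : Fin n × Fin t → ℤ, I.Feasible z' ∧
      (∀ v, |(z' v : ℝ) - x v| ≤ n * t * shortBound r s D) ∧
      (code = 2 → I.objective z ≤ I.objective z') := by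
  have hfeas : I.Feasible x := by
    rcases hx with h | h | h
    · exact absurd h.1 h0
    · exact h.2.1
    · exact h.2.1
  -- If the relaxation is unbounded, its solution is merely feasible and the zero objective is used:
  -- then only the distance matters.
  obtain ⟨c, hc, hopt⟩ : ∃ c : Fin n × Fin t → ℤ, (code = 2 → c = I.c) ∧
      ∀ y : Fin n × Fin t → ℝ, InKer (fun row v => I.matrix row v) y →
        Conf y (fun v => (z v : ℝ) - x v) → ∑ v, (c v : ℝ) * y v ≤ 0 := by
    rcases hx with h | h | h
    · exact absurd h.1 h0
    · exact ⟨0, fun h2 => by rw [h.1] at h2; norm_num at h2, fun y _ _ => by simp⟩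
    · refine ⟨I.c, fun _ => rfl, fun y hy hconf => ?_⟩
      have h1 := h.2.2 _ (hfeas.add hz.intCast hy hconf)
      rw [objective_add] at h1
      have : I.objective y ≤ 0 := by linarith
      exact this
  obtain ⟨z', h1, h2, h3, h4⟩ := (shortKernel_matrix hD).proximity x z
    (inKer_sub hz.intCast hfeas) c hopt
  refine ⟨z', ?_, fun v => ?_, fun h => ?_⟩
  · have h5 := hfeas.add hz.intCast h1 h2
    simp only [add_sub_cancel] at h5
    exact h5.of_intCast
  · have h5 := h3 v
    rw [Fintype.card_prod, Fintype.card_fin, Fintype.card_fin] at h5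
    push_cast at h5
    exact h5
  · rw [hc h] at h4
    simpa [objective] using h4

/-- If the LP relaxation is unbounded, then so is the integer program, if it is feasible. -/
theorem exists_better {D : ℕ} (hD : I.EntriesLE D) {z : Fin n × Fin t → ℤ} (hz : I.Feasible z)
    (hunb : ∀ K : ℝ, ∃ y : Fin n × Fin t → ℝ, I.Feasible y ∧ K < I.objective y) (K : ℤ) :
    ∃ y : Fin n × Fin t → ℤ, I.Feasible y ∧ K < I.objective y := by
  -- The threshold makes `y - z` valuable enough for `exists_large` to yield a kernel vector that
  -- gains more than `K - I.objective z`.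
  obtain ⟨y, hy, hyK⟩ := hunb (Fintype.card (Fin n × Fin t) * ((K - I.objective z : ℤ) : ℝ) +
    (∑ v, |(I.c v : ℝ)|) * (Fintype.card (Fin n × Fin t) * shortBound r s D) +
    I.objective (fun v => (z v : ℝ)))
  have hobj : I.objective y = I.objective (fun v => (z v : ℝ)) + ∑ v, (I.c v : ℝ) * (y v - z v) := by
    simp only [objective, mul_sub, Finset.sum_sub_distrib]
    ring
  obtain ⟨w, h1, h2, h3⟩ := (shortKernel_matrix hD).exists_large (fun v => y v - z v)
    (inKer_sub hy hz.intCast) I.c (K - I.objective z) (by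
      rw [hobj] at hyK
      linarith)
  refine ⟨fun v => z v + w v, ?_, ?_⟩
  · have h4 := hz.intCast.add hy h1.intCast h2
    refine Feasible.of_intCast ?_
    simpa using h4
  · rw [objective_add]
    have : I.objective w = ∑ v, I.c v * w v := by simp [objective]
    omega

end NFoldIP

/-! ### The rounded LP solution as a feasible point of the extended system. -/

namespace NFoldIP

variable {n r s t : ℕ} {I : NFoldIP n r s t} {σ τ : Store} {D : ℕ}

/-- The store `σ` contains the instance, a solution of its LP relaxation and the parameters,
and `τ` contains the items. -/
structure Prepared (I : NFoldIP n r s t) (σ τ : Store) (D : ℕ) : Prop where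
  r_pos : 0 < r
  s_pos : 0 < s
  loaded : I.Loaded σ
  lp : I.LPOutput σ
  status : σ arrLPStatus 0 ≠ 0
  params : Params σ n r s t D
  items : ∀ v < itemCount n r s t, ItemOK σ n r s t v τ

/-- The position of a variable among the items. -/
def itemPos (s : ℕ) (v : Fin n × Fin t) : ℕ := v.1 * (t + s) + v.2

/-- The entry of the rounded solution of the LP relaxation. -/
def lpRound (σ : Store) (v : Fin n × Fin t) : ℤ :=
  σ arrLPNum (varPos v : ℤ) / σ arrLPDen (varPos v : ℤ)

/-- The solution of the LP relaxation. -/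
noncomputable def lpSol (σ : Store) (v : Fin n × Fin t) : ℝ :=
  (σ arrLPNum (varPos v : ℤ) : ℝ) / (σ arrLPDen (varPos v : ℤ) : ℝ)

theorem varPos_lt (v : Fin n × Fin t) : varPos v < n * t := item_lt v.1.2 v.2.2

theorem itemPos_lt (r s : ℕ) (v : Fin n × Fin t) : itemPos s v < itemCount n r s t := by
  have := item_lt v.1.2 (Nat.lt_of_lt_of_le v.2.2 (Nat.le_add_right t s))
  unfold itemPos itemCount
  omega

theorem sum_rows_top (h : I.Loaded σ) (z : ℕ → ℤ) (f : ℕ → ℕ → ℕ) (j : Fin r) :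
    ∑ v, I.matrix (Sum.inl j) v * z (f v.1 v.2) = ∑ i ∈ Finset.range n, ∑ k ∈ Finset.range t,
      σ arrA (((i * t + k) * r + j : ℕ) : ℤ) * z (f i k) := by
  rw [Fintype.sum_prod_type, Finset.sum_range]
  refine Finset.sum_congr rfl fun i _ => ?_
  rw [Finset.sum_range]
  refine Finset.sum_congr rfl fun k _ => ?_
  have := h.block_A i j k
  rw [varPos] at this
  rw [this]
  rfl

theorem sum_rows_block (h : I.Loaded σ) (z : ℕ → ℤ) (f : ℕ → ℕ → ℕ) (i : Fin n) (j : Fin s) :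
    ∑ v, I.matrix (Sum.inr (i, j)) v * z (f v.1 v.2) = ∑ k ∈ Finset.range t,
      σ arrB (((i * t + k) * s + j : ℕ) : ℤ) * z (f i k) := by
  rw [Fintype.sum_prod_type, Finset.sum_eq_single i]
  · rw [Finset.sum_range]
    refine Finset.sum_congr rfl fun k _ => ?_
    have := h.block_B i j k
    rw [varPos] at this
    rw [this]
    simp [matrix]
  · intro i' _ hi'
    refine Finset.sum_eq_zero fun k _ => ?_
    simp [matrix, hi'.symm]
  · simp

theorem mul_le_radius (n r s t D : ℕ) :
    n * t * shortBound r s D + 1 ≤ radius n r s t D := by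
  unfold radius itemCount
  have : n * t ≤ n * (t + s) + r := by nlinarith
  have := Nat.mul_le_mul_right (shortBound r s D) this
  omega

theorem forall_items {p : ℕ → Prop} (h1 : ∀ v : Fin n × Fin t, p (itemPos s v))
    (h2 : ∀ (i : Fin n) (j : Fin s), p (i * (t + s) + (t + j)))
    (h3 : ∀ j : Fin r, p (n * (t + s) + j)) : ∀ v < itemCount n r s t, p v := by
  intro v hv
  rcases item_cases hv with ⟨i, hi, k, hk, rfl⟩ | ⟨i, hi, j, hj, rfl⟩ | ⟨j, hj, rfl⟩
  · exact h1 (⟨i, hi⟩, ⟨k, hk⟩)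
  · exact h2 ⟨i, hi⟩ ⟨j, hj⟩
  · exact h3 ⟨j, hj⟩

namespace Prepared

theorem var (H : Prepared I σ τ D) (v : Fin n × Fin t) : VarItem σ r s (itemPos s v) (varPos v) τ :=
  (H.items _ (itemPos_lt r s v)).var v.1 v.1.2 v.2 v.2.2 rfl

theorem block (H : Prepared I σ τ D) (i : Fin n) (j : Fin s) :
    SlackItem σ (i * (t + s) + (t + j)) (σ aPow (j : ℕ))
      (if s ≤ j + 1 then σ aPow s else 1) (blockRes σ r s t i j) τ := by
  refine (H.items _ ?_).block i i.2 j j.2 rfl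
  have := item_lt i.2 (by omega : t + (j : ℕ) < t + s)
  unfold itemCount
  omega

theorem top (H : Prepared I σ τ D) (j : Fin r) :
    SlackItem σ (n * (t + s) + j) (σ aPow ((s + j : ℕ) : ℤ))
      (if r ≤ j + 1 then σ rQ 0 else 1) (topRes σ n r t j) τ := by
  refine (H.items _ ?_).top j j.2 rfl
  unfold itemCount
  omega

theorem entriesLE (H : Prepared I σ τ D) : I.EntriesLE D := by
  constructor
  · intro i j k
    rw [← H.loaded.block_A i j k]
    exact H.params.entries.entryA _ (item_lt (varPos_lt (i, k)) j.2)
  · intro i j k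
    rw [← H.loaded.block_B i j k]
    exact H.params.entries.entryB _ (item_lt (varPos_lt (i, k)) j.2)

theorem topRes_eq (H : Prepared I σ τ D) (j : Fin r) :
    topRes σ n r t j = I.b (Sum.inl j) - ∑ v, I.matrix (Sum.inl j) v * lpRound σ v := by
  have h1 := sum_rows_top H.loaded (fun p : ℕ => σ arrLPNum p / σ arrLPDen p)
    (fun i k => i * t + k) j
  have h2 : ∀ v : Fin n × Fin t, lpRound σ v = (fun p : ℕ => σ arrLPNum p / σ arrLPDen p)
      ((fun i k => i * t + k) (v.1 : ℕ) (v.2 : ℕ)) := fun v => rfl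
  simp only [h2]
  rw [h1, topRes, sum_range_mul_add n t (fun k : ℕ => σ arrLPNum k / σ arrLPDen k *
    (0 - σ arrA ((k * r + j : ℕ) : ℤ)))]
  have h3 := H.loaded.rhs (Sum.inl j)
  rw [rowPos] at h3
  rw [h3, sub_eq_add_neg, ← Finset.sum_neg_distrib]
  congr 1
  refine Finset.sum_congr rfl fun i _ => ?_
  rw [← Finset.sum_neg_distrib]
  refine Finset.sum_congr rfl fun k _ => ?_
  ring

theorem blockRes_eq (H : Prepared I σ τ D) (i : Fin n) (j : Fin s) :
    blockRes σ r s t i j =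
      I.b (Sum.inr (i, j)) - ∑ v, I.matrix (Sum.inr (i, j)) v * lpRound σ v := by
  have h1 := sum_rows_block H.loaded (fun p : ℕ => σ arrLPNum p / σ arrLPDen p)
    (fun i k => i * t + k) i j
  have h2 : ∀ v : Fin n × Fin t, lpRound σ v = (fun p : ℕ => σ arrLPNum p / σ arrLPDen p)
      ((fun i k => i * t + k) (v.1 : ℕ) (v.2 : ℕ)) := fun v => rfl
  simp only [h2]
  rw [h1, blockRes]
  have h3 := H.loaded.rhs (Sum.inr (i, j))
  rw [rowPos] at h3
  rw [h3, sub_eq_add_neg, ← Finset.sum_neg_distrib]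
  congr 1
  refine Finset.sum_congr rfl fun k _ => ?_
  ring

theorem lpSol_sub (H : Prepared I σ τ D) (v : Fin n × Fin t) :
    0 ≤ lpSol σ v - lpRound σ v ∧ lpSol σ v - lpRound σ v < 1 := by
  have hden := H.lp.1 H.status v
  set a := σ arrLPNum (varPos v : ℤ) with ha
  set b := σ arrLPDen (varPos v : ℤ) with hb
  have h1 := Int.mul_ediv_add_emod a b
  have h2 := Int.emod_nonneg a hden.ne'
  have h3 := Int.emod_lt_of_pos a hden
  have hb' : (0 : ℝ) < b := by exact_mod_cast hden
  have e1 : lpSol σ v = (a : ℝ) / b := rfl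
  have e2 : lpRound σ v = a / b := rfl
  rw [e1, e2]
  have h4 : b * (a / b) ≤ a := by omega
  have h5 : a < b * (a / b) + b := by omega
  have h4' : (b : ℝ) * ((a / b : ℤ) : ℝ) ≤ a := by exact_mod_cast h4
  have h5' : (a : ℝ) < b * ((a / b : ℤ) : ℝ) + b := by exact_mod_cast h5
  constructor
  · rw [sub_nonneg, le_div_iff₀ hb']
    linarith
  · rw [sub_lt_iff_lt_add, div_lt_iff₀ hb']
    linarith

theorem lp_feasible (H : Prepared I σ τ D) : I.Feasible (lpSol (n := n) (t := t) σ) := by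
  rcases H.lp.2 with h | h | h
  · exact absurd h.1 H.status
  · exact h.2.1
  · exact h.2.1

/-- The LP solution satisfies every row exactly, and rounding moves each of the `n * t` entries by
less than 1, so the residual is at most n·t·D. -/
theorem abs_residual_le (H : Prepared I σ τ D) (row : Fin r ⊕ Fin n × Fin s) :
    |I.b row - ∑ v, I.matrix row v * lpRound σ v| ≤ radius n r s t D := by
  have h1 := ((feasible_iff _).1 H.lp_feasible).1 row
  have h2 : ((I.b row - ∑ v, I.matrix row v * lpRound σ v : ℤ) : ℝ) =
      ∑ v, (I.matrix row v : ℝ) * (lpSol σ v - lpRound σ v) := by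
    push_cast
    simp only [mul_sub, Finset.sum_sub_distrib]
    rw [h1]
  have h3 : |((I.b row - ∑ v, I.matrix row v * lpRound σ v : ℤ) : ℝ)| ≤ (n * t * D : ℕ) := by
    rw [h2]
    calc _ ≤ ∑ v : Fin n × Fin t, |(I.matrix row v : ℝ) * (lpSol σ v - lpRound σ v)| :=
          Finset.abs_sum_le_sum_abs _ _
      _ ≤ ∑ _v : Fin n × Fin t, (D : ℝ) := by
          refine Finset.sum_le_sum fun v _ => ?_
          have h4 : |(I.matrix row v : ℝ)| ≤ D := by
            exact_mod_cast abs_matrix_le H.entriesLE row v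
          have h5 := H.lpSol_sub v
          rw [abs_mul, abs_of_nonneg h5.1]
          have h6 := abs_nonneg (I.matrix row v : ℝ)
          nlinarith
      _ = _ := by
          rw [Finset.sum_const, Finset.card_univ, Fintype.card_prod, Fintype.card_fin,
            Fintype.card_fin, nsmul_eq_mul]
          push_cast
          ring
  have h4 : |I.b row - ∑ v, I.matrix row v * lpRound σ v| ≤ (n * t * D : ℕ) := by exact_mod_cast h3
  refine h4.trans ?_
  have h5 := mul_le_radius n r s t D
  have h6 := Nat.mul_le_mul_left (n * t) (le_shortBound r H.s_pos D)
  exact_mod_cast (by omega : n * t * D ≤ radius n r s t D)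

/-- Since the bounds are integers, rounding down respects the lower ones as well as the upper ones.
-/
theorem lo_le_round (H : Prepared I σ τ D) (v : Fin n × Fin t) :
    τ aLo (itemPos s v) ≤ lpRound σ v ∧ lpRound σ v ≤ τ aUp (itemPos s v) ∧
    lpRound σ v - radius n r s t D ≤ τ aLo (itemPos s v) ∧
    τ aUp (itemPos s v) ≤ lpRound σ v + radius n r s t D := by
  have hv := H.var v
  have hf := (feasible_iff _).1 H.lp_feasible
  have h1 := H.lpSol_sub v
  rw [hv.lo, hv.up, H.params.reg_W]
  change _ ≤ lpRound σ v ∧ _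
  have hlo : ∀ z : ℤ, I.l v = (z : WithBot ℤ) → z ≤ lpRound σ v := by
    intro z hz
    have h2 : (z : ℝ) < lpRound σ v + 1 := by linarith [hf.2.1 v z hz]
    have h3 : z < lpRound σ v + 1 := by exact_mod_cast h2
    omega
  have hup : ∀ z : ℤ, I.u v = (z : WithTop ℤ) → lpRound σ v ≤ z := by
    intro z hz
    have h2 : (lpRound σ v : ℝ) ≤ z := by linarith [hf.2.2 v z hz]
    exact_mod_cast h2
  have e : σ arrLPNum (varPos v : ℤ) / σ arrLPDen (varPos v : ℤ) = lpRound σ v := rfl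
  rw [e]
  refine ⟨?_, ?_, ?_, ?_⟩
  · split_ifs with h
    · rcases hl : I.l v with _ | z
      · have := H.loaded.lower_inf v hl
        omega
      · have h2 := (H.loaded.lower_fin v z hl).2
        rw [h2]
        exact max_le (by omega) (hlo z hl)
    · omega
  · split_ifs with h
    · rcases hl : I.u v with _ | z
      · have := H.loaded.upper_inf v hl
        omega
      · have h2 := (H.loaded.upper_fin v z hl).2
        rw [h2]
        exact le_min (by omega) (hup z hl)
    · omega
  · split_ifs
    · exact le_max_left _ _
    · exact le_rfl
  · split_ifs
    · exact min_le_left _ _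
    · exact le_rfl

/-- The bounds of the items are those of the variables, close to the rounded solution. -/
theorem bounds_iff (H : Prepared I σ τ D) (v : Fin n × Fin t) (z : ℤ) :
    (τ aLo (itemPos s v) ≤ z ∧ z ≤ τ aUp (itemPos s v)) ↔
      (∀ a : ℤ, I.l v = (a : WithBot ℤ) → a ≤ z) ∧ (∀ a : ℤ, I.u v = (a : WithTop ℤ) → z ≤ a) ∧
      |z - lpRound σ v| ≤ radius n r s t D := by
  have hv := H.var v
  rw [hv.lo, hv.up, H.params.reg_W]
  have e : σ arrLPNum (varPos v : ℤ) / σ arrLPDen (varPos v : ℤ) = lpRound σ v := rfl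
  rw [e]
  have hl : ((if 1 ≤ σ arrLowerFin (varPos v : ℤ) then
      max (lpRound σ v - radius n r s t D) (σ arrLower (varPos v : ℤ))
      else lpRound σ v - radius n r s t D) ≤ z) ↔
      (∀ a : ℤ, I.l v = (a : WithBot ℤ) → a ≤ z) ∧ lpRound σ v - radius n r s t D ≤ z := by
    rcases hl : I.l v with _ | a
    · rw [H.loaded.lower_inf v hl, if_neg (by norm_num)]
      exact ⟨fun h => ⟨fun a ha => absurd ha WithBot.bot_ne_coe, h⟩, fun h => h.2⟩
    · obtain ⟨h1, h2⟩ := H.loaded.lower_fin v a hl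
      rw [h1, if_pos le_rfl, h2, max_le_iff, and_comm]
      refine and_congr ⟨fun h b hb => ?_, fun h => h a rfl⟩ Iff.rfl
      have : a = b := WithBot.coe_injective hb
      omega
  have hu : (z ≤ (if 1 ≤ σ arrUpperFin (varPos v : ℤ) then
      min (lpRound σ v + radius n r s t D) (σ arrUpper (varPos v : ℤ))
      else lpRound σ v + radius n r s t D)) ↔
      (∀ a : ℤ, I.u v = (a : WithTop ℤ) → z ≤ a) ∧ z ≤ lpRound σ v + radius n r s t D := by
    rcases hl : I.u v with _ | a
    · rw [H.loaded.upper_inf v hl, if_neg (by norm_num)]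
      exact ⟨fun h => ⟨fun a ha => absurd ha WithTop.top_ne_coe, h⟩, fun h => h.2⟩
    · obtain ⟨h1, h2⟩ := H.loaded.upper_fin v a hl
      rw [h1, if_pos le_rfl, h2, le_min_iff, and_comm]
      refine and_congr ⟨fun h b hb => ?_, fun h => h a rfl⟩ Iff.rfl
      have : a = b := WithTop.coe_injective hb
      omega
  rw [hl, hu, abs_le]
  constructor
  · rintro ⟨⟨h1, h2⟩, h3, h4⟩
    exact ⟨h1, h3, by omega, by omega⟩
  · rintro ⟨h1, h3, h2, h4⟩
    exact ⟨⟨h1, by omega⟩, h3, by omega⟩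

/-- Augmentation can begin at once: the rounded entries lie in their boxes, and each slack lies
between zero and the residual. -/
theorem inBox_start (H : Prepared I σ τ D) : Ready.InBox τ (itemCount n r s t) 0 := by
  refine forall_items (fun v => ?_) (fun i j => ?_) (fun j => ?_)
  · have h1 := H.lo_le_round v
    have h2 : τ aX (itemPos s v) = lpRound σ v := (H.var v).sol
    simp only [Pi.zero_apply, add_zero, h2]
    exact ⟨h1.1, h1.2.1⟩
  · rw [(H.block i j).sol, (H.block i j).lo, (H.block i j).up]
    simp
  · rw [(H.top j).sol, (H.top j).lo, (H.top j).up]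
    simp

theorem width_le (H : Prepared I σ τ D) : ∀ v < itemCount n r s t,
    |τ aUp v - τ aLo v| ≤ (2 * radius n r s t D : ℕ) := by
  refine forall_items (p := fun v => |τ aUp v - τ aLo v| ≤ (2 * radius n r s t D : ℕ))
    (fun v => ?_) (fun i j => ?_) (fun j => ?_)
  · have h1 := H.lo_le_round v
    rw [abs_le]
    push_cast
    constructor <;> omega
  · have h1 := abs_le.1 (H.abs_residual_le (Sum.inr (i, j)))
    rw [← H.blockRes_eq] at h1
    rw [(H.block i j).lo, (H.block i j).up, abs_le]
    push_cast
    constructor <;> omega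
  · have h1 := abs_le.1 (H.abs_residual_le (Sum.inl j))
    rw [← H.topRes_eq] at h1
    rw [(H.top j).lo, (H.top j).up, abs_le]
    push_cast
    constructor <;> omega

/-- The solutions of the extended system. -/
theorem inKer_iff (H : Prepared I σ τ D) (z : ℕ → ℤ) :
    InKer (itemRows σ n r s t) (fun v : Fin (itemCount n r s t) => z v - τ aX ((v : ℕ) : ℤ)) ↔
      (∀ j : Fin r, ∑ v, I.matrix (Sum.inl j) v * z (itemPos s v) + z (n * (t + s) + j) =
        I.b (Sum.inl j)) ∧
      ∀ (i : Fin n) (j : Fin s), ∑ v, I.matrix (Sum.inr (i, j)) v * z (itemPos s v) +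
        z (i * (t + s) + (t + j)) = I.b (Sum.inr (i, j)) := by
  rw [inKer_itemRows (fun v => z v - τ aX (v : ℤ))]
  have hx : ∀ v : Fin n × Fin t, τ aX (itemPos s v) = lpRound σ v := fun v => (H.var v).sol
  have e1 : ∀ j : Fin r, (∑ i ∈ Finset.range n, ∑ k ∈ Finset.range t,
      σ arrA (((i * t + k) * r + j : ℕ) : ℤ) * (z (i * (t + s) + k) -
        τ aX ((i * (t + s) + k : ℕ) : ℤ)) +
      (z (n * (t + s) + j) - τ aX ((n * (t + s) + j : ℕ) : ℤ)) = 0) ↔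
      ∑ v, I.matrix (Sum.inl j) v * z (itemPos s v) + z (n * (t + s) + j) =
        I.b (Sum.inl j) := by
    intro j
    rw [← sum_rows_top H.loaded (fun v => z v - τ aX (v : ℤ)) (fun i k => i * (t + s) + k) j,
      (H.top j).sol, H.topRes_eq]
    have : ∑ v, I.matrix (Sum.inl j) v * (fun v : ℕ => z v - τ aX (v : ℤ))
        ((fun i k => i * (t + s) + k) (v.1 : ℕ) (v.2 : ℕ)) =
        ∑ v, I.matrix (Sum.inl j) v * z (itemPos s v) -
          ∑ v, I.matrix (Sum.inl j) v * lpRound σ v := by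
      rw [← Finset.sum_sub_distrib]
      refine Finset.sum_congr rfl fun v _ => ?_
      rw [← hx v, ← mul_sub]
      rfl
    rw [this]
    constructor <;> intro h <;> linarith
  have e2 : ∀ (i : Fin n) (j : Fin s), (∑ k ∈ Finset.range t,
      σ arrB (((i * t + k) * s + j : ℕ) : ℤ) * (z (i * (t + s) + k) -
        τ aX ((i * (t + s) + k : ℕ) : ℤ)) +
      (z (i * (t + s) + (t + j)) - τ aX ((i * (t + s) + (t + j) : ℕ) : ℤ)) = 0) ↔
      ∑ v, I.matrix (Sum.inr (i, j)) v * z (itemPos s v) + z (i * (t + s) + (t + j)) =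
        I.b (Sum.inr (i, j)) := by
    intro i j
    rw [← sum_rows_block H.loaded (fun v => z v - τ aX (v : ℤ)) (fun i k => i * (t + s) + k) i j,
      (H.block i j).sol, H.blockRes_eq]
    have : ∑ v, I.matrix (Sum.inr (i, j)) v * (fun v : ℕ => z v - τ aX (v : ℤ))
        ((fun i k => i * (t + s) + k) (v.1 : ℕ) (v.2 : ℕ)) =
        ∑ v, I.matrix (Sum.inr (i, j)) v * z (itemPos s v) -
          ∑ v, I.matrix (Sum.inr (i, j)) v * lpRound σ v := by
      rw [← Finset.sum_sub_distrib]
      refine Finset.sum_congr rfl fun v _ => ?_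
      rw [← hx v, ← mul_sub]
      rfl
    rw [this]
    constructor <;> intro h <;> linarith
  constructor
  · rintro ⟨h1, h2⟩
    exact ⟨fun j => (e1 j).1 (h1 j j.2), fun i j => (e2 i j).1 (h2 i i.2 j j.2)⟩
  · rintro ⟨h1, h2⟩
    exact ⟨fun j hj => (e1 ⟨j, hj⟩).2 (h1 ⟨j, hj⟩),
      fun i hi j hj => (e2 ⟨i, hi⟩ ⟨j, hj⟩).2 (h2 ⟨i, hi⟩ ⟨j, hj⟩)⟩

end Prepared

end NFoldIP

/-! ### Penalties for slack, and correctness of the answer. -/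

namespace NFoldIP

variable {n r s t : ℕ} {I : NFoldIP n r s t} {σ τ : Store} {D : ℕ}

/-- The vector on the items with zero slack. -/
def extend (s : ℕ) (z : Fin n × Fin t → ℤ) (p : ℕ) : ℤ :=
  if h : p / (t + s) < n ∧ p % (t + s) < t then z (⟨p / (t + s), h.1⟩, ⟨p % (t + s), h.2⟩) else 0

theorem extend_var (z : Fin n × Fin t → ℤ) (v : Fin n × Fin t) : extend s z (itemPos s v) = z v := by
  obtain ⟨⟨i, hi⟩, ⟨k, hk⟩⟩ := v
  obtain ⟨h1, h2⟩ := div_mod_item (i := i) (w := t + s) (k := k) (by omega)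
  simp only [extend, itemPos, h1, h2, hi, hk, and_self, dif_pos]

theorem extend_block (z : Fin n × Fin t → ℤ) (i : Fin n) (j : Fin s) :
    extend s z (i * (t + s) + (t + j)) = 0 := by
  obtain ⟨h1, h2⟩ := div_mod_item (i := (i : ℕ)) (w := t + s) (k := t + j) (by omega)
  rw [extend, dif_neg]
  omega

theorem extend_top (hs : 0 < s) (z : Fin n × Fin t → ℤ) (j : ℕ) :
    extend s z (n * (t + s) + j) = 0 := by
  rw [extend, dif_neg]
  have : n ≤ (n * (t + s) + j) / (t + s) := (Nat.le_div_iff_mul_le (by omega)).2 (by omega)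
  omega

/-- The cost of the slack items. -/
def penalty (τ : Store) (m : ℕ) (z : ℕ → ℤ) : ℤ :=
  ∑ v ∈ Finset.range m, if 1 ≤ τ aSlack v then τ aCost v * z v else 0

namespace Prepared

theorem gain_eq (H : Prepared I σ τ D) (z : ℕ → ℤ) :
    Ready.gain τ (itemCount n r s t) z =
      I.objective (fun v => z (itemPos s v)) + penalty τ (itemCount n r s t) z := by
  have h1 : Ready.gain τ (itemCount n r s t) z =
      ∑ v ∈ Finset.range (itemCount n r s t), (if 1 ≤ τ aSlack v then 0 else τ aCost v * z v) +
      penalty τ (itemCount n r s t) z := by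
    rw [Ready.gain, penalty, ← Finset.sum_add_distrib]
    refine Finset.sum_congr rfl fun v _ => ?_
    split_ifs <;> simp
  rw [h1, sum_items]
  congr 1
  rw [objective, Fintype.sum_prod_type, Finset.sum_range,
    Finset.sum_eq_zero (s := Finset.range r), add_zero]
  · refine Finset.sum_congr rfl fun i _ => ?_
    rw [Finset.sum_eq_zero (s := Finset.range s), add_zero, Finset.sum_range]
    · refine Finset.sum_congr rfl fun k _ => ?_
      have h2 := H.var (i, k)
      have h3 := H.loaded.obj (i, k)
      have e : itemPos s (i, k) = i * (t + s) + k := rfl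
      rw [← e, h2.slack, if_neg (by norm_num), h2.cost, h3]
      simp
    · intro j hj
      rw [(H.block i ⟨j, Finset.mem_range.1 hj⟩).slack, if_pos le_rfl]
  · intro j hj
    rw [(H.top ⟨j, Finset.mem_range.1 hj⟩).slack, if_pos le_rfl]

/-- Within its bounds a slack has the sign of its residual, and this decided the sign of the cost.
-/
theorem slack_cost (H : Prepared I σ τ D) (z : ℕ → ℤ) :
    ∀ v < itemCount n r s t, 1 ≤ τ aSlack v → τ aLo v ≤ z v → z v ≤ τ aUp v →
      τ aCost v * z v = - (σ rBM 0 * |z v|) := by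
  have h : ∀ (v : ℕ) (del md res : ℤ), SlackItem σ v del md res τ → τ aLo v ≤ z v →
      z v ≤ τ aUp v → τ aCost v * z v = - (σ rBM 0 * |z v|) := by
    intro v del md res hv h1 h2
    rw [hv.lo] at h1
    rw [hv.up] at h2
    rw [hv.cost]
    split_ifs with h3
    · rw [abs_of_nonneg (by omega)]
      ring
    · rw [abs_of_nonpos (by omega)]
      ring
  refine forall_items (p := fun v => 1 ≤ τ aSlack v → τ aLo v ≤ z v → z v ≤ τ aUp v →
    τ aCost v * z v = - (σ rBM 0 * |z v|)) (fun v h1 => ?_) (fun i j _ => h _ _ _ _ (H.block i j))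
    (fun j _ => h _ _ _ _ (H.top j))
  rw [(H.var v).slack] at h1
  omega

theorem penalty_eq_zero {m : ℕ} {z : ℕ → ℤ} (h : ∀ v < m, 1 ≤ τ aSlack v → z v = 0) :
    penalty τ m z = 0 := by
  refine Finset.sum_eq_zero fun v hv => ?_
  split_ifs with h1
  · rw [h v (Finset.mem_range.1 hv) h1, mul_zero]
  · rfl

theorem slackCost_pos (H : Prepared I σ τ D) : 0 < σ rBM 0 := by
  rw [H.params.reg_BM]
  positivity

/-- All terms are nonpositive, and one nonzero integer slack already contributes at most `- σ rBM
0`. -/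
theorem penalty_le (H : Prepared I σ τ D) {z : ℕ → ℤ}
    (hbox : ∀ v < itemCount n r s t, τ aLo v ≤ z v ∧ z v ≤ τ aUp v) {v₀ : ℕ}
    (hv₀ : v₀ < itemCount n r s t) (h1 : 1 ≤ τ aSlack v₀) (h2 : z v₀ ≠ 0) :
    penalty τ (itemCount n r s t) z ≤ - σ rBM 0 := by
  have hB := H.slackCost_pos
  have hneg : ∀ v ∈ Finset.range (itemCount n r s t),
      (if 1 ≤ τ aSlack v then τ aCost v * z v else 0) ≤ 0 := by
    intro v hv
    have hv := Finset.mem_range.1 hv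
    split_ifs with h3
    · rw [H.slack_cost z v hv h3 (hbox v hv).1 (hbox v hv).2]
      have := mul_nonneg hB.le (abs_nonneg (z v))
      omega
    · exact le_rfl
  have h4 := Finset.sum_le_sum_of_subset_of_nonneg
    (f := fun v : ℕ => -(if 1 ≤ τ aSlack v then τ aCost v * z v else 0))
    (Finset.singleton_subset_iff.2 (Finset.mem_range.2 hv₀))
    (fun v hv _ => neg_nonneg.2 (hneg v hv))
  rw [Finset.sum_singleton, if_pos h1, H.slack_cost z v₀ hv₀ h1 (hbox v₀ hv₀).1 (hbox v₀ hv₀).2,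
    Finset.sum_neg_distrib] at h4
  have h5 : 1 ≤ |z v₀| := Int.one_le_abs h2
  have h6 : σ rBM 0 * 1 ≤ σ rBM 0 * |z v₀| := Int.mul_le_mul_of_nonneg_left h5 hB.le
  unfold penalty
  omega

/-- Two points in the box differ little in the objective. -/
theorem objective_sub_lt (H : Prepared I σ τ D) {x y : Fin n × Fin t → ℤ}
    (hx : ∀ v, |x v - lpRound σ v| ≤ radius n r s t D)
    (hy : ∀ v, |y v - lpRound σ v| ≤ radius n r s t D) :
    I.objective x - I.objective y < σ rBM 0 := by
  rw [H.params.reg_BM]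
  have h1 : ∑ k ∈ Finset.range (n * t), |σ arrObj k| = ∑ v, |I.c v| := by
    rw [sum_range_mul_add n t (fun k : ℕ => |σ arrObj k|), Fintype.sum_prod_type, Finset.sum_range]
    refine Finset.sum_congr rfl fun i _ => ?_
    rw [Finset.sum_range]
    refine Finset.sum_congr rfl fun k _ => ?_
    rw [← H.loaded.obj (i, k)]
    rfl
  rw [h1, Finset.sum_mul, objective, objective, ← Finset.sum_sub_distrib, Int.lt_add_one_iff]
  refine Finset.sum_le_sum fun v _ => ?_
  have h2 := abs_le.1 (hx v)
  have h3 := abs_le.1 (hy v)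
  have h4 : |x v - y v| ≤ 2 * radius n r s t D := abs_le.2 ⟨by omega, by omega⟩
  calc (I.c v : ℤ) * x v - (I.c v : ℤ) * y v = I.c v * (x v - y v) := by
        ring
    _ ≤ |I.c v * (x v - y v)| := le_abs_self _
    _ = |I.c v| * |x v - y v| := abs_mul _ _
    _ ≤ _ := mul_le_mul_of_nonneg_left h4 (abs_nonneg _)

/-- A feasible point close to the rounded solution is at most as good as the best item vector. -/
theorem objective_le_gain (H : Prepared I σ τ D) {x : ℕ → ℤ}
    (hopt : ∀ z : ℕ → ℤ, (∀ v < itemCount n r s t, τ aLo v ≤ z v ∧ z v ≤ τ aUp v) →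
      InKer (itemRows σ n r s t) (fun v : Fin (itemCount n r s t) => z v - τ aX ((v : ℕ) : ℤ)) →
      Ready.gain τ (itemCount n r s t) z ≤ Ready.gain τ (itemCount n r s t) x)
    {z : Fin n × Fin t → ℤ} (hz : I.Feasible z)
    (hnear : ∀ v, |z v - lpRound σ v| ≤ radius n r s t D) :
    I.objective z ≤ Ready.gain τ (itemCount n r s t) x := by
  have hz' := (feasible_iff _).1 hz
  simp only [Int.cast_id] at hz'
  have h1 := hopt (extend s z) ?_ ?_
  · rw [H.gain_eq, penalty_eq_zero, add_zero] at h1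
    · simpa only [extend_var] using h1
    · refine forall_items (p := fun v => 1 ≤ τ aSlack v → extend s z v = 0) (fun v h2 => ?_)
        (fun i j _ => extend_block z i j) (fun j _ => extend_top H.s_pos z j)
      rw [(H.var v).slack] at h2
      omega
  · refine forall_items (p := fun v => τ aLo v ≤ extend s z v ∧ extend s z v ≤ τ aUp v)
      (fun v => ?_) (fun i j => ?_) (fun j => ?_)
    · rw [extend_var]
      exact (H.bounds_iff v (z v)).2 ⟨hz'.2.1 v, hz'.2.2 v, hnear v⟩
    · rw [extend_block, (H.block i j).lo, (H.block i j).up]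
      exact ⟨min_le_left _ _, le_max_left _ _⟩
    · rw [extend_top H.s_pos, (H.top j).lo, (H.top j).up]
      exact ⟨min_le_left _ _, le_max_left _ _⟩
  · rw [H.inKer_iff]
    simp only [extend_var, extend_block, extend_top H.s_pos, add_zero]
    exact ⟨fun j => hz'.1 _, fun i j => hz'.1 _⟩

/-- The best item vector solves the integer program. -/
theorem solved (H : Prepared I σ τ D) {x : ℕ → ℤ}
    (hbox : ∀ v < itemCount n r s t, τ aLo v ≤ x v ∧ x v ≤ τ aUp v)
    (hker : InKer (itemRows σ n r s t)
      (fun v : Fin (itemCount n r s t) => x v - τ aX ((v : ℕ) : ℤ)))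
    (hopt : ∀ z : ℕ → ℤ, (∀ v < itemCount n r s t, τ aLo v ≤ z v ∧ z v ≤ τ aUp v) →
      InKer (itemRows σ n r s t) (fun v : Fin (itemCount n r s t) => z v - τ aX ((v : ℕ) : ℤ)) →
      Ready.gain τ (itemCount n r s t) z ≤ Ready.gain τ (itemCount n r s t) x)
    {code : ℤ} (h0 : (∀ v < itemCount n r s t, 1 ≤ τ aSlack v → x v = 0) →
      code = σ arrLPStatus 0)
    (h1 : (¬ ∀ v < itemCount n r s t, 1 ≤ τ aSlack v → x v = 0) → code = 0) :
    I.Solved code (fun v => x (itemPos s v)) := by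
  have hin : ∀ v : Fin n × Fin t, _ := fun v =>
    (H.bounds_iff v (x (itemPos s v))).1 (hbox _ (itemPos_lt r s v))
  -- Proximity holds around the LP solution with distance n·t·L; rounding adds at most one more,
  -- which the radius allows for.
  have hnear : ∀ z : Fin n × Fin t → ℤ, I.Feasible z → ∃ z' : Fin n × Fin t → ℤ, I.Feasible z' ∧
      (∀ v, |z' v - lpRound σ v| ≤ radius n r s t D) ∧
      (σ arrLPStatus 0 = 2 → I.objective z ≤ I.objective z') := by
    intro z hz
    obtain ⟨z', h2, h3, h4⟩ := exists_near H.entriesLE H.lp.2 hz H.status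
    refine ⟨z', h2, fun v => ?_, h4⟩
    have h5 := H.lpSol_sub v
    have h6 := abs_le.1 (h3 v)
    have h7 : |((z' v - lpRound σ v : ℤ) : ℝ)| ≤ (n * t * shortBound r s D + 1 : ℕ) := by
      have e : (σ arrLPNum (varPos v : ℤ) : ℝ) / (σ arrLPDen (varPos v : ℤ) : ℝ) = lpSol σ v := rfl
      rw [e] at h6
      rw [abs_le]
      push_cast
      constructor <;> linarith
    have h8 : |z' v - lpRound σ v| ≤ (n * t * shortBound r s D + 1 : ℕ) := by exact_mod_cast h7
    exact h8.trans (by exact_mod_cast mul_le_radius n r s t D)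
  by_cases hz : ∀ v < itemCount n r s t, 1 ≤ τ aSlack v → x v = 0
  · have hfeas : I.Feasible (fun v => x (itemPos s v)) := by
      rw [feasible_iff]
      simp only [Int.cast_id]
      refine ⟨fun row => ?_, fun v => (hin v).1, fun v => (hin v).2.1⟩
      obtain ⟨h2, h3⟩ := (H.inKer_iff x).1 hker
      rcases row with j | ⟨i, j⟩
      · rw [← h2 j, hz (n * (t + s) + j) (by unfold itemCount; omega)
          (by rw [(H.top j).slack]), add_zero]
      · rw [← h3 i j, hz (i * (t + s) + (t + j)) ?_ (by rw [(H.block i j).slack]), add_zero]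
        have := item_lt i.2 (by omega : t + (j : ℕ) < t + s)
        unfold itemCount
        omega
    rw [h0 hz]
    -- Without slack, `x` is feasible. If the relaxation is unbounded, so is the program. If the
    -- relaxation has an optimum, some optimal competitor may be replaced by one inside the box,
    -- which `x` dominates there.
    rcases H.lp.2 with h | h | h
    · exact absurd h.1 H.status
    · exact Or.inr (Or.inl ⟨h.1, hfeas, exists_better H.entriesLE hfeas h.2.2⟩)
    · refine Or.inr (Or.inr ⟨h.1, hfeas, fun y hy => ?_⟩)
      obtain ⟨y', h2, h3, h4⟩ := hnear y hy
      have h5 := H.objective_le_gain hopt h2 h3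
      rw [H.gain_eq, penalty_eq_zero hz, add_zero] at h5
      exact (h4 h.1).trans h5
  -- With slack left, `x` pays at least `σ rBM 0`. A feasible point would give one in the box that
  -- pays nothing, and the objectives of the two differ by less than this penalty, against the
  -- optimality of `x`.
  · refine Or.inl ⟨h1 hz, fun y hy => ?_⟩
    push Not at hz
    obtain ⟨v₀, hv₀, h2, h3⟩ := hz
    obtain ⟨y', h4, h5, -⟩ := hnear y hy
    have h6 := H.objective_le_gain hopt h4 h5
    rw [H.gain_eq] at h6
    have h7 := H.penalty_le hbox hv₀ h2 h3
    have h8 := H.objective_sub_lt (fun v => (hin v).2.2) h5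
    omega

end Prepared

end NFoldIP

/-! ### The complete algorithm and its correctness. -/

/-- Solve the integer program, starting from a solution of the LP relaxation. -/
def solveItems : St := .seq itemLoop (.seq roundsProg (.seq Ready.augmentLoop outputProg))

/-- Solve the integer program, given the output of the solver for the LP relaxation. -/
def mainProg : St :=
  .ite (.le (va arrLPStatus) (.const 0)) (.set arrStatus (.const 0)) (.seq paramProg solveItems)

/-- A bound on the size of the gap between the first solution and the optimum. -/
def gapSize (n r s t D φ : ℕ) : ℕ :=
  φ + Nat.size (itemCount n r s t * ((n * t * (2 * radius n r s t D) + 1) * (2 * radius n r s t D)))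

/-- A bound on the time of `solveItems` with `E` rounds of scaling. -/
def solveTime (n r s t D E : ℕ) : ℕ :=
  (30 + itemCount n r s t * (itemTime n r s t D + 20)) +
  ((500 + itemCount n r s t * (400 + 20 * (2 * radius n r s t D)) + 40 * E +
      60 * (itemCount n r s t * (shortBound r s D + 1)) + 20 * (shortBound r s D + 1)) +
    ((30 + 2 * (itemCount n r s t * (shortBound r s D + 1)) * E *
        (Ready.augTime (itemCount n r s t) (shortBound r s D) (codeBound r s D)
          (Nat.size (2 * radius n r s t D)) + 20)) +
      (500 + 20 * t + itemCount n r s t * 200 + n * t * (500 + 40 * t + 20 * s))))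

theorem solveTime_mono {n r s t D E E' : ℕ} (h : E ≤ E') :
    solveTime n r s t D E ≤ solveTime n r s t D E' := by
  unfold solveTime
  gcongr

theorem size_mul_two_pow_le (a φ : ℕ) : Nat.size (a * 2 ^ φ) ≤ φ + Nat.size a := by
  rw [Nat.size_le, pow_add, mul_comm]
  exact Nat.mul_lt_mul_of_pos_left (Nat.lt_size_self a) (by positivity)

namespace NFoldIP

variable {n r s t : ℕ} {I : NFoldIP n r s t} {σ τ : Store} {D φ : ℕ}

theorem Loaded.congr (h : I.Loaded σ) (hτ : ∀ a < 9, τ a = σ a) : I.Loaded τ := by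
  obtain ⟨h1, h2, h3, h4, h5, h6, h7, h8, h9, h10, h11, h12⟩ := h
  have e0 : τ arrDim = σ arrDim := hτ _ (by decide)
  have e1 : τ arrA = σ arrA := hτ _ (by decide)
  have e2 : τ arrB = σ arrB := hτ _ (by decide)
  have e3 : τ arrRhs = σ arrRhs := hτ _ (by decide)
  have e4 : τ arrObj = σ arrObj := hτ _ (by decide)
  have e5 : τ arrLowerFin = σ arrLowerFin := hτ _ (by decide)
  have e6 : τ arrLower = σ arrLower := hτ _ (by decide)
  have e7 : τ arrUpperFin = σ arrUpperFin := hτ _ (by decide)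
  have e8 : τ arrUpper = σ arrUpper := hτ _ (by decide)
  constructor <;> simp only [e0, e1, e2, e3, e4, e5, e6, e7, e8] <;> assumption

theorem Loaded.dims (h : I.Loaded σ) : Dims σ n r s t := by
  constructor
  · simpa [dimN] using h.dim_n
  · simpa [dimR] using h.dim_r
  · simpa [dimS] using h.dim_s
  · simpa [dimT] using h.dim_t

theorem Loaded.maxEntry_le (h : I.Loaded σ) (hr : 0 < r) (hs : 0 < s) (hE : MaxEntry σ n r s t D)
    {Δ : ℕ} (h1 : 1 ≤ Δ) (hΔ : I.EntriesLE Δ) : D ≤ Δ := by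
  have key : ∀ w k : ℕ, 0 < w → k < n * t * w → ∃ (i : Fin n) (l : Fin t) (j : Fin w),
      k = varPos (i, l) * w + j := by
    intro w k hw hk
    have h2 : k / w < n * t := Nat.div_lt_of_lt_mul (by rwa [mul_comm])
    have ht : 0 < t := Nat.pos_of_ne_zero fun h0 => by simp [h0] at h2
    refine ⟨⟨k / w / t, Nat.div_lt_of_lt_mul (by rwa [mul_comm])⟩, ⟨k / w % t, Nat.mod_lt _ ht⟩,
      ⟨k % w, Nat.mod_lt _ hw⟩, ?_⟩
    simp only [varPos]
    rw [Nat.div_add_mod', Nat.div_add_mod']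
  refine hE.le_of_bound Δ h1 (fun k hk => ?_) (fun k hk => ?_)
  · obtain ⟨i, l, j, rfl⟩ := key r k hr hk
    rw [h.block_A i j l]
    exact hΔ.1 i j l
  · obtain ⟨i, l, j, rfl⟩ := key s k hs hk
    rw [h.block_B i j l]
    exact hΔ.2 i j l

namespace Prepared

/-- The penalty is the largest cost; it stays linear in 2^φ, so that φ enters the binary length of
the gap only additively. -/
theorem abs_cost_le (H : Prepared I σ τ D) (hφ : I.InputLE (2 ^ φ)) :
    ∀ v < itemCount n r s t,
      |τ aCost v| ≤ ((n * t * (2 * radius n r s t D) + 1) * 2 ^ φ : ℕ) := by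
  have h1 : ∑ k ∈ Finset.range (n * t), |σ arrObj k| ≤ (n * t * 2 ^ φ : ℕ) := by
    rw [sum_range_mul_add n t (fun k : ℕ => |σ arrObj k|), Finset.sum_range]
    calc _ ≤ ∑ _i : Fin n, ∑ _k : Fin t, ((2 ^ φ : ℕ) : ℤ) := by
          refine Finset.sum_le_sum fun i _ => ?_
          rw [Finset.sum_range]
          refine Finset.sum_le_sum fun k _ => ?_
          have h2 := H.loaded.obj (i, k)
          rw [varPos] at h2
          rw [h2]
          exact hφ.2.2.1 (i, k)
      _ = _ := by
          simp only [Finset.sum_const, Finset.card_univ, Fintype.card_fin, nsmul_eq_mul]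
          push_cast
          ring
  have hone : (1 : ℤ) ≤ (2 ^ φ : ℕ) := by exact_mod_cast Nat.one_le_two_pow
  have h2 : |σ rBM 0| ≤ ((n * t * (2 * radius n r s t D) + 1) * 2 ^ φ : ℕ) := by
    rw [abs_of_pos H.slackCost_pos, H.params.reg_BM]
    have h3 := mul_le_mul_of_nonneg_right h1
      (by positivity : (0 : ℤ) ≤ 2 * (radius n r s t D : ℤ))
    push_cast at h3 hone ⊢
    linarith
  have h3 : ∀ (v : ℕ) (del md res : ℤ), SlackItem σ v del md res τ →
      |τ aCost v| ≤ ((n * t * (2 * radius n r s t D) + 1) * 2 ^ φ : ℕ) := by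
    intro v del md res hv
    rw [hv.cost]
    split_ifs
    · rwa [abs_neg]
    · exact h2
  refine forall_items (p := fun v => |τ aCost v| ≤
    ((n * t * (2 * radius n r s t D) + 1) * 2 ^ φ : ℕ)) (fun v => ?_)
    (fun i j => h3 _ _ _ _ (H.block i j)) (fun j => h3 _ _ _ _ (H.top j))
  rw [(H.var v).cost, H.loaded.obj v]
  refine (hφ.2.2.1 v).trans ?_
  exact_mod_cast Nat.le_mul_of_pos_left _ (by omega)

theorem size_gap_le (H : Prepared I σ τ D) (hφ : I.InputLE (2 ^ φ)) :
    Nat.size (∑ v ∈ Finset.range (itemCount n r s t),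
      |τ aCost v| * (τ aUp v - τ aLo v)).toNat ≤ gapSize n r s t D φ := by
  refine le_trans (Nat.size_le_size ?_) (size_mul_two_pow_le _ φ)
  rw [Int.toNat_le]
  calc _ ≤ ∑ _v ∈ Finset.range (itemCount n r s t),
        (((n * t * (2 * radius n r s t D) + 1) * 2 ^ φ : ℕ) : ℤ) * (2 * radius n r s t D : ℕ) := by
        refine Finset.sum_le_sum fun v hv => ?_
        have h1 := H.abs_cost_le hφ v (Finset.mem_range.1 hv)
        have h2 := (le_abs_self _).trans (H.width_le v (Finset.mem_range.1 hv))
        calc _ ≤ |τ aCost v| * (2 * radius n r s t D : ℕ) :=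
              mul_le_mul_of_nonneg_left h2 (abs_nonneg _)
          _ ≤ _ := mul_le_mul_of_nonneg_right h1 (Int.natCast_nonneg _)
    _ = _ := by
        rw [Finset.sum_const, Finset.card_range, nsmul_eq_mul]
        push_cast
        ring

theorem ready (H : Prepared I σ τ D) (hτ : ∀ a ∈ [rL, rJ, rQ, rK, rItems], τ a = σ a) :
    Ready τ n (t + s) (itemCount n r s t) r s (colA σ n r s t) (colB σ n s t) D (shortBound r s D)
      (codeBound r s D) (Nat.size (2 * radius n r s t D)) (codeBase r s D) := by
  simp only [List.mem_cons, List.not_mem_nil, or_false, forall_eq_or_imp, forall_eq] at hτ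
  obtain ⟨h1, h2, h3, h4, h5⟩ := hτ
  constructor
  · exact coding_items H.r_pos H.s_pos H.params H.items
  · rw [h1, H.params.reg_L]
  · rw [h2, H.params.reg_J]
  · rw [h3, H.params.reg_Q]
  · rw [h4, H.params.reg_K]
  · rw [h5, H.params.reg_items]
  · unfold codeBound
    push_cast
    ring

end Prepared

/-- The number of rounds depends on the binary length `E` of the gap found at run time. The analysis
is carried out with this `E`, which is bounded by `gapSize` at the end. -/
theorem sat_solveItems (hr : 0 < r) (hs : 0 < s) (hL : I.Loaded σ) (hlp : I.LPOutput σ)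
    (hst : σ arrLPStatus 0 ≠ 0) (hP : Params σ n r s t D) (hφ : I.InputLE (2 ^ φ)) :
    Sat solveItems σ (solveTime n r s t D (gapSize n r s t D φ)) (fun τ => I.IPOutput τ) := by
  obtain ⟨τ, hτ⟩ : ∃ τ, τ = itemLoop.run σ := ⟨_, rfl⟩
  have hitems : ∀ v < itemCount n r s t, ItemOK σ n r s t v τ := by
    rw [hτ]
    exact (sat_itemLoop hs hP).1
  have H : Prepared I σ τ D := ⟨hr, hs, hL, hlp, hst, hP, hitems⟩
  obtain ⟨E, hE⟩ : ∃ E, E = Nat.size (∑ v ∈ Finset.range (itemCount n r s t),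
      |τ aCost v| * (τ aUp v - τ aLo v)).toNat := ⟨_, rfl⟩
  have hEle : E ≤ gapSize n r s t D φ := hE ▸ H.size_gap_le hφ
  refine Sat.le ?_ (solveTime_mono hEle)
  refine Sat.seq (Q₁ := fun τ' => τ = τ') ⟨hτ, (sat_itemLoop hs hP).2⟩ ?_
  rintro _ hfr rfl
  have hreg : ∀ a ∈ [rL, rJ, rQ, rK, rItems], τ a = σ a := fun a ha =>
    hfr a ((by decide : ∀ a ∈ [rL, rJ, rQ, rK, rItems], a ∉ itemLoop.mods) a ha)
  have hR := H.ready hreg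
  refine Sat.seq (sat_roundsProg hR.reg_items hR.reg_L H.width_le hE) ?_
  intro τ₁ hfr₁ hZ
  have hR₁ := hR.congr (τ := τ₁) (fun a ha => hfr₁ a
    ((by decide : ∀ a ∈ [aDel, aMd, rL, rJ, rQ, rK, rItems], a ∉ roundsProg.mods) a ha))
  have e1 : τ₁ aCost = τ aCost := hfr₁ _ (by decide)
  have e2 : τ₁ aLo = τ aLo := hfr₁ _ (by decide)
  have e3 : τ₁ aUp = τ aUp := hfr₁ _ (by decide)
  have e4 : τ₁ aX = τ aX := hfr₁ _ (by decide)
  have e5 : τ₁ aSlack = τ aSlack := hfr₁ _ (by decide)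
  have hbox₁ : Ready.InBox τ₁ (itemCount n r s t) 0 := by
    have := H.inBox_start
    unfold Ready.InBox at this ⊢
    rwa [e2, e3, e4]
  have hgain : ∀ z, Ready.gain τ₁ (itemCount n r s t) z = Ready.gain τ (itemCount n r s t) z := by
    intro z
    rw [Ready.gain, e1, Ready.gain]
  refine Sat.seq (Ready.sat_augmentLoop hR₁ hbox₁ ?_ ?_ ?_ hZ) ?_
  · exact shortKernel_blockRows _ _ _ D (fun v => abs_colA_le hP.entries v)
      (fun v => abs_colB_le hP.entries v)
  · intro v hv
    rw [e2, e3]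
    have h1 := (le_abs_self _).trans (H.width_le v hv)
    exact h1.trans_lt (by exact_mod_cast Nat.lt_size_self _)
  · rw [e1, e2, e3, hE]
    refine (Int.self_le_toNat _).trans_lt ?_
    exact_mod_cast Nat.lt_size_self _
  intro τ₂ hfr₂ ⟨hbox₂, hker, hopt⟩
  have f1 : τ₂ aLo = τ aLo := (hfr₂ _ (by decide)).trans e2
  have f2 : τ₂ aUp = τ aUp := (hfr₂ _ (by decide)).trans e3
  have f3 : τ₂ aSlack = τ aSlack := (hfr₂ _ (by decide)).trans e5
  have f4 : τ₂ arrDim = σ arrDim :=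
    (hfr₂ _ (by decide)).trans ((hfr₁ _ (by decide)).trans (hfr _ (by decide)))
  have f5 : τ₂ arrLPStatus = σ arrLPStatus :=
    (hfr₂ _ (by decide)).trans ((hfr₁ _ (by decide)).trans (hfr _ (by decide)))
  have f6 : τ₂ rItems 0 = itemCount n r s t := by
    rw [hfr₂ _ (by decide), hR₁.reg_items]
  refine (sat_outputProg (hL.dims.congr f4) f6).mono le_rfl ?_
  rintro τ₃ - ⟨h1, h2, h3⟩
  have hsol : (fun v : Fin n × Fin t => τ₃ arrSol (varPos v : ℤ)) =
      fun v => (fun p : ℕ => τ₂ aX (p : ℤ)) (itemPos s v) := by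
    funext v
    exact h3 v.1 v.1.2 v.2 v.2.2
  unfold IPOutput
  rw [hsol]
  rw [f3, f5] at h1
  rw [f3] at h2
  refine H.solved (x := fun p : ℕ => τ₂ aX (p : ℤ)) ?_ ?_ ?_ h1 h2
  · intro v hv
    have h4 := hbox₂ v hv
    rw [f1, f2] at h4
    simpa using h4
  · rw [e4] at hker
    exact hker
  · intro z hz hzk
    rw [← hgain, ← hgain]
    refine hopt z (fun v hv => ?_) ?_
    · rw [e2, e3]
      exact hz v hv
    · rw [e4]
      exact hzk

theorem sat_mainProg (hr : 0 < r) (hs : 0 < s) (hL : I.Loaded σ) (hlp : I.LPOutput σ)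
    (hφ : I.InputLE (2 ^ φ)) {Δ : ℕ} (h1 : 1 ≤ Δ) (hΔ : I.EntriesLE Δ) {T₁ T₂ : ℕ}
    (hT₁ : ∀ D, 1 ≤ D → D ≤ Δ → paramTime n r s t D ≤ T₁)
    (hT₂ : ∀ D, 1 ≤ D → D ≤ Δ → solveTime n r s t D (gapSize n r s t D φ) ≤ T₂) :
    Sat mainProg σ (100 + (T₁ + T₂)) (fun τ => I.IPOutput τ) := by
  have hcode : σ arrLPStatus 0 = 0 ∨ σ arrLPStatus 0 = 1 ∨ σ arrLPStatus 0 = 2 := by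
    rcases hlp.2 with h | h | h
    · exact Or.inl h.1
    · exact Or.inr (Or.inl h.1)
    · exact Or.inr (Or.inr h.1)
  refine Sat.le (T := 50 + (50 + (T₁ + T₂))) (Sat.ite (by simp) ?_ ?_) (by omega)
  · intro h
    have h0 : σ arrLPStatus 0 = 0 := by
      simp only [BE.holds, eval_va, eval_const] at h
      omega
    refine Sat.set (by simp only [cost_const]; omega) ?_
    rcases hlp.2 with h2 | h2 | h2
    · refine Or.inl ⟨?_, fun y hy => h2.2 _ hy.intCast⟩
      rw [put_eq, eval_const]
    · omega
    · omega
  · intro h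
    have h0 : σ arrLPStatus 0 ≠ 0 := by
      simp only [BE.holds, eval_va, eval_const] at h
      omega
    refine Sat.le (T := T₁ + T₂) (Sat.seq (sat_paramProg hL.dims T₁ fun D hD =>
      hT₁ D hD.one_le (hL.maxEntry_le hr hs hD h1 hΔ)) ?_) (by omega)
    rintro τ hfr ⟨D, hP⟩
    have hfr' : ∀ a < 12, τ a = σ a := fun a ha =>
      hfr a ((by decide : ∀ a < 12, a ∉ paramProg.mods) a ha)
    have hL' : I.Loaded τ := hL.congr fun a ha => hfr' a (by omega)
    have hlp' : I.LPOutput τ := by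
      unfold LPOutput at hlp ⊢
      rwa [hfr' arrLPStatus (by decide), hfr' arrLPNum (by decide), hfr' arrLPDen (by decide)]
    refine (sat_solveItems hr hs hL' hlp' ?_ hP hφ).le
      (hT₂ D hP.entries.one_le (hL'.maxEntry_le hr hs hP.entries h1 hΔ))
    rwa [hfr' arrLPStatus (by decide)]

end NFoldIP

/-- The algorithm: call the solver for the LP relaxation, and augment its rounded solution. -/
def nFoldSolver : Program := .seq .solveLP (mainProg.compile 100)

theorem exec_nFoldSolver {n r s t φ Δ : ℕ} {I : NFoldIP n r s t} (L : I.LPRun) {σ : Store}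
    (hr : 0 < r) (hs : 0 < s) (hL : I.Loaded σ) (hφ : I.InputLE (2 ^ φ)) (h1 : 1 ≤ Δ)
    (hΔ : I.EntriesLE Δ) {T₁ T₂ : ℕ} (hT₁ : ∀ D, 1 ≤ D → D ≤ Δ → paramTime n r s t D ≤ T₁)
    (hT₂ : ∀ D, 1 ≤ D → D ≤ Δ → solveTime n r s t D (gapSize n r s t D φ) ≤ T₂) :
    ∃ (T : ℕ) (σ' : Store), Exec L.out L.time nFoldSolver σ T σ' ∧ I.IPOutput σ' ∧
      T ≤ 200 + (T₁ + T₂) + L.time := by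
  set σ₁ : Store := fun a =>
    if a = arrLPStatus ∨ a = arrLPNum ∨ a = arrLPDen then L.out a else σ a with hσ₁
  have hL₁ : I.Loaded σ₁ := hL.congr fun a ha => if_neg (by
    unfold arrLPStatus arrLPNum arrLPDen
    omega)
  have hlp : I.LPOutput σ₁ := L.correct
  have hsat := NFoldIP.sat_mainProg hr hs hL₁ hlp hφ h1 hΔ hT₁ hT₂
  obtain ⟨T, σ', hx, hT, hσ', -⟩ := exec_stmt (out := L.out) (time := L.time) mainProg (by decide)
    100 le_rfl σ₁ σ₁ (fun _ _ => rfl)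
  refine ⟨_, σ', Exec.seq (Exec.solveLP σ) hx, ?_, ?_⟩
  · have h2 := hsat.1
    unfold NFoldIP.IPOutput at h2 ⊢
    rwa [hσ' arrStatus (by decide), hσ' arrSol (by decide)]
  · have := hsat.2
    omega

/-! ### Running time: calculus of monomial bounds. -/

/-- The number `a` is at most a monomial in `N`, `P`, `G` and `F` with the given exponents. -/
def Dom (N P G F : ℕ) (p q k i a : ℕ) : Prop := a ≤ N ^ p * P ^ q * G ^ k * F ^ i

namespace Dom

variable {N P G F p q k i a p' q' k' i' b : ℕ}

theorem mono (hN : 1 ≤ N) (hP : 1 ≤ P) (hG : 1 ≤ G) (hF : 1 ≤ F) (h : Dom N P G F p q k i a)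
    (hle : p ≤ p' ∧ q ≤ q' ∧ k ≤ k' ∧ i ≤ i') : Dom N P G F p' q' k' i' a := by
  obtain ⟨h1, h2, h3, h4⟩ := hle
  refine le_trans h ?_
  gcongr

theorem mul (h : Dom N P G F p q k i a) (h' : Dom N P G F p' q' k' i' b) :
    Dom N P G F (p + p') (q + q') (k + k') (i + i') (a * b) := by
  refine le_trans (Nat.mul_le_mul h h') (le_of_eq ?_)
  ring

/-- Both summands are at most the monomial with the larger exponents; the factor 2 is paid for by
one more power of `F`. -/
theorem add (hN : 1 ≤ N) (hP : 1 ≤ P) (hG : 1 ≤ G) (hF : 2 ≤ F) (h : Dom N P G F p q k i a)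
    (h' : Dom N P G F p' q' k' i' b) :
    Dom N P G F (max p p') (max q q') (max k k') (max i i' + 1) (a + b) := by
  have h1 := h.mono hN hP hG (by omega) (p' := max p p') (q' := max q q') (k' := max k k')
    (i' := max i i') ⟨le_max_left _ _, le_max_left _ _, le_max_left _ _, le_max_left _ _⟩
  have h2 := h'.mono hN hP hG (by omega) (p' := max p p') (q' := max q q') (k' := max k k')
    (i' := max i i') ⟨le_max_right _ _, le_max_right _ _, le_max_right _ _, le_max_right _ _⟩
  unfold Dom at *
  rw [pow_succ, ← mul_assoc]
  calc _ ≤ N ^ max p p' * P ^ max q q' * G ^ max k k' * F ^ max i i' * 2 := by omega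
    _ ≤ _ := Nat.mul_le_mul_left _ hF

theorem const (h : a ≤ F) : Dom N P G F 0 0 0 1 a := by
  simpa [Dom] using h

end Dom

/-- Here logarithms arise: `G` is to be ⌈log₂(nt+1)⌉, and the factor `y`, free of n and t, is
estimated crudely by 2^y. -/
theorem size_le_of_le {N G x y k : ℕ} (hN : N < 2 ^ G) (h : x ≤ N ^ k * y) :
    Nat.size x ≤ k * G + y := by
  rw [Nat.size_le, pow_add]
  refine lt_of_le_of_lt h ?_
  have h1 : N ^ k ≤ 2 ^ (k * G) := by
    rw [mul_comm, pow_mul]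
    exact Nat.pow_le_pow_left hN.le k
  calc N ^ k * y ≤ 2 ^ (k * G) * y := Nat.mul_le_mul_right _ h1
    _ < 2 ^ (k * G) * 2 ^ y := Nat.mul_lt_mul_of_pos_left Nat.lt_two_pow_self (by positivity)

theorem two_pow_size_le {x : ℕ} (hx : 0 < x) : 2 ^ Nat.size x ≤ 2 * x := by
  have h1 : 0 < Nat.size x := Nat.size_pos.2 hx
  have h2 : 2 ^ (Nat.size x - 1) ≤ x := Nat.lt_size.1 (by omega)
  calc 2 ^ Nat.size x = 2 * 2 ^ (Nat.size x - 1) := by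
        rw [← pow_succ', Nat.sub_add_cancel h1]
    _ ≤ 2 * x := Nat.mul_le_mul_left _ h2

/-- Bounds for the parameters of the algorithm by a common number. -/
structure ParamBound (r s D F : ℕ) : Prop where
  large : 10000 ≤ F
  r_le : r ≤ F
  s_le : s ≤ F
  D_le : D ≤ F
  block_le : blockBound s D ≤ F
  short_le : shortBound r s D ≤ F
  base_le : codeBase r s D ≤ F
  bound_le : codeBound r s D ≤ F

/-- The running time is bounded by a monomial in `n t`, `φ`, its logarithm and the common bound. -/
theorem time_le {n r s t D φ G F : ℕ} (hn : 0 < n) (ht : 0 < t) (hφ : 1 ≤ φ)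
    (hG : n * t < 2 ^ G) (hF : ParamBound r s D F) :
    paramTime n r s t D ≤ (n * t) ^ 2 * φ ^ 1 * G ^ 2 * F ^ 100 ∧
    solveTime n r s t D (gapSize n r s t D φ) ≤ (n * t) ^ 2 * φ ^ 1 * G ^ 2 * F ^ 100 := by
  obtain ⟨h0, hr, hs, hD, hb, hL, hM, hJ⟩ := hF
  have hN1 : 1 ≤ n * t := Nat.mul_pos hn ht
  have hG1 : 1 ≤ G := Nat.pos_of_ne_zero fun h => by
    rw [h] at hG
    omega
  have hF1 : 1 ≤ F := by omega
  have hF2 : 2 ≤ F := by omega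
  have dN : Dom (n * t) φ G F 1 0 0 0 (n * t) := by simp [Dom]
  have dn : Dom (n * t) φ G F 1 0 0 0 n := by simpa [Dom] using Nat.le_mul_of_pos_right n ht
  have dt : Dom (n * t) φ G F 1 0 0 0 t := by simpa [Dom] using Nat.le_mul_of_pos_left t hn
  have dφ : Dom (n * t) φ G F 0 1 0 0 φ := by simp [Dom]
  have dG : Dom (n * t) φ G F 0 0 1 0 G := by simp [Dom]
  have dF : Dom (n * t) φ G F 0 0 0 1 F := by simp [Dom]
  have dr : Dom (n * t) φ G F 0 0 0 1 r := Dom.const hr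
  have ds : Dom (n * t) φ G F 0 0 0 1 s := Dom.const hs
  have dD : Dom (n * t) φ G F 0 0 0 1 D := Dom.const hD
  have db : Dom (n * t) φ G F 0 0 0 1 (blockBound s D) := Dom.const hb
  have dL : Dom (n * t) φ G F 0 0 0 1 (shortBound r s D) := Dom.const hL
  have dM : Dom (n * t) φ G F 0 0 0 1 (codeBase r s D) := Dom.const hM
  have dJ : Dom (n * t) φ G F 0 0 0 1 (codeBound r s D) := Dom.const hJ
  have dm : Dom (n * t) φ G F 1 0 0 4 (itemCount n r s t) := by
    unfold itemCount
    rw [mul_add, mul_comm n s]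
    exact Dom.mono hN1 hφ hG1 hF1
      (Dom.add hN1 hφ hG1 hF2 (Dom.add hN1 hφ hG1 hF2 dN (ds.mul dn)) dr) (by decide)
  have dW : Dom (n * t) φ G F 1 0 0 7 (2 * radius n r s t D) := by
    unfold radius
    apply Dom.mono hN1 hφ hG1 hF1
    -- The rules for sums and products, followed along the expression, produce the exponents.
    -- Numerical constants are at most 10000 and count as one power of `F`.
    · repeat' first
        | with_reducible assumption
        | (refine Dom.const (le_trans ?_ h0); norm_num; done)
        | with_reducible apply Dom.add hN1 hφ hG1 hF2
        | with_reducible apply Dom.mul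
    · decide
  have dP : Dom (n * t) φ G F 1 0 0 8 (2 ^ Nat.size (2 * radius n r s t D)) := by
    refine le_trans (two_pow_size_le (by unfold radius; omega)) ?_
    change Dom _ _ _ _ _ _ _ _ _
    apply Dom.mono hN1 hφ hG1 hF1
    · repeat' first
        | with_reducible assumption
        | (refine Dom.const (le_trans ?_ h0); norm_num; done)
        | with_reducible apply Dom.add hN1 hφ hG1 hF2
        | with_reducible apply Dom.mul
    · decide
  -- The number of step lengths: the binary length of at most N·F^7 is at most G + F^7, so it
  -- contributes one logarithmic factor.
  have dK : Dom (n * t) φ G F 0 0 1 8 (Nat.size (2 * radius n r s t D)) := by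
    refine le_trans (size_le_of_le (k := 1) (y := F ^ 7) hG (by simpa [Dom] using dW)) ?_
    change Dom _ _ _ _ _ _ _ _ _
    have : Dom (n * t) φ G F 0 0 0 7 (F ^ 7) := by simp [Dom]
    rw [one_mul]
    exact Dom.mono hN1 hφ hG1 hF1 (Dom.add hN1 hφ hG1 hF2 dG this) (by decide)
  -- The binary length of the gap is at most φ + 4G + F^19, which contributes the factor φ and the
  -- second logarithmic factor.
  have dE : Dom (n * t) φ G F 0 1 1 22 (gapSize n r s t D φ) := by
    have h1 : Dom (n * t) φ G F 4 0 0 19 (itemCount n r s t *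
        ((n * t * (2 * radius n r s t D) + 1) * (2 * radius n r s t D))) := by
      apply Dom.mono hN1 hφ hG1 hF1
      · repeat' first
          | with_reducible assumption
          | (refine Dom.const (le_trans ?_ h0); norm_num; done)
          | with_reducible apply Dom.add hN1 hφ hG1 hF2
          | with_reducible apply Dom.mul
      · decide
    refine le_trans (Nat.add_le_add_left
      (size_le_of_le (k := 4) (y := F ^ 19) hG (by simpa [Dom] using h1)) φ) ?_
    change Dom _ _ _ _ _ _ _ _ _
    have : Dom (n * t) φ G F 0 0 0 19 (F ^ 19) := by simp [Dom]
    apply Dom.mono hN1 hφ hG1 hF1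
    · repeat' first
        | with_reducible assumption
        | (refine Dom.const (le_trans ?_ h0); norm_num; done)
        | with_reducible apply Dom.add hN1 hφ hG1 hF2
        | with_reducible apply Dom.mul
    · decide
  constructor
  · change Dom _ _ _ _ _ _ _ _ _
    unfold paramTime
    have dW' : Dom (n * t) φ G F 1 0 0 7 (radius n r s t D) :=
      le_trans (Nat.le_mul_of_pos_left _ two_pos) dW
    apply Dom.mono hN1 hφ hG1 hF1
    · repeat' first
        | with_reducible assumption
        | (refine Dom.const (le_trans ?_ h0); norm_num; done)
        | with_reducible apply Dom.add hN1 hφ hG1 hF2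
        | with_reducible apply Dom.mul
    · decide
  -- The dominant term is m(L+1)·E rounds times K tables of m rows: N² from the two factors m, φ·G
  -- from E and G from K. Computing the items also costs N², without logarithms.
  · change Dom _ _ _ _ _ _ _ _ _
    unfold solveTime Ready.augTime itemTime tableTime pickTime traceTime cellTime dotTime
    apply Dom.mono hN1 hφ hG1 hF1
    · repeat' first
        | with_reducible assumption
        | (refine Dom.const (le_trans ?_ h0); norm_num; done)
        | with_reducible apply Dom.add hN1 hφ hG1 hF2
        | with_reducible apply Dom.mul
    · decide

/-- The bound for the parameters in terms of `r s Δ`. -/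
theorem paramBound_pow {r s D Δ : ℕ} (hr : 0 < r) (hs : 0 < s) (hD : 1 ≤ D) (hDΔ : D ≤ Δ) :
    ParamBound r s D ((10000 * (r * s * Δ)) ^ (8 * (r ^ 2 * s + r * s ^ 2))) := by
  set e := r ^ 2 * s + r * s ^ 2 with he
  set Z := 10000 * (r * s * Δ) with hZ
  have hrs : 1 ≤ r * s := Nat.mul_pos hr hs
  have hers : e = r * s * (r + s) := by
    rw [he]
    ring
  have hrse : r * s ≤ e := hers ▸ Nat.le_mul_of_pos_right _ (by omega)
  have hrle : r ≤ r * s := Nat.le_mul_of_pos_right r hs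
  have hsle : s ≤ r * s := Nat.le_mul_of_pos_left s hr
  have hsD : s * D ≤ r * s * Δ := Nat.mul_le_mul hsle hDΔ
  have hrD : r * D ≤ r * s * Δ := Nat.mul_le_mul hrle hDΔ
  have hsD1 : 1 ≤ s * D := Nat.mul_pos hs hD
  have hrD1 : 1 ≤ r * D := Nat.mul_pos hr hD
  have hDle : D ≤ s * D := Nat.le_mul_of_pos_left D hs
  have hr' : r ≤ r * D := Nat.le_mul_of_pos_right r hD
  have hs' : s ≤ s * D := Nat.le_mul_of_pos_right s hD
  have hZ1 : 1 ≤ Z := by omega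
  have hpow : ∀ {a k : ℕ}, a ≤ Z ^ k → k ≤ 8 * e → a ≤ Z ^ (8 * e) := fun h1 h2 =>
    h1.trans (Nat.pow_le_pow_right hZ1 h2)
  have hblock : blockBound s D ≤ Z ^ s := by
    refine Nat.pow_le_pow_left ?_ s
    have : 2 * s * D = 2 * (s * D) := by ring
    omega
  have hblock1 : 1 ≤ blockBound s D := Nat.one_le_pow _ _ (by omega)
  have hstep : 2 * r * (D * blockBound s D) + 1 ≤ Z ^ (s + 1) := by
    have h1 : 1 ≤ r * D * blockBound s D := Nat.mul_pos hrD1 hblock1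
    calc 2 * r * (D * blockBound s D) + 1 = 2 * (r * D * blockBound s D) + 1 := by ring
      _ ≤ 3 * (r * D * blockBound s D) := by omega
      _ = (3 * (r * D)) * blockBound s D := by ring
      _ ≤ Z * Z ^ s := Nat.mul_le_mul (by omega) hblock
      _ = Z ^ (s + 1) := by ring
  have hshort : shortBound r s D ≤ Z ^ (3 * (r * s)) := by
    calc shortBound r s D ≤ Z ^ s * (Z ^ (s + 1)) ^ r :=
          Nat.mul_le_mul hblock (Nat.pow_le_pow_left hstep r)
      _ = Z ^ (s + (s + 1) * r) := by rw [← pow_mul, ← pow_add]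
      _ ≤ _ := Nat.pow_le_pow_right hZ1 (by
          have : (s + 1) * r = r * s + r := by ring
          omega)
  have hbase : codeBase r s D ≤ Z ^ (4 * (r * s)) := by
    have h1 : 1 ≤ D * shortBound r s D := Nat.mul_pos hD (one_le_shortBound r s D)
    calc codeBase r s D = 8 * (D * shortBound r s D) + 1 := by
          unfold codeBase
          ring
      _ ≤ (9 * D) * shortBound r s D := by
          rw [mul_assoc]
          omega
      _ ≤ Z * Z ^ (3 * (r * s)) := Nat.mul_le_mul (by omega) hshort
      _ = Z ^ (3 * (r * s) + 1) := by ring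
      _ ≤ _ := Nat.pow_le_pow_right hZ1 (by omega)
  refine ⟨?_, ?_, ?_, ?_, ?_, ?_, ?_, ?_⟩
  · exact hpow (k := 1) (by rw [pow_one]; omega) (by omega)
  · exact hpow (k := 1) (by rw [pow_one]; omega) (by omega)
  · exact hpow (k := 1) (by rw [pow_one]; omega) (by omega)
  · exact hpow (k := 1) (by rw [pow_one]; omega) (by omega)
  · exact hpow hblock (by omega)
  · exact hpow hshort (by omega)
  · exact hpow hbase (by omega)
  -- The largest parameter and the source of the exponent in the theorem: the base is at most
  -- Z^(4rs) and is raised to the power s + r, which gives Z^(4e) with e = rs(r+s). The remaining 1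
  -- + 3rs is at most 4e.
  · refine hpow (k := 1 + 3 * (r * s) + 4 * (r * s) * (s + r)) ?_ ?_
    · calc codeBound r s D ≤ 2 * Z ^ (3 * (r * s)) * (Z ^ (4 * (r * s))) ^ (s + r) :=
            Nat.mul_le_mul (Nat.mul_le_mul_left 2 hshort) (Nat.pow_le_pow_left hbase _)
        _ ≤ Z ^ 1 * Z ^ (3 * (r * s)) * (Z ^ (4 * (r * s))) ^ (s + r) := by
            gcongr
            rw [pow_one]
            omega
        _ = _ := by rw [← pow_mul, ← pow_add, ← pow_add]
    · have : 4 * (r * s) * (s + r) = 4 * e := by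
        rw [hers]
        ring
      omega

/-- The constant `b` inside the power has to be moved out. If X = rsΔ is at least 2, then b ≤ X^b
and only the exponent grows. If X = 1, then r = s = 1, the exponent is 2k, and b^(2k) is a constant
factor. -/
theorem exists_pow_le (b k : ℕ) : ∃ C : ℕ, ∀ r s Δ : ℕ, 0 < r → 0 < s → 1 ≤ Δ →
    (b * (r * s * Δ)) ^ (k * (r ^ 2 * s + r * s ^ 2)) ≤
      C * (r * s * Δ) ^ (C * (r ^ 2 * s + r * s ^ 2)) := by
  refine ⟨b ^ (k * 2) + (b + 1) * k + 1, fun r s Δ hr hs hΔ => ?_⟩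
  set C := b ^ (k * 2) + (b + 1) * k + 1 with hC
  have hX : 1 ≤ r * s * Δ := Nat.mul_pos (Nat.mul_pos hr hs) hΔ
  rcases hX.eq_or_lt with h | h
  · have h1 : r * s = 1 := Nat.eq_one_of_mul_eq_one_right h.symm
    have h2 : r = 1 := Nat.eq_one_of_mul_eq_one_right h1
    have h3 : s = 1 := Nat.eq_one_of_mul_eq_one_left h1
    rw [← h, h2, h3, one_pow, mul_one, mul_one]
    norm_num
    omega
  · set X := r * s * Δ
    set e := r ^ 2 * s + r * s ^ 2
    have h1 : b * X ≤ X ^ (b + 1) := by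
      rw [pow_succ]
      refine Nat.mul_le_mul_right X ?_
      exact Nat.lt_two_pow_self.le.trans (Nat.pow_le_pow_left h b)
    calc (b * X) ^ (k * e) ≤ (X ^ (b + 1)) ^ (k * e) := Nat.pow_le_pow_left h1 _
      _ = X ^ ((b + 1) * k * e) := by rw [← pow_mul, mul_assoc]
      _ ≤ X ^ (C * e) := Nat.pow_le_pow_right hX (Nat.mul_le_mul_right e (by omega))
      _ ≤ C * X ^ (C * e) := Nat.le_mul_of_pos_left _ (by omega)

theorem mainTheorem1 :
    ∃ (P : Program) (C : ℕ),
      ∀ (n r s t : ℕ), 0 < n → 0 < r → 0 < s → 0 < t →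
      ∀ (I : NFoldIP n r s t) (Δ φ : ℕ), 1 ≤ Δ → I.EntriesLE Δ → 1 ≤ φ → I.InputLE (2 ^ φ) →
      ∀ (L : I.LPRun) (σ : Store), I.Loaded σ →
        ∃ (T : ℕ) (σ' : Store),
          Exec L.out L.time P σ T σ' ∧ I.IPOutput σ' ∧
          T ≤ C * (n ^ 2 * t ^ 2 * φ * Nat.clog 2 (n * t + 1) ^ 2 *
                (r * s * Δ) ^ (C * (r ^ 2 * s + r * s ^ 2))) + L.time := by
  obtain ⟨C, hC⟩ := exists_pow_le 10000 800
  refine ⟨nFoldSolver, 202 * C, ?_⟩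
  intro n r s t hn hr hs ht I Δ φ hΔ hE hφ hI L σ hL
  set e := r ^ 2 * s + r * s ^ 2
  set G := Nat.clog 2 (n * t + 1) with hGdef
  set X := r * s * Δ
  have hX : 1 ≤ X := Nat.mul_pos (Nat.mul_pos hr hs) hΔ
  have hG : n * t < 2 ^ G := Nat.lt_of_succ_le (Nat.le_pow_clog (by norm_num) _)
  have hG1 : 1 ≤ G := Nat.clog_pos (by norm_num) (by
    have := Nat.mul_pos hn ht
    omega)
  set B := (n * t) ^ 2 * φ ^ 1 * G ^ 2 * ((10000 * X) ^ (8 * e)) ^ 100 with hB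
  have hB1 : 1 ≤ B := by
    have := Nat.mul_pos hn ht
    have : 0 < 10000 * X := by omega
    exact Nat.succ_le_of_lt (by positivity)
  obtain ⟨T, σ', h1, h2, h3⟩ := exec_nFoldSolver (T₁ := B) (T₂ := B) L hr hs hL hI hΔ hE
    (fun D h1 h2 => (time_le hn ht hφ hG (paramBound_pow hr hs h1 h2)).1)
    (fun D h1 h2 => (time_le hn ht hφ hG (paramBound_pow hr hs h1 h2)).2)
  refine ⟨T, σ', h1, h2, h3.trans (Nat.add_le_add_right ?_ _)⟩
  have h4 : ((10000 * X) ^ (8 * e)) ^ 100 ≤ C * X ^ (202 * C * e) := by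
    rw [← pow_mul, show 8 * e * 100 = 800 * e by ring]
    refine (hC r s Δ hr hs hΔ).trans (Nat.mul_le_mul_left C (Nat.pow_le_pow_right hX ?_))
    exact Nat.mul_le_mul_right e (by omega)
  -- Both phases, computing the parameters and solving, take at most `B` steps, and the constant
  -- overhead of 200 is at most 200·B because `B` is positive.
  calc 200 + (B + B) ≤ 202 * B := by omega
    _ ≤ 202 * ((n * t) ^ 2 * φ ^ 1 * G ^ 2 * (C * X ^ (202 * C * e))) :=
        Nat.mul_le_mul_left _ (Nat.mul_le_mul_left _ h4)
    _ = _ := by ring
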